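/- Conventions. Functions are indexed by input lengths $n\in\{0,1,2,\dots\}$. A function $f$ with natural-number values is polynomially bounded if $f(n)\in O(n^d)$ for some constant $d$, and is logarithmically bounded if it is log-space computable and $f(n)\in O(\log n)$. Log-space computability refers to deterministic Turing machines with a two-way read-only input tape, finitely many work tapes on which they use space logarithmic in the length of their input, and a one-way write-only output tape. A function $f$ with natural-number values is log-space computable if $f(n)$ can be computed in binary from $1^n$ in this way; a function $f$ with values in $[0,1]$ is log-space computable if from $1^n01^k$ one can compute in this way, in binary, a natural number $m$ with $|f(n)-m/2^k|\le 2^{-k}$. Model. Let $G$ be a finite set of unitary gates, each acting on a fixed number of qubits, that exactly implements (by circuits over $G$ without ancillas) the Hadamard gate, the NOT gate, the Toffoli gate, and the inverse of each gate in $G$. For $c,s:\mathbb{Z}_{\ge0}\to[0,1]$, the class $\mathrm{Q}_{\mathrm U}\mathrm{L}(c,s)$ (over $G$) consists of the promise problems $A=(A_{\mathrm{yes}},A_{\mathrm{no}})$, $A_{\mathrm{yes}},A_{\mathrm{no}}\subseteq\{0,1\}^*$ disjoint, for which there are a logarithmically bounded $l:\mathbb{Z}_{\ge0}\to\{1,2,\dots\}$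 and a logarithmic-space Turing machine that on every input $x\in\{0,1\}^*$ outputs the description of a circuit $V_x$ over $G$ on $l(|x|)$ qubits, such that the probability that measuring the first qubit of $V_x|0\cdots0\rangle$ in the computational basis gives $1$ is at least $c(|x|)$ for every $x\in A_{\mathrm{yes}}$ and at most $s(|x|)$ for every $x\in A_{\mathrm{no}}$. Statement. For every such $G$, every polynomially bounded and log-space computable $p:\mathbb{Z}_{\ge0}\to\{1,2,\dots\}$, and all log-space computable $c,s:\mathbb{Z}_{\ge0}\to[0,1]$ satisfying $c(n)-s(n)\ge 1/q(n)$ for all $n$, for some polynomially bounded $q:\mathbb{Z}_{\ge0}\to\{1,2,\dots\}$, $$\mathrm{Q}_{\mathrm U}\mathrm{L}(c,s)\subseteq \mathrm{Q}_{\mathrm U}\mathrm{L}\bigl(1-2^{-p},\,2^{-p}\bigr).$$ -/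

import Mathlib

open Filter Asymptotics

namespace UnitaryLogspace

/-! ### Deterministic space-bounded transducers -/

/-- What the input head scans: an end marker or an input bit. -/
inductive InSym where
  | leftEnd
  | bit (b : Bool)
  | rightEnd

/-- Head moves. -/
inductive Move where
  | left
  | stay
  | right

/-- Displacement of a work head. -/
def Move.toInt : Move → ℤ
  | .left => -1
  | .stay => 0
  | .right => 1

/-- Displacement of the input head, which never leaves the cells `0, …, n + 1`
(cells `0` and `n + 1` hold the end markers). -/
def Move.applyInput (n : ℕ) : Move → ℕ → ℕ
  | .left, i => i - 1
  | .stay, i => i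
  | .right, i => min (i + 1) (n + 1)

/-- The content of cell `i` of the input tape holding `x` between two end markers. -/
def inputSym (x : List Bool) : ℕ → InSym
  | 0 => .leftEnd
  | i + 1 => match x[i]? with
    | some b => .bit b
    | none => .rightEnd

/-- A deterministic multitape Turing machine with a two-way read-only input tape, finitely many
two-way infinite read-write work tapes, and a one-way write-only output tape over the
alphabet `O`.  The transition function returns `none` to halt; otherwise it returns the new
state, the input head move, for every work tape the symbol to write and the move to make, and
the finite word to append to the output. -/
structure Transducer (O : Type) where
  State : Type
  finiteState : Finite State
  Symbol : Type
  finiteSymbol : Finite Symbol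
  blank : Symbol
  tapes : ℕ
  start : State
  trans : State → InSym → (Fin tapes → Symbol) →
    Option (State × Move × (Fin tapes → Symbol × Move) × List O)

namespace Transducer

variable {O : Type}

/-- Configurations: control state, position of the input head, contents of the work tapes,
positions of the work heads, and the output written so far. -/
structure Cfg (M : Transducer O) where
  state : M.State
  inHead : ℕ
  work : Fin M.tapes → ℤ → M.Symbol
  head : Fin M.tapes → ℤ
  out : List O

/-- The initial configuration. -/
def init (M : Transducer O) : M.Cfg where
  state := M.start
  inHead := 0
  work := fun _ _ => M.blank
  head := fun _ => 0
  out := []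

/-- One step of the machine on input `x`; `none` means that the machine has halted. -/
def step (M : Transducer O) (x : List Bool) (a : M.Cfg) : Option M.Cfg :=
  (M.trans a.state (inputSym x a.inHead) (fun i => a.work i (a.head i))).map
    fun r =>
      { state := r.1
        inHead := r.2.1.applyInput x.length a.inHead
        work := fun i => Function.update (a.work i) (a.head i) (r.2.2.1 i).1
        head := fun i => a.head i + (r.2.2.1 i).2.toInt
        out := a.out ++ r.2.2.2 }

/-- The configuration `a` occurs in the run of the machine on input `x`. -/
def Reaches (M : Transducer O) (x : List Bool) (a : M.Cfg) : Prop :=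
  Relation.ReflTransGen (fun b b' => M.step x b = some b') M.init a

/-- On input `x` the machine halts with output `w`. -/
def Outputs (M : Transducer O) (x : List Bool) (w : List O) : Prop :=
  ∃ a, M.Reaches x a ∧ M.step x a = none ∧ a.out = w

/-- On input `x` every work head stays within distance `S` of its initial position. -/
def UsesSpace (M : Transducer O) (x : List Bool) (S : ℕ) : Prop :=
  ∀ a, M.Reaches x a → ∀ i, |a.head i| ≤ (S : ℤ)

end Transducer

/-- `f` is computed by a Turing machine in logarithmic space, where the argument `a` is given
to the machine as the bit string `enc a`. -/
def LogspaceComputable {α O : Type} (enc : α → List Bool) (f : α → List O) : Prop :=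
  ∃ (M : Transducer O) (K : ℕ), ∀ a,
    M.Outputs (enc a) (f a) ∧ M.UsesSpace (enc a) (K * (Nat.log 2 (enc a).length + 1))

/-- The string `1ⁿ`. -/
def unary (n : ℕ) : List Bool := List.replicate n true

/-- Log-space computability of `f : ℕ → ℕ`: from `1ⁿ` compute the binary expansion of `f n`
(least significant bit first) in space `O(log n)`. -/
def LogspaceComputableNat (f : ℕ → ℕ) : Prop :=
  LogspaceComputable unary (fun n => (f n).bits)

/-- Log-space computability of a nonnegative real-valued `f`: from `1ⁿ 0 1ᵏ` compute, in space
`O(log (n + k))`, the binary expansion of a natural number `m` with `|f n - m / 2ᵏ| ≤ 2⁻ᵏ`. -/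
def LogspaceComputableReal (f : ℕ → ℝ) : Prop :=
  ∃ m : ℕ × ℕ → ℕ,
    (∀ n k, |f n - (m (n, k) : ℝ) / 2 ^ k| ≤ ((2 : ℝ) ^ k)⁻¹) ∧
    LogspaceComputable (fun a : ℕ × ℕ => unary a.1 ++ false :: unary a.2)
      (fun a => (m a).bits)

/-- `f n = O(n ^ d)` for some `d`. -/
def PolynomiallyBounded (f : ℕ → ℕ) : Prop :=
  ∃ d : ℕ, (fun n => (f n : ℝ)) =O[atTop] (fun n => (n : ℝ) ^ d)

/-- `f` is log-space computable and `f n = O(log n)`. -/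
def LogarithmicallyBounded (f : ℕ → ℕ) : Prop :=
  LogspaceComputableNat f ∧ (fun n => (f n : ℝ)) =O[atTop] (fun n => Real.log (n : ℝ))

/-! ### Unitary quantum circuits -/

/-- Computational basis labels of `l` qubits. -/
abbrev Basis (l : ℕ) : Type := Fin l → Bool

/-- A finite set of unitary gates. -/
structure GateSet where
  Gate : Type
  finiteGate : Finite Gate
  arity : Gate → ℕ
  mat : (g : Gate) → Matrix (Basis (arity g)) (Basis (arity g)) ℂ
  unitary_mat : ∀ g, mat g ∈ Matrix.unitaryGroup (Basis (arity g)) ℂ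

/-- The operator on `l` qubits acting as `U` on the distinct qubits `w 0, …, w (r - 1)` and as
the identity on the others. -/
noncomputable def applyOn {r l : ℕ} (U : Matrix (Basis r) (Basis r) ℂ) (w : Fin r ↪ Fin l) :
    Matrix (Basis l) (Basis l) ℂ :=
  open Classical in
  fun y z => if ∀ i, i ∉ Set.range w → y i = z i then U (y ∘ w) (z ∘ w) else 0

/-- A circuit on `l` qubits: a list of gates, each with the distinct qubits it is applied to,
in order of application. -/
abbrev Circuit (G : GateSet) (l : ℕ) : Type := List (Σ g : G.Gate, Fin (G.arity g) ↪ Fin l)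

namespace Circuit

variable {G : GateSet} {l : ℕ}

/-- The unitary performed by a circuit (the head of the list acts first). -/
noncomputable def toMatrix : Circuit G l → Matrix (Basis l) (Basis l) ℂ
  | [] => 1
  | a :: C => toMatrix C * applyOn (G.mat a.1) a.2

/-- The textual description of a circuit: every gate is written as its name (`Sum.inl g`),
followed by the qubits it acts on in unary, the qubit `i` being written as `i` ticks
`Sum.inr true` and a separator `Sum.inr false`. -/
def encode (C : Circuit G l) : List (G.Gate ⊕ Bool) :=
  C.flatMap fun a => Sum.inl a.1 ::
    (List.ofFn fun j => (a.2 j : ℕ)).flatMap fun i =>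
      List.replicate i (Sum.inr true) ++ [Sum.inr false]

/-- The probability that measuring the first qubit in the computational basis gives `1` after
the circuit has been applied to `|0…0⟩`. -/
noncomputable def acceptProb (hl : 0 < l) (C : Circuit G l) : ℝ :=
  ∑ y : Basis l with y ⟨0, hl⟩ = true, ‖C.toMatrix y (fun _ => false)‖ ^ 2

end Circuit

/-- The Hadamard gate. -/
noncomputable def hadamard : Matrix (Basis 1) (Basis 1) ℂ :=
  fun y z => (if y 0 = true ∧ z 0 = true then -1 else 1) / (Real.sqrt 2 : ℂ)

/-- The NOT gate. -/
def notGate : Matrix (Basis 1) (Basis 1) ℂ :=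
  fun y z => if y 0 = !(z 0) then 1 else 0

/-- The Toffoli gate: qubit `2` is flipped iff qubits `0` and `1` are both `1`. -/
def toffoli : Matrix (Basis 3) (Basis 3) ℂ :=
  fun y z => if y 0 = z 0 ∧ y 1 = z 1 ∧ y 2 = xor (z 2) (z 0 && z 1) then 1 else 0

namespace GateSet

/-- `U` is performed exactly by some circuit over the gate set. -/
def Realizes (G : GateSet) {r : ℕ} (U : Matrix (Basis r) (Basis r) ℂ) : Prop :=
  ∃ C : Circuit G r, C.toMatrix = U

/-- The gate set exactly implements the Hadamard gate, the generators NOT and Toffoli of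
classical reversible computation, and the inverse of each of its gates. -/
structure Admissible (G : GateSet) : Prop where
  hadamard : G.Realizes hadamard
  notGate : G.Realizes notGate
  toffoli : G.Realizes toffoli
  inverse : ∀ g, G.Realizes (G.mat g).conjTranspose

end GateSet

/-! ### Promise problems and the complexity class -/

/-- A promise problem over the binary alphabet. -/
structure PromiseProblem where
  yes : Set (List Bool)
  no : Set (List Bool)
  disjoint : Disjoint yes no

/-- The class of promise problems solvable, with completeness `c` and soundness `s`, by
logarithmic-space unitary quantum computation over the gate set `G`: on input `x`, a
logarithmic-space Turing machine writes down a circuit `V x` on `l |x|` qubits, `l` being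
logarithmically bounded; the circuit is applied to `|0…0⟩`, and only then is the first qubit
measured, the outcome `1` meaning acceptance. -/
def QUL (G : GateSet) (c s : ℕ → ℝ) : Set PromiseProblem :=
  {A | ∃ (l : ℕ → ℕ) (hl : ∀ n, 0 < l n) (V : (x : List Bool) → Circuit G (l x.length)),
    LogarithmicallyBounded l ∧
    LogspaceComputable (fun x : List Bool => x) (fun x => (V x).encode) ∧
    (∀ x ∈ A.yes, c x.length ≤ (V x).acceptProb (hl x.length)) ∧
    (∀ x ∈ A.no, (V x).acceptProb (hl x.length) ≤ s x.length)}

end UnitaryLogspace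

/-!
Amplification for unitary logarithmic-space quantum computation.  Neither repetition with fresh
qubits nor intermediate measurement is available with logarithmically many qubits, so the error is
reduced by a recursion in which each level costs a constant number of qubits and triples the length
of the circuit.  A number of levels logarithmic in the input length suffices, and then the length
of the circuit remains polynomial.

**The basic circuit.**  Let `V` be the given circuit, with acceptance probability `a`, and let `t` be
the mean of approximations of `c` and `s` whose error is small against the gap, so that `a` differs
from `t` in the right direction by at least a quarter of the gap (`threshold`).  Hadamard gates on
fresh qubits toss coins, and a chain of them produces a qubit that is one with probability
`t / 2`, bit by bit from the binary expansions of the approximations.  Choosing at random between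
the negation of this qubit and the conjunction of the outcome of `V` with a fair coin gives acceptance
probability `1 / 2 + (a - t) / 4` (`prob_baseWord`).

**One level.**  Let `W` be a circuit with acceptance probability `a`.  Run `W`, copy the outcome, run
`W⁻¹`, record whether all qubits are back to zero, run `W` again.  As in the amplification of
quantum proofs without new copies of the proof, the state moves in a plane spanned by `W |0⟩` and its
projection on acceptance, and consecutive outcomes agree with probability `a`, independently.  Hence
the majority of the three comparisons has probability exactly `3 * a ^ 2 - 2 * a ^ 3`
(`IsLevel.prob_levelWord`).  All outcomes are recorded coherently, and the record gives a unitary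
circuit to which the next level is applied.  Under iteration a bias below `1 / 4` grows by the
factor `11 / 8`, and then three times the error is squared (`iterProb_amplify`).

**Layout.**  Qubit `0` is the output.  The other qubits used form cells: cell `i` has the ladder qubits
`8 * i + 5`, …, `8 * i + 8`, which are zero except during the tests for zero, and the data qubits
`8 * i + 9`, …, `8 * i + 12`.  The given circuit and the coins use the first cells, and each level
one further cell.  The acceptance qubit of a word on `h` cells is `8 * h + 3`.

**Writing the circuit.**  Words of gates are lists of tokens `(name, arguments)`, encoded as circuit
descriptions are.  Logarithmic-space Turing machines are replaced by machines with several input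
heads and stacks of logarithmic height, programmed with loops and branches
(`LogspaceComputable.ls`, `LS.logspaceComputable`).  A head may run on a tape that is itself only
computable in logarithmic space: its letters are recomputed when they are scanned (`LS.query`,
`LS.ofProg`).  The word for the levels is written by a depth-first traversal of the recursion
(`LS.treeWord`), the coins are written by one pass over the bits (`LS.chainWord`), the basic circuit
and its inverse are substituted for the leaves (`LS.subst`, `LS.blockReverse`), and named blocks are
expanded into elementary gates and these into gates of the gate set (`LS.expand`).
-/

namespace UnitaryLogspace

/-! ### Stack machines -/

/-- What an input head scans: an end marker or a letter. -/
inductive Cell (I : Type) where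
  | left
  | sym (a : I)
  | right

instance {I : Type} [Finite I] : Finite (Cell I) :=
  Finite.of_injective
    (fun c : Cell I => match c with
      | .left => (Sum.inl false : Bool ⊕ I)
      | .right => Sum.inl true
      | .sym a => Sum.inr a)
    (by intro a b h; cases a <;> cases b <;> simp_all)

instance : Finite Move :=
  Finite.of_injective
    (fun c : Move => match c with
      | .left => (0 : Fin 3)
      | .stay => 1
      | .right => 2)
    (by intro a b h; cases a <;> cases b <;> simp_all)

/-- The content of cell `i` of a read-only tape holding `X` between two end markers. -/
def cellAt {I : Type} (X : List I) : ℕ → Cell I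
  | 0 => .left
  | i + 1 => match X[i]? with
    | some b => .sym b
    | none => .right

/-- Operations on one stack; `put a` replaces the top by `a`. -/
inductive StackOp (Γ : Type) where
  | keep
  | pop
  | push (a : Γ)
  | put (a : Γ)

/-- The effect of an operation on a stack, the top of which is the head of the list. -/
def StackOp.apply {Γ : Type} : StackOp Γ → List Γ → List Γ
  | .keep, l => l
  | .pop, l => l.tail
  | .push a, l => a :: l
  | .put a, l => a :: l.tail

/-- The data part of a configuration: positions of the input heads and contents of the
stacks. -/
@[ext] structure Store (H : Type) {ι : Type} (Γ : ι → Type) where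
  pos : H → ℕ
  stk : ∀ i, List (Γ i)

/-- What a machine sees in one step: the scanned cells and the tops of the stacks. -/
@[ext] structure View {H ι : Type} (I : H → Type) (Γ : ι → Type) where
  sym : ∀ h, Cell (I h)
  top : ∀ i, Option (Γ i)

/-- What a machine does in one step: moves of the heads, stack operations, and at most one
letter of output. -/
structure Eff (H : Type) {ι : Type} (Γ : ι → Type) (O : Type) where
  mv : H → Move
  op : ∀ i, StackOp (Γ i)
  out : Option O

section Store

variable {H ι O : Type} {I : H → Type} {Γ : ι → Type}

/-- The view of a store when head `h` runs on the tape holding `X h`. -/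
def Store.view (X : ∀ h, List (I h)) (σ : Store H Γ) : View I Γ where
  sym h := cellAt (X h) (σ.pos h)
  top i := (σ.stk i).head?

/-- The store after one step. -/
def Eff.app (X : ∀ h, List (I h)) (e : Eff H Γ O) (σ : Store H Γ) : Store H Γ where
  pos h := (e.mv h).applyInput (X h).length (σ.pos h)
  stk i := (e.op i).apply (σ.stk i)

/-- All stacks have height at most `S`. -/
def Store.Bdd (S : ℕ) (σ : Store H Γ) : Prop := ∀ i, (σ.stk i).length ≤ S

/-- The initial store. -/
def Store.init (H : Type) {ι : Type} (Γ : ι → Type) : Store H Γ where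
  pos _ := 0
  stk _ := []

/-- Replace one stack. -/
def Store.set [DecidableEq ι] (σ : Store H Γ) (i : ι) (l : List (Γ i)) : Store H Γ :=
  { σ with stk := Function.update σ.stk i l }

/-- Move one head. -/
def Store.goto [DecidableEq H] (σ : Store H Γ) (h : H) (p : ℕ) : Store H Γ :=
  { σ with pos := Function.update σ.pos h p }

@[simp] lemma Store.init_stk (i : ι) : (Store.init H Γ).stk i = [] := rfl
@[simp] lemma Store.init_pos (h : H) : (Store.init H Γ).pos h = 0 := rfl
@[simp] lemma Store.init_bdd (S : ℕ) : (Store.init H Γ).Bdd S := fun _ => Nat.zero_le _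

@[simp] lemma Store.set_pos [DecidableEq ι] (σ : Store H Γ) (i : ι) (l : List (Γ i)) :
    (σ.set i l).pos = σ.pos := rfl
@[simp] lemma Store.goto_stk [DecidableEq H] (σ : Store H Γ) (h : H) (p : ℕ) :
    (σ.goto h p).stk = σ.stk := rfl
@[simp] lemma Store.set_stk_self [DecidableEq ι] (σ : Store H Γ) (i : ι) (l : List (Γ i)) :
    (σ.set i l).stk i = l := by simp [Store.set]
lemma Store.set_stk_ne [DecidableEq ι] (σ : Store H Γ) {i j : ι} (h : j ≠ i)
    (l : List (Γ i)) : (σ.set i l).stk j = σ.stk j := by simp [Store.set, h]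
@[simp] lemma Store.goto_pos_self [DecidableEq H] (σ : Store H Γ) (h : H) (p : ℕ) :
    (σ.goto h p).pos h = p := by simp [Store.goto]
lemma Store.goto_pos_ne [DecidableEq H] (σ : Store H Γ) {h k : H} (hk : k ≠ h) (p : ℕ) :
    (σ.goto h p).pos k = σ.pos k := by simp [Store.goto, hk]
@[simp] lemma Store.set_set [DecidableEq ι] (σ : Store H Γ) (i : ι) (l l' : List (Γ i)) :
    (σ.set i l).set i l' = σ.set i l' := by simp [Store.set]
@[simp] lemma Store.goto_goto [DecidableEq H] (σ : Store H Γ) (h : H) (p p' : ℕ) :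
    (σ.goto h p).goto h p' = σ.goto h p' := by simp [Store.goto]
@[simp] lemma Store.set_self [DecidableEq ι] (σ : Store H Γ) (i : ι) :
    σ.set i (σ.stk i) = σ := by simp [Store.set]
lemma Store.set_eq_self [DecidableEq ι] (σ : Store H Γ) (i : ι) {l : List (Γ i)}
    (h : σ.stk i = l) : σ.set i l = σ := by subst h; simp
@[simp] lemma Store.goto_self [DecidableEq H] (σ : Store H Γ) (h : H) :
    σ.goto h (σ.pos h) = σ := by simp [Store.goto]
lemma Store.goto_eq_self [DecidableEq H] (σ : Store H Γ) (h : H) {p : ℕ} (hp : σ.pos h = p) :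
    σ.goto h p = σ := by subst hp; simp

lemma Store.set_comm [DecidableEq ι] (σ : Store H Γ) {i j : ι} (h : i ≠ j) (l : List (Γ i))
    (l' : List (Γ j)) : (σ.set i l).set j l' = (σ.set j l').set i l := by
  simp [Store.set, Function.update_comm h]

lemma Store.Bdd.set [DecidableEq ι] {S : ℕ} {σ : Store H Γ} (hσ : σ.Bdd S) {i : ι}
    {l : List (Γ i)} (hl : l.length ≤ S) : (σ.set i l).Bdd S := by
  intro j
  by_cases h : j = i
  · subst h; simpa using hl
  · rw [Store.set_stk_ne _ h]; exact hσ j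

lemma Store.Bdd.mono {S T : ℕ} (h : S ≤ T) {σ : Store H Γ} (hσ : σ.Bdd S) : σ.Bdd T :=
  fun i => (hσ i).trans h

end Store

/-- A machine with finite control, one two-way read-only head on a tape over `I h` for each
`h : H`, and finitely many stacks, that outputs at most one letter in each step. -/
structure SM (H : Type) (I : H → Type) (O : Type) where
  State : Type
  finiteState : Finite State
  ι : Type
  finiteι : Finite ι
  Γ : ι → Type
  finiteΓ : ∀ i, Finite (Γ i)
  start : State
  trans : State → View I Γ → Option (State × Eff H Γ O)

namespace SM

variable {H O : Type} {I : H → Type}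

/-- `M.Run X S q σ w q' σ'`: on the tapes `X` the machine gets from state `q` and store `σ` to
`q'` and `σ'`, writing `w`, and all stores on the way, except perhaps `σ`, have height at
most `S`. -/
inductive Run (M : SM H I O) (X : ∀ h, List (I h)) (S : ℕ) :
    M.State → Store H M.Γ → List O → M.State → Store H M.Γ → Prop
  | refl (q σ) : Run M X S q σ [] q σ
  | step {q σ q₁ e w q₂ σ₂} : M.trans q (σ.view X) = some (q₁, e) → (e.app X σ).Bdd S →
      Run M X S q₁ (e.app X σ) w q₂ σ₂ → Run M X S q σ (e.out.toList ++ w) q₂ σ₂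

/-- The machine halts on the tapes `X` with output `w`, its stacks never being higher
than `S`. -/
def Computes (M : SM H I O) (X : ∀ h, List (I h)) (S : ℕ) (w : List O) : Prop :=
  ∃ q σ, M.Run X S M.start (Store.init H M.Γ) w q σ ∧ M.trans q (σ.view X) = none

lemma Run.trans {M : SM H I O} {X : ∀ h, List (I h)} {S : ℕ} {q₁ q₂ q₃ σ₁ σ₂ σ₃ w w'}
    (h : M.Run X S q₁ σ₁ w q₂ σ₂) (h' : M.Run X S q₂ σ₂ w' q₃ σ₃) :
    M.Run X S q₁ σ₁ (w ++ w') q₃ σ₃ := by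
  induction h with
  | refl => exact h'
  | step h1 h2 _ ih => rw [List.append_assoc]; exact .step h1 h2 (ih h')

lemma Run.single {M : SM H I O} {X : ∀ h, List (I h)} {S : ℕ} {q σ q₁ e}
    (h : M.trans q (σ.view X) = some (q₁, e)) (hb : (e.app X σ).Bdd S) :
    M.Run X S q σ e.out.toList q₁ (e.app X σ) := by
  simpa using Run.step h hb (.refl _ _)

lemma Run.mono {M : SM H I O} {X : ∀ h, List (I h)} {S T : ℕ} (hST : S ≤ T) {q₁ q₂ σ₁ σ₂ w}
    (h : M.Run X S q₁ σ₁ w q₂ σ₂) : M.Run X T q₁ σ₁ w q₂ σ₂ := by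
  induction h with
  | refl => exact .refl _ _
  | step h1 h2 _ ih => exact .step h1 (h2.mono hST) ih

lemma Computes.mono {M : SM H I O} {X : ∀ h, List (I h)} {S T : ℕ} (hST : S ≤ T) {w}
    (h : M.Computes X S w) : M.Computes X T w := by
  obtain ⟨q, σ, h1, h2⟩ := h
  exact ⟨q, σ, h1.mono hST, h2⟩

end SM

/-! ### While programs -/

/-- While programs over elementary steps that see a value of `V` and have an effect in `E`. -/
inductive Prog (V E : Type) where
  /-- One step, whose effect depends on what is seen. -/
  | act (f : V → E)
  /-- First `p`, then `q`. -/
  | seq (p q : Prog V E)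
  /-- Go on with a program that depends on what is seen. -/
  | branch (f : V → Prog V E)
  /-- Repeat `p` while `b` holds. -/
  | loop (b : V → Bool) (p : Prog V E)

namespace Prog

variable {V E : Type}

/-- The control flow on lists of programs waiting to be executed. -/
inductive Flow : List (Prog V E) → List (Prog V E) → Prop
  | act (f k) : Flow (act f :: k) k
  | seq (p q k) : Flow (seq p q :: k) (p :: q :: k)
  | branch (f v k) : Flow (branch f :: k) (f v :: k)
  | loop (b p k) : Flow (loop b p :: k) (p :: loop b p :: k)
  | exit (b p k) : Flow (loop b p :: k) k

lemma Flow.append_inv {k s k' : List (Prog V E)} (hk : k ≠ []) (h : Flow (k ++ s) k') :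
    ∃ k₁, Flow k k₁ ∧ k' = k₁ ++ s := by
  obtain ⟨p, k, rfl⟩ := List.exists_cons_of_ne_nil hk
  rw [List.cons_append] at h
  cases h with
  | act => exact ⟨_, .act _ _, rfl⟩
  | seq => exact ⟨_, .seq _ _ _, rfl⟩
  | branch => exact ⟨_, .branch _ _ _, rfl⟩
  | loop => exact ⟨_, .loop _ _ _, rfl⟩
  | exit => exact ⟨_, .exit _ _ _, rfl⟩

/-- The nonempty lists of waiting programs that the execution of a program can lead to. -/
def conts : Prog V E → Set (List (Prog V E))
  | act f => {[act f]}
  | seq p q => {[seq p q]} ∪ (· ++ [q]) '' conts p ∪ conts q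
  | branch f => {[branch f]} ∪ ⋃ v, conts (f v)
  | loop b p => {[loop b p]} ∪ (· ++ [loop b p]) '' conts p

lemma conts_finite [Finite V] (p : Prog V E) : p.conts.Finite := by
  induction p with
  | act f => exact Set.finite_singleton _
  | seq p q hp hq => exact ((Set.finite_singleton _).union (hp.image _)).union hq
  | branch f ih => exact (Set.finite_singleton _).union (Set.finite_iUnion ih)
  | loop b p ih => exact (Set.finite_singleton _).union (ih.image _)

lemma self_mem_conts (p : Prog V E) : [p] ∈ p.conts := by
  cases p <;> simp [conts]

lemma conts_ne_nil (p : Prog V E) : ∀ k ∈ p.conts, k ≠ [] := by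
  induction p with
  | act f => simp [conts]
  | seq p q hp hq =>
    rintro k ((rfl | ⟨k, -, rfl⟩) | h)
    · simp
    · simp
    · exact hq k h
  | branch f ih =>
    rintro k (rfl | h)
    · simp
    · obtain ⟨v, h⟩ := Set.mem_iUnion.1 h
      exact ih v k h
  | loop b p ih =>
    rintro k (rfl | ⟨k, -, rfl⟩) <;> simp

/-- The lists that can be reached from a program form a finite set closed under `Flow`, so that they can
serve as the states of a machine. -/
lemma conts_closed (p : Prog V E) :
    ∀ k ∈ p.conts, ∀ k', Flow k k' → k' ∈ p.conts ∨ k' = [] := by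
  induction p with
  | act f =>
    rintro k rfl k' h
    cases h; simp
  | seq p q hp hq =>
    rintro k ((rfl | ⟨k, hk, rfl⟩) | hk) k' h
    · cases h
      exact .inl (.inl (.inr ⟨[p], self_mem_conts p, rfl⟩))
    · obtain ⟨k₁, h1, rfl⟩ := h.append_inv (conts_ne_nil p k hk)
      rcases hp k hk k₁ h1 with h2 | rfl
      · exact .inl (.inl (.inr ⟨k₁, h2, rfl⟩))
      · exact .inl (.inr (self_mem_conts q))
    · exact (hq k hk k' h).imp_left .inr
  | branch f ih =>
    rintro k (rfl | hk) k' h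
    · cases h with
      | branch f v => exact .inl (.inr (Set.mem_iUnion.2 ⟨v, self_mem_conts _⟩))
    · obtain ⟨v, hk⟩ := Set.mem_iUnion.1 hk
      exact (ih v k hk k' h).imp_left fun h => .inr (Set.mem_iUnion.2 ⟨v, h⟩)
  | loop b p ih =>
    rintro k (rfl | ⟨k, hk, rfl⟩) k' h
    · cases h with
      | loop => exact .inl (.inr ⟨[p], self_mem_conts p, rfl⟩)
      | exit => exact .inr rfl
    · obtain ⟨k₁, h1, rfl⟩ := h.append_inv (conts_ne_nil p k hk)
      rcases ih k hk k₁ h1 with h2 | rfl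
      · exact .inl (.inr ⟨k₁, h2, rfl⟩)
      · exact .inl (.inl rfl)

end Prog

section Exec

variable {H ι O : Type} {I : H → Type} {Γ : ι → Type}

/-- The step without effect. -/
def Eff.skip : Eff H Γ O where
  mv _ := .stay
  op _ := .keep
  out := none

/-- Programs that control a machine with tapes over `I` and stacks over `Γ`. -/
abbrev SProg (I : H → Type) (Γ : ι → Type) (O : Type) := Prog (View I Γ) (Eff H Γ O)

/-- `Exec X S p σ w σ'`: started on the tapes `X` with store `σ`, the program `p` ends with
store `σ'` and has written `w`; stack heights stay at most `S`. -/
inductive Exec (X : ∀ h, List (I h)) (S : ℕ) :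
    SProg I Γ O → Store H Γ → List O → Store H Γ → Prop
  | act {f : View I Γ → Eff H Γ O} {σ} : ((f (σ.view X)).app X σ).Bdd S →
      Exec X S (.act f) σ (f (σ.view X)).out.toList ((f (σ.view X)).app X σ)
  | seq {p q σ₁ w σ₂ w' σ₃} : Exec X S p σ₁ w σ₂ → Exec X S q σ₂ w' σ₃ →
      Exec X S (.seq p q) σ₁ (w ++ w') σ₃
  | branch {f : View I Γ → SProg I Γ O} {σ w σ'} : Exec X S (f (σ.view X)) σ w σ' →
      Exec X S (.branch f) σ w σ'
  | loop {b p σ₁ w σ₂ w' σ₃} : b (σ₁.view X) = true → Exec X S p σ₁ w σ₂ →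
      Exec X S (.loop b p) σ₂ w' σ₃ → Exec X S (.loop b p) σ₁ (w ++ w') σ₃
  | exit {b p σ} : b (σ.view X) = false → Exec X S (.loop b p) σ [] σ

variable {X : ∀ h, List (I h)} {S : ℕ}

lemma Exec.bdd {p : SProg I Γ O} {σ w σ'} (h : Exec X S p σ w σ') (hσ : σ.Bdd S) :
    σ'.Bdd S := by
  induction h with
  | act h => exact h
  | seq _ _ h1 h2 => exact h2 (h1 hσ)
  | branch _ ih => exact ih hσ
  | loop _ _ _ h1 h2 => exact h2 (h1 hσ)
  | exit => exact hσ

open Classical in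
/-- The machine that executes a program; its states are the lists of programs still to be
executed. -/
noncomputable def Prog.toSM [Finite H] [∀ h, Finite (I h)] [Finite ι] [∀ i, Finite (Γ i)]
    (p : SProg I Γ O) : SM H I O where
  State := ↥(p.conts ∪ {[]})
  finiteState := by
    have : Finite (View I Γ) := Finite.of_injective (fun v => (v.sym, v.top))
      (fun a b h => by cases a; cases b; simp_all)
    exact (p.conts_finite.union (Set.finite_singleton _)).to_subtype
  ι := ι
  finiteι := inferInstance
  Γ := Γ
  finiteΓ := inferInstance
  start := ⟨[p], .inl p.self_mem_conts⟩
  trans q v :=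
    let go (k : List (SProg I Γ O)) (e : Eff H Γ O) :=
      if h : k ∈ p.conts ∪ {[]} then some (⟨k, h⟩, e) else none
    match q.1 with
    | [] => none
    | .act f :: k => go k (f v)
    | .seq p q :: k => go (p :: q :: k) .skip
    | .branch f :: k => go (f v :: k) .skip
    | .loop b p :: k => if b v then go (p :: .loop b p :: k) .skip else go k .skip

lemma Prog.flow_mem [Finite H] [∀ h, Finite (I h)] [Finite ι] [∀ i, Finite (Γ i)]
    {p : SProg I Γ O} {k k' : List (SProg I Γ O)} (hk : k ∈ p.conts ∪ {[]})
    (h : Prog.Flow k k') : k' ∈ p.conts ∪ {[]} := by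
  rcases hk with hk | rfl
  · exact p.conts_closed k hk k' h
  · cases h

lemma Exec.run [Finite H] [∀ h, Finite (I h)] [Finite ι] [∀ i, Finite (Γ i)]
    (p₀ : SProg I Γ O) {p : SProg I Γ O} {σ w σ'} (h : Exec X S p σ w σ') (hσ : σ.Bdd S) :
    ∀ k (hk : p :: k ∈ p₀.conts ∪ {[]}), ∃ hk' : k ∈ p₀.conts ∪ {[]},
      p₀.toSM.Run X S ⟨p :: k, hk⟩ σ w ⟨k, hk'⟩ σ' := by
  have skip {σ : Store H Γ} (hσ : σ.Bdd S) {k k' : List (SProg I Γ O)}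
      (hk : k ∈ p₀.conts ∪ {[]}) (hk' : k' ∈ p₀.conts ∪ {[]})
      (h : p₀.toSM.trans ⟨k, hk⟩ (σ.view X) = some (⟨k', hk'⟩, .skip)) :
      p₀.toSM.Run X S ⟨k, hk⟩ σ [] ⟨k', hk'⟩ σ := SM.Run.single h hσ
  induction h with
  | @act f σ h =>
    intro k hk
    have hk' := Prog.flow_mem hk (.act _ _)
    exact ⟨hk', SM.Run.single (M := p₀.toSM) (by simp only [Prog.toSM]; rw [dif_pos hk']) h⟩
  | @seq p q σ₁ w σ₂ w' σ₃ h1 h2 ih1 ih2 =>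
    intro k hk
    have m1 := Prog.flow_mem hk (.seq _ _ _)
    obtain ⟨m2, r1⟩ := ih1 hσ (q :: k) m1
    obtain ⟨m3, r2⟩ := ih2 (h1.bdd hσ) k m2
    refine ⟨m3, (skip hσ hk m1 ?_).trans (r1.trans r2)⟩
    simp only [Prog.toSM]; rw [dif_pos m1]
  | @branch f σ w σ' _ ih =>
    intro k hk
    have m1 := Prog.flow_mem hk (.branch _ (σ.view X) _)
    obtain ⟨m2, r1⟩ := ih hσ k m1
    refine ⟨m2, (skip hσ hk m1 ?_).trans r1⟩
    simp only [Prog.toSM]; rw [dif_pos m1]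
  | @loop b p σ₁ w σ₂ w' σ₃ hb h1 h2 ih1 ih2 =>
    intro k hk
    have m1 := Prog.flow_mem hk (.loop _ _ _)
    obtain ⟨m2, r1⟩ := ih1 hσ _ m1
    obtain ⟨m3, r2⟩ := ih2 (h1.bdd hσ) k m2
    refine ⟨m3, (skip hσ hk m1 ?_).trans (r1.trans r2)⟩
    simp only [Prog.toSM]; rw [if_pos hb, dif_pos m1]
  | @exit b p σ hb =>
    intro k hk
    have m1 := Prog.flow_mem hk (.exit _ _ _)
    refine ⟨m1, skip hσ hk m1 ?_⟩
    simp only [Prog.toSM]; rw [hb, if_neg (by simp), dif_pos m1]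

lemma Exec.computes [Finite H] [∀ h, Finite (I h)] [Finite ι] [∀ i, Finite (Γ i)]
    {p : SProg I Γ O} {w σ'} (h : Exec X S p (Store.init H Γ) w σ') :
    p.toSM.Computes X S w := by
  obtain ⟨hk, r⟩ := h.run p (Store.init_bdd S) [] (.inl p.self_mem_conts)
  exact ⟨_, _, r, rfl⟩

end Exec

/-! ### Turing machines and stack machines -/

/-- `f` is computed by a stack machine with one input head and stacks of logarithmic height. -/
def LS {O : Type} (f : List Bool → List O) : Prop :=
  ∃ (M : SM Unit (fun _ => Bool) O) (K : ℕ), ∀ x,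
    M.Computes (fun _ => x) (K * (Nat.log 2 x.length + 1)) (f x)

instance : Finite InSym :=
  Finite.of_injective
    (fun c : InSym => match c with
      | .leftEnd => (none : Option (Option Bool))
      | .rightEnd => some none
      | .bit b => some (some b))
    (by intro a b h; cases a <;> cases b <;> simp_all)

/-- A scanned cell of a binary tape as a symbol of `InSym`. -/
def Cell.toInSym : Cell Bool → InSym
  | .left => .leftEnd
  | .sym b => .bit b
  | .right => .rightEnd

lemma toInSym_cellAt (x : List Bool) (i : ℕ) : (cellAt x i).toInSym = inputSym x i := by
  cases i with
  | zero => rfl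
  | succ i => simp only [cellAt, inputSym]; cases x[i]? <;> rfl

namespace Transducer

variable {O : Type}

/-- The words that remain to be written at some time during a step. -/
def buffers (M : Transducer O) : Set (List O) :=
  {[]} ∪ ⋃ a : M.State × InSym × (Fin M.tapes → M.Symbol),
    {w | ∃ r, M.trans a.1 a.2.1 a.2.2 = some r ∧ w <:+ r.2.2.2}

lemma buffers_finite (M : Transducer O) : M.buffers.Finite := by
  have := M.finiteState
  have := M.finiteSymbol
  refine (Set.finite_singleton _).union (Set.finite_iUnion fun a => ?_)
  rcases h : M.trans a.1 a.2.1 a.2.2 with _ | r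
  · simp
  · refine (List.finite_toSet r.2.2.2.tails).subset ?_
    rintro w ⟨r', h1, h2⟩
    cases h1
    simpa using h2

open Classical in
/-- Simulation of a Turing machine by a stack machine: a work tape is kept as the scanned symbol,
which is part of the state, and two stacks with the symbols to the left and to the right of it;
the words written in one step are written letter by letter. -/
noncomputable def toSM (M : Transducer O) : SM Unit (fun _ => Bool) O where
  State := M.State × (Fin M.tapes → M.Symbol) × ↥M.buffers
  finiteState := by
    have := M.finiteState
    have := M.finiteSymbol
    have := M.buffers_finite.to_subtype
    infer_instance
  ι := Fin M.tapes × Bool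
  finiteι := inferInstance
  Γ := fun _ => M.Symbol
  finiteΓ := fun _ => M.finiteSymbol
  start := (M.start, fun _ => M.blank, ⟨[], .inl rfl⟩)
  trans q v :=
    match q.2.2.1 with
    | c :: w =>
      if h : w ∈ M.buffers then
        some ((q.1, q.2.1, ⟨w, h⟩), { mv := fun _ => .stay, op := fun _ => .keep, out := some c })
      else none
    | [] =>
      match M.trans q.1 (v.sym ()).toInSym q.2.1 with
      | none => none
      | some r =>
        if h : r.2.2.2 ∈ M.buffers then
          some ((r.1,
            fun t => match (r.2.2.1 t).2 with
              | .left => (v.top (t, false)).getD M.blank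
              | .stay => (r.2.2.1 t).1
              | .right => (v.top (t, true)).getD M.blank,
            ⟨r.2.2.2, h⟩),
            { mv := fun _ => r.2.1
              op := fun j => match (r.2.2.1 j.1).2, j.2 with
                | .left, false => .pop
                | .left, true => .push (r.2.2.1 j.1).1
                | .stay, _ => .keep
                | .right, false => .push (r.2.2.1 j.1).1
                | .right, true => .pop
              out := none })
        else none

/-- The pair of stacks `l`, `r` and the symbol `c` represent a tape with content `g` and head
position `h`, inside the window of radius `S`. -/
structure Zips {Γ : Type} (blank : Γ) (S : ℕ) (g : ℤ → Γ) (h : ℤ) (c : Γ) (l r : List Γ) :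
    Prop where
  cur : c = g h
  left : ∀ j : ℕ, g (h - 1 - j) = l.getD j blank
  right : ∀ j : ℕ, g (h + 1 + j) = r.getD j blank
  lengthLeft : (l.length : ℤ) ≤ h + S
  lengthRight : (r.length : ℤ) ≤ S - h

lemma Zips.moveLeft {Γ : Type} {blank : Γ} {S : ℕ} {g : ℤ → Γ} {h : ℤ} {c : Γ} {l r : List Γ}
    (z : Zips blank S g h c l r) (a : Γ) (hS : |h - 1| ≤ S) :
    Zips blank S (Function.update g h a) (h - 1) (l.head?.getD blank) l.tail (a :: r) := by
  have h0 := abs_le.1 hS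
  refine ⟨?_, fun j => ?_, fun j => ?_, ?_, ?_⟩
  · rw [Function.update_of_ne (by omega)]
    have := z.left 0
    simp only [Nat.cast_zero, sub_zero] at this
    rw [this]; cases l <;> simp
  · rw [Function.update_of_ne (by omega)]
    have := z.left (j + 1)
    rw [show h - 1 - 1 - (j : ℤ) = h - 1 - ((j + 1 : ℕ) : ℤ) by push_cast; ring, this]
    cases l <;> simp
  · cases j with
    | zero => simp
    | succ j =>
      rw [Function.update_of_ne (by push_cast; omega)]
      have := z.right j
      rw [show h - 1 + 1 + ((j + 1 : ℕ) : ℤ) = h + 1 + j by push_cast; ring, this]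
      simp
  · have := z.lengthLeft
    cases l with
    | nil => simp; omega
    | cons => simp at this ⊢; omega
  · have := z.lengthRight
    simp; omega

lemma Zips.moveRight {Γ : Type} {blank : Γ} {S : ℕ} {g : ℤ → Γ} {h : ℤ} {c : Γ} {l r : List Γ}
    (z : Zips blank S g h c l r) (a : Γ) (hS : |h + 1| ≤ S) :
    Zips blank S (Function.update g h a) (h + 1) (r.head?.getD blank) (a :: l) r.tail := by
  have h0 := abs_le.1 hS
  refine ⟨?_, fun j => ?_, fun j => ?_, ?_, ?_⟩
  · rw [Function.update_of_ne (by omega)]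
    have := z.right 0
    simp only [Nat.cast_zero, add_zero] at this
    rw [this]; cases r <;> simp
  · cases j with
    | zero => simp
    | succ j =>
      rw [Function.update_of_ne (by push_cast; omega)]
      have := z.left j
      rw [show h + 1 - 1 - ((j + 1 : ℕ) : ℤ) = h - 1 - j by push_cast; ring, this]
      simp
  · rw [Function.update_of_ne (by omega)]
    have := z.right (j + 1)
    rw [show h + 1 + 1 + (j : ℤ) = h + 1 + ((j + 1 : ℕ) : ℤ) by push_cast; ring, this]
    cases r <;> simp
  · have := z.lengthLeft
    simp; omega
  · have := z.lengthRight
    cases r with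
    | nil => simp; omega
    | cons => simp at this ⊢; omega

lemma Zips.stay {Γ : Type} {blank : Γ} {S : ℕ} {g : ℤ → Γ} {h : ℤ} {c : Γ} {l r : List Γ}
    (z : Zips blank S g h c l r) (a : Γ) :
    Zips blank S (Function.update g h a) h a l r := by
  refine ⟨by simp, fun j => ?_, fun j => ?_, z.lengthLeft, z.lengthRight⟩
  · rw [Function.update_of_ne (by omega), z.left]
  · rw [Function.update_of_ne (by omega), z.right]

lemma Zips.height {Γ : Type} {blank : Γ} {S : ℕ} {g : ℤ → Γ} {h : ℤ} {c : Γ} {l r : List Γ}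
    (z : Zips blank S g h c l r) (hS : |h| ≤ S) : l.length ≤ 2 * S ∧ r.length ≤ 2 * S := by
  have h0 := abs_le.1 hS
  have := z.lengthLeft
  have := z.lengthRight
  omega

lemma toSM_flush (M : Transducer O) {X : Unit → List Bool} {S : ℕ} {σ : Store Unit M.toSM.Γ}
    (hσ : σ.Bdd S) (q : M.State) (cur : Fin M.tapes → M.Symbol) (w : List O)
    (hw : w ∈ M.buffers) :
    M.toSM.Run X S (q, cur, ⟨w, hw⟩) σ w (q, cur, ⟨[], .inl rfl⟩) σ := by
  induction w with
  | nil => exact .refl _ _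
  | cons c w ih =>
    have hw' : w ∈ M.buffers := by
      rcases hw with hw | hw
      · cases hw
      · obtain ⟨a, r, h1, h2⟩ := Set.mem_iUnion.1 hw
        exact .inr (Set.mem_iUnion.2 ⟨a, r, h1, (List.suffix_cons c w).trans h2⟩)
    refine (SM.Run.single (M := M.toSM) (e := { mv := fun _ => .stay, op := fun _ => .keep, out := some c })
      ?_ ?_).trans (ih hw')
    · simp only [toSM]; rw [dif_pos hw']
    · exact hσ

/-- The stack machine reaches a representation of each reachable configuration of the Turing machine,
with nothing left to be written. -/
lemma toSM_run (M : Transducer O) {x : List Bool} {S : ℕ} (hS : M.UsesSpace x S) {a : M.Cfg}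
    (ha : M.Reaches x a) :
    ∃ (cur : Fin M.tapes → M.Symbol) (σ : Store Unit M.toSM.Γ),
      M.toSM.Run (fun _ => x) (2 * S) M.toSM.start (Store.init Unit M.toSM.Γ) a.out
        (a.state, cur, ⟨[], .inl rfl⟩) σ ∧ σ.pos () = a.inHead ∧
      ∀ t, Zips M.blank S (a.work t) (a.head t) (cur t) (σ.stk (t, false)) (σ.stk (t, true)) := by
  induction ha with
  | refl =>
    refine ⟨fun _ => M.blank, Store.init _ _, .refl _ _, rfl, fun t => ?_⟩
    refine ⟨rfl, fun j => rfl, fun j => rfl, ?_, ?_⟩ <;> simp [init, Store.init]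
  | @tail a b hab hstep ih =>
    obtain ⟨cur, σ, hrun, hpos, hz⟩ := ih
    have hcur : cur = fun i => a.work i (a.head i) := funext fun t => (hz t).cur
    have hb : M.Reaches x b := hab.tail hstep
    obtain ⟨r, hr, rfl⟩ := Option.map_eq_some_iff.1 hstep
    have hbuf : r.2.2.2 ∈ M.buffers :=
      .inr (Set.mem_iUnion.2 ⟨(a.state, inputSym x a.inHead, fun i => a.work i (a.head i)), r, hr,
        List.suffix_refl _⟩)
    have hsp := hS _ hb
    simp only at hsp
    -- the symbols scanned after the step, and the effect of the step on the stacks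
    let cur' : Fin M.tapes → M.Symbol := fun t => match (r.2.2.1 t).2 with
      | .left => ((σ.stk (t, false)).head?).getD M.blank
      | .stay => (r.2.2.1 t).1
      | .right => ((σ.stk (t, true)).head?).getD M.blank
    let e : Eff Unit M.toSM.Γ O :=
      { mv := fun _ => r.2.1
        op := fun j => match (r.2.2.1 j.1).2, j.2 with
          | .left, false => .pop
          | .left, true => .push (r.2.2.1 j.1).1
          | .stay, _ => .keep
          | .right, false => .push (r.2.2.1 j.1).1
          | .right, true => .pop
        out := none }
    have hz' : ∀ t, Zips M.blank S (Function.update (a.work t) (a.head t) (r.2.2.1 t).1)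
        (a.head t + (r.2.2.1 t).2.toInt) (cur' t)
        ((e.app (fun _ => x) σ).stk (t, false)) ((e.app (fun _ => x) σ).stk (t, true)) := by
      intro t
      have h1 := hsp t
      simp only [Eff.app, e, cur']
      cases h : (r.2.2.1 t).2 <;> rw [h] at h1 <;> simp only [Move.toInt, StackOp.apply] at h1 ⊢
      · exact (hz t).moveLeft _ h1
      · rw [add_zero]; exact (hz t).stay _
      · exact (hz t).moveRight _ h1
    have hbd : (e.app (fun _ => x) σ).Bdd (2 * S) := by
      rintro ⟨t, s⟩
      have := (hz' t).height (hsp t)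
      cases s
      · exact this.1
      · exact this.2
    refine ⟨cur', e.app (fun _ => x) σ, hrun.trans ?_, ?_, hz'⟩
    · refine (SM.Run.single (M := M.toSM) (e := e) (q₁ := (r.1, cur', ⟨r.2.2.2, hbuf⟩)) ?_ hbd).trans
        (M.toSM_flush hbd r.1 cur' r.2.2.2 hbuf)
      have h2 : ((σ.view fun _ => x).sym ()).toInSym = inputSym x a.inHead := by
        rw [← hpos]; exact toInSym_cellAt _ _
      have key : ∀ v : View (fun _ : Unit => Bool) (fun _ : Fin M.tapes × Bool => M.Symbol),
          (v.sym ()).toInSym = inputSym x a.inHead →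
          M.toSM.trans (a.state, cur, ⟨[], .inl rfl⟩) v = some ((r.1,
            fun t => match (r.2.2.1 t).2 with
              | .left => (v.top (t, false)).getD M.blank
              | .stay => (r.2.2.1 t).1
              | .right => (v.top (t, true)).getD M.blank, ⟨r.2.2.2, hbuf⟩), e) := by
        intro v hv
        simp only [toSM]
        rw [hv, hcur, hr]
        simp only
        rw [dif_pos hbuf]
        rfl
      exact key _ h2
    · simp [Eff.app, e, hpos]

lemma toSM_computes (M : Transducer O) {x : List Bool} {S : ℕ} {w : List O}
    (hS : M.UsesSpace x S) (h : M.Outputs x w) : M.toSM.Computes (fun _ => x) (2 * S) w := by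
  obtain ⟨a, ha, hhalt, rfl⟩ := h
  obtain ⟨cur, σ, hrun, hpos, hz⟩ := M.toSM_run hS ha
  refine ⟨_, σ, hrun, ?_⟩
  have hcur : cur = fun i => a.work i (a.head i) := funext fun t => (hz t).cur
  have h2 : ((σ.view fun _ => x).sym ()).toInSym = inputSym x a.inHead := by
    rw [← hpos]; exact toInSym_cellAt _ _
  have h3 := Option.map_eq_none_iff.1 hhalt
  have key : ∀ v : View (fun _ : Unit => Bool) (fun _ : Fin M.tapes × Bool => M.Symbol),
      (v.sym ()).toInSym = inputSym x a.inHead →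
      M.toSM.trans (a.state, cur, ⟨[], .inl rfl⟩) v = none := by
    intro v hv
    simp only [toSM]
    rw [hv, hcur, h3]
  exact key _ h2

end Transducer

lemma LogspaceComputable.ls {O : Type} {f : List Bool → List O}
    (h : LogspaceComputable (fun x => x) f) : LS f := by
  obtain ⟨M, K, h⟩ := h
  refine ⟨M.toSM, 2 * K, fun x => ?_⟩
  rw [mul_assoc]
  exact M.toSM_computes (h x).2 (h x).1

namespace SM

open Classical in
/-- The tape symbol whose component at `i` is `a`. -/
noncomputable def tapeSym {ι : Type} {Γ : ι → Type} (i : ι) (a : Γ i) (j : ι) : Option (Γ j) :=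
  Function.update (fun _ => none) i (some a) j

variable {O : Type}

section Tape

variable {ι : Type} {Γ : ι → Type} {i : ι}

open Classical in
/-- What is written on the tape of stack `i`, and how its head moves, in the first of the two steps
for the operation `op`, when the head scans `s`. -/
noncomputable def firstAct (op : StackOp (Γ i)) (s : ∀ j, Option (Γ j)) :
    (∀ j, Option (Γ j)) × Move :=
  match op with
  | .keep => (s, .stay)
  | .pop => if s i = none then (s, .stay) else (fun _ => none, .left)
  | .push _ => (s, .right)
  | .put a => if s i = none then (s, .right) else (tapeSym i a, .stay)

open Classical in
/-- The symbol to be written in the second step. -/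
noncomputable def pending (op : StackOp (Γ i)) (s : ∀ j, Option (Γ j)) : Option (Γ i) :=
  match op with
  | .push a => some a
  | .put a => if s i = none then some a else none
  | _ => none

/-- What is written in the second step, when `p` is pending and the head scans `s`. -/
noncomputable def secondSym (p : Option (Γ i)) (s : ∀ j, Option (Γ j)) : ∀ j, Option (Γ j) :=
  match p with
  | none => s
  | some a => tapeSym i a

end Tape

/-- A scanned cell of a binary tape as a `Cell`. -/
def _root_.UnitaryLogspace.InSym.toCell : InSym → Cell Bool
  | .leftEnd => .left
  | .bit b => .sym b
  | .rightEnd => .right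

/-- The stacks of a machine in bijection with the tapes of the Turing machine simulating it. -/
noncomputable def stackEquiv (M : SM Unit (fun _ => Bool) O) : M.ι ≃ Fin (Nat.card M.ι) :=
  @Finite.equivFin M.ι M.finiteι

/-- Simulation of a stack machine by a Turing machine.  A stack of height `k` occupies the cells
`1, …, k` of its tape, with the head on cell `k`; on the tape of stack `i` only the `i`-th
component of a symbol matters.  A push takes two steps: the first moves the head, and the second
writes. -/
noncomputable abbrev toTransducer (M : SM Unit (fun _ => Bool) O) : Transducer O where
  State := M.State × Option (∀ i, Option (M.Γ i))
  finiteState := by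
    have := M.finiteι
    have := M.finiteState
    have := M.finiteΓ
    infer_instance
  Symbol := ∀ i, Option (M.Γ i)
  finiteSymbol := by
    have := M.finiteι
    have := M.finiteΓ
    infer_instance
  blank := fun _ => none
  tapes := Nat.card M.ι
  start := (M.start, none)
  trans := fun q s f =>
    match q.2 with
    | none =>
      (M.trans q.1 ⟨fun _ => s.toCell, fun i => f (M.stackEquiv i) i⟩).map fun r =>
        ((r.1, some fun i => pending (r.2.op i) (f (M.stackEquiv i))), r.2.mv (),
          fun t => firstAct (r.2.op (M.stackEquiv.symm t)) (f t), r.2.out.toList)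
    | some p => some ((q.1, none), .stay,
        fun t => (secondSym (p (M.stackEquiv.symm t)) (f t), .stay), [])

/-- The component `g` of a tape content and the head position `h` represent the stack `l`. -/
structure TapeRep {Γ : Type} (g : ℤ → Option Γ) (h : ℤ) (l : List Γ) : Prop where
  head : h = l.length
  zero : g 0 = none
  cell : ∀ k : ℕ, g (k + 1) = l.reverse[k]?

lemma TapeRep.top {Γ : Type} {g : ℤ → Option Γ} {h : ℤ} {l : List Γ} (r : TapeRep g h l) :
    g h = l.head? := by
  rw [r.head]
  cases l with
  | nil => simpa using r.zero
  | cons a l =>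
    have := r.cell l.length
    simp only [List.reverse_cons] at this
    rw [List.getElem?_append_right (by simp)] at this
    simpa using this

lemma TapeRep.pop {Γ : Type} {g : ℤ → Option Γ} {h : ℤ} {a : Γ} {l : List Γ}
    (r : TapeRep g h (a :: l)) : TapeRep (Function.update g h none) (h - 1) l := by
  have hh := r.head
  simp only [List.length_cons, Nat.cast_add, Nat.cast_one] at hh
  refine ⟨by omega, ?_, fun k => ?_⟩
  · rw [Function.update_of_ne (by omega)]; exact r.zero
  · have := r.cell k
    simp only [List.reverse_cons] at this
    by_cases hk : k = l.length
    · subst hk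
      rw [← hh]; simp
    · rw [Function.update_of_ne (by omega), this]
      rcases Nat.lt_or_gt_of_ne hk with h1 | h1
      · rw [List.getElem?_append_left (by simpa using h1)]
      · rw [List.getElem?_append_right (by simp; omega), List.getElem?_eq_none (by simp; omega),
          List.getElem?_eq_none (by simp; omega)]

lemma TapeRep.push {Γ : Type} {g : ℤ → Option Γ} {h : ℤ} {l : List Γ}
    (r : TapeRep g h l) (a : Γ) :
    TapeRep (Function.update g (h + 1) (some a)) (h + 1) (a :: l) := by
  have hh := r.head
  refine ⟨by simp [hh], ?_, fun k => ?_⟩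
  · rw [Function.update_of_ne (by omega)]; exact r.zero
  · have := r.cell k
    simp only [List.reverse_cons]
    by_cases hk : k = l.length
    · subst hk
      rw [← hh]; simp
    · rw [Function.update_of_ne (by omega), this]
      rcases Nat.lt_or_gt_of_ne hk with h1 | h1
      · rw [List.getElem?_append_left (by simpa using h1)]
      · rw [List.getElem?_append_right (by simp; omega), List.getElem?_eq_none (by simp; omega),
          List.getElem?_eq_none (by simp; omega)]

lemma TapeRep.put {Γ : Type} {g : ℤ → Option Γ} {h : ℤ} {a : Γ} {l : List Γ}
    (r : TapeRep g h (a :: l)) (b : Γ) : TapeRep (Function.update g h (some b)) h (b :: l) := by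
  have := (r.pop.push b)
  simpa using this

end SM

namespace Transducer

variable {O : Type}

/-- A run all configurations of which satisfy `B`. -/
inductive Path (M : Transducer O) (x : List Bool) (B : M.Cfg → Prop) : M.Cfg → M.Cfg → Prop
  | refl {a} : B a → Path M x B a a
  | step {a b c} : B a → M.step x a = some b → Path M x B b c → Path M x B a c

lemma Path.trans {M : Transducer O} {x B a b c} (h : M.Path x B a b) (h' : M.Path x B b c) :
    M.Path x B a c := by
  induction h with
  | refl => exact h'
  | step h1 h2 _ ih => exact .step h1 h2 (ih h')

lemma Path.reaches {M : Transducer O} {x B a b} (h : M.Path x B a b) :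
    Relation.ReflTransGen (fun b b' => M.step x b = some b') a b := by
  induction h with
  | refl => exact .refl
  | step _ h2 _ ih => exact .head h2 ih

/-- Since the machine is deterministic, a halting run contains all reachable configurations. -/
lemma Path.all {M : Transducer O} {x B a b} (h : M.Path x B a b) (hb : M.step x b = none)
    {c} (hc : Relation.ReflTransGen (fun b b' => M.step x b = some b') a c) : B c := by
  induction h with
  | refl h1 =>
    rcases Relation.ReflTransGen.cases_head hc with rfl | ⟨d, hd, -⟩
    · exact h1
    · rw [hb] at hd; cases hd
  | step h1 h2 _ ih =>
    rcases Relation.ReflTransGen.cases_head hc with rfl | ⟨d, hd, h3⟩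
    · exact h1
    · rw [h2] at hd; cases hd
      exact ih hb h3

end Transducer

namespace SM

variable {O : Type}

lemma update_component {ι : Type} {Γ : ι → Type} (w : ℤ → ∀ i, Option (Γ i)) (h : ℤ)
    (s : ∀ i, Option (Γ i)) (i : ι) :
    (fun z => Function.update w h s z i) = Function.update (fun z => w z i) h (s i) := by
  funext z
  by_cases hz : z = h
  · subst hz; simp
  · simp [hz]

@[simp] lemma tapeSym_self {ι : Type} {Γ : ι → Type} (i : ι) (a : Γ i) :
    tapeSym i a i = some a := by simp [tapeSym]

/-- The two steps of the Turing machine that simulate an operation on a stack. -/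
lemma TapeRep.twoSteps {ι : Type} {Γ : ι → Type} {i : ι} {w : ℤ → ∀ j, Option (Γ j)} {h : ℤ}
    {l : List (Γ i)} (r : TapeRep (fun z => w z i) h l) (op : StackOp (Γ i)) :
    let w₁ := Function.update w h (firstAct op (w h)).1
    let h₁ := h + (firstAct op (w h)).2.toInt
    TapeRep (fun z => Function.update w₁ h₁ (secondSym (pending op (w h)) (w₁ h₁)) z i) h₁
      (op.apply l) := by
  have htop := r.top
  dsimp only
  have hnone : pending op (w h) = none → ∀ h₁, (fun z => Function.update
      (Function.update w h (firstAct op (w h)).1) h₁ (secondSym (pending op (w h))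
        (Function.update w h (firstAct op (w h)).1 h₁)) z i) =
      Function.update (fun z => w z i) h ((firstAct op (w h)).1 i) := by
    intro hp h₁
    rw [hp, ← update_component, secondSym, Function.update_eq_self]
  cases op with
  | keep =>
    rw [hnone rfl]
    simpa [firstAct, Move.toInt, StackOp.apply] using r
  | push c =>
    rw [update_component, update_component]
    simpa [firstAct, secondSym, pending, Move.toInt, StackOp.apply] using r.push c
  | pop =>
    rw [hnone rfl]
    cases l with
    | nil =>
      have h1 : firstAct (i := i) .pop (w h) = (w h, .stay) := if_pos htop
      rw [h1]
      simpa [Move.toInt, StackOp.apply] using r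
    | cons d l =>
      have h1 : firstAct (i := i) .pop (w h) = (fun _ => none, .left) :=
        if_neg (by rw [htop]; simp)
      rw [h1]
      simpa [Move.toInt, StackOp.apply, ← sub_eq_add_neg] using r.pop
  | put c =>
    cases l with
    | nil =>
      have h1 : firstAct (i := i) (.put c) (w h) = (w h, .right) := if_pos htop
      have h2 : pending (i := i) (.put c) (w h) = some c := if_pos htop
      rw [update_component, update_component, h1, h2]
      simpa [secondSym, Move.toInt, StackOp.apply] using r.push c
    | cons d l =>
      have h0 : ¬ w h i = none := by rw [htop]; simp
      have h1 : firstAct (i := i) (.put c) (w h) = (tapeSym i c, .stay) := if_neg h0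
      rw [hnone (if_neg h0), h1]
      simpa [Move.toInt, StackOp.apply] using r.put c

/-- The configuration `a` of the Turing machine represents state `q` and store `σ`. -/
structure CfgRep (M : SM Unit (fun _ => Bool) O) (q : M.State) (σ : Store Unit M.Γ)
    (a : M.toTransducer.Cfg) : Prop where
  state : a.state = (q, none)
  inHead : a.inHead = σ.pos ()
  tape : ∀ t, TapeRep (fun z => a.work t z (M.stackEquiv.symm t)) (a.head t)
    (σ.stk (M.stackEquiv.symm t))

lemma CfgRep.view {M : SM Unit (fun _ => Bool) O} {q σ a} (r : M.CfgRep q σ a) (x : List Bool) :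
    (⟨fun _ => (inputSym x a.inHead).toCell,
      fun i => a.work (M.stackEquiv i) (a.head (M.stackEquiv i)) i⟩ :
        View (fun _ : Unit => Bool) M.Γ) = σ.view fun _ => x := by
  refine View.ext ?_ (funext fun i => ?_)
  · funext h
    simp only [Store.view, r.inHead, ← toInSym_cellAt]
    cases cellAt x (σ.pos ()) <;> rfl
  · have : ∀ t j, M.stackEquiv.symm t = j → a.work t (a.head t) j = (σ.stk j).head? := by
      rintro t _ rfl
      exact (r.tape t).top
    exact this _ _ (by simp)

lemma CfgRep.head_le {M : SM Unit (fun _ => Bool) O} {q σ a} (r : M.CfgRep q σ a) {S : ℕ}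
    (hσ : σ.Bdd S) (t) : |a.head t| ≤ (S : ℤ) := by
  rw [(r.tape t).head]
  simp only [Nat.abs_cast, Nat.cast_le]
  exact hσ _

lemma CfgRep.step {M : SM Unit (fun _ => Bool) O} {q σ a} (r : M.CfgRep q σ a) {x : List Bool}
    {S : ℕ} (hσ : σ.Bdd S) {q' e} (h : M.trans q (σ.view fun _ => x) = some (q', e))
    (hσ' : (e.app (fun _ => x) σ).Bdd S) :
    ∃ b, M.CfgRep q' (e.app (fun _ => x) σ) b ∧ b.out = a.out ++ e.out.toList ∧
      M.toTransducer.Path x (fun c => ∀ i, |c.head i| ≤ (S : ℤ)) a b := by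
  -- the configurations after the first and after the second step
  let b₁ : M.toTransducer.Cfg :=
    { state := (q', some fun i => pending (e.op i)
        (a.work (M.stackEquiv i) (a.head (M.stackEquiv i))))
      inHead := (e.mv ()).applyInput x.length a.inHead
      work := fun t => Function.update (a.work t) (a.head t)
        (firstAct (e.op (M.stackEquiv.symm t)) (a.work t (a.head t))).1
      head := fun t => a.head t +
        (firstAct (e.op (M.stackEquiv.symm t)) (a.work t (a.head t))).2.toInt
      out := a.out ++ e.out.toList }
  let b₂ : M.toTransducer.Cfg :=
    { state := (q', none)
      inHead := (e.mv ()).applyInput x.length a.inHead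
      work := fun t => Function.update (b₁.work t) (b₁.head t)
        (secondSym (pending (e.op (M.stackEquiv.symm t)) (a.work t (a.head t)))
          (b₁.work t (b₁.head t)))
      head := b₁.head
      out := a.out ++ e.out.toList }
  have hs₁ : M.toTransducer.step x a = some b₁ := by
    simp [Transducer.step, r.state, r.view x, h, b₁]
  have hs₂ : M.toTransducer.step x b₁ = some b₂ := by
    simp [Transducer.step, b₁, b₂, Move.applyInput, Move.toInt]
  have hb₂ : M.CfgRep q' (e.app (fun _ => x) σ) b₂ :=
    ⟨rfl, by simp [b₂, Eff.app, r.inHead], fun t => (r.tape t).twoSteps (e.op _)⟩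
  exact ⟨b₂, hb₂, rfl, .step (r.head_le hσ) hs₁ (.step (hb₂.head_le hσ') hs₂
    (.refl (hb₂.head_le hσ')))⟩

lemma CfgRep.run {M : SM Unit (fun _ => Bool) O} {x : List Bool} {S : ℕ} {q σ w q' σ'}
    (h : M.Run (fun _ => x) S q σ w q' σ') {a} (r : M.CfgRep q σ a) (hσ : σ.Bdd S) :
    ∃ b, M.CfgRep q' σ' b ∧ b.out = a.out ++ w ∧
      M.toTransducer.Path x (fun c => ∀ i, |c.head i| ≤ (S : ℤ)) a b := by
  induction h generalizing a with
  | refl q σ => exact ⟨a, r, by simp, .refl (r.head_le hσ)⟩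
  | step h1 h2 _ ih =>
    obtain ⟨b, rb, ho, hp⟩ := r.step hσ h1 h2
    obtain ⟨c, rc, ho', hp'⟩ := ih rb h2
    exact ⟨c, rc, by rw [ho', ho, List.append_assoc], hp.trans hp'⟩

lemma toTransducer_spec (M : SM Unit (fun _ => Bool) O) {x : List Bool} {S : ℕ} {w : List O}
    (h : M.Computes (fun _ => x) S w) :
    M.toTransducer.Outputs x w ∧ M.toTransducer.UsesSpace x S := by
  obtain ⟨q, σ, hrun, hhalt⟩ := h
  have r₀ : M.CfgRep M.start (Store.init Unit M.Γ) M.toTransducer.init :=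
    ⟨rfl, rfl, fun t => ⟨by simp [Transducer.init], rfl, fun k => by simp [Transducer.init]⟩⟩
  obtain ⟨b, rb, ho, hp⟩ := CfgRep.run hrun r₀ (Store.init_bdd S)
  have hb : M.toTransducer.step x b = none := by
    simp [Transducer.step, rb.state, rb.view x, hhalt]
  exact ⟨⟨b, hp.reaches, hb, by rw [ho]; rfl⟩, fun a ha => hp.all hb ha⟩

end SM

lemma LS.logspaceComputable {O : Type} {f : List Bool → List O} (h : LS f) :
    LogspaceComputable (fun x => x) f := by
  obtain ⟨M, K, h⟩ := h
  exact ⟨M.toTransducer, K, fun x => (M.toTransducer_spec (h x))⟩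

/-! ### The length of the output -/

namespace SM

variable {O : Type} {M : SM Unit (fun _ => Bool) O}

/-- The machine halts after exactly `t` steps. -/
def HaltsIn (M : SM Unit (fun _ => Bool) O) (x : List Bool) :
    ℕ → M.State → Store Unit M.Γ → Prop
  | 0, q, σ => M.trans q (σ.view fun _ => x) = none
  | t + 1, q, σ => ∃ q' e, M.trans q (σ.view fun _ => x) = some (q', e) ∧
      M.HaltsIn x t q' (e.app (fun _ => x) σ)

lemma HaltsIn.unique {x : List Bool} {t t' : ℕ} {q σ} (h : M.HaltsIn x t q σ)
    (h' : M.HaltsIn x t' q σ) : t = t' := by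
  induction t generalizing t' q σ with
  | zero =>
    cases t' with
    | zero => rfl
    | succ t' =>
      obtain ⟨q', e, h1, -⟩ := h'
      rw [HaltsIn, h1] at h; cases h
  | succ t ih =>
    obtain ⟨q', e, h1, h2⟩ := h
    cases t' with
    | zero => rw [HaltsIn, h1] at h'; cases h'
    | succ t' =>
      obtain ⟨q'', e', h3, h4⟩ := h'
      rw [h1] at h3; cases h3
      rw [ih h2 h4]

/-- A halting run visits pairwise different configurations, since the number of steps up to the
halt is determined by the configuration. -/
lemma Run.trace {x : List Bool} {S : ℕ} {q σ w q' σ'}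
    (h : M.Run (fun _ => x) S q σ w q' σ') (hhalt : M.trans q' (σ'.view fun _ => x) = none)
    (hσ : σ.Bdd S) (hp : σ.pos () ≤ x.length + 1) :
    ∃ L : List (M.State × Store Unit M.Γ), w.length < L.length ∧ L.Nodup ∧
      M.HaltsIn x (L.length - 1) q σ ∧
      ∀ c ∈ L, c.2.Bdd S ∧ c.2.pos () ≤ x.length + 1 ∧ ∃ t < L.length, M.HaltsIn x t c.1 c.2 := by
  induction h with
  | refl q σ =>
    refine ⟨[(q, σ)], by simp, by simp, hhalt, fun c hc => ?_⟩
    simp only [List.mem_singleton] at hc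
    subst hc
    exact ⟨hσ, hp, 0, by simp, hhalt⟩
  | @step q σ q₁ e w q₂ σ₂ h1 h2 _ ih =>
    obtain ⟨L, hw, hL, ht, hc⟩ := ih hhalt h2 (by
      simp only [Eff.app]
      cases e.mv () <;> simp only [Move.applyInput] <;> omega)
    have ht' : M.HaltsIn x L.length q σ := by
      obtain ⟨k, hk⟩ : ∃ k, L.length = k + 1 := ⟨L.length - 1, by omega⟩
      rw [hk] at ht ⊢
      exact ⟨q₁, e, h1, ht⟩
    refine ⟨(q, σ) :: L, ?_, ?_, ht', ?_⟩
    · have : e.out.toList.length ≤ 1 := by cases e.out <;> simp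
      simp only [List.length_append, List.length_cons]
      omega
    · refine List.nodup_cons.2 ⟨fun hmem => ?_, hL⟩
      obtain ⟨-, -, t, htl, ht2⟩ := hc _ hmem
      exact htl.ne (ht2.unique ht')
    · intro c hmem
      rcases List.mem_cons.1 hmem with rfl | hmem
      · exact ⟨hσ, hp, L.length, by simp, ht'⟩
      · obtain ⟨a1, a2, t, a3, a4⟩ := hc c hmem
        exact ⟨a1, a2, t, by simp; omega, a4⟩

/-- At most one letter is written per step, and there are at most as many steps as configurations. -/
lemma Computes.length_le {x : List Bool} {S : ℕ} {w : List O}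
    (h : M.Computes (fun _ => x) S w) :
    w.length ≤ Nat.card (M.State × Fin (x.length + 2) × (∀ i, Fin S → Option (M.Γ i))) := by
  obtain ⟨q, σ, hrun, hhalt⟩ := h
  obtain ⟨L, hw, hL, -, hc⟩ := hrun.trace hhalt (Store.init_bdd S) (Nat.zero_le _)
  have := M.finiteState
  have := M.finiteι
  have := M.finiteΓ
  let code : M.State × Store Unit M.Γ →
      M.State × Fin (x.length + 2) × (∀ i, Fin S → Option (M.Γ i)) := fun c =>
    (c.1, Fin.ofNat _ (c.2.pos ()), fun i j => (c.2.stk i)[(j : ℕ)]?)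
  have hinj : ∀ a ∈ L, ∀ b ∈ L, code a = code b → a = b := by
    rintro ⟨q₁, σ₁⟩ h1 ⟨q₂, σ₂⟩ h2 h12
    obtain ⟨b1, p1, -⟩ := hc _ h1
    obtain ⟨b2, p2, -⟩ := hc _ h2
    simp only at p1 p2
    simp only [code, Prod.mk.injEq] at h12
    obtain ⟨rfl, h3, h4⟩ := h12
    congr 1
    refine Store.ext (funext fun u => ?_) (funext fun i => List.ext_getElem? fun j => ?_)
    · have := congrArg Fin.val h3
      simp only [Fin.ofNat] at this
      rwa [Nat.mod_eq_of_lt (by omega), Nat.mod_eq_of_lt (by omega)] at this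
    · by_cases hj : j < S
      · exact congrFun (congrFun h4 i) ⟨j, hj⟩
      · rw [List.getElem?_eq_none ((b1 i).trans (by omega)),
          List.getElem?_eq_none ((b2 i).trans (by omega))]
  have hnd : (L.map code).Nodup := hL.map_on fun a ha b hb => hinj a ha b hb
  have := Fintype.ofFinite (M.State × Fin (x.length + 2) × (∀ i, Fin S → Option (M.Γ i)))
  rw [Nat.card_eq_fintype_card]
  have := hnd.length_le_card
  rw [List.length_map] at this
  omega

end SM

lemma add_two_le_two_pow_log (n : ℕ) : n + 2 ≤ 2 ^ (2 * (Nat.log 2 n + 1)) := by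
  have h1 : n < 2 ^ (Nat.log 2 n + 1) := Nat.lt_pow_succ_log_self (by norm_num) n
  have h2 : 2 ≤ 2 ^ (Nat.log 2 n + 1) := by
    calc 2 = 2 ^ 1 := rfl
      _ ≤ _ := Nat.pow_le_pow_right (by norm_num) (by omega)
  calc n + 2 ≤ 2 ^ (Nat.log 2 n + 1) * 2 := by omega
    _ ≤ 2 ^ (Nat.log 2 n + 1) * 2 ^ (Nat.log 2 n + 1) := by gcongr
    _ = _ := by rw [← pow_add]; congr 1; ring

/-- A word computable in logarithmic space has polynomial length. -/
lemma LS.length_le {O : Type} {f : List Bool → List O} (h : LS f) :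
    ∃ C : ℕ, ∀ x, (f x).length ≤ 2 ^ (C * (Nat.log 2 x.length + 1)) := by
  obtain ⟨M, K, h⟩ := h
  have := M.finiteState
  have := M.finiteι
  have := M.finiteΓ
  have := Fintype.ofFinite M.ι
  have hpow : ∀ m : ℕ, m ≤ 2 ^ m := fun m => Nat.lt_two_pow_self.le
  let c := Nat.card M.State + 2 + (∑ i, Nat.card (Option (M.Γ i))) * K
  refine ⟨c, fun x => (h x).length_le.trans ?_⟩
  set B := Nat.log 2 x.length + 1 with hB
  have hB1 : 1 ≤ B := by omega
  rw [Nat.card_prod, Nat.card_prod, Nat.card_pi, Nat.card_eq_fintype_card (α := Fin _),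
    Fintype.card_fin]
  calc Nat.card M.State * ((x.length + 2) * ∏ i, Nat.card (Fin (K * B) → Option (M.Γ i)))
      ≤ 2 ^ (Nat.card M.State * B) *
        (2 ^ (2 * B) * ∏ i, 2 ^ (Nat.card (Option (M.Γ i)) * (K * B))) := by
        gcongr with i
        · exact (hpow _).trans (Nat.pow_le_pow_right (by norm_num) (Nat.le_mul_of_pos_right _ hB1))
        · exact add_two_le_two_pow_log _
        · rw [Nat.card_fun, Nat.card_eq_fintype_card (α := Fin _), Fintype.card_fin,
            pow_mul 2]
          exact Nat.pow_le_pow_left (hpow _) _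
    _ = 2 ^ (c * B) := by
        rw [Finset.prod_pow_eq_pow_sum, ← pow_add, ← pow_add]
        congr 1
        simp only [c]
        rw [← Finset.sum_mul]
        ring

/-! ### Elementary programs -/

namespace Prog

variable {H ι O : Type} {I : H → Type} {Γ : ι → Type}

/-- Do nothing. -/
def skip : SProg I Γ O := .act fun _ => .skip

/-- Apply an operation to one stack. -/
def op [DecidableEq ι] (i : ι) (o : StackOp (Γ i)) : SProg I Γ O :=
  .act fun _ => { mv := fun _ => .stay, op := Function.update (fun _ => .keep) i o, out := none }

/-- Move one head. -/
def move [DecidableEq H] (h : H) (m : Move) : SProg I Γ O :=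
  .act fun _ => { mv := Function.update (fun _ => .stay) h m, op := fun _ => .keep, out := none }

/-- Write a letter that may depend on the view. -/
def emit (o : View I Γ → Option O) : SProg I Γ O :=
  .act fun v => { mv := fun _ => .stay, op := fun _ => .keep, out := o v }

/-- Write a word. -/
def emits (w : List O) : SProg I Γ O :=
  w.foldr (fun a p => .seq (emit fun _ => some a) p) skip

/-- Conditional. -/
def ite (b : View I Γ → Bool) (p q : SProg I Γ O) : SProg I Γ O :=
  .branch fun v => if b v then p else q

/-- Execute `p a` for all `a` in a list. -/
def forEach {α : Type} (l : List α) (p : α → SProg I Γ O) : SProg I Γ O :=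
  l.foldr (fun a q => .seq (p a) q) skip

open Classical in
/-- Pop the stack `c` and push `a` on the stack `u`. -/
noncomputable def transfer (c u : ι) (a : Γ u) : Eff H Γ O where
  mv _ := .stay
  op := Function.update (Function.update (fun _ => .keep) c .pop) u (.push a)
  out := none

/-- While the top of stack `c` satisfies `p`, move it, transformed by `f`, to the stack `u`,
writing a word. -/
noncomputable def drain (c u : ι) (p : Γ c → Bool) (f : Γ c → Γ u) (w : Γ c → List O) :
    SProg I Γ O :=
  .loop (fun v => (v.top c).any p) <| .branch fun v =>
    match v.top c with
    | some a => .seq (.act fun _ => transfer c u (f a)) (emits (w a))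
    | none => skip

/-- Empty a stack. -/
def clear [DecidableEq ι] (i : ι) : SProg I Γ O :=
  .loop (fun v => (v.top i).isSome) (op i .pop)

/-- Move a head to the left end of its tape. -/
def rewind [DecidableEq H] (h : H) : SProg I Γ O :=
  .loop (fun v => match v.sym h with | .left => false | _ => true) (move h .left)

end Prog

section ExecLemmas

variable {H ι O : Type} {I : H → Type} {Γ : ι → Type} {X : ∀ h, List (I h)} {S : ℕ}

lemma Exec.seq_nil {p q : SProg I Γ O} {σ₁ σ₂ σ₃ w} (h : Exec X S p σ₁ [] σ₂)
    (h' : Exec X S q σ₂ w σ₃) : Exec X S (.seq p q) σ₁ w σ₃ := by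
  simpa using h.seq h'

lemma Exec.loop_nil {b} {p : SProg I Γ O} {σ₁ σ₂ σ₃ w} (hb : b (σ₁.view X) = true)
    (h : Exec X S p σ₁ [] σ₂) (h' : Exec X S (.loop b p) σ₂ w σ₃) :
    Exec X S (.loop b p) σ₁ w σ₃ := by
  simpa using Exec.loop hb h h'

lemma exec_skip {σ : Store H Γ} (hσ : σ.Bdd S) :
    Exec X S (Prog.skip : SProg I Γ O) σ [] σ :=
  Exec.act (f := fun _ => .skip) hσ

lemma exec_op [DecidableEq ι] {σ : Store H Γ} {i : ι} {o : StackOp (Γ i)}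
    (hσ : (σ.set i (o.apply (σ.stk i))).Bdd S) :
    Exec X S (Prog.op i o : SProg I Γ O) σ [] (σ.set i (o.apply (σ.stk i))) := by
  have key : ({ mv := fun _ => .stay, op := Function.update (fun _ => .keep) i o, out := none } :
      Eff H Γ O).app X σ = σ.set i (o.apply (σ.stk i)) := by
    refine Store.ext rfl (funext fun j => ?_)
    by_cases h : j = i
    · subst h; simp [Eff.app]
    · rw [Store.set_stk_ne _ h]; simp [Eff.app, h, StackOp.apply]
  rw [← key] at hσ ⊢
  exact Exec.act (f := fun _ => { mv := fun _ => .stay, op := Function.update (fun _ => .keep) i o, out := none }) hσ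

lemma exec_push [DecidableEq ι] {σ : Store H Γ} (hσ : σ.Bdd S) {i : ι} {a : Γ i}
    (h : (σ.stk i).length < S) :
    Exec X S (Prog.op i (.push a) : SProg I Γ O) σ [] (σ.set i (a :: σ.stk i)) :=
  exec_op (hσ.set (by simpa [StackOp.apply] using h))

lemma exec_pop [DecidableEq ι] {σ : Store H Γ} (hσ : σ.Bdd S) {i : ι} :
    Exec X S (Prog.op i .pop : SProg I Γ O) σ [] (σ.set i (σ.stk i).tail) :=
  exec_op (hσ.set (by have := hσ i; simp [StackOp.apply]; omega))

lemma exec_put [DecidableEq ι] {σ : Store H Γ} (hσ : σ.Bdd S) {i : ι} {a : Γ i}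
    (h : (σ.stk i).tail.length < S) :
    Exec X S (Prog.op i (.put a) : SProg I Γ O) σ [] (σ.set i (a :: (σ.stk i).tail)) :=
  exec_op (hσ.set (by simp only [StackOp.apply, List.length_cons]; omega))

lemma exec_move [DecidableEq H] {σ : Store H Γ} (hσ : σ.Bdd S) (h : H) (m : Move) :
    Exec X S (Prog.move h m : SProg I Γ O) σ []
      (σ.goto h (m.applyInput (X h).length (σ.pos h))) := by
  have key : ({ mv := Function.update (fun _ => .stay) h m, op := fun _ => .keep, out := none } :
      Eff H Γ O).app X σ = σ.goto h (m.applyInput (X h).length (σ.pos h)) := by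
    refine Store.ext (funext fun j => ?_) rfl
    by_cases hj : j = h
    · subst hj; simp [Eff.app]
    · rw [Store.goto_pos_ne _ hj]; simp [Eff.app, hj, Move.applyInput]
  have := Exec.act (X := X) (S := S) (σ := σ) (O := O) (f := fun _ : View I Γ =>
    { mv := Function.update (fun _ => .stay) h m, op := fun _ => .keep, out := none })
    (by rw [key]; exact hσ)
  rw [key] at this
  exact this

lemma exec_emit {σ : Store H Γ} (hσ : σ.Bdd S) (o : View I Γ → Option O) :
    Exec X S (Prog.emit o : SProg I Γ O) σ (o (σ.view X)).toList σ :=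
  Exec.act (f := fun v => { mv := fun _ => .stay, op := fun _ => .keep, out := o v }) hσ

lemma exec_emits {σ : Store H Γ} (hσ : σ.Bdd S) (w : List O) :
    Exec X S (Prog.emits w : SProg I Γ O) σ w σ := by
  induction w with
  | nil => exact exec_skip hσ
  | cons a w ih => exact (exec_emit hσ fun _ => some a).seq ih

lemma exec_ite_true {b : View I Γ → Bool} {p q : SProg I Γ O} {σ w σ'}
    (hb : b (σ.view X) = true) (h : Exec X S p σ w σ') : Exec X S (Prog.ite b p q) σ w σ' :=
  .branch (by rw [hb]; exact h)

lemma exec_ite_false {b : View I Γ → Bool} {p q : SProg I Γ O} {σ w σ'}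
    (hb : b (σ.view X) = false) (h : Exec X S q σ w σ') : Exec X S (Prog.ite b p q) σ w σ' :=
  .branch (by rw [hb]; exact h)

/-- The top segment of a stack whose symbols satisfy the condition arrives on the other stack in the
opposite order. -/
lemma exec_drain [DecidableEq ι] {c u : ι} (hcu : c ≠ u) {p : Γ c → Bool} {f : Γ c → Γ u}
    {w : Γ c → List O} (l₁ l₂ : List (Γ c)) {σ : Store H Γ} (hσ : σ.Bdd S)
    (hc : σ.stk c = l₁ ++ l₂) (h₁ : ∀ a ∈ l₁, p a = true) (h₂ : ∀ a ∈ l₂.head?, p a = false)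
    (hS : l₁.length + (σ.stk u).length ≤ S) :
    Exec X S (Prog.drain c u p f w : SProg I Γ O) σ (l₁.flatMap w)
      ((σ.set c l₂).set u ((l₁.map f).reverse ++ σ.stk u)) := by
  induction l₁ generalizing σ with
  | nil =>
    have : (σ.set c l₂).set u (([].map f).reverse ++ σ.stk u) = σ := by
      rw [Store.set_eq_self σ c (by simpa using hc)]
      exact Store.set_eq_self _ _ (by simp)
    rw [this]
    refine Exec.exit ?_
    simp only [Store.view, hc, List.nil_append]
    cases h : l₂.head? with
    | none => rfl
    | some a => simpa using h₂ a h
  | cons a l₁ ih =>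
    have hσ₁ : ((σ.set c (l₁ ++ l₂)).set u (f a :: σ.stk u)).Bdd S := by
      refine (hσ.set ?_).set ?_
      · have := hσ c; rw [hc] at this; simp at this ⊢; omega
      · simp at hS ⊢; omega
    have key : (Prog.transfer c u (f a) : Eff H Γ O).app X σ =
        (σ.set c (l₁ ++ l₂)).set u (f a :: σ.stk u) := by
      refine Store.ext rfl (funext fun j => ?_)
      by_cases hj : j = u
      · subst hj; simp [Eff.app, Prog.transfer, StackOp.apply]
      · rw [Store.set_stk_ne _ hj]
        by_cases hj' : j = c
        · subst hj'; simp [Eff.app, Prog.transfer, hj, StackOp.apply, hc]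
        · rw [Store.set_stk_ne _ hj']; simp [Eff.app, Prog.transfer, hj, hj', StackOp.apply]
    have hstep : Exec X S (.act fun _ => Prog.transfer c u (f a) : SProg I Γ O) σ []
        ((σ.set c (l₁ ++ l₂)).set u (f a :: σ.stk u)) := by
      rw [← key] at hσ₁ ⊢
      exact Exec.act (f := fun _ => _) hσ₁
    have ih' := ih hσ₁ (by rw [Store.set_stk_ne _ hcu]; simp) (fun b hb => h₁ b (by simp [hb]))
      (by simp at hS ⊢; omega)
    have hfin : ((((σ.set c (l₁ ++ l₂)).set u (f a :: σ.stk u)).set c l₂).set u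
        ((l₁.map f).reverse ++ ((σ.set c (l₁ ++ l₂)).set u (f a :: σ.stk u)).stk u)) =
        (σ.set c l₂).set u (((a :: l₁).map f).reverse ++ σ.stk u) := by
      rw [Store.set_comm _ hcu.symm, Store.set_set, Store.set_set, Store.set_stk_self]
      simp
    rw [hfin] at ih'
    refine Exec.loop (w := w a) ?_ (.branch ?_) ih'
    · simp [Store.view, hc, h₁ a]
    · have : (σ.view X).top c = some a := by simp [Store.view, hc]
      rw [this]
      exact hstep.seq_nil (exec_emits hσ₁ _)

lemma exec_clear [DecidableEq ι] {σ : Store H Γ} (hσ : σ.Bdd S) (i : ι) :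
    Exec X S (Prog.clear i : SProg I Γ O) σ [] (σ.set i []) := by
  obtain ⟨l, hl⟩ : ∃ l, σ.stk i = l := ⟨_, rfl⟩
  induction l generalizing σ with
  | nil =>
    rw [Store.set_eq_self _ _ hl]
    exact .exit (by simp [Store.view, hl])
  | cons a l ih =>
    have h1 := exec_pop (X := X) (O := O) (I := I) hσ (i := i)
    have h2 := ih (h1.bdd hσ) (by simp [hl])
    rw [Store.set_set] at h2
    exact Exec.loop_nil (by simp [Store.view, hl]) h1 h2

lemma exec_rewind [DecidableEq H] {σ : Store H Γ} (hσ : σ.Bdd S) (h : H) :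
    Exec X S (Prog.rewind h : SProg I Γ O) σ [] (σ.goto h 0) := by
  obtain ⟨p, hp⟩ : ∃ p, σ.pos h = p := ⟨_, rfl⟩
  induction p generalizing σ with
  | zero =>
    rw [Store.goto_eq_self _ _ hp]
    exact .exit (by simp [Store.view, hp, cellAt])
  | succ p ih =>
    have h1 := exec_move (X := X) (O := O) hσ h .left
    have h2 := ih (h1.bdd hσ) (by simp [hp, Move.applyInput])
    rw [Store.goto_goto] at h2
    refine Exec.loop_nil ?_ h1 h2
    simp only [Store.view, hp, cellAt]
    cases (X h)[p]? <;> rfl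

end ExecLemmas

/-! ### Binary counters -/

/-- The successor on binary expansions, least significant bit first. -/
def incBits : List Bool → List Bool
  | [] => [true]
  | false :: l => true :: l
  | true :: l => false :: incBits l

/-- The predecessor on binary expansions without leading zeros. -/
def decBits : List Bool → List Bool
  | [] => []
  | true :: l => if l = [] then [] else false :: l
  | false :: l => true :: decBits l

lemma bits_eq_nil {n : ℕ} : n.bits = [] ↔ n = 0 := by
  constructor
  · intro h
    have := Nat.size_eq_bits_len n
    rw [h] at this
    exact Nat.size_eq_zero.1 this.symm
  · rintro rfl; simp

lemma incBits_bits (n : ℕ) : incBits n.bits = (n + 1).bits := by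
  induction n using Nat.strong_induction_on with
  | _ n ih =>
    obtain ⟨k, rfl | rfl⟩ := Nat.even_or_odd' n
    · rcases Nat.eq_zero_or_pos k with rfl | hk
      · simp [incBits, show Nat.bits 1 = [true] from rfl]
      · rw [Nat.bit0_bits k hk.ne', Nat.bit1_bits, incBits]
    · rw [Nat.bit1_bits, incBits, ih k (by omega), show 2 * k + 1 + 1 = 2 * (k + 1) by ring,
        Nat.bit0_bits _ (by omega)]

lemma decBits_bits (n : ℕ) : decBits (n + 1).bits = n.bits := by
  induction n using Nat.strong_induction_on with
  | _ n ih =>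
    obtain ⟨k, rfl | rfl⟩ := Nat.even_or_odd' n
    · rw [Nat.bit1_bits, decBits]
      rcases Nat.eq_zero_or_pos k with rfl | hk
      · simp
      · rw [if_neg (by rw [bits_eq_nil]; omega), Nat.bit0_bits k hk.ne']
    · rw [show 2 * k + 1 + 1 = 2 * (k + 1) by ring, Nat.bit0_bits _ (by omega), decBits,
        ih k (by omega), Nat.bit1_bits]

lemma bits_length_le {n S : ℕ} (h : n < 2 ^ S) : n.bits.length ≤ S := by
  rw [Nat.size_eq_bits_len]
  exact Nat.size_le.2 h

lemma incBits_eq (l : List Bool) :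
    incBits l = (l.takeWhile id).map (fun _ => false) ++ true :: (l.dropWhile id).tail := by
  induction l with
  | nil => rfl
  | cons b l ih => cases b <;> simp [incBits, ih]

lemma decBits_eq (l₁ l₂ : List Bool) (h : ∀ b ∈ l₁, b = false) :
    decBits (l₁ ++ true :: l₂) =
      l₁.map (fun _ => true) ++ if l₂ = [] then [] else false :: l₂ := by
  induction l₁ with
  | nil => rfl
  | cons b l ih =>
    obtain rfl := h b (by simp)
    simp [decBits, ih fun b hb => h b (by simp [hb])]

lemma bits_succ_eq (n : ℕ) :
    ∃ l₁ l₂, (n + 1).bits = l₁ ++ true :: l₂ ∧ ∀ b ∈ l₁, b = false := by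
  induction n using Nat.strong_induction_on with
  | _ n ih =>
    obtain ⟨k, rfl | rfl⟩ := Nat.even_or_odd' n
    · exact ⟨[], k.bits, by rw [Nat.bit1_bits]; rfl, by simp⟩
    · obtain ⟨l₁, l₂, h1, h2⟩ := ih k (by omega)
      refine ⟨false :: l₁, l₂, ?_, by simpa using h2⟩
      rw [show 2 * k + 1 + 1 = 2 * (k + 1) by ring, Nat.bit0_bits _ (by omega), h1]
      rfl

section Counter

variable {H ι O : Type} {I : H → Type} {Γ : ι → Type} {X : ∀ h, List (I h)} {S : ℕ}
  [DecidableEq ι] {c u : ι}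

/-- Increment the counter `c`, the bits of which are written with `e` and read with `d`; the stack
`u` is used as auxiliary memory. -/
noncomputable def Prog.inc (c u : ι) (e : Bool → Γ c) (d : Γ c → Bool) (m : Γ u) :
    SProg I Γ O :=
  .seq (drain c u d (fun _ => m) fun _ => []) <| .seq (op c (.put (e true))) <|
    drain u c (fun _ => true) (fun _ => e false) fun _ => []

/-- Decrement the counter `c`. -/
noncomputable def Prog.dec (c u : ι) (e : Bool → Γ c) (d : Γ c → Bool) (m : Γ u) :
    SProg I Γ O :=
  .seq (drain c u (fun a => !d a) (fun _ => m) fun _ => []) <| .seq (op c .pop) <|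
    .seq (ite (fun v => (v.top c).isSome) (op c (.push (e false))) skip) <|
      drain u c (fun _ => true) (fun _ => e true) fun _ => []

lemma Store.set_set_set {σ : Store H Γ} (hcu : c ≠ u) (l l' : List (Γ c)) (k : List (Γ u)) :
    ((σ.set c l).set u k).set c l' = (σ.set c l').set u k := by
  rw [Store.set_comm _ hcu.symm, Store.set_set]

lemma Store.set_set_set' {σ : Store H Γ} (hcu : c ≠ u) (l : List (Γ c)) (k k' : List (Γ u))
    (l' : List (Γ c)) : (((σ.set c l).set u k).set u k').set c l' = (σ.set c l').set u k' := by
  rw [Store.set_set, Store.set_set_set hcu]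

/-- A `drain` that replaces every symbol by the same one and writes nothing. -/
lemma exec_shift (hcu : c ≠ u) {p : Γ c → Bool} {m : Γ u}
    (l₁ l₂ : List (Γ c)) {σ : Store H Γ} (hσ : σ.Bdd S)
    (hc : σ.stk c = l₁ ++ l₂) (h₁ : ∀ a ∈ l₁, p a = true) (h₂ : ∀ a ∈ l₂.head?, p a = false)
    (hS : l₁.length + (σ.stk u).length ≤ S) :
    Exec X S (Prog.drain c u p (fun _ => m) (fun _ => []) : SProg I Γ O) σ []
      ((σ.set c l₂).set u (List.replicate l₁.length m ++ σ.stk u)) := by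
  have := exec_drain (X := X) (S := S) (O := O) (I := I) hcu (p := p) (f := fun _ => m)
    (w := fun _ => []) l₁ l₂ hσ hc h₁ h₂ hS
  rw [List.map_const', List.reverse_replicate] at this
  convert this using 1
  simp

variable {e : Bool → Γ c} {d : Γ c → Bool} {m : Γ u}

lemma exec_inc (hcu : c ≠ u) (hd : ∀ b, d (e b) = b) {σ : Store H Γ} (hσ : σ.Bdd S) {n : ℕ}
    (hc : σ.stk c = n.bits.map e) (hu : σ.stk u = []) (hS : n.bits.length < S) :
    Exec X S (Prog.inc c u e d m : SProg I Γ O) σ [] (σ.set c ((n + 1).bits.map e)) := by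
  rw [← incBits_bits, incBits_eq]
  set l := n.bits with hl
  have hlen : (l.takeWhile id).length + (l.dropWhile id).length = l.length := by
    rw [← List.length_append, List.takeWhile_append_dropWhile]
  have s1 := exec_shift (X := X) (S := S) (O := O) (I := I) hcu (p := d) (m := m)
    ((l.takeWhile id).map e) ((l.dropWhile id).map e) hσ
    (by rw [hc, ← List.map_append, List.takeWhile_append_dropWhile])
    (by
      simp only [List.mem_map, forall_exists_index, and_imp]
      rintro _ b hb rfl
      rw [hd]; exact List.mem_takeWhile_imp hb)
    (by
      intro a ha
      rw [List.head?_map, Option.mem_def, Option.map_eq_some_iff] at ha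
      obtain ⟨b, hb, rfl⟩ := ha
      have := List.head?_dropWhile_not id l
      rw [hb] at this
      simpa [hd] using this)
    (by rw [hu]; simp; omega)
  rw [hu, List.append_nil, List.length_map] at s1
  have b1 := s1.bdd hσ
  have s2 := exec_put (X := X) (O := O) (I := I) b1 (i := c) (a := e true)
    (by rw [Store.set_stk_ne _ hcu, Store.set_stk_self]; simp; omega)
  have b2 := s2.bdd b1
  rw [Store.set_set_set hcu, Store.set_stk_ne _ hcu, Store.set_stk_self] at s2 b2
  have s3 := exec_shift (X := X) (S := S) (O := O) (I := I) hcu.symm (p := fun _ => true)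
    (m := e false) (List.replicate (l.takeWhile id).length m) [] b2 (by simp)
    (by simp) (by simp) (by rw [Store.set_stk_ne _ hcu, Store.set_stk_self]; simp; omega)
  rw [Store.set_set_set' hcu, Store.set_stk_ne _ hcu, Store.set_stk_self,
    Store.set_eq_self _ u (l := []) (by rw [Store.set_stk_ne _ hcu.symm, hu])] at s3
  convert s1.seq_nil (s2.seq_nil s3) using 2
  · rfl
  · simp

lemma exec_dec (hcu : c ≠ u) (hd : ∀ b, d (e b) = b) {σ : Store H Γ} (hσ : σ.Bdd S) {n : ℕ}
    (hc : σ.stk c = (n + 1).bits.map e) (hu : σ.stk u = []) :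
    Exec X S (Prog.dec c u e d m : SProg I Γ O) σ [] (σ.set c (n.bits.map e)) := by
  obtain ⟨l₁, l₂, hl, hl₁⟩ := bits_succ_eq n
  rw [← decBits_bits n, hl, decBits_eq _ _ hl₁]
  rw [hl] at hc
  have hS := hσ c
  rw [hc] at hS
  simp only [List.map_append, List.length_append, List.length_map, List.map_cons,
    List.length_cons] at hS
  have s1 := exec_shift (X := X) (S := S) (O := O) (I := I) hcu (p := fun a => !d a) (m := m)
    (l₁.map e) ((true :: l₂).map e) hσ (by rw [hc, List.map_append])
    (by
      simp only [List.mem_map, forall_exists_index, and_imp]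
      rintro _ b hb rfl
      rw [hd, hl₁ b hb]; rfl)
    (by simp [hd])
    (by rw [hu]; simp; omega)
  rw [hu, List.append_nil, List.length_map] at s1
  have b1 := s1.bdd hσ
  have s2 := exec_pop (X := X) (O := O) (I := I) b1 (i := c)
  have b2 := s2.bdd b1
  rw [Store.set_set_set hcu, Store.set_stk_ne _ hcu, Store.set_stk_self] at s2 b2
  simp only [List.map_cons, List.tail_cons] at s2 b2
  have s3 : Exec X S (Prog.ite (fun v => (v.top c).isSome) (.op c (.push (e false))) .skip :
      SProg I Γ O) ((σ.set c (l₂.map e)).set u (List.replicate l₁.length m)) []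
      ((σ.set c ((if l₂ = [] then [] else false :: l₂).map e)).set u
        (List.replicate l₁.length m)) := by
    cases l₂ with
    | nil =>
      refine exec_ite_false ?_ (exec_skip b2)
      simp [Store.view, Store.set_stk_ne _ hcu]
    | cons b l₂ =>
      refine exec_ite_true ?_ ?_
      · simp [Store.view, Store.set_stk_ne _ hcu]
      · have := exec_push (X := X) (O := O) (I := I) b2 (i := c) (a := e false)
          (by rw [Store.set_stk_ne _ hcu, Store.set_stk_self]; simp at hS ⊢; omega)
        rw [Store.set_set_set hcu, Store.set_stk_ne _ hcu, Store.set_stk_self] at this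
        exact this
  have b3 := s3.bdd b2
  have s4 := exec_shift (X := X) (S := S) (O := O) (I := I) hcu.symm (p := fun _ => true)
    (m := e true) (List.replicate l₁.length m) [] b3 (by simp)
    (by simp) (by simp) (by
      rw [Store.set_stk_ne _ hcu, Store.set_stk_self]
      split_ifs with h
      · simp; omega
      · simp; omega)
  rw [Store.set_set_set' hcu, Store.set_stk_ne _ hcu, Store.set_stk_self,
    Store.set_eq_self _ u (l := []) (by rw [Store.set_stk_ne _ hcu.symm, hu])] at s4
  convert s1.seq_nil (s2.seq_nil (s3.seq_nil s4)) using 2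
  · rfl
  · simp

end Counter

/-! ### Machines that read computed tapes -/

/-- The two stores agree on the stacks outside `T`. -/
def AgreeOff {H ι : Type} {Γ : ι → Type} (T : Set ι) (σ σ' : Store H Γ) : Prop :=
  ∀ j, j ∉ T → σ'.stk j = σ.stk j

lemma AgreeOff.trans {H ι : Type} {Γ : ι → Type} {T : Set ι} {σ σ' σ'' : Store H Γ}
    (h : AgreeOff T σ σ') (h' : AgreeOff T σ' σ'') : AgreeOff T σ σ'' :=
  fun j hj => (h' j hj).trans (h j hj)

lemma AgreeOff.mono {H ι : Type} {Γ : ι → Type} {T T' : Set ι} (hT : T ⊆ T') {σ σ' : Store H Γ}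
    (h : AgreeOff T σ σ') : AgreeOff T' σ σ' :=
  fun j hj => h j fun hj' => hj (hT hj')

lemma AgreeOff.refl {H ι : Type} {Γ : ι → Type} (T : Set ι) (σ : Store H Γ) : AgreeOff T σ σ :=
  fun _ _ => rfl

lemma AgreeOff.set {H ι : Type} {Γ : ι → Type} [DecidableEq ι] {T : Set ι} (σ : Store H Γ) {i : ι}
    (hi : i ∈ T) (l : List (Γ i)) : AgreeOff T σ (σ.set i l) :=
  fun _ hj => Store.set_stk_ne _ (by rintro rfl; exact hj hi) _

namespace Query

/-- The stacks of the machine that simulates a machine `G` reading computed tapes: the state and the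
stacks of `G`; for each head `h` of `G` the scanned cell, the pending move, the state, the stacks
and the last output of the machine computing the tape, the counter `cA h` with the position of the
head, and a counter `cB h` needed while the tape is recomputed; and an auxiliary stack. -/
inductive Idx (H G : Type) (Mi : H → Type) where
  | gst
  | g (i : G)
  | sym (h : H)
  | mvr (h : H)
  | ms (h : H)
  | m (h : H) (i : Mi h)
  | o (h : H)
  | cA (h : H)
  | cB (h : H)
  | aux

instance {H G : Type} {Mi : H → Type} [Finite H] [Finite G] [∀ h, Finite (Mi h)] :
    Finite (Idx H G Mi) := by
  refine Finite.of_surjective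
    (fun s : (Bool ⊕ G) ⊕ (H × Fin 6) ⊕ (Σ h, Mi h) => (match s with
      | .inl (.inl false) => .gst
      | .inl (.inl true) => .aux
      | .inl (.inr i) => .g i
      | .inr (.inl (h, 0)) => .sym h
      | .inr (.inl (h, 1)) => .mvr h
      | .inr (.inl (h, 2)) => .ms h
      | .inr (.inl (h, 3)) => .o h
      | .inr (.inl (h, 4)) => .cA h
      | .inr (.inl (h, 5)) => .cB h
      | .inr (.inr ⟨h, i⟩) => .m h i : Idx H G Mi)) fun j => ?_
  cases j with
  | gst => exact ⟨.inl (.inl false), rfl⟩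
  | aux => exact ⟨.inl (.inl true), rfl⟩
  | g i => exact ⟨.inl (.inr i), rfl⟩
  | sym h => exact ⟨.inr (.inl (h, 0)), rfl⟩
  | mvr h => exact ⟨.inr (.inl (h, 1)), rfl⟩
  | ms h => exact ⟨.inr (.inl (h, 2)), rfl⟩
  | o h => exact ⟨.inr (.inl (h, 3)), rfl⟩
  | cA h => exact ⟨.inr (.inl (h, 4)), rfl⟩
  | cB h => exact ⟨.inr (.inl (h, 5)), rfl⟩
  | m h i => exact ⟨.inr (.inr ⟨h, i⟩), rfl⟩

noncomputable instance {H G : Type} {Mi : H → Type} : DecidableEq (Idx H G Mi) :=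
  Classical.decEq _

variable {H O : Type} {I : H → Type} (G : SM H I O) (M : ∀ h, SM Unit (fun _ => Bool) (I h))

/-- The stack alphabets. -/
abbrev Alph : Idx H G.ι (fun h => (M h).ι) → Type
  | .gst => G.State
  | .g i => G.Γ i
  | .sym h => Cell (I h)
  | .mvr _ => Move
  | .ms h => (M h).State
  | .m h i => (M h).Γ i
  | .o h => I h
  | .cA _ => Bool
  | .cB _ => Bool
  | .aux => Unit

/-- Programs of the simulating machine. -/
abbrev QProg := SProg (fun _ : Unit => Bool) (Alph G M) O

variable {G M}

/-- What the simulated machine does next. -/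
def gNext (v : View (fun _ : Unit => Bool) (Alph G M)) : Option (G.State × Eff H G.Γ O) :=
  match v.top .gst with
  | none => none
  | some q => G.trans q ⟨fun h => (v.top (.sym h)).getD .left, fun i => v.top (.g i)⟩

/-- What the machine computing the tape of head `h` does next. -/
def mNext (v : View (fun _ : Unit => Bool) (Alph G M)) (h : H) :
    Option ((M h).State × Eff Unit (M h).Γ (I h)) :=
  match v.top (.ms h) with
  | none => none
  | some q => (M h).trans q ⟨fun _ => v.sym (), fun i => v.top (.m h i)⟩

/-- One step of the simulated machine, without the moves of its heads. -/
noncomputable def gStep : QProg G M := .act fun v =>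
  match gNext v with
  | none => .skip
  | some r =>
    { mv := fun _ => .stay
      op := fun j => match j with
        | .gst => .put r.1
        | .g i => r.2.op i
        | .mvr h => .put (r.2.mv h)
        | _ => .keep
      out := r.2.out }

open Classical in
/-- One step of the machine computing the tape of head `h`. -/
noncomputable def mStep (h : H) : QProg G M := .act fun v =>
  { mv := fun _ => (mNext v h).elim .stay fun r => r.2.mv ()
    op := fun j => match j with
      | .ms k => if k = h then (mNext v k).elim .keep fun r => .put r.1 else .keep
      | .m k i => if k = h then (mNext v k).elim .keep fun r => r.2.op i else .keep
      | .o k => if k = h then (mNext v k).elim .keep fun r => r.2.out.elim .pop .put else .keep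
      | _ => .keep
    out := none }

/-- Increment the position counter. -/
noncomputable def incA (h : H) : QProg G M :=
  Prog.inc (.cA h) .aux (fun b => b) (fun b => b) ()

/-- Decrement the position counter. -/
noncomputable def decA (h : H) : QProg G M :=
  Prog.dec (.cA h) .aux (fun b => b) (fun b => b) ()

/-- Increment the second counter. -/
noncomputable def incB (h : H) : QProg G M :=
  Prog.inc (.cB h) .aux (fun b => b) (fun b => b) ()

/-- Decrement the second counter. -/
noncomputable def decB (h : H) : QProg G M :=
  Prog.dec (.cB h) .aux (fun b => b) (fun b => b) ()

/-- Take notice of a letter written by the machine computing the tape of head `h`: unless `cA h` is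
already zero, move one unit from `cA h` to `cB h`, and keep the letter if `cA h` is now zero. -/
noncomputable def consume (h : H) : QProg G M := .branch fun v =>
  match v.top (.o h) with
  | none => .skip
  | some a => .ite (fun v => (v.top (.cA h)).isNone) .skip <|
    .seq (decA h) <| .seq (incB h) <|
      .ite (fun v => (v.top (.cA h)).isNone) (.op (.sym h) (.put (.sym a))) .skip

/-- Move the content of `cB h` back to `cA h`. -/
noncomputable def restore (h : H) : QProg G M :=
  .loop (fun v => (v.top (.cB h)).isSome) (.seq (decB h) (incA h))

/-- Store the cell scanned by head `h`, recomputing its tape from the start.  The register `sym h` is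
initialized with the end marker that is correct if position `cA h` holds no letter. -/
noncomputable def fetch (is : List (M h).ι) : QProg G M :=
  .seq (.forEach is fun i => .clear (.m h i)) <|
  .seq (.rewind ()) <|
  .seq (.clear (.ms h)) <|
  .seq (.op (.ms h) (.push (M h).start)) <|
  .seq (.clear (.o h)) <|
  .seq (.clear (.sym h)) <|
  .seq (.branch fun v => .op (.sym h) (.push (if (v.top (.cA h)).isNone then .left else .right))) <|
  .seq (.loop (fun v => (mNext v h).isSome) (.seq (mStep h) (consume h)))
  (restore h)

/-- Carry out the pending move of head `h`. -/
noncomputable def moveHead (h : H) : QProg G M := .branch fun v =>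
  match v.top (.mvr h), v.top (.sym h) with
  | some .left, _ => .ite (fun v => (v.top (.cA h)).isNone) .skip (decA h)
  | some .right, some .right => .skip
  | some .right, _ => incA h
  | _, _ => .skip

/-- The program of the simulating machine. -/
noncomputable def program (hs : List H) (is : ∀ h, List (M h).ι) : QProg G M :=
  .seq (.op .gst (.push G.start)) <|
  .seq (.forEach hs fun h => fetch (is h)) <|
  .loop (fun v => (gNext v).isSome) <|
    .seq gStep <| .seq (.forEach hs moveHead) (.forEach hs fun h => fetch (is h))

section Spec

variable {x : List Bool} {S : ℕ}

/-- The stacks of the simulating machine that belong to the machine computing the tape of `h`. -/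
def sub (h : H) (σ : Store Unit (Alph G M)) : Store Unit (M h).Γ where
  pos := σ.pos
  stk i := σ.stk (.m h i)

/-- The stacks that are overwritten when the tape of `h` is recomputed. -/
def junk (h : H) : Set (Idx H G.ι fun h => (M h).ι) :=
  {j | j = .ms h ∨ j = .o h ∨ j = .sym h ∨ ∃ i, j = .m h i}

lemma exec_mStep {h : H} {σ : Store Unit (Alph G M)} (hσ : σ.Bdd S) (hS : 1 ≤ S) {q q' e}
    (hq : σ.stk (.ms h) = [q]) (ho : (σ.stk (.o h)).tail = [])
    (ht : (M h).trans q ((sub h σ).view fun _ => x) = some (q', e))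
    (hb : (e.app (fun _ => x) (sub h σ)).Bdd S) :
    ∃ σ', Exec (fun _ => x) S (mStep h : QProg G M) σ [] σ' ∧ σ'.stk (.ms h) = [q'] ∧
      sub h σ' = e.app (fun _ => x) (sub h σ) ∧ σ'.stk (.o h) = e.out.toList ∧
      AgreeOff (fun j => j = .ms h ∨ j = .o h ∨ ∃ i, j = .m h i) σ σ' := by
  have hn : mNext (σ.view fun _ => x) h = some (q', e) := by
    have h1 : (σ.view fun _ => x).top (.ms h) = some q := by simp [Store.view, hq]
    rw [mNext, h1]
    exact ht
  obtain ⟨f, hf⟩ : ∃ f : View (fun _ : Unit => Bool) (Alph G M) → Eff Unit (Alph G M) O,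
    (mStep h : QProg G M) = .act f := ⟨_, rfl⟩
  have hout : (f (σ.view fun _ => x)).out = none := by
    cases hf; rfl
  set σ' := (f (σ.view fun _ => x)).app (fun _ => x) σ with hσ'
  have h1 : σ'.stk (.ms h) = [q'] := by
    cases hf; simp [hσ', Eff.app, hn, StackOp.apply, hq]
  have h2 : sub h σ' = e.app (fun _ => x) (sub h σ) := by
    cases hf
    refine Store.ext (funext fun u => ?_) (funext fun i => ?_)
    · simp [hσ', sub, Eff.app, hn]
    · simp [hσ', sub, Eff.app, hn]
  have h3 : σ'.stk (.o h) = e.out.toList := by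
    cases hf
    simp only [hσ', Eff.app, hn, if_true, Option.elim_some]
    cases e.out <;> simp [StackOp.apply, ho]
  have h4 : AgreeOff (fun j => j = .ms h ∨ j = .o h ∨ ∃ i, j = .m h i) σ σ' := by
    intro j hj
    cases hf
    have hj : ¬ (j = .ms h ∨ j = .o h ∨ ∃ i, j = .m h i) := hj
    cases j with
    | ms k =>
      have : k ≠ h := by rintro rfl; exact hj (.inl rfl)
      simp [hσ', Eff.app, this, StackOp.apply]
    | o k =>
      have : k ≠ h := by rintro rfl; exact hj (.inr (.inl rfl))
      simp [hσ', Eff.app, this, StackOp.apply]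
    | m k i =>
      have : k ≠ h := by rintro rfl; exact hj (.inr (.inr ⟨i, rfl⟩))
      simp [hσ', Eff.app, this, StackOp.apply]
    | _ => rfl
  refine ⟨σ', ?_, h1, h2, h3, h4⟩
  have hbd : σ'.Bdd S := by
    intro j
    by_cases hj : j = .ms h ∨ j = .o h ∨ ∃ i, j = .m h i
    · rcases hj with rfl | rfl | ⟨i, rfl⟩
      · rw [h1]; simpa using hS
      · rw [h3]
        have : e.out.toList.length ≤ 1 := by cases e.out <;> simp
        omega
      · have := congrArg (fun τ => τ.stk i) h2
        simp only [sub] at this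
        rw [this]; exact hb i
    · rw [h4 j hj]; exact hσ j
  have := Exec.act (X := fun _ => x) (S := S) (f := f) (σ := σ) hbd
  rw [hout] at this
  rw [hf]
  exact this

/-- The register for the scanned cell, with initial content `c`, after a tape with content `w` has been
recomputed with position counter `a`. -/
def scanned {A : Type} (a : ℕ) (w : List A) (c : Cell A) : Cell A :=
  match a with
  | 0 => c
  | a + 1 => match w[a]? with
    | some s => .sym s
    | none => c

lemma scanned_append {A : Type} (a : ℕ) (w w' : List A) (c : Cell A) :
    scanned (a - w.length) w' (scanned a w c) = scanned a (w ++ w') c := by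
  cases a with
  | zero => simp [scanned]
  | succ a =>
    rcases Nat.lt_or_ge a w.length with h | h
    · have : a + 1 - w.length = 0 := by omega
      simp [scanned, this, List.getElem?_append_left h, h]
    · have : a + 1 - w.length = (a - w.length) + 1 := by omega
      simp [scanned, this, List.getElem?_append_right h, List.getElem?_eq_none h]

lemma scanned_eq_cellAt {A : Type} (a : ℕ) (w : List A) :
    scanned a w (if a.bits = [] then .left else .right) = cellAt w a := by
  cases a with
  | zero => simp [scanned, cellAt]
  | succ a =>
    rw [if_neg (by rw [bits_eq_nil]; omega)]
    cases h : w[a]? <;> simp [scanned, cellAt, h]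

lemma exec_consume {h : H} {σ : Store Unit (Alph G M)} (hσ : σ.Bdd S) {a b : ℕ}
    {out : Option (I h)} {c : Cell (I h)} (ho : σ.stk (.o h) = out.toList)
    (hA : σ.stk (.cA h) = a.bits) (hB : σ.stk (.cB h) = b.bits) (hu : σ.stk .aux = [])
    (hs : σ.stk (.sym h) = [c]) (hS : b.bits.length < S) :
    ∃ σ', Exec (fun _ => x) S (consume h : QProg G M) σ [] σ' ∧ σ'.pos = σ.pos ∧
      AgreeOff {j | j = .cA h ∨ j = .cB h ∨ j = .sym h} σ σ' ∧
      σ'.stk (.cA h) = (a - out.toList.length).bits ∧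
      σ'.stk (.cB h) = (b + min a out.toList.length).bits ∧
      σ'.stk (.sym h) = [scanned a out.toList c] := by
  have htop : (σ.view fun _ => x).top (.o h) = out := by
    simp only [Store.view, ho]; cases out <;> rfl
  cases out with
  | none =>
    refine ⟨σ, .branch ?_, rfl, .refl _ _, by simpa using hA, by simpa using hB, ?_⟩
    · rw [htop]; exact exec_skip hσ
    · rw [hs]; cases a <;> simp [scanned]
  | some s =>
    cases a with
    | zero =>
      refine ⟨σ, .branch ?_, rfl, .refl _ _, by simpa using hA, by simpa using hB, ?_⟩
      · rw [htop]
        exact exec_ite_true (by simp [Store.view, hA]) (exec_skip hσ)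
      · rw [hs]; simp [scanned]
    | succ a =>
      have s1 := exec_dec (X := fun _ : Unit => x) (S := S) (O := O)
        (I := fun _ : Unit => Bool) (c := .cA h) (u := .aux)
        (e := fun b => b) (d := fun b => b) (m := ()) (by simp) (fun _ => rfl) hσ (n := a)
        (by rw [hA]; exact (List.map_id _).symm) hu
      have hid : ∀ n : ℕ, n.bits.map (fun b : Bool => (b : Alph G M (.cA h))) = n.bits :=
        fun n => List.map_id _
      rw [hid] at s1
      have b1 := s1.bdd hσ
      have s2 := exec_inc (X := fun _ : Unit => x) (S := S) (O := O)
        (I := fun _ : Unit => Bool) (c := .cB h) (u := .aux)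
        (e := fun b => b) (d := fun b => b) (m := ()) (by simp) (fun _ => rfl) b1 (n := b)
        (by rw [Store.set_stk_ne _ (by simp), hB]; exact (List.map_id _).symm)
        (by rw [Store.set_stk_ne _ (by simp), hu]) hS
      have hid' : ∀ n : ℕ, n.bits.map (fun b : Bool => (b : Alph G M (.cB h))) = n.bits :=
        fun n => List.map_id _
      rw [hid'] at s2
      have b2 := s2.bdd b1
      set σ₁ := σ.set (.cA h) a.bits with hσ₁
      set σ₂ := σ₁.set (.cB h) (b + 1).bits with hσ₂
      have hA₂ : σ₂.stk (.cA h) = a.bits := by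
        rw [hσ₂, Store.set_stk_ne _ (by simp), hσ₁, Store.set_stk_self]
      have hs₂ : σ₂.stk (.sym h) = [c] := by
        rw [hσ₂, Store.set_stk_ne _ (by simp), hσ₁, Store.set_stk_ne _ (by simp), hs]
      have hagree : AgreeOff {j | j = .cA h ∨ j = .cB h ∨ j = .sym h} σ σ₂ :=
        (AgreeOff.set _ (by simp) _).trans (AgreeOff.set _ (by simp) _)
      have hB₂ : σ₂.stk (.cB h) = (b + 1).bits := by rw [hσ₂, Store.set_stk_self]
      cases a with
      | zero =>
        have s3 := exec_put (X := fun _ : Unit => x) (O := O) (I := fun _ : Unit => Bool) b2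
          (i := .sym h) (a := .sym s) (by rw [hs₂]; simp; omega)
        refine ⟨σ₂.set (.sym h) (.sym s :: (σ₂.stk (.sym h)).tail), .branch ?_, rfl,
          hagree.trans (AgreeOff.set _ (by simp) _), ?_, ?_, ?_⟩
        · rw [htop]
          refine exec_ite_false (by simp [Store.view, hA, show Nat.bits 1 = [true] from rfl])
            (s1.seq_nil (s2.seq_nil (exec_ite_true ?_ s3)))
          simp [Store.view, hA₂]
        · rw [Store.set_stk_ne _ (by simp), hA₂]; simp
        · rw [Store.set_stk_ne _ (by simp), hB₂]; simp
        · rw [Store.set_stk_self, hs₂]; simp [scanned]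
      | succ a =>
        refine ⟨σ₂, .branch ?_, rfl, hagree, ?_, ?_, ?_⟩
        · rw [htop]
          have hne : ∀ n : ℕ, ((n + 1).bits.head?).isNone = false := by
            intro n
            cases h : (n + 1).bits with
            | nil => rw [bits_eq_nil] at h; omega
            | cons => rfl
          refine exec_ite_false (by simp only [Store.view, hA]; exact hne _)
            (s1.seq_nil (s2.seq_nil (exec_ite_false ?_ (exec_skip b2))))
          simp only [Store.view, hA₂]; exact hne _
        · rw [hA₂]; simp
        · rw [hB₂]; simp
        · rw [hs₂]; simp [scanned]

/-- From any configuration of the machine computing the tape, the letters it still writes are counted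
against the position counter. -/
lemma exec_recompute {h : H} {q τ w q' τ'} (hr : (M h).Run (fun _ => x) S q τ w q' τ')
    (hhalt : (M h).trans q' (τ'.view fun _ => x) = none) {σ : Store Unit (Alph G M)} {a b : ℕ}
    {c : Cell (I h)} (hσ : σ.Bdd S) (hq : σ.stk (.ms h) = [q]) (hsub : sub h σ = τ)
    (ho : (σ.stk (.o h)).tail = [])
    (hA : σ.stk (.cA h) = a.bits) (hB : σ.stk (.cB h) = b.bits) (hu : σ.stk .aux = [])
    (hs : σ.stk (.sym h) = [c]) (hS : ∀ n ≤ a + b, n.bits.length < S) :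
    ∃ σ', Exec (fun _ => x) S (.loop (fun v => (mNext v h).isSome)
        (.seq (mStep h) (consume h)) : QProg G M) σ [] σ' ∧
      AgreeOff (junk h ∪ {.cA h, .cB h}) σ σ' ∧
      σ'.stk (.cA h) = (a - w.length).bits ∧ σ'.stk (.cB h) = (b + min a w.length).bits ∧
      σ'.stk (.sym h) = [scanned a w c] := by
  induction hr generalizing σ a b c with
  | refl q τ =>
    refine ⟨σ, .exit ?_, .refl _ _, by simpa using hA, by simpa using hB, ?_⟩
    · have h1 : (σ.view fun _ => x).top (.ms h) = some q := by simp [Store.view, hq]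
      subst hsub
      rw [mNext, h1]
      simp only
      erw [hhalt]
      rfl
    · rw [hs]; cases a <;> simp [scanned]
  | @step q τ q₁ e w q₂ τ₂ ht hb _ ih =>
    subst hsub
    have hS1 : 1 ≤ S := by have := hS 0 (by omega); omega
    obtain ⟨σ₁, x1, hq₁, hsub₁, ho₁, ag₁⟩ := exec_mStep (G := G) (x := x) hσ hS1 hq ho ht hb
    have nA : Idx.cA h ∉ {j : Idx H G.ι fun h => (M h).ι | j = .ms h ∨ j = .o h ∨ ∃ i, j = .m h i} := by simp
    have nB : Idx.cB h ∉ {j : Idx H G.ι fun h => (M h).ι | j = .ms h ∨ j = .o h ∨ ∃ i, j = .m h i} := by simp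
    have nu : Idx.aux ∉ {j : Idx H G.ι fun h => (M h).ι | j = .ms h ∨ j = .o h ∨ ∃ i, j = .m h i} := by simp
    have ns : Idx.sym h ∉ {j : Idx H G.ι fun h => (M h).ι | j = .ms h ∨ j = .o h ∨ ∃ i, j = .m h i} := by simp
    obtain ⟨σ₂, x2, hp₂, ag₂, hA₂, hB₂, hs₂⟩ := exec_consume (x := x) (x1.bdd hσ) ho₁
      ((ag₁ _ nA).trans hA) ((ag₁ _ nB).trans hB) ((ag₁ _ nu).trans hu) ((ag₁ _ ns).trans hs)
      (hS b (by omega))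
    have m2 : ∀ j : Idx H G.ι fun h => (M h).ι, j ≠ .cA h → j ≠ .cB h → j ≠ .sym h →
        σ₂.stk j = σ₁.stk j := fun j h1 h2 h3 => ag₂ j (by simp [h1, h2, h3])
    obtain ⟨σ₃, x3, ag₃, hA₃, hB₃, hs₃⟩ := ih hhalt (σ := σ₂) (a := a - e.out.toList.length)
      (b := b + min a e.out.toList.length) (c := scanned a e.out.toList c)
      (x2.bdd (x1.bdd hσ)) (by rw [m2 _ (by simp) (by simp) (by simp), hq₁])
      (by
        rw [← hsub₁]
        exact Store.ext hp₂ (funext fun i => m2 _ (by simp) (by simp) (by simp)))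
      (by
        rw [m2 _ (by simp) (by simp) (by simp), ho₁]
        cases e.out <;> rfl)
      hA₂ hB₂ (by rw [m2 _ (by simp) (by simp) (by simp), ag₁ _ nu, hu]) hs₂
      (fun n hn => hS n (by omega))
    refine ⟨σ₃, .loop_nil ?_ (x1.seq_nil x2) x3, ?_, ?_, ?_, ?_⟩
    · have h1 : (σ.view fun _ => x).top (.ms h) = some q := by simp [Store.view, hq]
      rw [mNext, h1]
      simp only
      erw [ht]
      rfl
    · refine ((ag₁.mono ?_).trans (ag₂.mono ?_)).trans ag₃
      · rintro j (rfl | rfl | ⟨i, rfl⟩) <;> simp [junk]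
      · rintro j (rfl | rfl | rfl) <;> simp [junk]
    · rw [hA₃, List.length_append, Nat.sub_sub]
    · rw [hB₃, List.length_append]; congr 1; omega
    · rw [hs₃, scanned_append]

lemma incA_exec {h : H} {σ : Store Unit (Alph G M)} (hσ : σ.Bdd S) {n : ℕ}
    (hA : σ.stk (.cA h) = n.bits) (hu : σ.stk .aux = []) (hS : n.bits.length < S) :
    Exec (fun _ => x) S (incA h : QProg G M) σ [] (σ.set (.cA h) (n + 1).bits) := by
  have := exec_inc (X := fun _ : Unit => x) (S := S) (O := O)
    (I := fun _ : Unit => Bool) (c := .cA h) (u := .aux)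
    (e := fun b => b) (d := fun b => b) (m := ()) (by simp) (fun _ => rfl) hσ (n := n)
    (by rw [hA]; exact (List.map_id _).symm) hu hS
  have hid : ∀ n : ℕ, n.bits.map (fun b : Bool => (b : Alph G M (.cA h))) = n.bits :=
    fun n => List.map_id _
  rwa [hid] at this

lemma decA_exec {h : H} {σ : Store Unit (Alph G M)} (hσ : σ.Bdd S) {n : ℕ}
    (hA : σ.stk (.cA h) = (n + 1).bits) (hu : σ.stk .aux = []) :
    Exec (fun _ => x) S (decA h : QProg G M) σ [] (σ.set (.cA h) n.bits) := by
  have := exec_dec (X := fun _ : Unit => x) (S := S) (O := O)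
    (I := fun _ : Unit => Bool) (c := .cA h) (u := .aux)
    (e := fun b => b) (d := fun b => b) (m := ()) (by simp) (fun _ => rfl) hσ (n := n)
    (by rw [hA]; exact (List.map_id _).symm) hu
  have hid : ∀ n : ℕ, n.bits.map (fun b : Bool => (b : Alph G M (.cA h))) = n.bits :=
    fun n => List.map_id _
  rwa [hid] at this

lemma decB_exec {h : H} {σ : Store Unit (Alph G M)} (hσ : σ.Bdd S) {n : ℕ}
    (hB : σ.stk (.cB h) = (n + 1).bits) (hu : σ.stk .aux = []) :
    Exec (fun _ => x) S (decB h : QProg G M) σ [] (σ.set (.cB h) n.bits) := by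
  have := exec_dec (X := fun _ : Unit => x) (S := S) (O := O)
    (I := fun _ : Unit => Bool) (c := .cB h) (u := .aux)
    (e := fun b => b) (d := fun b => b) (m := ()) (by simp) (fun _ => rfl) hσ (n := n)
    (by rw [hB]; exact (List.map_id _).symm) hu
  have hid : ∀ n : ℕ, n.bits.map (fun b : Bool => (b : Alph G M (.cB h))) = n.bits :=
    fun n => List.map_id _
  rwa [hid] at this

lemma exec_restore {h : H} {σ : Store Unit (Alph G M)} (hσ : σ.Bdd S) {a b : ℕ}
    (hA : σ.stk (.cA h) = a.bits) (hB : σ.stk (.cB h) = b.bits) (hu : σ.stk .aux = [])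
    (hS : ∀ n ≤ a + b, n.bits.length < S) :
    Exec (fun _ => x) S (restore h : QProg G M) σ []
      ((σ.set (.cB h) []).set (.cA h) (a + b).bits) := by
  induction b generalizing σ a with
  | zero =>
    rw [Store.set_eq_self σ (.cB h) (by simpa using hB), Store.set_eq_self _ _ (by simpa using hA)]
    exact .exit (by simp [Store.view, hB])
  | succ b ih =>
    have s1 := decB_exec (x := x) hσ hB hu
    have b1 := s1.bdd hσ
    have s2 := incA_exec (x := x) b1 (h := h) (n := a)
      (by rw [Store.set_stk_ne _ (by simp), hA])
      (by rw [Store.set_stk_ne _ (by simp), hu]) (hS a (by omega))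
    have b2 := s2.bdd b1
    have s3 := ih b2 (a := a + 1) (by simp)
      (by rw [Store.set_stk_ne _ (by simp), Store.set_stk_self])
      (by rw [Store.set_stk_ne _ (by simp), Store.set_stk_ne _ (by simp), hu])
      (fun n hn => hS n (by omega))
    have : (((((σ.set (.cB h) b.bits).set (.cA h) (a + 1).bits).set (.cB h) []).set (.cA h)
        (a + 1 + b).bits)) = (σ.set (.cB h) []).set (.cA h) (a + (b + 1)).bits := by
      rw [Store.set_set_set (by simp), Store.set_set_set (by simp)]; congr 2; omega
    rw [this] at s3
    refine Exec.loop_nil ?_ (s1.seq_nil s2) s3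
    simp only [Store.view, hB]
    cases hh : (b + 1).bits with
    | nil => rw [bits_eq_nil] at hh; omega
    | cons => rfl

lemma exec_clearAll {h : H} (is : List (M h).ι) {σ : Store Unit (Alph G M)} (hσ : σ.Bdd S) :
    ∃ σ', Exec (fun _ => x) S (.forEach is fun i => .clear (.m h i) : QProg G M) σ [] σ' ∧
      AgreeOff {j | ∃ i, j = .m h i} σ σ' ∧
      ∀ i, i ∈ is ∨ σ.stk (.m h i) = [] → σ'.stk (.m h i) = [] := by
  induction is generalizing σ with
  | nil => exact ⟨σ, exec_skip hσ, .refl _ _, by simp⟩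
  | cons i is ih =>
    have s1 := exec_clear (X := fun _ : Unit => x) (O := O) (I := fun _ : Unit => Bool) hσ
      (.m h i)
    obtain ⟨σ', s2, ag, hcl⟩ := ih (s1.bdd hσ)
    refine ⟨σ', s1.seq_nil s2, (AgreeOff.set _ (by simp) _).trans ag, fun k hk => hcl k ?_⟩
    by_cases hki : k = i
    · subst hki; right; simp
    · rw [Store.set_stk_ne _ (by simpa using hki)]
      simpa [hki] using hk

/-- After a recomputation the register holds the scanned cell, and the counters are as before. -/
lemma exec_fetch {h : H} {is : List (M h).ι} (his : ∀ i, i ∈ is) {w : List (I h)}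
    (hM : (M h).Computes (fun _ => x) S w) {σ : Store Unit (Alph G M)} (hσ : σ.Bdd S) {n : ℕ}
    (hA : σ.stk (.cA h) = n.bits) (hB : σ.stk (.cB h) = []) (hu : σ.stk .aux = [])
    (hS : ∀ k ≤ n, k.bits.length < S) :
    ∃ σ', Exec (fun _ => x) S (fetch is : QProg G M) σ [] σ' ∧
      AgreeOff (junk h) σ σ' ∧ σ'.stk (.sym h) = [cellAt w n] := by
  have hS1 : 0 < S := by have := hS 0 (by omega); omega
  obtain ⟨q', τ', hr, hhalt⟩ := hM
  obtain ⟨σ₁, s1, ag1, cl1⟩ := exec_clearAll (G := G) (x := x) is hσ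
  have b1 := s1.bdd hσ
  have s2 := exec_rewind (X := fun _ : Unit => x) (O := O) (I := fun _ : Unit => Bool) b1 ()
  have b2 := s2.bdd b1
  have s3 := exec_clear (X := fun _ : Unit => x) (O := O) (I := fun _ : Unit => Bool) b2 (.ms h)
  have b3 := s3.bdd b2
  have s4 := exec_push (X := fun _ : Unit => x) (O := O) (I := fun _ : Unit => Bool) b3
    (i := .ms h) (a := (M h).start) (by simpa using hS1)
  have b4 := s4.bdd b3
  have s5 := exec_clear (X := fun _ : Unit => x) (O := O) (I := fun _ : Unit => Bool) b4 (.o h)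
  have b5 := s5.bdd b4
  have s6 := exec_clear (X := fun _ : Unit => x) (O := O) (I := fun _ : Unit => Bool) b5 (.sym h)
  have b6 := s6.bdd b5
  have s7 := exec_push (X := fun _ : Unit => x) (O := O) (I := fun _ : Unit => Bool) b6
    (i := .sym h) (a := if n.bits = [] then .left else .right) (by simpa using hS1)
  have b7 := s7.bdd b6
  rw [Store.set_stk_self, Store.set_set] at s4 s7
  rw [Store.set_stk_self, Store.set_set] at b4 b7
  rw [Store.set_stk_self, Store.set_set] at s5 b5 s6 b6 s7 b7
  set σ₆ := (((σ₁.goto () 0).set (.ms h) [(M h).start]).set (.o h) []) with hσ₆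
  set c : Cell (I h) := if n.bits = [] then .left else .right with hc
  set σ₇ := σ₆.set (.sym h) [c] with hσ₇
  have e7 : ∀ j : Idx H G.ι fun h => (M h).ι, j ≠ .ms h → j ≠ .o h → j ≠ .sym h →
      σ₇.stk j = σ₁.stk j := by
    intro j h1 h2 h3
    rw [hσ₇, Store.set_stk_ne _ h3, hσ₆, Store.set_stk_ne _ h2, Store.set_stk_ne _ h1,
      Store.goto_stk]
  have a1 : ∀ j : Idx H G.ι fun h => (M h).ι, (∀ i, j ≠ .m h i) → σ₁.stk j = σ.stk j :=
    fun j hj => ag1 j (by simpa using hj)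
  have hA6 : σ₆.stk (.cA h) = n.bits := by
    rw [hσ₆, Store.set_stk_ne _ (by simp), Store.set_stk_ne _ (by simp), Store.goto_stk,
      a1 _ (by simp), hA]
  obtain ⟨σ₈, s8, ag8, hA8, hB8, hs8⟩ := exec_recompute (G := G) hr hhalt (σ := σ₇) (a := n)
    (b := 0) (c := c) b7
    (by rw [hσ₇, Store.set_stk_ne _ (by simp), hσ₆, Store.set_stk_ne _ (by simp),
      Store.set_stk_self])
    (by
      refine Store.ext (funext fun u => by simp [sub, hσ₇, hσ₆]) (funext fun i => ?_)
      simp only [sub, Store.init_stk]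
      rw [e7 _ (by simp) (by simp) (by simp), cl1 i (.inl (his i))])
    (by rw [hσ₇, Store.set_stk_ne _ (by simp), hσ₆, Store.set_stk_self]; rfl)
    (by rw [e7 _ (by simp) (by simp) (by simp), a1 _ (by simp), hA])
    (by rw [e7 _ (by simp) (by simp) (by simp), a1 _ (by simp), hB]; simp)
    (by rw [e7 _ (by simp) (by simp) (by simp), a1 _ (by simp), hu])
    (by rw [hσ₇, Store.set_stk_self]) (by simpa using hS)
  have b8 := s8.bdd b7
  have s9 := exec_restore (x := x) b8 hA8 hB8
    (by rw [ag8 _ (by simp [junk]), e7 _ (by simp) (by simp) (by simp), a1 _ (by simp), hu])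
    (fun k hk => hS k (by omega))
  refine ⟨_, s1.seq_nil <| s2.seq_nil <| s3.seq_nil <| s4.seq_nil <| s5.seq_nil <| s6.seq_nil <|
    Exec.seq_nil (.branch ?_) <| s8.seq_nil s9, ?_, ?_⟩
  · convert s7 using 2
    simp only [Store.view, Store.set_stk_ne _ (show Idx.cA h ≠ Idx.sym h by simp), hA6, hc]
    cases n.bits <;> simp
  · intro j hj
    by_cases h1 : j = .cA h
    · subst h1
      rw [Store.set_stk_self, hA]; congr 1; omega
    by_cases h2 : j = .cB h
    · subst h2
      rw [Store.set_stk_ne _ (by simp), Store.set_stk_self, hB]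
    rw [Store.set_stk_ne _ h1, Store.set_stk_ne _ h2, ag8 j (by simp [hj, h1, h2])]
    simp only [junk, Set.mem_ofPred_eq, not_or, not_exists] at hj
    rw [e7 j hj.1 hj.2.1 hj.2.2.1, a1 j hj.2.2.2]
  · rw [Store.set_stk_ne _ (by simp), Store.set_stk_ne _ (by simp), hs8, hc, scanned_eq_cellAt]

lemma exec_fetchAll {is : ∀ h, List (M h).ι} (his : ∀ h i, i ∈ is h) {X : ∀ h, List (I h)}
    (hM : ∀ h, (M h).Computes (fun _ => x) S (X h)) {n : H → ℕ}
    (hS : ∀ h, ∀ k ≤ n h, k.bits.length < S) (hs : List H)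
    {σ : Store Unit (Alph G M)} (hσ : σ.Bdd S)
    (hA : ∀ h, σ.stk (.cA h) = (n h).bits) (hB : ∀ h, σ.stk (.cB h) = [])
    (hu : σ.stk .aux = []) :
    ∃ σ', Exec (fun _ => x) S (.forEach hs fun h => fetch (is h) : QProg G M) σ [] σ' ∧
      AgreeOff (⋃ h ∈ hs, junk h) σ σ' ∧ ∀ h ∈ hs, σ'.stk (.sym h) = [cellAt (X h) (n h)] := by
  induction hs generalizing σ with
  | nil => exact ⟨σ, exec_skip hσ, .refl _ _, by simp⟩
  | cons h hs ih =>
    obtain ⟨σ₁, s1, ag1, f1⟩ := exec_fetch (his h) (hM h) hσ (hA h) (hB h) hu (hS h)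
    obtain ⟨σ₂, s2, ag2, f2⟩ := ih (s1.bdd hσ)
      (fun k => by rw [ag1 _ (by simp [junk]), hA])
      (fun k => by rw [ag1 _ (by simp [junk]), hB])
      (by rw [ag1 _ (by simp [junk]), hu])
    refine ⟨σ₂, s1.seq_nil s2, (ag1.mono ?_).trans (ag2.mono ?_), ?_⟩
    · intro j hj; simp only [Set.mem_iUnion] at hj ⊢; exact ⟨h, by simp, hj⟩
    · intro j hj
      simp only [Set.mem_iUnion] at hj ⊢
      obtain ⟨k, hk, hj⟩ := hj
      exact ⟨k, by simp [hk], hj⟩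
    · intro k hk
      by_cases hk' : k ∈ hs
      · exact f2 k hk'
      · obtain rfl : k = h := by simpa [hk'] using hk
        rw [ag2 _ ?_, f1]
        simp only [Set.mem_iUnion, not_exists]
        intro k₁ hk₁ hj
        rcases hj with hj | hj | hj | ⟨i, hj⟩ <;> cases hj
        exact hk' hk₁

lemma cellAt_eq_right {A : Type} (w : List A) (n : ℕ) :
    cellAt w n = .right ↔ w.length < n := by
  cases n with
  | zero => simp [cellAt]
  | succ n =>
    rcases Nat.lt_or_ge n w.length with h | h
    · simp [cellAt, h]
    · simp [cellAt, h]

lemma exec_moveHead {h : H} {w : List (I h)} {σ : Store Unit (Alph G M)} (hσ : σ.Bdd S) {n : ℕ}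
    {m : Move} (hA : σ.stk (.cA h) = n.bits) (hu : σ.stk .aux = [])
    (hs : σ.stk (.sym h) = [cellAt w n]) (hm : σ.stk (.mvr h) = [m]) (hn : n ≤ w.length + 1)
    (hS : n.bits.length < S) :
    Exec (fun _ => x) S (moveHead h : QProg G M) σ []
      (σ.set (.cA h) (m.applyInput w.length n).bits) := by
  have t1 : (σ.view fun _ => x).top (.mvr h) = some m := by simp [Store.view, hm]
  have t2 : (σ.view fun _ => x).top (.sym h) = some (cellAt w n) := by simp [Store.view, hs]
  refine .branch ?_
  rw [t1, t2]
  cases m with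
  | stay =>
    simp only [Move.applyInput]
    rw [Store.set_eq_self _ _ hA]; exact exec_skip hσ
  | left =>
    simp only [Move.applyInput]
    cases n with
    | zero =>
      rw [Store.set_eq_self _ _ hA]
      exact exec_ite_true (by simp [Store.view, hA]) (exec_skip hσ)
    | succ n =>
      refine exec_ite_false ?_ (decA_exec hσ hA hu)
      simp only [Store.view, hA]
      cases hh : (n + 1).bits with
      | nil => rw [bits_eq_nil] at hh; omega
      | cons => rfl
  | right =>
    simp only [Move.applyInput]
    by_cases hr : w.length < n
    · rw [(cellAt_eq_right w n).2 hr, show min (n + 1) (w.length + 1) = n by omega,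
        Store.set_eq_self _ _ hA]
      exact exec_skip hσ
    · rw [show min (n + 1) (w.length + 1) = n + 1 by omega]
      have hr' : cellAt w n ≠ .right := fun e => hr ((cellAt_eq_right w n).1 e)
      cases hcell : cellAt w n with
      | right => exact absurd hcell hr'
      | left => exact incA_exec hσ hA hu hS
      | sym a => exact incA_exec hσ hA hu hS

lemma exec_moveAll {X : ∀ h, List (I h)} {n : H → ℕ} {m : H → Move}
    (hn : ∀ h, n h ≤ (X h).length + 1) (hS : ∀ h, (n h).bits.length < S) (hs : List H)
    (hnd : hs.Nodup) {σ : Store Unit (Alph G M)} (hσ : σ.Bdd S)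
    (hA : ∀ h ∈ hs, σ.stk (.cA h) = (n h).bits) (hu : σ.stk .aux = [])
    (hsy : ∀ h, σ.stk (.sym h) = [cellAt (X h) (n h)]) (hm : ∀ h, σ.stk (.mvr h) = [m h]) :
    ∃ σ', Exec (fun _ => x) S (.forEach hs moveHead : QProg G M) σ [] σ' ∧
      AgreeOff {j | ∃ h ∈ hs, j = .cA h} σ σ' ∧
      ∀ h ∈ hs, σ'.stk (.cA h) = ((m h).applyInput (X h).length (n h)).bits := by
  induction hs generalizing σ with
  | nil => exact ⟨σ, exec_skip hσ, .refl _ _, by simp⟩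
  | cons h hs ih =>
    have s1 := exec_moveHead (x := x) hσ (hA h (by simp)) hu (hsy h) (hm h) (hn h) (hS h)
    rw [List.nodup_cons] at hnd
    obtain ⟨σ₂, s2, ag2, f2⟩ := ih hnd.2 (s1.bdd hσ)
      (fun k hk => by
        have hne : (Idx.cA k : Idx H G.ι fun h => (M h).ι) ≠ .cA h := by
          rintro ⟨⟩; exact hnd.1 hk
        rw [Store.set_stk_ne _ hne, hA k (by simp [hk])])
      (by rw [Store.set_stk_ne _ (by simp), hu])
      (fun k => by rw [Store.set_stk_ne _ (by simp), hsy])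
      (fun k => by rw [Store.set_stk_ne _ (by simp), hm])
    refine ⟨σ₂, s1.seq_nil s2, (AgreeOff.set _ (by simp) _).trans (ag2.mono ?_), ?_⟩
    · rintro j ⟨k, hk, rfl⟩; exact ⟨k, by simp [hk], rfl⟩
    · intro k hk
      by_cases hk' : k ∈ hs
      · exact f2 k hk'
      · obtain rfl : k = h := by simpa [hk'] using hk
        rw [ag2 _ (by rintro ⟨k₁, hk₁, ⟨⟩⟩; exact hk' hk₁), Store.set_stk_self]

/-- The simulating machine with store `σ` represents the simulated machine in state `q` with store `τ`,
its heads running on the tapes `X`. -/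
structure Rep (X : ∀ h, List (I h)) (S : ℕ) (q : G.State) (τ : Store H G.Γ)
    (σ : Store Unit (Alph G M)) : Prop where
  bdd : σ.Bdd S
  gst : σ.stk .gst = [q]
  g : ∀ i, σ.stk (.g i) = τ.stk i
  cA : ∀ h, σ.stk (.cA h) = (τ.pos h).bits
  cB : ∀ h, σ.stk (.cB h) = []
  aux : σ.stk .aux = []
  sym : ∀ h, σ.stk (.sym h) = [cellAt (X h) (τ.pos h)]
  mvr : ∀ h, (σ.stk (.mvr h)).tail = []
  pos : ∀ h, τ.pos h ≤ (X h).length + 1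

lemma Rep.gNext_eq {X : ∀ h, List (I h)} {q : G.State} {τ : Store H G.Γ}
    {σ : Store Unit (Alph G M)} (r : Rep X S q τ σ) :
    gNext (σ.view fun _ => x) = G.trans q (τ.view X) := by
  have h1 : (σ.view fun _ => x).top .gst = some q := by simp [Store.view, r.gst]
  rw [gNext, h1]
  simp only
  congr 1
  refine View.ext (funext fun h => ?_) (funext fun i => ?_)
  · simp [Store.view, r.sym]
  · simp [Store.view, r.g]

lemma exec_gStep {X : ∀ h, List (I h)} {q q' : G.State} {τ : Store H G.Γ} {e}
    {σ : Store Unit (Alph G M)} (r : Rep X S q τ σ) (ht : G.trans q (τ.view X) = some (q', e))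
    (hb : (e.app X τ).Bdd S) (hS : 1 ≤ S) :
    ∃ σ', Exec (fun _ => x) S (gStep : QProg G M) σ e.out.toList σ' ∧ σ'.Bdd S ∧
      σ'.stk .gst = [q'] ∧ (∀ i, σ'.stk (.g i) = (e.app X τ).stk i) ∧
      (∀ h, σ'.stk (.mvr h) = [e.mv h]) ∧
      AgreeOff {j | j = .gst ∨ (∃ i, j = .g i) ∨ ∃ h, j = .mvr h} σ σ' := by
  have hn := r.gNext_eq (x := x)
  rw [ht] at hn
  obtain ⟨f, hf⟩ : ∃ f : View (fun _ : Unit => Bool) (Alph G M) → Eff Unit (Alph G M) O,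
    (gStep : QProg G M) = .act f := ⟨_, rfl⟩
  have hout : (f (σ.view fun _ => x)).out = e.out := by cases hf; simp only [hn]
  set σ' := (f (σ.view fun _ => x)).app (fun _ => x) σ with hσ'
  have h1 : σ'.stk .gst = [q'] := by
    cases hf; simp only [hσ', Eff.app, hn]; simp [StackOp.apply, r.gst]
  have h2 : ∀ i, σ'.stk (.g i) = (e.app X τ).stk i := by
    intro i; cases hf; simp only [hσ', Eff.app, hn]; rw [r.g]
  have h3 : ∀ h, σ'.stk (.mvr h) = [e.mv h] := by
    intro h; cases hf; simp only [hσ', Eff.app, hn]; simp [StackOp.apply, r.mvr]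
  have h4 : AgreeOff {j | j = .gst ∨ (∃ i, j = .g i) ∨ ∃ h, j = .mvr h} σ σ' := by
    intro j hj
    cases hf
    simp only [hσ', Eff.app, hn]
    cases j <;> first | rfl | (exfalso; exact hj (by simp))
  have hbd : σ'.Bdd S := by
    intro j
    by_cases hj : j = .gst ∨ (∃ i, j = .g i) ∨ ∃ h, j = .mvr h
    · rcases hj with rfl | ⟨i, rfl⟩ | ⟨h, rfl⟩
      · rw [h1]; simpa using hS
      · rw [h2]; exact hb i
      · rw [h3]; simpa using hS
    · rw [h4 j hj]; exact r.bdd j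
  refine ⟨σ', ?_, hbd, h1, h2, h3, h4⟩
  have := Exec.act (X := fun _ => x) (S := S) (f := f) (σ := σ) hbd
  rw [hout] at this
  rw [hf]
  exact this

/-- The main loop preserves the representation, since the counters and the registers follow the heads. -/
lemma exec_main {hs : List H} (hhs : ∀ h, h ∈ hs) (hnd : hs.Nodup) {is : ∀ h, List (M h).ι}
    (his : ∀ h i, i ∈ is h) {X : ∀ h, List (I h)}
    (hM : ∀ h, (M h).Computes (fun _ => x) S (X h))
    (hS : ∀ h, ∀ k ≤ (X h).length + 1, k.bits.length < S) (hS1 : 1 ≤ S) {q τ w q' τ'}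
    (hr : G.Run X S q τ w q' τ') (hhalt : G.trans q' (τ'.view X) = none)
    {σ : Store Unit (Alph G M)} (r : Rep X S q τ σ) :
    ∃ σ', Exec (fun _ => x) S (.loop (fun v => (gNext v).isSome) <|
      .seq gStep <| .seq (.forEach hs moveHead) (.forEach hs fun h => fetch (is h)) : QProg G M)
      σ w σ' := by
  induction hr generalizing σ with
  | refl q τ =>
    exact ⟨σ, .exit (by rw [r.gNext_eq, hhalt]; rfl)⟩
  | @step q τ q₁ e w q₂ τ₂ ht hb _ ih =>
    obtain ⟨σ₁, s1, b1, gst1, g1, mv1, ag1⟩ := exec_gStep (x := x) r ht hb hS1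
    obtain ⟨σ₂, s2, ag2, hA2⟩ := exec_moveAll (G := G) (x := x) r.pos
      (fun h => hS h _ (r.pos h)) hs hnd b1
      (fun h _ => by rw [ag1 _ (by simp), r.cA]) (by rw [ag1 _ (by simp), r.aux])
      (fun h => by rw [ag1 _ (by simp), r.sym]) mv1
    have b2 := s2.bdd b1
    have hpos : ∀ h, (e.app X τ).pos h ≤ (X h).length + 1 := by
      intro h
      have := r.pos h
      simp only [Eff.app]
      cases e.mv h <;> simp only [Move.applyInput] <;> omega
    obtain ⟨σ₃, s3, ag3, f3⟩ := exec_fetchAll (G := G) (x := x) his hM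
      (n := (e.app X τ).pos) (fun h k hk => hS h k (hk.trans (hpos h))) hs b2
      (fun h => hA2 h (hhs h)) (fun h => by rw [ag2 _ (by simp), ag1 _ (by simp), r.cB])
      (by rw [ag2 _ (by simp), ag1 _ (by simp), r.aux])
    have hr : Rep X S q₁ (e.app X τ) σ₃ :=
      { bdd := s3.bdd b2
        gst := by rw [ag3 _ (by simp [junk]), ag2 _ (by simp), gst1]
        g := fun i => by rw [ag3 _ (by simp [junk]), ag2 _ (by simp), g1]
        cA := fun h => by rw [ag3 _ (by simp [junk]), hA2 h (hhs h)]; rfl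
        cB := fun h => by
          rw [ag3 _ (by simp [junk]), ag2 _ (by simp), ag1 _ (by simp), r.cB]
        aux := by rw [ag3 _ (by simp [junk]), ag2 _ (by simp), ag1 _ (by simp), r.aux]
        sym := fun h => f3 h (hhs h)
        mvr := fun h => by rw [ag3 _ (by simp [junk]), ag2 _ (by simp), mv1]; rfl
        pos := hpos }
    obtain ⟨σ₄, s4⟩ := ih hhalt hr
    refine ⟨σ₄, .loop (by rw [r.gNext_eq, ht]; rfl) ?_ s4⟩
    have := s1.seq (s2.seq_nil s3)
    rwa [List.append_nil] at this

end Spec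

end Query

/-- A machine whose heads run on tapes that can be computed in logarithmic space can be simulated in
logarithmic space by a machine that reads the input: whenever the simulated machine scans a
cell, the content of that cell is recomputed, only its position being stored. -/
theorem LS.query {H O : Type} [Finite H] {I : H → Type} [∀ h, Finite (I h)] [Finite O]
    {F : ∀ h, List Bool → List (I h)} (hF : ∀ h, LS (F h)) (G : SM H I O) (K : ℕ)
    {g : List Bool → List O}
    (hG : ∀ x, G.Computes (fun h => F h x) (K * (Nat.log 2 x.length + 1)) (g x)) : LS g := by
  classical
  have hlen := fun h => (hF h).length_le
  choose C hC using hlen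
  choose M KM hM using hF
  have := Fintype.ofFinite H
  have hfin : ∀ h, Fintype (M h).ι := fun h => by
    have := (M h).finiteι
    exact Fintype.ofFinite _
  have := G.finiteι
  have := fun h => (M h).finiteι
  have : ∀ j, Finite (Query.Alph G M j) := by
    intro j
    have := G.finiteState
    cases j with
    | g i => exact G.finiteΓ i
    | ms h => exact (M h).finiteState
    | m h i => exact (M h).finiteΓ i
    | _ => simp only [Query.Alph]; infer_instance
  let p : Query.QProg G M := Query.program Finset.univ.toList fun h => Finset.univ.toList
  -- the stacks of all machines have to fit, and the position counters, whose length is bounded by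
  -- the logarithm of the length of the tapes
  refine ⟨p.toSM, K + ∑ h, (KM h + C h) + 4, fun x => ?_⟩
  set S := (K + ∑ h, (KM h + C h) + 4) * (Nat.log 2 x.length + 1) with hSdef
  have hle : ∀ h, KM h + C h ≤ ∑ h, (KM h + C h) := fun h =>
    Finset.single_le_sum (f := fun h => KM h + C h) (fun _ _ => Nat.zero_le _) (Finset.mem_univ h)
  have hS1 : 1 ≤ S := Nat.mul_pos (by omega) (by omega)
  have hM' : ∀ h, (M h).Computes (fun _ => x) S (F h x) := fun h =>
    (hM h x).mono (Nat.mul_le_mul_right _ (by have := hle h; omega))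
  have hS : ∀ h, ∀ k ≤ (F h x).length + 1, k.bits.length < S := by
    intro h k hk
    have h1 := hC h x
    set L := Nat.log 2 x.length + 1
    have h2 : k < 2 ^ (C h * L + 2) := by
      have : 0 < 2 ^ (C h * L) := by positivity
      rw [pow_add]; omega
    have h3 := bits_length_le h2
    have h4 : (C h + 4) * L ≤ S := Nat.mul_le_mul_right _ (by have := hle h; omega)
    have h5 : 1 ≤ L := by omega
    nlinarith
  obtain ⟨q', τ', hr, hhalt⟩ := (hG x).mono (T := S) (Nat.mul_le_mul_right _ (by omega))
  have b0 : (Store.init Unit (Query.Alph G M)).Bdd S := Store.init_bdd S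
  have s1 := exec_push (X := fun _ : Unit => x) (O := O) (I := fun _ : Unit => Bool) b0
    (i := .gst) (a := G.start) (by simp; omega)
  have b1 := s1.bdd b0
  obtain ⟨σ₂, s2, ag2, f2⟩ := Query.exec_fetchAll (G := G) (x := x)
    (is := fun h => Finset.univ.toList) (fun h i => by simp) hM' (n := fun _ => 0)
    (fun h k hk => hS h k (by omega)) Finset.univ.toList b1
    (fun h => by rw [Store.set_stk_ne _ (by simp)]; simp)
    (fun h => by rw [Store.set_stk_ne _ (by simp)]; simp)
    (by rw [Store.set_stk_ne _ (by simp)]; simp)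
  have hrep : Query.Rep (fun h => F h x) S G.start (Store.init H G.Γ) σ₂ :=
    { bdd := s2.bdd b1
      gst := by rw [ag2 _ (by simp [Query.junk]), Store.set_stk_self]; simp
      g := fun i => by rw [ag2 _ (by simp [Query.junk]), Store.set_stk_ne _ (by simp)]; simp
      cA := fun h => by rw [ag2 _ (by simp [Query.junk]), Store.set_stk_ne _ (by simp)]; simp
      cB := fun h => by rw [ag2 _ (by simp [Query.junk]), Store.set_stk_ne _ (by simp)]; simp
      aux := by rw [ag2 _ (by simp [Query.junk]), Store.set_stk_ne _ (by simp)]; simp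
      sym := fun h => f2 h (by simp)
      mvr := fun h => by
        rw [ag2 _ (by simp [Query.junk]), Store.set_stk_ne _ (by simp)]; simp
      pos := fun h => by simp }
  obtain ⟨σ₃, s3⟩ := Query.exec_main (G := G) (M := M)
    (hs := Finset.univ.toList) (by simp) (Finset.nodup_toList _)
    (is := fun h => Finset.univ.toList) (fun h i => by simp) hM' hS hS1 hr hhalt hrep
  exact (s1.seq_nil (s2.seq_nil s3)).computes

/-- A program whose heads run on tapes that can be computed in logarithmic space, and whose stacks stay
of logarithmic height, computes a function in logarithmic space. -/
theorem LS.ofProg {H ι O : Type} [Finite H] [Finite ι] [Finite O] {I : H → Type}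
    [∀ h, Finite (I h)] {Γ : ι → Type} [∀ i, Finite (Γ i)]
    {F : ∀ h, List Bool → List (I h)} (hF : ∀ h, LS (F h)) (p : SProg I Γ O) (K : ℕ)
    {g : List Bool → List O}
    (hp : ∀ x, ∃ σ, Exec (fun h => F h x) (K * (Nat.log 2 x.length + 1)) p
      (Store.init H Γ) (g x) σ) : LS g :=
  LS.query hF p.toSM K fun x => (hp x).choose_spec.computes

/-! ### Scanning tapes -/

/-- The cell holds a letter. -/
def Cell.isSym {I : Type} : Cell I → Bool
  | .sym _ => true
  | _ => false

/-- From cell `p` on the tape holding `X` reads `r`. -/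
def Reads {I : Type} (X : List I) (p : ℕ) (r : List I) : Prop :=
  ∃ u, X = u ++ r ∧ p = u.length + 1

lemma Reads.cellAt_cons {I : Type} {X : List I} {p : ℕ} {a : I} {r : List I}
    (h : Reads X p (a :: r)) : cellAt X p = .sym a := by
  obtain ⟨u, rfl, rfl⟩ := h
  simp [cellAt]

lemma Reads.cellAt_nil {I : Type} {X : List I} {p : ℕ} (h : Reads X p []) :
    cellAt X p = .right := by
  obtain ⟨u, rfl, rfl⟩ := h
  simp [cellAt]

lemma Reads.tail {I : Type} {X : List I} {p : ℕ} {a : I} {r : List I}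
    (h : Reads X p (a :: r)) : Reads X (p + 1) r := by
  obtain ⟨u, rfl, rfl⟩ := h
  exact ⟨u ++ [a], by simp, by simp⟩

lemma Reads.start {I : Type} (X : List I) : Reads X 1 X := ⟨[], by simp, rfl⟩

lemma Reads.applyInput {I : Type} {X : List I} {p : ℕ} {a : I} {r : List I}
    (h : Reads X p (a :: r)) : Move.applyInput X.length .right p = p + 1 := by
  obtain ⟨u, rfl, rfl⟩ := h
  simp only [Move.applyInput, List.length_append, List.length_cons]
  omega

section Scan

variable {H ι O : Type} {I : H → Type} {Γ : ι → Type} {X : ∀ h, List (I h)} {S : ℕ}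
  [DecidableEq H]

/-- Execute `p a` for each letter `a` on the tape of head `h`, from the scanned cell to the right
end. -/
def Prog.scan (h : H) (p : I h → SProg I Γ O) : SProg I Γ O :=
  .loop (fun v => (v.sym h).isSym) <| .branch fun v =>
    match v.sym h with
    | .sym a => .seq (p a) (.move h .right)
    | _ => .skip

lemma exec_move_right {σ : Store H Γ} (hσ : σ.Bdd S) {h : H} {a : I h} {r : List (I h)}
    (hr : Reads (X h) (σ.pos h) (a :: r)) :
    Exec X S (Prog.move h .right : SProg I Γ O) σ [] (σ.goto h (σ.pos h + 1)) := by
  have := exec_move (X := X) (O := O) hσ h .right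
  rwa [hr.applyInput] at this

lemma exec_move_first {σ : Store H Γ} (hσ : σ.Bdd S) {h : H} (h0 : σ.pos h = 0) :
    Exec X S (Prog.move h .right : SProg I Γ O) σ [] (σ.goto h 1) := by
  have := exec_move (X := X) (O := O) hσ h .right
  rw [h0] at this
  simpa [Move.applyInput] using this

/-- Scanning a tape, with a loop invariant that depends on what remains to be read. -/
lemma exec_scan {h : H} {p : I h → SProg I Γ O} {Inv : List (I h) → Store H Γ → Prop}
    {w : I h → List (I h) → List O}
    (step : ∀ a r σ, σ.Bdd S → Inv (a :: r) σ → Reads (X h) (σ.pos h) (a :: r) →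
      ∃ σ', Exec X S (p a) σ (w a r) σ' ∧ σ'.pos h = σ.pos h ∧ Inv r (σ'.goto h (σ'.pos h + 1)))
    (out : List (I h) → List O) (out_nil : out [] = [])
    (out_cons : ∀ a r, out (a :: r) = w a r ++ out r)
    (r : List (I h)) {σ : Store H Γ} (hσ : σ.Bdd S) (hr : Reads (X h) (σ.pos h) r)
    (hi : Inv r σ) :
    ∃ σ', Exec X S (Prog.scan h p) σ (out r) σ' ∧ Inv [] σ' := by
  induction r generalizing σ with
  | nil =>
    rw [out_nil]
    exact ⟨σ, .exit (by simp [Store.view, hr.cellAt_nil, Cell.isSym]), hi⟩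
  | cons a r ih =>
    obtain ⟨σ₁, s1, hp, hi₁⟩ := step a r σ hσ hi hr
    have b1 := s1.bdd hσ
    have s2 := exec_move_right (X := X) (O := O) (S := S) (σ := σ₁) b1 (h := h) (a := a) (r := r)
      (by rw [hp]; exact hr)
    obtain ⟨σ₂, s3, hi₂⟩ := ih (s2.bdd b1) (by rw [Store.goto_pos_self, hp]; exact hr.tail) hi₁
    rw [out_cons]
    refine ⟨σ₂, .loop ?_ (.branch ?_) s3, hi₂⟩
    · simp [Store.view, hr.cellAt_cons, Cell.isSym]
    · have : (σ.view X).sym h = .sym a := hr.cellAt_cons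
      rw [this]
      simpa using s1.seq s2

/-- Write the letters of the tape of head `h`, transformed by `f`. -/
def Prog.copy (h : H) (f : I h → List O) : SProg I Γ O :=
  .seq (.rewind h) <| .seq (.move h .right) <| .scan h fun a => .emits (f a)

lemma exec_copy {σ : Store H Γ} (hσ : σ.Bdd S) (h : H) (f : I h → List O) :
    ∃ p, Exec X S (Prog.copy h f : SProg I Γ O) σ ((X h).flatMap f) (σ.goto h p) := by
  have s1 := exec_rewind (X := X) (O := O) hσ h
  have b1 := s1.bdd hσ
  have s2 := exec_move_first (X := X) (O := O) b1 (h := h) (by simp)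
  have b2 := s2.bdd b1
  obtain ⟨σ', s3, p, rfl⟩ := exec_scan (X := X) (S := S) (h := h)
    (p := fun a => (Prog.emits (f a) : SProg I Γ O)) (Inv := fun _ τ => ∃ p, τ = σ.goto h p)
    (w := fun a _ => f a)
    (fun a r τ hτ ⟨p, hp⟩ _ => ⟨τ, exec_emits hτ _, rfl, τ.pos h + 1, by
      subst hp; rw [Store.goto_goto]⟩)
    (fun r => r.flatMap f) rfl (fun _ _ => rfl) (X h) b2
    (by simpa using Reads.start (X h)) ⟨1, by simp⟩
  exact ⟨p, s1.seq_nil (s2.seq_nil s3)⟩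

end Scan

/-! ### Closure properties of the functions computable in logarithmic space -/

lemma LS.flatMap_const {O : Type} (f : Bool → List O) : LS (fun x => x.flatMap f) := by
  refine ⟨(Prog.copy () f : SProg (fun _ : Unit => Bool) (fun _ : Fin 0 => Unit) O).toSM, 0,
    fun x => ?_⟩
  obtain ⟨p, h⟩ := exec_copy (X := fun _ : Unit => x) (I := fun _ : Unit => Bool)
    (Γ := fun _ : Fin 0 => Unit) (S := 0 * (Nat.log 2 x.length + 1)) (Store.init_bdd _) () f
  exact h.computes

lemma LS.const {O : Type} [Finite O] (w : List O) : LS (fun _ => w) := by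
  refine LS.ofProg (H := Fin 0) (ι := Fin 0) (I := fun _ => Unit) (Γ := fun _ => Unit)
    (F := fun _ _ => []) (fun h => h.elim0) (Prog.emits w) 0 fun x => ?_
  exact ⟨_, exec_emits (Store.init_bdd _) w⟩

/-- Words computable in logarithmic space may be substituted for the letters of such a word: one head
scans the word, and for each letter `t` the tape with the word of `t` is copied. -/
theorem LS.subst {T O : Type} [Finite T] [Finite O] {f : List Bool → List T}
    {g : T → List Bool → List O} (hf : LS f) (hg : ∀ t, LS (g t)) :
    LS (fun x => (f x).flatMap fun t => g t x) := by
  classical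
  let I : Option T → Type := fun h => match h with
    | none => T
    | some _ => O
  have : ∀ h, Finite (I h) := by rintro (_ | _) <;> simp only [I] <;> infer_instance
  let F : ∀ h, List Bool → List (I h) := fun h => match h with
    | none => f
    | some t => g t
  refine LS.ofProg (I := I) (ι := Fin 0) (Γ := fun _ => Unit) (F := F)
    (by rintro (_ | t); exacts [hf, hg t])
    (.seq (.move none .right) (.scan none fun t : T => .copy (some t) fun a : O => [a])) 0
    fun x => ?_
  have s1 := exec_move_first (X := fun h => F h x) (O := O) (S := 0 * (Nat.log 2 x.length + 1))
    (Store.init_bdd (H := Option T) (Γ := fun _ : Fin 0 => Unit) _) (h := none) rfl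
  obtain ⟨σ', s2, -⟩ := exec_scan (X := fun h => F h x)
    (S := 0 * (Nat.log 2 x.length + 1)) (h := none)
    (p := fun t : T => (.copy (some t) fun a : O => [a] : SProg I (fun _ : Fin 0 => Unit) O))
    (Inv := fun _ _ => True)
    (w := fun t _ => g t x)
    (fun t r σ hσ _ _ => by
      obtain ⟨p, hp⟩ := exec_copy (X := fun h => F h x) hσ (some t) fun a : O => [a]
      rw [List.flatMap_singleton'] at hp
      exact ⟨σ.goto (some t) p, hp, Store.goto_pos_ne _ (by simp) _, trivial⟩)
    (fun r => r.flatMap fun t => g t x) rfl (fun _ _ => rfl) (f x)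
    (s1.bdd (Store.init_bdd _)) (by simpa using Reads.start (f x)) trivial
  exact ⟨_, s1.seq_nil s2⟩

lemma LS.flatMap {T O : Type} [Finite T] [Finite O] {f : List Bool → List T} (hf : LS f)
    (g : T → List O) : LS (fun x => (f x).flatMap g) :=
  hf.subst fun t => LS.const (g t)

lemma LS.append {O : Type} [Finite O] {f g : List Bool → List O} (hf : LS f) (hg : LS g) :
    LS (fun x => f x ++ g x) := by
  have := (LS.const [false, true]).subst (g := fun b => bif b then g else f)
    (by rintro (_ | _); exacts [hf, hg])
  simpa using this

/-- The length of a word computable in logarithmic space is counted in binary while the word is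
scanned. -/
theorem LS.length_bits {T : Type} [Finite T] {f : List Bool → List T} (hf : LS f) :
    LS (fun x => (f x).length.bits) := by
  classical
  obtain ⟨C, hC⟩ := hf.length_le
  let Γ : Bool → Type := fun _ => Bool
  refine LS.ofProg (H := Unit) (I := fun _ => T) (ι := Bool) (Γ := Γ) (F := fun _ => f)
    (fun _ => hf)
    (.seq (.move () .right) <| .seq (.scan () fun _ => .inc true false (fun b => b) (fun b => b) true)
      (.drain true false (fun _ => true) (fun b => b) fun b => [b])) (C + 2) fun x => ?_
  set S := (C + 2) * (Nat.log 2 x.length + 1) with hS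
  have hbits : ∀ n ≤ (f x).length, n.bits.length < S := by
    intro n hn
    have h1 : n < 2 ^ (C * (Nat.log 2 x.length + 1) + 1) := by
      have := hC x
      have h2 : 0 < 2 ^ (C * (Nat.log 2 x.length + 1)) := by positivity
      rw [pow_succ]; omega
    have := bits_length_le h1
    have : S = C * (Nat.log 2 x.length + 1) + 2 * (Nat.log 2 x.length + 1) := by rw [hS]; ring
    omega
  have s1 := exec_move_first (X := fun _ : Unit => f x) (O := Bool) (S := S)
    (Store.init_bdd (H := Unit) (Γ := Γ) _) (h := ()) rfl
  obtain ⟨σ₁, s2, h1, h2⟩ := exec_scan (X := fun _ : Unit => f x) (S := S) (h := ())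
    (p := fun _ => (.inc true false (fun b => b) (fun b => b) true :
      SProg (fun _ : Unit => T) Γ Bool))
    (Inv := fun r σ => σ.stk true = ((f x).length - r.length).bits ∧ σ.stk false = [])
    (w := fun _ _ => [])
    (fun t r σ hσ hi hr => by
      have hlen : r.length + 1 ≤ (f x).length := by
        obtain ⟨u, hu, -⟩ := hr
        rw [hu]; simp
      have := exec_inc (X := fun _ : Unit => f x) (I := fun _ : Unit => T) (O := Bool)
        (c := true) (u := false) (e := fun b => b) (d := fun b => b) (m := true) (by simp)
        (fun _ => rfl) hσ (n := (f x).length - (r.length + 1))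
        (by rw [hi.1]; exact (List.map_id _).symm) hi.2 (hbits _ (by omega))
      refine ⟨_, this, rfl, ?_, ?_⟩
      · rw [Store.goto_stk, Store.set_stk_self]
        rw [show (f x).length - (r.length + 1) + 1 = (f x).length - r.length by omega]
        exact List.map_id _
      · rw [Store.goto_stk, Store.set_stk_ne _ (by simp)]; exact hi.2)
    (fun _ => []) rfl (fun _ _ => rfl) (f x) (s1.bdd (Store.init_bdd _))
    (by simpa using Reads.start (f x)) (by simp)
  have b2 := s2.bdd (s1.bdd (Store.init_bdd _))
  have s3 := exec_drain (X := fun _ : Unit => f x) (I := fun _ : Unit => T) (O := Bool)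
    (c := true) (u := false) (p := fun _ => true) (f := fun b => b) (w := fun b => [b])
    (by simp) (f x).length.bits [] b2 (by rw [h1]; simp) (by simp) (by simp)
    (by rw [h2]; simpa using (hbits _ le_rfl).le)
  rw [List.flatMap_singleton'] at s3
  exact ⟨_, s1.seq_nil (s2.seq_nil s3)⟩

/-- A logarithmic-space computation may be applied to a word computable in logarithmic space. -/
theorem LS.comp_logspaceComputable {α O : Type} [Finite O] {enc : α → List Bool}
    {f : α → List O} (hf : LogspaceComputable enc f) {a : List Bool → α}
    (ha : LS (fun x => enc (a x))) : LS (fun x => f (a x)) := by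
  obtain ⟨C, hC⟩ := ha.length_le
  obtain ⟨M, K, hM⟩ := hf
  refine LS.query (H := Unit) (I := fun _ => Bool) (F := fun _ x => enc (a x)) (fun _ => ha)
    M.toSM (2 * K * (C + 1)) fun x => ?_
  refine (M.toSM_computes (hM (a x)).2 (hM (a x)).1).mono ?_
  have h1 : Nat.log 2 (enc (a x)).length ≤ C * (Nat.log 2 x.length + 1) := by
    calc _ ≤ Nat.log 2 (2 ^ (C * (Nat.log 2 x.length + 1))) := Nat.log_mono_right (hC x)
      _ = _ := Nat.log_pow (by norm_num) _
  calc 2 * (K * (Nat.log 2 (enc (a x)).length + 1))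
      ≤ 2 * (K * (C * (Nat.log 2 x.length + 1) + (Nat.log 2 x.length + 1))) := by gcongr; omega
    _ = _ := by ring

/-! ### Words of tokens -/

/-- A token: a name with numerical arguments. -/
abbrev Tok (K : Type) : Type := K × List ℕ

/-- The unary code of a number, in the style of `Circuit.encode`. -/
def encNat {K : Type} (i : ℕ) : List (K ⊕ Bool) := List.replicate i (.inr true) ++ [.inr false]

/-- The code of a token. -/
def encTok {K : Type} (t : Tok K) : List (K ⊕ Bool) := .inl t.1 :: t.2.flatMap encNat

/-- The code of a word of tokens. -/
def encToks {K : Type} (w : List (Tok K)) : List (K ⊕ Bool) := w.flatMap encTok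

@[simp] lemma encToks_nil {K : Type} : encToks ([] : List (Tok K)) = [] := rfl
@[simp] lemma encToks_cons {K : Type} (t : Tok K) (w : List (Tok K)) :
    encToks (t :: w) = encTok t ++ encToks w := rfl
@[simp] lemma encToks_append {K : Type} (w w' : List (Tok K)) :
    encToks (w ++ w') = encToks w ++ encToks w' := by simp [encToks]

/-- The letter belongs to the code of an argument. -/
def isTick {K : Type} : Cell (K ⊕ Bool) → Bool
  | .sym (.inr _) => true
  | _ => false

lemma isInr_of_mem_flatMap_encNat {K : Type} {a : K ⊕ Bool} {l : List ℕ}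
    (h : a ∈ l.flatMap encNat) : ∃ b, a = .inr b := by
  simp only [List.mem_flatMap, encNat, List.mem_append, List.mem_replicate, List.mem_singleton] at h
  obtain ⟨_, _, ⟨_, rfl⟩ | rfl⟩ := h
  · exact ⟨_, rfl⟩
  · exact ⟨_, rfl⟩

/-! ### Reversal -/

namespace BlockReverse

variable {K K' : Type} (φ : K → K')

/-- Programs with one head and no stacks. -/
abbrev RProg (K K' : Type) :=
  SProg (fun _ : Unit => K ⊕ Bool) (fun _ : Fin 0 => Unit) (K' ⊕ Bool)

/-- The argument letter in the cell, if there is one. -/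
def tick : Cell (K ⊕ Bool) → Option (K' ⊕ Bool)
  | .sym (.inr b) => some (.inr b)
  | _ => none

/-- The cell is not the left end of the tape. -/
def notLeft : Cell (K ⊕ Bool) → Bool
  | .left => false
  | _ => true

/-- Copy an argument letter. -/
def copyTick : RProg K K' := .emit fun v => tick (v.sym ())

/-- Copy the block that starts at the scanned cell, and return. -/
def copyBlock (k : K) : RProg K K' :=
  .seq (.emit fun _ => some (.inl (φ k))) <| .seq (.move () .right) <|
    .seq (.loop (fun v => isTick (v.sym ())) (.seq copyTick (.move () .right))) <|
    .seq (.move () .left) (.loop (fun v => isTick (v.sym ())) (.move () .left))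

/-- Move left, and copy the block if it starts here. -/
def body : RProg K K' :=
  .seq (.move () .left) <| .branch fun v => match v.sym () with
    | .sym (.inl k) => copyBlock φ k
    | _ => .skip

/-- Write the blocks of the tape in the opposite order. -/
def program : RProg K K' :=
  .seq (.move () .right) <| .seq (.scan () fun _ => .skip) <|
    .loop (fun v => notLeft (v.sym ())) (body φ)

/-- The store in which the head is at `p`. -/
def at' (p : ℕ) : Store Unit (fun _ : Fin 0 => Unit) := ⟨fun _ => p, fun i => i.elim0⟩

variable {S : ℕ} {X : List (K ⊕ Bool)}

lemma bdd (σ : Store Unit (fun _ : Fin 0 => Unit)) : σ.Bdd S := fun i => i.elim0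

lemma goto_eq (σ : Store Unit (fun _ : Fin 0 => Unit)) (p : ℕ) : σ.goto () p = at' p :=
  Store.ext (funext fun _ => by simp [at']) (funext fun i => i.elim0)

lemma exec_left (p : ℕ) :
    Exec (fun _ => X) S (.move () .left : RProg K K') (at' (p + 1)) [] (at' p) := by
  have := exec_move (X := fun _ : Unit => X) (O := K' ⊕ Bool) (S := S)
    (bdd (at' (p + 1))) () .left
  rwa [goto_eq] at this

lemma exec_right {p a r} (h : Reads X p (a :: r)) :
    Exec (fun _ => X) S (.move () .right : RProg K K') (at' p) [] (at' (p + 1)) := by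
  have := exec_move_right (X := fun _ : Unit => X) (O := K' ⊕ Bool) (S := S) (h := ())
    (bdd (at' p)) (a := a) (r := r) h
  rwa [goto_eq] at this

lemma exec_copyTicks (b r : List (K ⊕ Bool)) (hb : ∀ a ∈ b, ∃ c, a = .inr c)
    (hr : ∀ a ∈ r.head?, ∃ k, a = .inl k) {p : ℕ} (h : Reads X p (b ++ r)) :
    Exec (fun _ => X) S
      (.loop (fun v => isTick (v.sym ())) (.seq copyTick (.move () .right)) : RProg K K')
      (at' p) (b.filterMap fun a => a.elim (fun _ => none) fun c => some (.inr c))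
      (at' (p + b.length)) := by
  induction b generalizing p with
  | nil =>
    refine .exit ?_
    cases r with
    | nil =>
      have : cellAt X p = .right := h.cellAt_nil
      simp [Store.view, at', this, isTick]
    | cons a r =>
      obtain ⟨k, rfl⟩ := hr a rfl
      have : cellAt X p = .sym (.inl k) := h.cellAt_cons
      simp [Store.view, at', this, isTick]
  | cons a b ih =>
    obtain ⟨c, rfl⟩ := hb a (by simp)
    have hc : cellAt X p = .sym (.inr c) := h.cellAt_cons
    have s2 := ih (fun a ha => hb a (by simp [ha])) h.tail
    have s1 := exec_emit (X := fun _ : Unit => X) (S := S) (bdd (at' p))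
      (fun v : View (fun _ : Unit => K ⊕ Bool) (fun _ : Fin 0 => Unit) =>
        (tick (v.sym ()) : Option (K' ⊕ Bool)))
    have hv : ((at' p).view fun _ : Unit => X).sym () = .sym (.inr c) := hc
    rw [hv] at s1
    have := Exec.loop (b := fun v => isTick (v.sym ())) (by rw [hv]; rfl)
      (s1.seq (exec_right h)) s2
    rw [show p + 1 + b.length = p + (Sum.inr c :: b : List (K ⊕ Bool)).length by
      rw [List.length_cons]; omega] at this
    exact this

lemma exec_backTicks (u : List (K ⊕ Bool)) (k : K) (b r : List (K ⊕ Bool))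
    (hb : ∀ a ∈ b, ∃ c, a = .inr c) (h : X = u ++ .inl k :: (b ++ r)) :
    Exec (fun _ => X) S (.loop (fun v => isTick (v.sym ())) (.move () .left) : RProg K K')
      (at' (u.length + 1 + b.length)) [] (at' (u.length + 1)) := by
  induction b using List.reverseRecOn generalizing r with
  | nil =>
    refine .exit ?_
    have h1 : Reads X (u.length + 1) (.inl k :: r) := ⟨u, by simpa using h, rfl⟩
    have : cellAt X (u.length + 1) = .sym (.inl k) := h1.cellAt_cons
    simp [Store.view, at', this, isTick]
  | append_singleton b a ih =>
    obtain ⟨c, rfl⟩ := hb a (by simp)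
    have h1 : Reads X (u.length + 1 + b.length + 1) (.inr c :: r) :=
      ⟨u ++ .inl k :: b, by rw [h]; simp, by simp; omega⟩
    have h2 : cellAt X (u.length + 1 + b.length + 1) = .sym (.inr c) := h1.cellAt_cons
    have := ih (.inr c :: r) (fun a ha => hb a (by simp [ha])) (by rw [h]; simp)
    rw [List.length_append, List.length_singleton, ← add_assoc]
    exact Exec.loop_nil (by simp [Store.view, at', h2, isTick]) (exec_left _) this

lemma filterMap_ticks (b : List (K ⊕ Bool)) (l : List ℕ) (hb : b = l.flatMap encNat) :
    (b.filterMap fun a => a.elim (fun _ => none) fun c => some (.inr c : K' ⊕ Bool)) =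
      l.flatMap encNat := by
  subst hb
  rw [List.filterMap_flatMap]
  congr 1
  funext i
  have : ∀ i : ℕ, ((List.replicate i (.inr true) : List (K ⊕ Bool)).filterMap fun a =>
      a.elim (fun _ => none) fun c => some (.inr c : K' ⊕ Bool)) = List.replicate i (.inr true) := by
    intro i
    induction i with
    | zero => rfl
    | succ i ih => simp [List.replicate_succ, ih]
  rw [encNat, List.filterMap_append, this]
  rfl

lemma exec_copyBlock (u : List (K ⊕ Bool)) (t : Tok K) (w : List (Tok K))
    (h : X = u ++ encTok t ++ encToks w) :
    Exec (fun _ => X) S (copyBlock φ t.1) (at' (u.length + 1)) (encTok (φ t.1, t.2))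
      (at' (u.length + 1)) := by
  set b : List (K ⊕ Bool) := t.2.flatMap encNat with hbdef
  have hb : ∀ a ∈ b, ∃ c, a = .inr c := fun a ha => isInr_of_mem_flatMap_encNat ha
  have hX : X = u ++ .inl t.1 :: (b ++ encToks w) := by
    rw [h, encTok]; simp [hbdef]
  have r1 : Reads X (u.length + 1) (.inl t.1 :: (b ++ encToks w)) := ⟨u, hX, rfl⟩
  have s1 := exec_emit (X := fun _ : Unit => X) (S := S) (I := fun _ : Unit => K ⊕ Bool)
    (bdd (at' (u.length + 1))) (fun _ => some (.inl (φ t.1) : K' ⊕ Bool))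
  have s3 := exec_copyTicks (K' := K') (S := S) b (encToks w) hb
    (by cases w with
      | nil => simp
      | cons t' w => simp [encTok]) r1.tail
  rw [filterMap_ticks b t.2 rfl] at s3
  have s4 := exec_left (K' := K') (S := S) (X := X) (u.length + 1 + b.length)
  rw [show u.length + 1 + b.length + 1 = u.length + 1 + 1 + b.length by omega] at s4
  have s5 := exec_backTicks (K' := K') (S := S) u t.1 b (encToks w) hb hX
  have := s1.seq ((exec_right r1).seq_nil (s3.seq (s4.seq_nil s5)))
  rw [copyBlock]
  simpa [encTok] using this

/-- With the head to the right of `encToks w`, the blocks of `w` are written from the last to the first. -/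
lemma exec_blocks (w w' : List (Tok K)) (h : X = encToks w ++ encToks w') :
    Exec (fun _ => X) S
      (.loop (fun v => notLeft (v.sym ())) (body φ) : RProg K K')
      (at' ((encToks w).length + 1))
      (encToks (w.map fun t => (φ t.1, t.2)).reverse) (at' 0) := by
  induction w using List.reverseRecOn generalizing w' with
  | nil =>
    have hv : ((at' 0).view fun _ : Unit => X).sym () = .left := rfl
    refine Exec.loop_nil (σ₂ := at' 0) ?_ ((exec_left 0).seq_nil (.branch ?_)) (.exit ?_)
    · simp only [Store.view, at', encToks_nil, List.length_nil, zero_add, cellAt]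
      cases X[0]? <;> rfl
    · rw [hv]; exact exec_skip (bdd _)
    · rw [hv]; rfl
  | append_singleton w t ih =>
    have hih := ih (t :: w') (by rw [h]; simp)
    have hcopy := exec_copyBlock φ (S := S) (X := X) (encToks w) t w' (by rw [h]; simp)
    have hX : X = encToks w ++ .inl t.1 :: (t.2.flatMap encNat ++ encToks w') := by
      rw [h]; simp [encTok]
    -- the head walks over the letters of the arguments without effect
    have key : ∀ (b r : List (K ⊕ Bool)), (∀ a ∈ b, ∃ c, a = .inr c) →
        X = encToks w ++ .inl t.1 :: (b ++ r) →
        Exec (fun _ => X) S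
          (.loop (fun v => notLeft (v.sym ())) (body φ) : RProg K K')
          (at' ((encToks w).length + 1 + b.length + 1))
          (encTok (φ t.1, t.2) ++ encToks (w.map fun t => (φ t.1, t.2)).reverse) (at' 0) := by
      intro b
      have notleft : ∀ p, notLeft (((at' (p + 1)).view fun _ : Unit => X).sym ()) = true := by
        intro p
        simp only [Store.view, at', cellAt]
        cases X[p]? <;> rfl
      induction b using List.reverseRecOn with
      | nil =>
        intro r _ hr
        refine Exec.loop (notleft _) ((exec_left _).seq_nil (.branch ?_)) hih
        have h1 : Reads X ((encToks w).length + 1) (.inl t.1 :: r) :=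
          ⟨encToks w, by simpa using hr, rfl⟩
        have hv : ((at' ((encToks w).length + 1)).view fun _ : Unit => X).sym () =
          .sym (.inl t.1) := h1.cellAt_cons
        simp only [List.length_nil, add_zero]
        rw [hv]
        exact hcopy
      | append_singleton b a ihb =>
        intro r hb hr
        obtain ⟨c, rfl⟩ := hb a (by simp)
        have h1 : Reads X ((encToks w).length + 1 + b.length + 1) (.inr c :: r) :=
          ⟨encToks w ++ .inl t.1 :: b, by rw [hr]; simp, by simp; omega⟩
        have hv : ((at' ((encToks w).length + 1 + b.length + 1)).view fun _ : Unit => X).sym () =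
          .sym (.inr c) := h1.cellAt_cons
        have s2 := ihb (.inr c :: r) (fun a ha => hb a (by simp [ha])) (by rw [hr]; simp)
        rw [List.length_append, List.length_singleton, ← add_assoc]
        refine Exec.loop_nil (notleft _) ((exec_left _).seq_nil (.branch ?_)) s2
        rw [hv]
        exact exec_skip (bdd _)
    have := key _ _ (fun a ha => isInr_of_mem_flatMap_encNat ha) hX
    simp only [List.map_append, List.map_cons, List.map_nil, List.reverse_append,
      List.reverse_cons, List.reverse_nil, List.nil_append, List.singleton_append, encToks_cons]
    convert this using 2
    simp [encTok]; omega

end BlockReverse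

/-- Words of tokens may be written backward: the head moves left over the tape, and whenever it meets
the start of a block, it makes an excursion to the right and copies the block. -/
theorem LS.blockReverse {K K' : Type} [Finite K] [Finite K'] (φ : K → K')
    {w : List Bool → List (Tok K)} (hw : LS (fun x => encToks (w x))) :
    LS (fun x => encToks ((w x).map fun t => (φ t.1, t.2)).reverse) := by
  refine LS.ofProg (H := Unit) (I := fun _ => K ⊕ Bool) (ι := Fin 0) (Γ := fun _ => Unit)
    (F := fun _ x => encToks (w x)) (fun _ => hw) (BlockReverse.program φ) 0 fun x => ?_
  set S := 0 * (Nat.log 2 x.length + 1)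
  have s1 := exec_move_first (X := fun _ : Unit => encToks (w x)) (O := K' ⊕ Bool) (S := S)
    (BlockReverse.bdd (Store.init Unit (fun _ : Fin 0 => Unit))) (h := ()) rfl
  obtain ⟨σ₁, s2, h1⟩ := exec_scan (X := fun _ : Unit => encToks (w x)) (S := S) (h := ())
    (p := fun _ => (.skip : BlockReverse.RProg K K')) (w := fun _ _ => [])
    (Inv := fun r σ => Reads (encToks (w x)) (σ.pos ()) r)
    (fun t r σ hσ hi hr => ⟨σ, exec_skip hσ, rfl, by simpa using hi.tail⟩)
    (fun _ => []) rfl (fun _ _ => rfl) (encToks (w x)) (s1.bdd (BlockReverse.bdd _))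
    (by simpa using Reads.start _) (by simpa using Reads.start (encToks (w x)))
  obtain ⟨u, hu, hp⟩ := h1
  have hσ₁ : σ₁ = BlockReverse.at' ((encToks (w x)).length + 1) := by
    rw [← BlockReverse.goto_eq σ₁]
    refine (Store.goto_eq_self _ _ ?_).symm
    rw [hp]
    conv_rhs => rw [hu]
    simp
  rw [hσ₁] at s2
  exact ⟨_, s1.seq_nil (s2.seq_nil
    (BlockReverse.exec_blocks φ (w x) [] (by simp)))⟩

/-! ### Writing tokens with unary arguments -/

lemma Exec.congr_out {H ι O : Type} {I : H → Type} {Γ : ι → Type} {X : ∀ h, List (I h)} {S : ℕ}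
    {p : SProg I Γ O} {σ σ' : Store H Γ} {w w' : List O} (h : Exec X S p σ w σ') (hw : w = w') :
    Exec X S p σ w' σ' := hw ▸ h

section Height

variable {H ι K : Type} {I : H → Type} {Γ : ι → Type} {X : ∀ h, List (I h)} {S : ℕ}

/-- For each element of the stack `c` write `w`, using the stack `u` of the same kind as auxiliary
memory. -/
noncomputable def Prog.height (c u : ι) (f : Γ c → Γ u) (g : Γ u → Γ c) (w : List (K ⊕ Bool)) :
    SProg I Γ (K ⊕ Bool) :=
  .seq (.drain c u (fun _ => true) f fun _ => w) (.drain u c (fun _ => true) g fun _ => [])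

lemma exec_height [DecidableEq ι] {c u : ι} (hcu : c ≠ u) {f : Γ c → Γ u} {g : Γ u → Γ c}
    (hgf : ∀ a, g (f a) = a) (w : List (K ⊕ Bool)) {σ : Store H Γ} (hσ : σ.Bdd S)
    (hu : σ.stk u = []) :
    Exec X S (Prog.height c u f g w : SProg I Γ (K ⊕ Bool)) σ
      (List.replicate (σ.stk c).length w).flatten σ := by
  have s1 := exec_drain (X := X) (I := I) hcu (p := fun _ => true) (f := f) (w := fun _ => w)
    (σ.stk c) [] hσ (by simp) (by simp) (by simp) (by rw [hu]; simpa using hσ c)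
  have b1 := s1.bdd hσ
  rw [hu, List.append_nil] at s1 b1
  have s2 := exec_drain (X := X) (I := I) (O := K ⊕ Bool) hcu.symm (p := fun _ => true) (f := g)
    (w := fun _ => [])
    ((σ.stk c).map f).reverse [] b1 (by simp) (by simp) (by simp)
    (by rw [Store.set_stk_ne _ hcu]; simpa using hσ c)
  have hfin : ((((σ.set c []).set u ((σ.stk c).map f).reverse).set u []).set c
      ((((σ.stk c).map f).reverse.map g).reverse ++
        ((σ.set c []).set u ((σ.stk c).map f).reverse).stk c)) = σ := by
    rw [Store.set_set_set' hcu, Store.set_stk_ne _ hcu, Store.set_stk_self]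
    rw [List.append_nil, List.map_reverse, List.reverse_reverse, List.map_map,
      show g ∘ f = id from funext hgf, List.map_id, Store.set_self, Store.set_eq_self _ _ hu]
  rw [hfin] at s2
  have := s1.seq s2
  have h2 : ∀ l : List (Γ u), l.flatMap (fun _ => ([] : List (K ⊕ Bool))) = [] := fun l => by simp
  rw [h2, List.append_nil, List.flatMap_def, List.map_const'] at this
  exact this

/-- Write the token `k` with the height of the stack `c` as its argument. -/
noncomputable def Prog.tokAt (c u : ι) (f : Γ c → Γ u) (g : Γ u → Γ c) (k : K) :
    SProg I Γ (K ⊕ Bool) :=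
  .seq (.emits [.inl k]) <| .seq (.height c u f g [.inr true]) (.emits [.inr false])

lemma exec_tokAt [DecidableEq ι] {c u : ι} (hcu : c ≠ u) {f : Γ c → Γ u} {g : Γ u → Γ c}
    (hgf : ∀ a, g (f a) = a) (k : K) {σ : Store H Γ} (hσ : σ.Bdd S) (hu : σ.stk u = []) {n : ℕ}
    (hn : (σ.stk c).length = n) :
    Exec X S (Prog.tokAt c u f g k : SProg I Γ (K ⊕ Bool)) σ (encTok (k, [n])) σ := by
  have := (exec_emits (X := X) (I := I) hσ [(.inl k : K ⊕ Bool)]).seq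
    ((exec_height (X := X) (I := I) hcu hgf [(.inr true : K ⊕ Bool)] hσ hu).seq
      (exec_emits (X := X) (I := I) hσ [(.inr false : K ⊕ Bool)]))
  rw [hn] at this
  rw [show encTok (k, [n]) = [.inl k] ++ ((List.replicate n [.inr true]).flatten ++ [.inr false]) by
    simp [encTok, encNat, List.flatten_replicate_singleton]]
  exact this

/-- Push the elements of a list. -/
def Prog.pushes [DecidableEq ι] {O : Type} (i : ι) (l : List (Γ i)) : SProg I Γ O :=
  l.foldr (fun a p => .seq p (.op i (.push a))) .skip

lemma exec_pushes [DecidableEq ι] {O : Type} {i : ι} (l : List (Γ i)) {σ : Store H Γ}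
    (hσ : σ.Bdd S) (hS : l.length + (σ.stk i).length ≤ S) :
    Exec X S (Prog.pushes i l : SProg I Γ O) σ [] (σ.set i (l ++ σ.stk i)) := by
  induction l with
  | nil => rw [Store.set_eq_self _ _ (by simp)]; exact exec_skip hσ
  | cons a l ih =>
    have s1 := ih (by simp at hS; omega)
    have s2 := exec_push (X := X) (O := O) (I := I) (s1.bdd hσ) (i := i) (a := a)
      (by simp at hS ⊢; omega)
    rw [Store.set_set, Store.set_stk_self] at s2
    exact s1.seq_nil s2

end Height

/-! ### The words that describe the circuits -/

/-- The names of the building blocks of the amplified circuit over the gates `Γ`; the Boolean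
argument `o` of a name tells whether the block is performed backward. -/
inductive Name (Γ : Type) where
  /-- A gate of the given circuit. -/
  | gate (g : Γ) (o : Bool)
  /-- A step of the preparation of a biased coin, depending on two bits. -/
  | chain (b c : Bool) (o : Bool)
  /-- The combination of the given circuit with the biased coin. -/
  | mux (o : Bool)
  /-- The basic circuit. -/
  | leaf (o : Bool)
  /-- The acceptance qubit of a level is copied. -/
  | copy
  /-- The first rung of the ladder that tests whether all qubits of a level are zero. -/
  | rung
  /-- The other rungs. -/
  | up (o : Bool)
  /-- The outcome of the test is recorded. -/
  | record
  /-- The acceptance qubit of the next level is computed. -/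
  | sum (o : Bool)
  /-- The acceptance qubit of the last level is copied to the first qubit. -/
  | fin

instance {Γ : Type} [Finite Γ] : Finite (Name Γ) := by
  refine Finite.of_surjective
    (fun s : (Γ × Bool) ⊕ (Bool × Bool × Bool) ⊕ Bool × Fin 8 => (match s with
      | .inl (g, o) => .gate g o
      | .inr (.inl (b, c, o)) => .chain b c o
      | .inr (.inr (o, 0)) => .mux o
      | .inr (.inr (o, 1)) => .leaf o
      | .inr (.inr (o, 2)) => .up o
      | .inr (.inr (_, 3)) => .copy
      | .inr (.inr (_, 4)) => .rung
      | .inr (.inr (_, 5)) => .record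
      | .inr (.inr (o, 6)) => .sum o
      | .inr (.inr (_, 7)) => .fin : Name Γ)) fun j => ?_
  cases j with
  | gate g o => exact ⟨.inl (g, o), rfl⟩
  | chain b c o => exact ⟨.inr (.inl (b, c, o)), rfl⟩
  | mux o => exact ⟨.inr (.inr (o, 0)), rfl⟩
  | leaf o => exact ⟨.inr (.inr (o, 1)), rfl⟩
  | up o => exact ⟨.inr (.inr (o, 2)), rfl⟩
  | copy => exact ⟨.inr (.inr (false, 3)), rfl⟩
  | rung => exact ⟨.inr (.inr (false, 4)), rfl⟩
  | record => exact ⟨.inr (.inr (false, 5)), rfl⟩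
  | sum o => exact ⟨.inr (.inr (o, 6)), rfl⟩
  | fin => exact ⟨.inr (.inr (false, 7)), rfl⟩

/-- The word that records whether the first `h` cells are zero. -/
def zeroTest (Γ : Type) (h : ℕ) : List (Tok (Name Γ)) :=
  (.rung, []) :: (List.range h).map (fun i => (.up false, [i])) ++
    (.record, [h]) :: (List.range h).reverse.map (fun i => (.up true, [i])) ++ [(.rung, [])]

/-- The word for the circuit of level `j`, or, if the Boolean argument is `true`, for its inverse, when
the basic circuit occupies `h` cells. -/
def treeWord (Γ : Type) (h : ℕ) : Bool → ℕ → List (Tok (Name Γ))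
  | o, 0 => [(.leaf o, [])]
  | false, j + 1 => treeWord Γ h false j ++ (.copy, [h + j]) :: treeWord Γ h true j ++
      zeroTest Γ (h + j) ++ treeWord Γ h false j ++ [(.sum false, [h + j])]
  | true, j + 1 => (.sum true, [h + j]) :: treeWord Γ h true j ++ zeroTest Γ (h + j) ++
      treeWord Γ h false j ++ (.copy, [h + j]) :: treeWord Γ h true j

/-- The word for the preparation of the biased coin, its bias being given by two binary numbers. -/
def chainWord (Γ : Type) (n : ℕ) (b c : List Bool) : List (Tok (Name Γ)) :=
  (List.range n).map fun i => (.chain (b.getD i false) (c.getD i false) false, [i])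

namespace TreeProg

/-- The tasks of the machine that writes the circuits recursively; they refer to the current
level. -/
inductive Task where
  /-- Write the circuit, or its inverse. -/
  | tree (o : Bool)
  /-- Go to the next lower level. -/
  | lower
  /-- Go to the next higher level. -/
  | raise
  /-- Write the token `Name.copy`. -/
  | copy
  /-- Write the test for zero. -/
  | zero
  /-- Write the token `Name.sum`. -/
  | sum (o : Bool)

instance : Finite Task := by
  refine Finite.of_surjective
    (fun s : Fin 8 => (match s with
      | 0 => .tree false
      | 1 => .tree true
      | 2 => .lower
      | 3 => .raise
      | 4 => .copy
      | 5 => .zero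
      | 6 => .sum false
      | 7 => .sum true : Task)) fun j => ?_
  cases j with
  | tree o => cases o; exacts [⟨0, rfl⟩, ⟨1, rfl⟩]
  | lower => exact ⟨2, rfl⟩
  | raise => exact ⟨3, rfl⟩
  | copy => exact ⟨4, rfl⟩
  | zero => exact ⟨5, rfl⟩
  | sum o => cases o; exacts [⟨6, rfl⟩, ⟨7, rfl⟩]

/-- The stacks: tasks, the current level, and two auxiliary ones.  On the stack for the level `j` there
are `j` entries `true` above `h` entries `false`, where `h` is the number of cells of the basic
circuit, so that the height `h + j` is the argument of the tokens of the next level. -/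
inductive Idx where
  | task
  | lev
  | aux
  | tmp
  deriving DecidableEq

instance : Finite Idx := by
  refine Finite.of_surjective
    (fun s : Fin 4 => (match s with
      | 0 => .task
      | 1 => .lev
      | 2 => .aux
      | 3 => .tmp : Idx)) fun j => ?_
  cases j
  exacts [⟨0, rfl⟩, ⟨1, rfl⟩, ⟨2, rfl⟩, ⟨3, rfl⟩]

/-- The stack alphabets. -/
abbrev Alph : Idx → Type
  | .task => Task
  | _ => Bool

/-- Programs with one head. -/
abbrev TProg (Γ : Type) := SProg (fun _ : Unit => Bool) Alph (Name Γ ⊕ Bool)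

variable {Γ : Type}

/-- Write a token with the height of the level stack as its argument. -/
noncomputable def tokLev (k : Name Γ) : TProg Γ := .tokAt .lev .tmp (fun b => b) (fun b => b) k
/-- Write a token with the height of the auxiliary stack as its argument. -/
noncomputable def tokAux (k : Name Γ) : TProg Γ := .tokAt .aux .tmp (fun b => b) (fun b => b) k

/-- Write the test for zero. -/
noncomputable def zero : TProg Γ :=
  .seq (.emits [.inl .rung]) <|
  .seq (.loop (fun v => (v.top .lev).isSome) <|
    .seq (tokAux (.up false)) <| .act fun v => Prog.transfer .lev .aux ((v.top .lev).getD false)) <|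
  .seq (tokAux .record) <|
  .seq (.loop (fun v => (v.top .aux).isSome) <|
    .seq (.act fun v => Prog.transfer .aux .lev ((v.top .aux).getD false)) (tokAux (.up true)))
  (.emits [.inl .rung])

/-- The tasks into which the task of writing a circuit of positive level is divided. -/
def children : Bool → List Task
  | false => [.lower, .tree false, .copy, .tree true, .zero, .tree false, .sum false, .raise]
  | true => [.lower, .sum true, .tree true, .zero, .tree false, .copy, .tree true, .raise]

/-- Carry out a task. -/
noncomputable def perform : Task → TProg Γ
  | .tree o => .ite (fun v => (v.top .lev).getD false) (.pushes .task (children o))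
      (.emits [.inl (.leaf o)])
  | .lower => .op .lev .pop
  | .raise => .op .lev (.push true)
  | .copy => tokLev .copy
  | .zero => zero
  | .sum o => tokLev (.sum o)

/-- Carry out the tasks on the stack. -/
noncomputable def main : TProg Γ := .loop (fun v => (v.top .task).isSome) <| .branch fun v =>
  match v.top .task with
  | some t => .seq (.op .task .pop) (perform t)
  | none => .skip

/-- The program; the tape holds the initial content of the level stack. -/
noncomputable def program : TProg Γ :=
  .seq (.move () .right) <|
  .seq (.scan () fun b : Bool => .op .lev (.push b)) <|
  .seq (.op .task (.push (.tree false))) <| .seq main (tokLev .fin)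

variable {X : List Bool} {S : ℕ}

lemma exec_tokLev (k : Name Γ) {σ : Store Unit Alph} (hσ : σ.Bdd S) (hu : σ.stk .tmp = []) {n : ℕ}
    (hn : (σ.stk .lev).length = n) :
    Exec (fun _ => X) S (tokLev k) σ (encTok (k, [n])) σ :=
  exec_tokAt (X := fun _ : Unit => X) (by simp) (fun _ => rfl) k hσ hu hn

lemma exec_tokAux (k : Name Γ) {σ : Store Unit Alph} (hσ : σ.Bdd S) (hu : σ.stk .tmp = []) {n : ℕ}
    (hn : (σ.stk .aux).length = n) :
    Exec (fun _ => X) S (tokAux k) σ (encTok (k, [n])) σ :=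
  exec_tokAt (X := fun _ : Unit => X) (by simp) (fun _ => rfl) k hσ hu hn

lemma exec_transfer {c u : Idx} (hcu : c ≠ u) {σ : Store Unit Alph} (hσ : σ.Bdd S)
    (f : View (fun _ : Unit => Bool) Alph → Alph u) {a : Alph u}
    (hf : f (σ.view fun _ => X) = a) (hS : (σ.stk u).length < S) :
    Exec (fun _ => X) S (.act fun v => Prog.transfer c u (f v) : TProg Γ) σ []
      ((σ.set c (σ.stk c).tail).set u (a :: σ.stk u)) := by
  have key : (Prog.transfer c u (f (σ.view fun _ => X)) : Eff Unit Alph (Name Γ ⊕ Bool)).app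
      (fun _ : Unit => X) σ = (σ.set c (σ.stk c).tail).set u (a :: σ.stk u) := by
    refine Store.ext rfl (funext fun j => ?_)
    by_cases hj : j = u
    · subst hj; simp [Eff.app, Prog.transfer, StackOp.apply, hf]
    · rw [Store.set_stk_ne _ hj]
      by_cases hj' : j = c
      · subst hj'; simp [Eff.app, Prog.transfer, hj, StackOp.apply]
      · rw [Store.set_stk_ne _ hj']; simp [Eff.app, Prog.transfer, hj, hj', StackOp.apply]
  have hb : ((σ.set c (σ.stk c).tail).set u (a :: σ.stk u)).Bdd S := by
    refine (hσ.set ?_).set (by simpa using hS)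
    have := hσ c
    simp; omega
  rw [← key] at hb ⊢
  exact Exec.act (X := fun _ : Unit => X)
    (f := fun v => (Prog.transfer c u (f v) : Eff Unit Alph (Name Γ ⊕ Bool))) hb

lemma exec_up (l : List Bool) {σ : Store Unit Alph} (hσ : σ.Bdd S) (hu : σ.stk .tmp = [])
    (hl : σ.stk .lev = l) (hS : l.length + (σ.stk .aux).length ≤ S) :
    Exec (fun _ => X) S (.loop (fun v => (v.top .lev).isSome) <|
      .seq (tokAux (.up false)) <| .act fun v => Prog.transfer .lev .aux ((v.top .lev).getD false) :
        TProg Γ) σ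
      (encToks ((List.range l.length).map fun i => (.up false, [(σ.stk .aux).length + i])))
      ((σ.set .lev []).set .aux (l.reverse ++ σ.stk .aux)) := by
  induction l generalizing σ with
  | nil =>
    rw [Store.set_eq_self _ _ hl, Store.set_eq_self _ _ (by simp)]
    exact .exit (by simp [Store.view, hl])
  | cons a l ih =>
    have s1 := exec_tokAux (X := X) (Γ := Γ) (.up false) hσ hu rfl
    have s2 := exec_transfer (X := X) (Γ := Γ) (c := .lev) (u := .aux) (by simp) hσ
      (fun v => (v.top .lev).getD false) (a := a) (by simp [Store.view, hl])
      (by simp at hS; omega)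
    rw [hl, List.tail_cons] at s2
    have b2 := s2.bdd hσ
    have s3 := ih b2
      (by rw [Store.set_stk_ne _ (by simp), Store.set_stk_ne _ (by simp), hu])
      (by rw [Store.set_stk_ne _ (by simp), Store.set_stk_self])
      (by simp at hS ⊢; omega)
    have hfin : (((σ.set .lev l).set .aux (a :: σ.stk .aux)).set .lev []).set .aux
        (l.reverse ++ ((σ.set .lev l).set .aux (a :: σ.stk .aux)).stk .aux) =
        (σ.set .lev []).set .aux ((a :: l).reverse ++ σ.stk .aux) := by
      rw [Store.set_set_set (by simp), Store.set_set_set (by simp), Store.set_stk_self]; simp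
    rw [hfin, Store.set_stk_self] at s3
    have := Exec.loop (b := fun v => (v.top .lev).isSome) (by simp [Store.view, hl]) (s1.seq s2) s3
    refine this.congr_out ?_
    simp only [List.length_cons, List.range_succ_eq_map, List.map_cons, encToks_cons,
      List.append_nil, add_zero, List.map_map]
    congr 2
    refine List.map_congr_left fun i _ => ?_
    simp only [Function.comp_apply, Nat.succ_eq_add_one]
    rw [add_right_comm, ← add_assoc]

lemma exec_down (l : List Bool) {σ : Store Unit Alph} (hσ : σ.Bdd S) (hu : σ.stk .tmp = [])
    (hl : σ.stk .aux = l) (hS : l.length + (σ.stk .lev).length ≤ S) :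
    Exec (fun _ => X) S (.loop (fun v => (v.top .aux).isSome) <|
      .seq (.act fun v => Prog.transfer .aux .lev ((v.top .aux).getD false)) (tokAux (.up true)) :
        TProg Γ) σ
      (encToks ((List.range l.length).reverse.map fun i => (.up true, [i])))
      ((σ.set .aux []).set .lev (l.reverse ++ σ.stk .lev)) := by
  induction l generalizing σ with
  | nil =>
    rw [Store.set_eq_self _ _ hl, Store.set_eq_self _ _ (by simp)]
    exact .exit (by simp [Store.view, hl])
  | cons a l ih =>
    have s2 := exec_transfer (X := X) (Γ := Γ) (c := .aux) (u := .lev) (by simp) hσ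
      (fun v => (v.top .aux).getD false) (a := a) (by simp [Store.view, hl])
      (by simp at hS; omega)
    rw [hl, List.tail_cons] at s2
    have b2 := s2.bdd hσ
    have s1 := exec_tokAux (X := X) (Γ := Γ) (.up true) b2
      (by rw [Store.set_stk_ne _ (by simp), Store.set_stk_ne _ (by simp), hu])
      (n := l.length) (by rw [Store.set_stk_ne _ (by simp), Store.set_stk_self])
    have s3 := ih b2
      (by rw [Store.set_stk_ne _ (by simp), Store.set_stk_ne _ (by simp), hu])
      (by rw [Store.set_stk_ne _ (by simp), Store.set_stk_self])
      (by simp at hS ⊢; omega)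
    have hfin : (((σ.set .aux l).set .lev (a :: σ.stk .lev)).set .aux []).set .lev
        (l.reverse ++ ((σ.set .aux l).set .lev (a :: σ.stk .lev)).stk .lev) =
        (σ.set .aux []).set .lev ((a :: l).reverse ++ σ.stk .lev) := by
      rw [Store.set_set_set (by simp), Store.set_set_set (by simp), Store.set_stk_self]; simp
    rw [hfin] at s3
    have := Exec.loop (b := fun v => (v.top .aux).isSome) (by simp [Store.view, hl])
      (s2.seq_nil s1) s3
    refine this.congr_out ?_
    simp only [List.length_cons, List.range_succ, List.reverse_append, List.map_append,
      encToks_append]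
    simp

lemma exec_zero {σ : Store Unit Alph} (hσ : σ.Bdd S) (hu : σ.stk .tmp = [])
    (ha : σ.stk .aux = []) {n : ℕ} (hn : (σ.stk .lev).length = n) :
    Exec (fun _ => X) S (zero : TProg Γ) σ (encToks (zeroTest Γ n)) σ := by
  have s1 := exec_emits (X := fun _ : Unit => X) (I := fun _ : Unit => Bool) hσ
    [(.inl .rung : Name Γ ⊕ Bool)]
  have s2 := exec_up (X := X) (Γ := Γ) (σ.stk .lev) hσ hu rfl (by rw [ha]; simpa using hσ .lev)
  rw [ha, List.append_nil] at s2
  have b2 := s2.bdd hσ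
  have ht : ((σ.set .lev []).set .aux (σ.stk .lev).reverse).stk .tmp = [] := by
    rw [Store.set_stk_ne _ (by simp), Store.set_stk_ne _ (by simp), hu]
  have s3 := exec_tokAux (X := X) (Γ := Γ) .record b2 ht (n := n) (by simpa using hn)
  have s4 := exec_down (X := X) (Γ := Γ) (σ.stk .lev).reverse b2 ht (by simp)
    (by rw [Store.set_stk_ne _ (by simp), Store.set_stk_self]; simpa using hσ .lev)
  have hfin : (((σ.set .lev []).set .aux (σ.stk .lev).reverse).set .aux []).set .lev
      ((σ.stk .lev).reverse.reverse ++
        ((σ.set .lev []).set .aux (σ.stk .lev).reverse).stk .lev) = σ := by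
    rw [Store.set_set_set' (by simp), Store.set_stk_ne _ (by simp), Store.set_stk_self]
    rw [List.reverse_reverse, List.append_nil, Store.set_self, Store.set_eq_self _ _ ha]
  rw [hfin] at s4
  have := s1.seq (s2.seq (s3.seq (s4.seq s1)))
  refine this.congr_out ?_
  simp [zeroTest, encTok, hn]

lemma exec_main_nil {σ : Store Unit Alph} (ht : σ.stk .task = []) :
    Exec (fun _ => X) S (main : TProg Γ) σ [] σ := .exit (by simp [Store.view, ht])

lemma exec_main_cons {σ σ₁ σ₂ : Store Unit Alph} {t : Task} {r : List Task} {w w'}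
    (hσ : σ.Bdd S) (ht : σ.stk .task = t :: r)
    (h1 : Exec (fun _ => X) S (perform t : TProg Γ) (σ.set .task r) w σ₁)
    (h2 : Exec (fun _ => X) S (main : TProg Γ) σ₁ w' σ₂) :
    Exec (fun _ => X) S (main : TProg Γ) σ (w ++ w') σ₂ := by
  refine .loop (by simp [Store.view, ht]) (.branch ?_) h2
  have hv : (σ.view fun _ : Unit => X).top .task = some t := by simp [Store.view, ht]
  rw [hv]
  have := exec_pop (X := fun _ : Unit => X) (I := fun _ : Unit => Bool) (O := Name Γ ⊕ Bool) hσ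
    (i := .task)
  rw [ht] at this
  exact this.seq_nil h1

/-- The store with the given contents of the task and level stacks. -/
def store (p : ℕ) (t : List Task) (l : List Bool) : Store Unit Alph where
  pos _ := p
  stk
    | .task => t
    | .lev => l
    | .aux => []
    | .tmp => []

lemma store_bdd {p : ℕ} {t : List Task} {l : List Bool} (ht : t.length ≤ S) (hl : l.length ≤ S) :
    (store p t l).Bdd S := by
  rintro (_ | _ | _ | _)
  exacts [ht, hl, Nat.zero_le _, Nat.zero_le _]

lemma store_set_task (p : ℕ) (t t' : List Task) (l : List Bool) :
    (store p t l).set .task t' = store p t' l := by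
  refine Store.ext rfl (funext fun j => ?_)
  cases j <;> rfl

lemma store_set_lev (p : ℕ) (t : List Task) (l l' : List Bool) :
    (store p t l).set .lev l' = store p t l' := by
  refine Store.ext rfl (funext fun j => ?_)
  cases j <;> rfl

/-- Carrying out the task of writing a circuit: the tasks that remain are not affected.  A circuit of
level `j` is divided into eight tasks of the next lower level, so that the task stack has height at
most `8 * j + 1` above the remaining tasks. -/
lemma exec_tree (h p : ℕ) (j : ℕ) (o : Bool) (r : List Task) {σ : Store Unit Alph} {w}
    (hS : r.length + 8 * j + 1 ≤ S) (hS' : h + j ≤ S)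
    (hr : Exec (fun _ => X) S (main : TProg Γ)
      (store p r (List.replicate j true ++ List.replicate h false)) w σ) :
    Exec (fun _ => X) S (main : TProg Γ)
      (store p (.tree o :: r) (List.replicate j true ++ List.replicate h false))
      (encToks (treeWord Γ h o j) ++ w) σ := by
  induction j generalizing o r w with
  | zero =>
    have hb : (store p (.tree o :: r) (List.replicate 0 true ++ List.replicate h false)).Bdd S :=
      store_bdd (by simp at hS ⊢; omega) (by simpa using hS')
    refine exec_main_cons hb rfl ?_ hr
    rw [store_set_task]
    have hb' : (store p r (List.replicate 0 true ++ List.replicate h false)).Bdd S :=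
      store_bdd (by omega) (by simpa using hS')
    have := exec_ite_false (X := fun _ : Unit => X) (I := fun _ : Unit => Bool)
      (σ := store p r (List.replicate 0 true ++ List.replicate h false))
      (b := fun v => (v.top .lev).getD false) (p := .pushes .task (children o))
      (by cases h <;> simp [Store.view, store, List.replicate_succ])
      (exec_emits hb' [(.inl (.leaf o) : Name Γ ⊕ Bool)])
    refine this.congr_out ?_
    cases o <;> simp [treeWord, encTok]
  | succ j ih =>
    set lo := List.replicate j true ++ List.replicate h false with hlo
    have hlen : lo.length = h + j := by simp [hlo]; omega
    have hhi : List.replicate (j + 1) true ++ List.replicate h false = true :: lo := by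
      simp [hlo, List.replicate_succ]
    rw [hhi] at hr ⊢
    -- the single steps at the lower level
    have tok : ∀ (k : Name Γ) (t : Task) (r' : List Task) {w},
        (perform t : TProg Γ) = tokLev k → r'.length + 1 ≤ S →
        Exec (fun _ => X) S (main : TProg Γ) (store p r' lo) w σ →
        Exec (fun _ => X) S (main : TProg Γ) (store p (t :: r') lo)
          (encTok (k, [h + j]) ++ w) σ := by
      intro k t r' w ht hr' hx
      refine exec_main_cons (store_bdd (by simpa using hr') (by omega)) rfl ?_ hx
      rw [store_set_task, ht]
      exact exec_tokLev k (store_bdd (by omega) (by omega)) rfl hlen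
    have zer : ∀ (r' : List Task) {w}, r'.length + 1 ≤ S →
        Exec (fun _ => X) S (main : TProg Γ) (store p r' lo) w σ →
        Exec (fun _ => X) S (main : TProg Γ) (store p (.zero :: r') lo)
          (encToks (zeroTest Γ (h + j)) ++ w) σ := by
      intro r' w hr' hx
      refine exec_main_cons (store_bdd (by simpa using hr') (by omega)) rfl ?_ hx
      rw [store_set_task]
      exact exec_zero (store_bdd (by omega) (by omega)) rfl rfl hlen
    have hraise : Exec (fun _ => X) S (main : TProg Γ) (store p (.raise :: r) lo) w σ := by
      refine exec_main_cons (w := []) (store_bdd (by simp; omega) (by omega)) rfl ?_ hr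
      rw [store_set_task]
      have := exec_push (X := fun _ : Unit => X) (I := fun _ : Unit => Bool) (O := Name Γ ⊕ Bool)
        (store_bdd (S := S) (p := p) (t := r) (l := lo) (by omega) (by omega)) (i := .lev) (a := true)
        (by change lo.length < S; omega)
      rw [store_set_lev] at this
      exact this
    have hlower : ∀ (r' : List Task) {w}, r'.length + 1 ≤ S →
        Exec (fun _ => X) S (main : TProg Γ) (store p r' lo) w σ →
        Exec (fun _ => X) S (main : TProg Γ) (store p (.lower :: r') (true :: lo)) w σ := by
      intro r' w hr' hx
      refine exec_main_cons (w := []) (store_bdd (by simpa using hr') (by simp; omega)) rfl ?_ hx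
      rw [store_set_task]
      have := exec_pop (X := fun _ : Unit => X) (I := fun _ : Unit => Bool) (O := Name Γ ⊕ Bool)
        (store_bdd (S := S) (p := p) (t := r') (l := true :: lo) (by omega) (by simp; omega))
        (i := .lev)
      rw [store_set_lev] at this
      exact this
    have hexp : ∀ {w}, Exec (fun _ => X) S (main : TProg Γ) (store p (children o ++ r) (true :: lo))
        w σ → Exec (fun _ => X) S (main : TProg Γ) (store p (.tree o :: r) (true :: lo)) w σ := by
      intro w hx
      refine exec_main_cons (w := []) (store_bdd (by simp; omega) (by simp; omega)) rfl ?_ hx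
      rw [store_set_task]
      have := exec_pushes (X := fun _ : Unit => X) (I := fun _ : Unit => Bool) (O := Name Γ ⊕ Bool)
        (i := .task) (children o)
        (store_bdd (S := S) (p := p) (t := r) (l := true :: lo) (by omega) (by simp; omega))
        (by
          change (children o).length + r.length ≤ S
          cases o <;> simp [children] <;> omega)
      rw [store_set_task] at this
      exact exec_ite_true (by rfl) this
    -- the tasks into which the circuit is divided, from the last to the first
    refine hexp ?_
    cases o with
    | false =>
      have x1 := tok (.sum false) (.sum false) (.raise :: r) rfl (by simp; omega) hraise
      have x2 := ih false (.sum false :: .raise :: r) (by simp; omega) (by omega) x1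
      have x3 := zer (.tree false :: .sum false :: .raise :: r) (by simp; omega) x2
      have x4 := ih true (.zero :: .tree false :: .sum false :: .raise :: r) (by simp; omega) (by omega) x3
      have x5 := tok .copy .copy _ rfl (by simp; omega) x4
      have x6 := ih false _ (by simp; omega) (by omega) x5
      have x7 := hlower _ (by simp; omega) x6
      refine x7.congr_out ?_
      simp [treeWord]
    | true =>
      have x2 := ih true (.raise :: r) (by simp; omega) (by omega) hraise
      have x3 := tok .copy .copy _ rfl (by simp; omega) x2
      have x4 := ih false (.copy :: .tree true :: .raise :: r) (by simp; omega) (by omega) x3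
      have x5 := zer _ (by simp; omega) x4
      have x6 := ih true (.zero :: .tree false :: .copy :: .tree true :: .raise :: r)
        (by simp; omega) (by omega) x5
      have x7 := tok (.sum true) (.sum true) _ rfl (by simp; omega) x6
      have x8 := hlower _ (by simp; omega) x7
      refine x8.congr_out ?_
      simp [treeWord]

end TreeProg

/-- The words for the iterated circuits are computable in logarithmic space, if the number of levels
is logarithmic. -/
theorem LS.treeWord {Γ : Type} [Finite Γ] {h L : List Bool → ℕ}
    (hw : LS (fun x => List.replicate (h x) false ++ List.replicate (L x) true)) (K : ℕ)
    (hK : ∀ x, h x + L x ≤ K * (Nat.log 2 x.length + 1)) :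
    LS (fun x => encToks (treeWord Γ (h x) false (L x) ++ [(.fin, [h x + L x])])) := by
  have : ∀ i, Finite (TreeProg.Alph i) := by
    intro i
    cases i <;> simp only [TreeProg.Alph] <;> infer_instance
  refine LS.ofProg (H := Unit) (I := fun _ => Bool) (F := fun _ x => List.replicate (h x) false ++
    List.replicate (L x) true) (fun _ => hw) TreeProg.program (8 * K + 1) fun x => ?_
  set S := (8 * K + 1) * (Nat.log 2 x.length + 1) with hSdef
  have hS : 8 * (h x + L x) + 1 ≤ S := by
    have := hK x
    calc 8 * (h x + L x) + 1 ≤ 8 * (K * (Nat.log 2 x.length + 1)) + (Nat.log 2 x.length + 1) := by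
          omega
      _ = S := by rw [hSdef]; ring
  set X := List.replicate (h x) false ++ List.replicate (L x) true with hX
  have hlen : X.length = h x + L x := by simp [hX]
  have b0 : (Store.init Unit TreeProg.Alph).Bdd S := Store.init_bdd S
  have s1 := exec_move_first (X := fun _ : Unit => X) (I := fun _ : Unit => Bool)
    (O := Name Γ ⊕ Bool) b0 (h := ()) rfl
  obtain ⟨σ₁, s2, p, hσ₁⟩ := exec_scan (X := fun _ : Unit => X) (S := S) (h := ())
    (p := fun b : Bool => (.op .lev (.push b) : TreeProg.TProg Γ)) (w := fun _ _ => [])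
    (Inv := fun r σ => ∃ p u, X = u ++ r ∧ σ = TreeProg.store p [] u.reverse)
    (fun b r σ hσ hi hr => by
      obtain ⟨p, u, hu, rfl⟩ := hi
      have hul : u.length < X.length := by rw [hu]; simp
      have := exec_push (X := fun _ : Unit => X) (I := fun _ : Unit => Bool) (O := Name Γ ⊕ Bool)
        hσ (i := .lev) (a := b) (by change u.reverse.length < S; rw [List.length_reverse]; omega)
      rw [TreeProg.store_set_lev] at this
      refine ⟨_, this, rfl, p + 1, u ++ [b], by simp [hu], ?_⟩
      refine Store.ext (funext fun _ => by simp [TreeProg.store]) (funext fun j => ?_)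
      cases j <;> simp [TreeProg.store])
    (fun _ => []) rfl (fun _ _ => rfl) X (s1.bdd b0) (by simpa using Reads.start X)
    ⟨1, [], rfl, by
      refine Store.ext (funext fun _ => by simp [TreeProg.store]) (funext fun j => ?_)
      cases j <;> simp [TreeProg.store]⟩
  obtain ⟨u, hu, rfl⟩ := hσ₁
  rw [List.append_nil] at hu
  subst hu
  have hrev : X.reverse = List.replicate (L x) true ++ List.replicate (h x) false := by
    simp [hX]
  rw [hrev] at s2
  set l := List.replicate (L x) true ++ List.replicate (h x) false with hl
  have hll : l.length = h x + L x := by rw [← hrev, List.length_reverse, hlen]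
  have b2 : (TreeProg.store p [] l).Bdd S := TreeProg.store_bdd (by simp) (by omega)
  have s3 := exec_push (X := fun _ : Unit => X) (I := fun _ : Unit => Bool) (O := Name Γ ⊕ Bool)
    b2 (i := .task) (a := .tree false) (by change 0 < S; omega)
  rw [TreeProg.store_set_task] at s3
  have s4 := TreeProg.exec_tree (X := X) (S := S) (Γ := Γ) (h x) p (L x) false []
    (by simp; omega) (by omega) (TreeProg.exec_main_nil rfl)
  have s5 := TreeProg.exec_tokLev (X := X) (Γ := Γ) .fin b2 rfl hll
  rw [List.append_nil] at s4
  refine ⟨_, s1.seq_nil (s2.seq_nil (s3.seq_nil ((s4.seq s5).congr_out ?_)))⟩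
  simp

/-! ### The word for the biased coin -/

/-- The words `w a r` for all letters `a` of a word, `r` being the rest of the word after `a`. -/
def scanOut {A O : Type} (w : A → List A → List O) : List A → List O
  | [] => []
  | a :: r => w a r ++ scanOut w r

namespace ChainProg

variable {Γ : Type}

/-- Programs with three heads, on a unary number and on two binary numbers, a counter in unary and an
auxiliary stack. -/
abbrev CProg (Γ : Type) := SProg (fun _ : Fin 3 => Bool) (fun _ : Bool => Unit) (Name Γ ⊕ Bool)

/-- The bit in the cell, by default zero. -/
def bitOf : Cell Bool → Bool
  | .sym b => b
  | _ => false

/-- Write one token of the word, and go on. -/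
noncomputable def body : CProg Γ :=
  .seq (.branch fun v => .tokAt true false (fun u => u) (fun u => u)
    (.chain (bitOf (v.sym 1)) (bitOf (v.sym 2)) false)) <|
  .seq (.op true (.push ())) <| .seq (.move 1 .right) (.move 2 .right)

/-- The program that writes the word: head `0` counts the tokens, and heads `1` and `2` read the bits,
staying on the right end when these are exhausted. -/
noncomputable def program : CProg Γ :=
  .seq (.move 1 .right) <| .seq (.move 2 .right) <| .seq (.move 0 .right) <| .scan 0 fun _ => body

/-- The store with heads at the given positions and counter `i`. -/
def store (p : Fin 3 → ℕ) (i : ℕ) : Store (Fin 3) (fun _ : Bool => Unit) where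
  pos := p
  stk
    | true => List.replicate i ()
    | false => []

lemma store_bdd {S i : ℕ} (p : Fin 3 → ℕ) (h : i ≤ S) : (store p i).Bdd S := by
  rintro (_ | _) <;> simp [store, h]

lemma bitOf_cellAt (b : List Bool) (i : ℕ) :
    bitOf (cellAt b (min (i + 1) (b.length + 1))) = b.getD i false := by
  rcases Nat.lt_or_ge i b.length with h | h
  · rw [min_eq_left (by omega)]
    simp [cellAt, h, bitOf]
  · rw [min_eq_right (by omega)]
    simp [cellAt, bitOf, h]

lemma exec_move_store {S i : ℕ} {X : Fin 3 → List Bool} (p : Fin 3 → ℕ) (h : i ≤ S) (k : Fin 3) :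
    Exec X S (.move k .right : CProg Γ) (store p i) []
      (store (Function.update p k (min (p k + 1) ((X k).length + 1))) i) :=
  exec_move (X := X) (I := fun _ => Bool) (O := Name Γ ⊕ Bool) (store_bdd p h) k .right

end ChainProg

/-- The word for the biased coin is written by a single pass over the bits of the two numbers. -/
theorem LS.chainWord {Γ : Type} [Finite Γ] {n : List Bool → ℕ} {b c : List Bool → List Bool}
    (hn : LS (fun x => List.replicate (n x) true)) (hb : LS b) (hc : LS c) (K : ℕ)
    (hK : ∀ x, n x ≤ K * (Nat.log 2 x.length + 1)) :
    LS (fun x => encToks (chainWord Γ (n x) (b x) (c x))) := by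
  let F : Fin 3 → List Bool → List Bool := ![fun x => List.replicate (n x) true, b, c]
  refine LS.ofProg (H := Fin 3) (I := fun _ => Bool) (F := F)
    (by intro h; fin_cases h; exacts [hn, hb, hc]) ChainProg.program K fun x => ?_
  set S := K * (Nat.log 2 x.length + 1)
  set X : Fin 3 → List Bool := fun h => F h x with hX
  have X0 : X 0 = List.replicate (n x) true := rfl
  have hinit : Store.init (Fin 3) (fun _ : Bool => Unit) = ChainProg.store (fun _ => 0) 0 :=
    Store.ext rfl (funext fun j => by cases j <;> rfl)
  have mv := fun p i (hi : i ≤ S) k => ChainProg.exec_move_store (Γ := Γ) (X := X) p hi k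
  have s1 := mv (fun _ => 0) 0 (Nat.zero_le _) 1
  have s2 := fun p => mv p 0 (Nat.zero_le _) 2
  have s3 := fun p => mv p 0 (Nat.zero_le _) 0
  have s12 := s1.seq_nil ((s2 _).seq_nil (s3 _))
  let w : Bool → List Bool → List (Name Γ ⊕ Bool) := fun _ r =>
    encTok (.chain ((X 1).getD (n x - (r.length + 1)) false)
      ((X 2).getD (n x - (r.length + 1)) false) false, [n x - (r.length + 1)])
  have hout : ∀ m i, i + m = n x → scanOut w (List.replicate m true) =
      encToks ((List.range' i m).map fun i => (.chain ((X 1).getD i false) ((X 2).getD i false) false,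
        [i])) := by
    intro m
    induction m with
    | zero => intro i _; rfl
    | succ m ih =>
      intro i him
      rw [List.replicate_succ, scanOut, ih (i + 1) (by omega), List.range'_succ, List.map_cons,
        encToks_cons]
      simp only [w, List.length_replicate]
      rw [show n x - (m + 1) = i by omega]
  -- before the token `i` the counter holds `i`, and the heads `1` and `2` are on the bit `i`, if it
  -- exists
  obtain ⟨σ₁, s4, -⟩ := exec_scan (X := X) (S := S) (h := 0)
    (p := fun _ => (ChainProg.body : ChainProg.CProg Γ))
    (w := w)
    (Inv := fun r σ => ∃ i p, i + r.length = n x ∧ p 1 = min (i + 1) ((X 1).length + 1) ∧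
      p 2 = min (i + 1) ((X 2).length + 1) ∧ σ = ChainProg.store p i)
    (fun a r σ hσ hi _ => by
      obtain ⟨i, p, hin, h1, h2, rfl⟩ := hi
      rw [List.length_cons] at hin
      have hle : i + 1 ≤ S := (by omega : i + 1 ≤ n x).trans (hK x)
      simp only [w]
      rw [show n x - (r.length + 1) = i by omega]
      have t1 := exec_tokAt (X := X) (I := fun _ => Bool) (c := true) (u := false)
        (f := fun u => u) (g := fun u => u) (by simp) (fun _ => rfl)
        (.chain ((X 1).getD i false) ((X 2).getD i false) false : Name Γ) hσ rfl
        (n := i) (by simp [ChainProg.store])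
      have t2 := exec_push (X := X) (I := fun _ => Bool) (O := Name Γ ⊕ Bool) hσ (i := true)
        (a := ()) (by simp [ChainProg.store]; omega)
      have hpush : (ChainProg.store p i).set true (() :: (ChainProg.store p i).stk true) =
          ChainProg.store p (i + 1) :=
        Store.ext rfl (funext fun j => by
          cases j <;> simp [ChainProg.store, Store.set, List.replicate_succ])
      rw [hpush] at t2
      have t3 := mv p _ hle 1
      have t4 := fun p => mv p _ hle 2
      have t1' : Exec X S (.branch fun v => .tokAt true false (fun u => u) (fun u => u)
          (.chain (ChainProg.bitOf (v.sym 1)) (ChainProg.bitOf (v.sym 2)) false) :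
          ChainProg.CProg Γ) (ChainProg.store p i)
          (encTok (.chain ((X 1).getD i false) ((X 2).getD i false) false, [i]))
          (ChainProg.store p i) := by
        refine .branch ?_
        have e1 : ((ChainProg.store p i).view X).sym 1 =
          cellAt (X 1) (min (i + 1) ((X 1).length + 1)) := by rw [← h1]; rfl
        have e2 : ((ChainProg.store p i).view X).sym 2 =
          cellAt (X 2) (min (i + 1) ((X 2).length + 1)) := by rw [← h2]; rfl
        rw [e1, e2, ChainProg.bitOf_cellAt, ChainProg.bitOf_cellAt]
        exact t1
      have := t1'.seq (t2.seq_nil (t3.seq_nil (t4 _)))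
      rw [List.append_nil] at this
      refine ⟨_, this, by simp [ChainProg.store], i + 1, _, by omega, ?_, ?_, rfl⟩
      · simp [ChainProg.store, h1]; omega
      · simp [ChainProg.store, h2]; omega)
    (scanOut w) rfl (fun _ _ => rfl)
    (X 0) (s12.bdd (ChainProg.store_bdd _ (Nat.zero_le _)))
    (by simpa [ChainProg.store] using Reads.start (X 0))
    ⟨0, _, by simp [X0], by simp, by simp, rfl⟩
  refine ⟨σ₁, ?_⟩
  rw [hinit]
  refine (s1.seq_nil ((s2 _).seq_nil ((s3 _).seq_nil s4))).congr_out ?_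
  rw [X0, hout _ 0 (by omega), UnitaryLogspace.chainWord, List.range_eq_range']
  rfl

/-! ### Expansion of tokens -/

/-- An affine function of one of the arguments: `(j, a, b)` stands for `a` times the argument `j`
plus `b`. -/
abbrev Aff : Type := ℕ × ℕ × ℕ

/-- The value of an affine function. -/
def Aff.val (args : List ℕ) (f : Aff) : ℕ := f.2.1 * args.getD f.1 0 + f.2.2

/-- The word that replaces a token. -/
def expandTok {K K' : Type} (e : K → List (K' × List Aff)) (t : Tok K) : List (Tok K') :=
  (e t.1).map fun u => (u.1, u.2.map (Aff.val t.2))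

namespace Expand

variable {K K' : Type} {R : ℕ}

/-- Programs with one head, `R` stacks for arguments and an auxiliary stack. -/
abbrev EProg (K K' : Type) (R : ℕ) :=
  SProg (fun _ : Unit => K ⊕ Bool) (fun _ : Option (Fin R) => Unit) (K' ⊕ Bool)

/-- The cell holds a tick. -/
def isOne : Cell (K ⊕ Bool) → Bool
  | .sym (.inr true) => true
  | _ => false

/-- Read an argument and store it in unary. -/
def readArg (j : Fin R) : EProg K K' R :=
  .seq (.loop (fun v => isOne (v.sym ())) (.seq (.op (some j) (.push ())) (.move () .right)))
    (.move () .right)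

/-- Read the arguments from `i` on. -/
def readArgs : ℕ → ℕ → EProg K K' R
  | _, 0 => .skip
  | i, m + 1 => .seq (if h : i < R then readArg ⟨i, h⟩ else .skip) (readArgs (i + 1) m)

/-- Write the value of an affine function of the stored arguments. -/
noncomputable def emitArg (f : Aff) : EProg K K' R :=
  .seq (if h : f.1 < R then .height (some ⟨f.1, h⟩) none (fun u => u) (fun u => u)
      (List.replicate f.2.1 (.inr true)) else .skip)
    (.emits (encNat f.2.2))

/-- Write a token with affine functions of the stored arguments as its arguments. -/
noncomputable def emitTok (u : K' × List Aff) : EProg K K' R :=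
  .seq (.emits [.inl u.1]) (.forEach u.2 emitArg)

/-- Read a token, the name `k` having `ar k` arguments, and write its expansion. -/
noncomputable def body (e : K → List (K' × List Aff)) (ar : K → ℕ) : EProg K K' R :=
  .branch fun v => match v.sym () with
    | .sym (.inl k) => .seq (.move () .right) <| .seq (readArgs 0 (ar k)) <|
        .seq (.forEach (e k) emitTok) (.forEach (List.finRange R) fun j => .clear (some j))
    | _ => .skip

/-- Write the expansions of all tokens on the tape. -/
noncomputable def program (e : K → List (K' × List Aff)) (ar : K → ℕ) : EProg K K' R :=
  .seq (.move () .right) (.loop (fun v => (v.sym ()).isSym) (body e ar))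

/-- The store with the head at `p` and the given arguments. -/
def store (p : ℕ) (args : List ℕ) : Store Unit (fun _ : Option (Fin R) => Unit) where
  pos _ := p
  stk
    | some j => List.replicate (args.getD j 0) ()
    | none => []

variable {S : ℕ} {X : List (K ⊕ Bool)}

lemma store_bdd (p : ℕ) {args : List ℕ} (h : ∀ i ∈ args, i ≤ S) :
    (store p args : Store Unit (fun _ : Option (Fin R) => Unit)).Bdd S := by
  rintro (_ | j)
  · exact Nat.zero_le _
  · simp only [store, List.length_replicate]
    rcases Nat.lt_or_ge j args.length with hj | hj
    · rw [List.getD_eq_getElem _ _ hj]; exact h _ (List.getElem_mem hj)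
    · rw [List.getD_eq_default _ _ hj]; exact Nat.zero_le _

lemma exec_move_store {p : ℕ} {args : List ℕ} (h : ∀ i ∈ args, i ≤ S) {a r}
    (hr : Reads X p (a :: r)) :
    Exec (fun _ => X) S (.move () .right : EProg K K' R) (store p args) [] (store (p + 1) args) := by
  have := exec_move_right (X := fun _ : Unit => X) (O := K' ⊕ Bool) (S := S) (h := ())
    (store_bdd (R := R) p h) (a := a) (r := r) hr
  have e : (store p args : Store Unit (fun _ : Option (Fin R) => Unit)).goto ()
      ((store p args : Store Unit (fun _ : Option (Fin R) => Unit)).pos () + 1) =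
      store (p + 1) args :=
    Store.ext (funext fun _ => by simp [store]) rfl
  rwa [e] at this

lemma store_append_zero (p : ℕ) (args : List ℕ) :
    (store p (args ++ [0]) : Store Unit (fun _ : Option (Fin R) => Unit)) = store p args := by
  refine Store.ext rfl (funext fun j => ?_)
  cases j with
  | none => rfl
  | some j =>
    simp only [store]
    congr 1
    rcases Nat.lt_or_ge j args.length with hj | hj
    · rw [List.getD_append _ _ _ _ hj]
    · rw [List.getD_append_right _ _ _ _ hj, List.getD_eq_default args _ hj]
      cases j.1 - args.length <;> simp

lemma store_push (p : ℕ) (args : List ℕ) (m : ℕ) (h : args.length < R) :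
    (store p (args ++ [m]) : Store Unit (fun _ : Option (Fin R) => Unit)).set
      (some ⟨args.length, h⟩) (() :: (store p (args ++ [m]) :
        Store Unit (fun _ : Option (Fin R) => Unit)).stk (some ⟨args.length, h⟩)) =
      store p (args ++ [m + 1]) := by
  refine Store.ext rfl (funext fun j => ?_)
  by_cases hj : j = some ⟨args.length, h⟩
  · subst hj
    rw [Store.set_stk_self]
    simp [store, List.replicate_succ]
  · rw [Store.set_stk_ne _ hj]
    cases j with
    | none => rfl
    | some j =>
      have hne : j.1 ≠ args.length := fun e => hj (congrArg some (Fin.ext e))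
      simp only [store]
      congr 1
      rcases Nat.lt_or_ge j args.length with hj | hj
      · rw [List.getD_append _ _ _ _ hj, List.getD_append _ _ _ _ hj]
      · rw [List.getD_eq_default _ _ (by simp; omega), List.getD_eq_default _ _ (by simp; omega)]

lemma exec_readArg {args : List ℕ} (ha : ∀ i ∈ args, i ≤ S) (h : args.length < R) {p n : ℕ}
    {r : List (K ⊕ Bool)} (hr : Reads X p (encNat n ++ r)) (hn : n ≤ S) :
    ∃ p', Exec (fun _ => X) S (readArg ⟨args.length, h⟩ : EProg K K' R) (store p args) []
      (store p' (args ++ [n])) ∧ Reads X p' r := by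
  have key : ∀ n m p, n + m ≤ S → Reads X p (encNat n ++ r) →
      ∃ p', Exec (fun _ => X) S (.loop (fun v => isOne (v.sym ()))
        (.seq (.op (some ⟨args.length, h⟩) (.push ())) (.move () .right)) : EProg K K' R)
        (store p (args ++ [m])) [] (store p' (args ++ [n + m])) ∧ Reads X p' (.inr false :: r) := by
    intro n
    induction n with
    | zero =>
      intro m p _ hr
      have hr : Reads X p (.inr false :: r) := hr
      refine ⟨p, ?_, hr⟩
      rw [zero_add]
      refine .exit ?_
      have : cellAt X p = .sym (.inr false) := hr.cellAt_cons
      simp [Store.view, store, this, isOne]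
    | succ n ih =>
      intro m p hS hr
      have hr : Reads X p (.inr true :: (encNat n ++ r)) := hr
      have hm : ∀ i ∈ args ++ [m], i ≤ S := by
        intro i hi
        rcases List.mem_append.1 hi with hi | hi
        · exact ha i hi
        · rw [List.mem_singleton] at hi; omega
      have hm' : ∀ i ∈ args ++ [m + 1], i ≤ S := by
        intro i hi
        rcases List.mem_append.1 hi with hi | hi
        · exact ha i hi
        · rw [List.mem_singleton] at hi; omega
      have s1 := exec_push (X := fun _ : Unit => X) (I := fun _ : Unit => K ⊕ Bool)
        (O := K' ⊕ Bool) (store_bdd (R := R) p hm) (i := some ⟨args.length, h⟩) (a := ())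
        (by simp [store]; omega)
      rw [store_push] at s1
      obtain ⟨p', s3, hp'⟩ := ih (m + 1) (p + 1) (by omega) hr.tail
      refine ⟨p', ?_, hp'⟩
      rw [show n + 1 + m = n + (m + 1) by omega]
      refine Exec.loop_nil ?_ (s1.seq_nil (exec_move_store hm' hr)) s3
      have : cellAt X p = .sym (.inr true) := hr.cellAt_cons
      simp [Store.view, store, this, isOne]
  obtain ⟨p', s1, hp'⟩ := key n 0 p (by omega) hr
  rw [store_append_zero, add_zero] at s1
  refine ⟨p' + 1, s1.seq_nil (exec_move_store ?_ hp'), hp'.tail⟩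
  intro i hi
  rcases List.mem_append.1 hi with hi | hi
  · exact ha i hi
  · rw [List.mem_singleton] at hi; omega

lemma exec_readArgs (l : List ℕ) {args : List ℕ} (ha : ∀ i ∈ args, i ≤ S) (hl : ∀ i ∈ l, i ≤ S)
    (h : args.length + l.length ≤ R) {p : ℕ} {r : List (K ⊕ Bool)}
    (hr : Reads X p (l.flatMap encNat ++ r)) :
    ∃ p', Exec (fun _ => X) S (readArgs args.length l.length : EProg K K' R) (store p args) []
      (store p' (args ++ l)) ∧ Reads X p' r := by
  induction l generalizing args p with
  | nil => exact ⟨p, by rw [List.append_nil]; exact exec_skip (store_bdd p ha), hr⟩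
  | cons n l ih =>
    rw [List.length_cons] at h
    have hlt : args.length < R := by omega
    obtain ⟨p₁, s1, hr₁⟩ := exec_readArg (K' := K') ha hlt (n := n)
      (r := l.flatMap encNat ++ r) (by simpa using hr) (hl n (by simp))
    obtain ⟨p₂, s2, hr₂⟩ := ih (args := args ++ [n])
      (by
        intro i hi
        rcases List.mem_append.1 hi with hi | hi
        · exact ha i hi
        · rw [List.mem_singleton] at hi; subst hi; exact hl _ (by simp))
      (fun i hi => hl i (by simp [hi])) (by simp; omega) hr₁
    refine ⟨p₂, ?_, hr₂⟩
    rw [List.length_append, List.length_singleton, List.append_assoc, List.singleton_append] at s2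
    rw [List.length_cons, readArgs, dif_pos hlt]
    exact s1.seq_nil s2

lemma exec_emitArg {p : ℕ} {args : List ℕ} (ha : ∀ i ∈ args, i ≤ S) (hR : args.length ≤ R)
    (f : Aff) :
    Exec (fun _ => X) S (emitArg f : EProg K K' R) (store p args) (encNat (f.val args))
      (store p args) := by
  have b := store_bdd (R := R) p ha
  have s2 := exec_emits (X := fun _ : Unit => X) (I := fun _ : Unit => K ⊕ Bool) b
    (encNat f.2.2 : List (K' ⊕ Bool))
  by_cases h : f.1 < R
  · have s1 := exec_height (X := fun _ : Unit => X) (I := fun _ : Unit => K ⊕ Bool)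
      (c := some ⟨f.1, h⟩) (u := none) (f := fun u => u) (g := fun u => u) (by simp)
      (fun _ => rfl) (List.replicate f.2.1 (.inr true : K' ⊕ Bool)) b rfl
    rw [emitArg, dif_pos h]
    refine (s1.seq s2).congr_out ?_
    simp only [store, List.length_replicate, List.flatten_replicate_replicate, encNat, Aff.val]
    rw [← List.append_assoc, List.replicate_append_replicate, mul_comm]
  · rw [emitArg, dif_neg h]
    refine ((exec_skip b).seq_nil s2).congr_out ?_
    rw [Aff.val, List.getD_eq_default _ _ (by omega)]; simp

lemma exec_forEach {α H ι O : Type} {I : H → Type} {Γ : ι → Type} {X : ∀ h, List (I h)}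
    {p : α → SProg I Γ O} {w : α → List O} {σ : Store H Γ} (hσ : σ.Bdd S) (l : List α)
    (h : ∀ a ∈ l, Exec X S (p a) σ (w a) σ) : Exec X S (.forEach l p) σ (l.flatMap w) σ := by
  induction l with
  | nil => exact exec_skip hσ
  | cons a l ih => exact (h a (by simp)).seq (ih fun b hb => h b (by simp [hb]))

lemma exec_clearAll {p : ℕ} {args : List ℕ} (ha : ∀ i ∈ args, i ≤ S) :
    Exec (fun _ => X) S (.forEach (List.finRange R) fun j => .clear (some j) : EProg K K' R)
      (store p args) [] (store p []) := by
  have key : ∀ (l : List (Fin R)) {σ : Store Unit (fun _ : Option (Fin R) => Unit)}, σ.Bdd S →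
      ∃ σ', Exec (fun _ => X) S (.forEach l fun j => .clear (some j) : EProg K K' R) σ [] σ' ∧
        σ'.pos = σ.pos ∧ σ'.stk none = σ.stk none ∧
        ∀ j, j ∈ l ∨ σ.stk (some j) = [] → σ'.stk (some j) = [] := by
    intro l
    induction l with
    | nil => exact fun hσ => ⟨_, exec_skip hσ, rfl, rfl, by simp⟩
    | cons j l ih =>
      intro σ hσ
      have s1 := exec_clear (X := fun _ : Unit => X) (O := K' ⊕ Bool) (I := fun _ : Unit => K ⊕ Bool)
        hσ (some j)
      obtain ⟨σ', s2, h1, h2, h3⟩ := ih (s1.bdd hσ)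
      refine ⟨σ', s1.seq_nil s2, h1, by rw [h2, Store.set_stk_ne _ (by simp)], fun k hk => h3 k ?_⟩
      by_cases hkj : k = j
      · subst hkj; right; simp
      · rw [Store.set_stk_ne _ (by simpa using hkj)]
        simpa [hkj] using hk
  obtain ⟨σ', s1, h1, h2, h3⟩ := key (List.finRange R) (store_bdd p ha)
  have : σ' = store p [] := by
    refine Store.ext h1 (funext fun j => ?_)
    cases j with
    | none => exact h2
    | some j => rw [h3 j (by simp)]; simp [store]
  rwa [this] at s1

lemma exec_main {e : K → List (K' × List Aff)} {ar : K → ℕ} (hR : ∀ k, ar k ≤ R)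
    (w : List (Tok K)) (hw : ∀ t ∈ w, t.2.length = ar t.1 ∧ ∀ i ∈ t.2, i ≤ S) {p : ℕ}
    (hr : Reads X p (encToks w)) :
    ∃ p', Exec (fun _ => X) S (.loop (fun v => (v.sym ()).isSym) (body e ar) : EProg K K' R)
      (store p []) (encToks (w.flatMap (expandTok e))) (store p' []) := by
  induction w generalizing p with
  | nil =>
    have : cellAt X p = .right := hr.cellAt_nil
    exact ⟨p, .exit (by simp [Store.view, store, this, Cell.isSym])⟩
  | cons t w ih =>
    obtain ⟨hlen, hS⟩ := hw t (by simp)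
    have hr : Reads X p (.inl t.1 :: (t.2.flatMap encNat ++ encToks w)) := by
      simpa [encTok] using hr
    have hc : ((store p [] : Store Unit (fun _ : Option (Fin R) => Unit)).view
      fun _ : Unit => X).sym () = .sym (.inl t.1) := hr.cellAt_cons
    have s1 := exec_move_store (K' := K') (R := R) (S := S) (args := []) (by simp) hr
    obtain ⟨p₁, s2, hr₁⟩ := exec_readArgs (K' := K') (R := R) (S := S) t.2 (args := []) (by simp) hS
      (by simpa [hlen] using hR t.1) hr.tail
    rw [List.nil_append, hlen, List.length_nil] at s2
    have s3 := exec_forEach (X := fun _ : Unit => X) (I := fun _ : Unit => K ⊕ Bool)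
      (p := emitTok) (w := fun u : K' × List Aff => encTok (u.1, u.2.map (Aff.val t.2)))
      (store_bdd (R := R) p₁ hS) (e t.1) fun u _ => by
        have t1 := exec_emits (X := fun _ : Unit => X) (I := fun _ : Unit => K ⊕ Bool)
          (store_bdd (R := R) p₁ hS) [(.inl u.1 : K' ⊕ Bool)]
        have t2 := exec_forEach (X := fun _ : Unit => X) (I := fun _ : Unit => K ⊕ Bool)
          (p := emitArg) (w := fun f => (encNat (f.val t.2) : List (K' ⊕ Bool)))
          (store_bdd (R := R) p₁ hS) u.2 fun f _ => exec_emitArg hS (hlen.le.trans (hR _)) f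
        refine (t1.seq t2).congr_out ?_
        simp [encTok, List.flatMap_map]
    have s4 := exec_clearAll (K' := K') (R := R) (X := X) (p := p₁) hS
    obtain ⟨p₂, s5⟩ := ih (fun t ht => hw t (by simp [ht])) hr₁
    refine ⟨p₂, (Exec.loop (w := (e t.1).flatMap fun u => encTok (u.1, u.2.map (Aff.val t.2)))
      ?_ (.branch ?_) s5).congr_out ?_⟩
    · rw [hc]; rfl
    · rw [hc]
      refine (s1.seq_nil (s2.seq_nil (s3.seq s4))).congr_out ?_
      simp
    · simp [expandTok, encToks, List.flatMap_map]

end Expand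

/-- Each token may be replaced by a word of tokens whose arguments are affine functions of its
arguments, provided that the arguments are logarithmic, since they are stored in unary. -/
theorem LS.expand {K K' : Type} [Finite K] [Finite K'] {w : List Bool → List (Tok K)}
    (hw : LS (fun x => encToks (w x))) (e : K → List (K' × List Aff)) (ar : K → ℕ) (C : ℕ)
    (har : ∀ x, ∀ t ∈ w x, t.2.length = ar t.1 ∧ ∀ i ∈ t.2, i ≤ C * (Nat.log 2 x.length + 1)) :
    LS (fun x => encToks ((w x).flatMap (expandTok e))) := by
  obtain ⟨R, hR⟩ : ∃ R, ∀ k, ar k ≤ R := by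
    obtain ⟨R, hR⟩ := (Set.finite_range ar).bddAbove
    exact ⟨R, fun k => hR ⟨k, rfl⟩⟩
  refine LS.ofProg (H := Unit) (I := fun _ => K ⊕ Bool) (F := fun _ x => encToks (w x))
    (fun _ => hw) (Expand.program (R := R) e ar) C fun x => ?_
  have hinit : Store.init Unit (fun _ : Option (Fin R) => Unit) = Expand.store 0 [] :=
    Store.ext rfl (funext fun j => by cases j <;> simp [Expand.store])
  have s1 := exec_move_first (X := fun _ : Unit => encToks (w x)) (I := fun _ : Unit => K ⊕ Bool)
    (O := K' ⊕ Bool) (Store.init_bdd (H := Unit) (Γ := fun _ : Option (Fin R) => Unit)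
      (C * (Nat.log 2 x.length + 1))) (h := ()) rfl
  have hgoto : (Store.init Unit (fun _ : Option (Fin R) => Unit)).goto () 1 = Expand.store 1 [] :=
    Store.ext (funext fun _ => by simp [Expand.store])
      (funext fun j => by cases j <;> simp [Expand.store])
  rw [hgoto] at s1
  obtain ⟨p, s2⟩ := Expand.exec_main (S := C * (Nat.log 2 x.length + 1)) (e := e) hR (w x) (har x)
    (Reads.start (encToks (w x)))
  exact ⟨_, s1.seq_nil s2⟩

/-! ### Gates applied to some of the qubits -/

section ApplyOn

variable {r l m : ℕ}

/-- The action on vectors of a gate applied to the qubits `w`. -/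
lemma applyOn_mulVec (U : Matrix (Basis r) (Basis r) ℂ) (w : Fin r ↪ Fin l) (ψ : Basis l → ℂ)
    (y : Basis l) :
    (applyOn U w).mulVec ψ y = ∑ b : Basis r, U (y ∘ w) b * ψ (Function.extend w b y) := by
  classical
  simp only [Matrix.mulVec, dotProduct, applyOn, ite_mul, zero_mul]
  rw [← Finset.sum_filter]
  refine Finset.sum_nbij' (fun z => z ∘ w) (fun b => Function.extend w b y) ?_ ?_ ?_ ?_ ?_
  · simp
  · intro b _
    simp only [Finset.mem_filter, Finset.mem_univ, true_and]
    intro i hi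
    rw [Function.extend_apply' _ _ _ hi]
  · intro z hz
    simp only [Finset.mem_filter, Finset.mem_univ, true_and] at hz
    funext i
    by_cases hi : i ∈ Set.range w
    · obtain ⟨j, rfl⟩ := hi
      rw [w.injective.extend_apply]; rfl
    · rw [Function.extend_apply' _ _ _ hi, hz i hi]
  · intro b _
    funext j
    simp [w.injective.extend_apply]
  · intro z hz
    simp only [Finset.mem_filter, Finset.mem_univ, true_and] at hz
    congr 2
    funext i
    by_cases hi : i ∈ Set.range w
    · obtain ⟨j, rfl⟩ := hi
      rw [w.injective.extend_apply]; rfl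
    · rw [Function.extend_apply' _ _ _ hi, hz i hi]

lemma extend_comp (w : Fin r ↪ Fin l) (b : Basis r) (y : Basis l) :
    Function.extend w b y ∘ w = b := by
  funext j; simp [w.injective.extend_apply]

lemma extend_extend (w : Fin r ↪ Fin l) (b c : Basis r) (y : Basis l) :
    Function.extend w c (Function.extend w b y) = Function.extend w c y := by
  funext i
  by_cases hi : i ∈ Set.range w
  · obtain ⟨j, rfl⟩ := hi
    rw [w.injective.extend_apply, w.injective.extend_apply]
  · rw [Function.extend_apply' _ _ _ hi, Function.extend_apply' _ _ _ hi,
      Function.extend_apply' _ _ _ hi]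

lemma extend_comp_self (w : Fin r ↪ Fin l) (y : Basis l) :
    Function.extend w (y ∘ w) y = y := by
  funext i
  by_cases hi : i ∈ Set.range w
  · obtain ⟨j, rfl⟩ := hi
    rw [w.injective.extend_apply]; rfl
  · rw [Function.extend_apply' _ _ _ hi]

lemma ext_mulVec {A B : Matrix (Basis l) (Basis l) ℂ} (h : ∀ ψ, A.mulVec ψ = B.mulVec ψ) :
    A = B := by
  ext y z
  have := congrFun (h (Pi.single z 1)) y
  simpa using this

lemma applyOn_mul (U V : Matrix (Basis r) (Basis r) ℂ) (w : Fin r ↪ Fin l) :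
    applyOn (U * V) w = applyOn U w * applyOn V w := by
  refine ext_mulVec fun ψ => funext fun y => ?_
  rw [← Matrix.mulVec_mulVec, applyOn_mulVec, applyOn_mulVec]
  simp only [applyOn_mulVec, extend_comp, extend_extend, Matrix.mul_apply, Finset.sum_mul,
    Finset.mul_sum]
  rw [Finset.sum_comm]
  simp only [mul_assoc]

lemma applyOn_one (w : Fin r ↪ Fin l) : applyOn (1 : Matrix (Basis r) (Basis r) ℂ) w = 1 := by
  refine ext_mulVec fun ψ => funext fun y => ?_
  rw [applyOn_mulVec, Matrix.one_mulVec, Finset.sum_eq_single (y ∘ w)]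
  · rw [Matrix.one_apply_eq, extend_comp_self, one_mul]
  · intro b _ hb
    rw [Matrix.one_apply_ne hb.symm, zero_mul]
  · simp

lemma applyOn_conjTranspose (U : Matrix (Basis r) (Basis r) ℂ) (w : Fin r ↪ Fin l) :
    applyOn U.conjTranspose w = (applyOn U w).conjTranspose := by
  ext y z
  simp only [applyOn, Matrix.conjTranspose_apply]
  by_cases h : ∀ i, i ∉ Set.range w → y i = z i
  · rw [if_pos h, if_pos fun i hi => (h i hi).symm]
  · rw [if_neg h, if_neg fun h' => h fun i hi => (h' i hi).symm]
    simp

lemma applyOn_trans (U : Matrix (Basis r) (Basis r) ℂ) (v : Fin r ↪ Fin m) (w : Fin m ↪ Fin l) :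
    applyOn (applyOn U v) w = applyOn U (v.trans w) := by
  ext y z
  simp only [applyOn]
  by_cases h : ∀ i, i ∉ Set.range w → y i = z i
  · rw [if_pos h]
    by_cases h' : ∀ i, i ∉ Set.range v → (y ∘ w) i = (z ∘ w) i
    · rw [if_pos h', if_pos]
      · rfl
      · intro i hi
        by_cases hw : i ∈ Set.range w
        · obtain ⟨j, rfl⟩ := hw
          refine h' j fun ⟨k, hk⟩ => hi ⟨k, ?_⟩
          rw [← hk]; rfl
        · exact h i hw
    · rw [if_neg h', if_neg]
      intro h''
      refine h' fun i hi => h'' (w i) ?_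
      rintro ⟨k, hk⟩
      exact hi ⟨k, w.injective hk⟩
  · rw [if_neg h, if_neg]
    intro h''
    refine h fun i hi => h'' i ?_
    rintro ⟨k, rfl⟩
    exact hi ⟨v k, rfl⟩

lemma applyOn_mem_unitaryGroup {U : Matrix (Basis r) (Basis r) ℂ}
    (hU : U ∈ Matrix.unitaryGroup (Basis r) ℂ) (w : Fin r ↪ Fin l) :
    applyOn U w ∈ Matrix.unitaryGroup (Basis l) ℂ := by
  rw [Matrix.mem_unitaryGroup_iff'] at hU ⊢
  rw [Matrix.star_eq_conjTranspose] at hU ⊢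
  rw [← applyOn_conjTranspose, ← applyOn_mul, hU, applyOn_one]

/-- A gate that permutes the computational basis. -/
lemma applyOn_mulVec_perm {U : Matrix (Basis r) (Basis r) ℂ} {τ : Basis r → Basis r}
    (hU : ∀ c b, U c b = if b = τ c then 1 else 0) (w : Fin r ↪ Fin l) (ψ : Basis l → ℂ)
    (y : Basis l) :
    (applyOn U w).mulVec ψ y = ψ (Function.extend w (τ (y ∘ w)) y) := by
  rw [applyOn_mulVec]
  simp [hU]

end ApplyOn

namespace Circuit

variable {G : GateSet} {l m : ℕ}

lemma toMatrix_mem_unitaryGroup (C : Circuit G l) :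
    C.toMatrix ∈ Matrix.unitaryGroup (Basis l) ℂ := by
  induction C with
  | nil => exact one_mem _
  | cons a C ih => exact mul_mem ih (applyOn_mem_unitaryGroup (G.unitary_mat a.1) a.2)

lemma applyOn_toMatrix (C : Circuit G m) (w : Fin m ↪ Fin l) :
    applyOn C.toMatrix w =
      toMatrix (C.map fun a => ⟨a.1, a.2.trans w⟩ : Circuit G l) := by
  induction C with
  | nil => simp [toMatrix, applyOn_one]
  | cons a C ih => simp [toMatrix, applyOn_mul, ih, applyOn_trans]

end Circuit

/-! ### The semantics of words of tokens -/

section TokMat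

variable (G : GateSet) (N : ℕ)

/-- The token denotes a gate applied to distinct qubits among the first `N`. -/
def TokValid (t : Tok G.Gate) : Prop :=
  t.2.length = G.arity t.1 ∧ t.2.Nodup ∧ ∀ i ∈ t.2, i < N

variable {G N}

/-- The qubits of a token. -/
def TokValid.wires {t : Tok G.Gate} (h : TokValid G N t) : Fin (G.arity t.1) ↪ Fin N where
  toFun j := ⟨t.2[j.1]'(by rw [h.1]; exact j.2), h.2.2 _ (List.getElem_mem _)⟩
  inj' := by
    intro i j hij
    simp only [Fin.mk.injEq] at hij
    exact Fin.ext ((h.2.1.getElem_inj_iff).1 hij)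

variable (G N)

open Classical in
/-- The operator of a token; the identity, by convention, if the token is not valid. -/
noncomputable def tokMat (t : Tok G.Gate) : Matrix (Basis N) (Basis N) ℂ :=
  if h : TokValid G N t then applyOn (G.mat t.1) h.wires else 1

/-- The operator of a word, whose first token is the first to be applied. -/
noncomputable def wordMat : List (Tok G.Gate) → Matrix (Basis N) (Basis N) ℂ
  | [] => 1
  | t :: w => wordMat w * tokMat G N t

variable {G N}

lemma wordMat_append (w w' : List (Tok G.Gate)) :
    wordMat G N (w ++ w') = wordMat G N w' * wordMat G N w := by
  induction w with
  | nil => simp [wordMat]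
  | cons a C ih => simp [wordMat, ih, Matrix.mul_assoc]

lemma tokMat_mem_unitaryGroup (t : Tok G.Gate) :
    tokMat G N t ∈ Matrix.unitaryGroup (Basis N) ℂ := by
  rw [tokMat]
  split_ifs with h
  · exact applyOn_mem_unitaryGroup (G.unitary_mat t.1) _
  · exact one_mem _

lemma wordMat_mem_unitaryGroup (w : List (Tok G.Gate)) :
    wordMat G N w ∈ Matrix.unitaryGroup (Basis N) ℂ := by
  induction w with
  | nil => exact one_mem _
  | cons a C ih => exact mul_mem ih (tokMat_mem_unitaryGroup a)

/-- Words of valid tokens are circuits. -/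
lemma exists_circuit (w : List (Tok G.Gate)) (hw : ∀ t ∈ w, TokValid G N t) :
    ∃ C : Circuit G N, C.encode = encToks w ∧ C.toMatrix = wordMat G N w := by
  induction w with
  | nil => exact ⟨[], rfl, rfl⟩
  | cons t w ih =>
    obtain ⟨C, h1, h2⟩ := ih fun t ht => hw t (by simp [ht])
    have h := hw t (by simp)
    refine ⟨⟨t.1, h.wires⟩ :: C, ?_, ?_⟩
    · have : (List.ofFn fun j => (h.wires j : ℕ)) = t.2 := by
        refine List.ext_getElem (by simp [h.1]) fun i h1 h2 => ?_
        simp only [List.getElem_ofFn]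
        rfl
      rw [encToks_cons, ← h1, Circuit.encode, List.flatMap_cons, this]
      rfl
    · rw [Circuit.toMatrix, h2, wordMat, tokMat, dif_pos h]

/-- The tokens of a circuit. -/
def Circuit.toks {l : ℕ} (C : Circuit G l) : List (Tok G.Gate) :=
  C.map fun a => (a.1, List.ofFn fun j => (a.2 j : ℕ))

lemma Circuit.encode_eq {l : ℕ} (C : Circuit G l) : C.encode = encToks C.toks := by
  simp only [Circuit.encode, encToks, Circuit.toks, List.flatMap_map]
  rfl

/-- The expansion of a gate by a circuit for it: qubit `j` of the circuit is argument `j` of the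
gate. -/
def circuitExpand {l : ℕ} (C : Circuit G l) : List (G.Gate × List Aff) :=
  C.map fun a => (a.1, List.ofFn fun j => ((a.2 j : ℕ), 1, 0))

/-- The expansion of a gate has the same operator as the gate, on whatever qubits it is placed. -/
lemma wordMat_circuit {l : ℕ} (C : Circuit G l) (args : List ℕ) (w : Fin l ↪ Fin N)
    (hl : ∀ j : Fin l, args.getD j 0 = w j) :
    (∀ t ∈ (circuitExpand C).map (fun u => (u.1, u.2.map (Aff.val args))), TokValid G N t) ∧
    wordMat G N ((circuitExpand C).map fun u => (u.1, u.2.map (Aff.val args))) =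
      applyOn C.toMatrix w := by
  have key : ∀ a : Σ g : G.Gate, Fin (G.arity g) ↪ Fin l,
      (List.ofFn fun j => ((a.2 j : ℕ), 1, 0)).map (Aff.val args) =
        List.ofFn fun j => ((a.2.trans w) j : ℕ) := by
    intro a
    rw [List.map_ofFn]
    congr 1
    funext j
    simp only [Function.comp_apply, Aff.val, one_mul, add_zero]
    rw [hl]; rfl
  have hval : ∀ a : Σ g : G.Gate, Fin (G.arity g) ↪ Fin l,
      TokValid G N (a.1, List.ofFn fun j => ((a.2.trans w) j : ℕ)) := by
    intro a
    refine ⟨by simp, ?_, ?_⟩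
    · rw [List.nodup_ofFn]
      intro i j hij
      exact (a.2.trans w).injective (Fin.ext hij)
    · intro i hi
      rw [List.mem_ofFn] at hi
      obtain ⟨j, rfl⟩ := hi
      exact Fin.isLt _
  constructor
  · intro t ht
    simp only [circuitExpand, List.map_map, List.mem_map, Function.comp_apply] at ht
    obtain ⟨a, -, rfl⟩ := ht
    rw [key a]; exact hval a
  · rw [Circuit.applyOn_toMatrix]
    induction C with
    | nil => rfl
    | cons a C ih =>
      have h := hval a
      rw [circuitExpand, List.map_cons, List.map_cons, wordMat, List.map_cons, Circuit.toMatrix]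
      rw [circuitExpand] at ih
      rw [ih]
      congr 1
      simp only [key a]
      rw [tokMat, dif_pos h]
      congr 1
      refine Function.Embedding.ext fun j => Fin.ext ?_
      simp [TokValid.wires]

end TokMat

/-! ### Bits -/

section Bits

variable {N : ℕ}

/-- Bit `q` of a basis label, by default zero. -/
def bit (y : Basis N) (q : ℕ) : Bool := if h : q < N then y ⟨q, h⟩ else false

/-- Flip bit `q`. -/
def flip (q : ℕ) (y : Basis N) : Basis N := fun i => if i.1 = q then !(y i) else y i

lemma bit_flip_self {q : ℕ} (h : q < N) (y : Basis N) : bit (flip q y) q = !bit y q := by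
  simp [bit, flip, h]

lemma bit_flip_ne {q q' : ℕ} (h : q' ≠ q) (y : Basis N) : bit (flip q y) q' = bit y q' := by
  simp [bit, flip, h]

lemma bit_ext {y z : Basis N} (h : ∀ q, bit y q = bit z q) : y = z := by
  funext i
  have := h i
  simpa [bit, i.2] using this

@[simp] lemma flip_flip (q : ℕ) (y : Basis N) : flip q (flip q y) = y := by
  funext i
  simp only [flip]
  split_ifs <;> simp

lemma flip_comm (q q' : ℕ) (y : Basis N) : flip q (flip q' y) = flip q' (flip q y) := by
  funext i
  simp only [flip]
  split_ifs <;> rfl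

@[simp] lemma bit_zero (q : ℕ) : bit (fun _ => false : Basis N) q = false := by
  simp [bit]

/-- Flipping a bit, as a permutation of the basis labels. -/
def flipEquiv (N q : ℕ) : Equiv.Perm (Basis N) where
  toFun := flip q
  invFun := flip q
  left_inv := flip_flip q
  right_inv := flip_flip q

end Bits

/-! ### Elementary gates -/

/-- The elementary gates: Hadamard, NOT, Toffoli, and the gates in `Γ` and their inverses. -/
inductive El (Γ : Type) where
  | had
  | not
  | tof
  | gate (g : Γ)
  | inv (g : Γ)

instance {Γ : Type} [Finite Γ] : Finite (El Γ) := by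
  refine Finite.of_surjective
    (fun s : Fin 3 ⊕ (Γ ⊕ Γ) => (match s with
      | .inl 0 => .had
      | .inl 1 => .not
      | .inl 2 => .tof
      | .inr (.inl g) => .gate g
      | .inr (.inr g) => .inv g : El Γ)) fun j => ?_
  cases j with
  | had => exact ⟨.inl 0, rfl⟩
  | not => exact ⟨.inl 1, rfl⟩
  | tof => exact ⟨.inl 2, rfl⟩
  | gate g => exact ⟨.inr (.inl g), rfl⟩
  | inv g => exact ⟨.inr (.inr g), rfl⟩

/-- The inverse of an elementary gate. -/
def El.inverse {Γ : Type} : El Γ → El Γ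
  | .had => .had
  | .not => .not
  | .tof => .tof
  | .gate g => .inv g
  | .inv g => .gate g

/-- The number of qubits of an elementary gate. -/
def El.arity (G : GateSet) : El G.Gate → ℕ
  | .had => 1
  | .not => 1
  | .tof => 3
  | .gate g => G.arity g
  | .inv g => G.arity g

/-- The unitary performed by an elementary gate. -/
noncomputable def El.mat (G : GateSet) :
    (e : El G.Gate) → Matrix (Basis (e.arity G)) (Basis (e.arity G)) ℂ
  | .had => hadamard
  | .not => UnitaryLogspace.notGate
  | .tof => toffoli
  | .gate g => G.mat g
  | .inv g => (G.mat g).conjTranspose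

lemma El.exists_circuit {G : GateSet} (hG : G.Admissible) (e : El G.Gate) :
    ∃ C : Circuit G (e.arity G), C.toMatrix = e.mat G := by
  cases e with
  | had => exact hG.hadamard
  | not => exact hG.notGate
  | tof => exact hG.toffoli
  | gate g =>
    refine ⟨[⟨g, Function.Embedding.refl _⟩], ?_⟩
    simp only [Circuit.toMatrix, one_mul, El.mat]
    ext y z
    exact if_pos fun i hi => (hi ⟨i, rfl⟩).elim
  | inv g => exact hG.inverse g

/-- The elementary gates as a gate set. -/
noncomputable abbrev elGates (G : GateSet) (hG : G.Admissible) : GateSet where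
  Gate := El G.Gate
  finiteGate := by have := G.finiteGate; infer_instance
  arity := El.arity G
  mat := El.mat G
  unitary_mat e := by
    obtain ⟨C, hC⟩ := El.exists_circuit hG e
    rw [← hC]
    exact C.toMatrix_mem_unitaryGroup

lemma hadamard_conjTranspose : hadamard.conjTranspose = hadamard := by
  ext y z
  simp only [Matrix.conjTranspose_apply, hadamard, star_div₀, and_comm (a := y 0 = true)]
  congr 1
  · split_ifs <;> simp
  · simp

lemma notGate_conjTranspose : notGate.conjTranspose = notGate := by
  ext y z
  simp only [Matrix.conjTranspose_apply, notGate]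
  cases y 0 <;> cases z 0 <;> simp

lemma toffoli_conjTranspose : toffoli.conjTranspose = toffoli := by
  ext y z
  simp only [Matrix.conjTranspose_apply, toffoli]
  cases y 0 <;> cases z 0 <;> cases y 1 <;> cases z 1 <;> cases y 2 <;> cases z 2 <;> simp

lemma notGate_apply (c b : Basis 1) :
    notGate c b = if b = (fun _ => !(c 0)) then 1 else 0 := by
  have : (b = fun _ => !(c 0)) ↔ c 0 = !(b 0) := by
    constructor
    · rintro rfl; simp
    · intro h
      funext i
      rw [Subsingleton.elim i 0, h]; simp
  simp [notGate, this]

lemma toffoli_apply (c b : Basis 3) :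
    toffoli c b = if b = Function.update c 2 (xor (c 2) (c 0 && c 1)) then 1 else 0 := by
  have : b = Function.update c 2 (xor (c 2) (c 0 && c 1)) ↔
      c 0 = b 0 ∧ c 1 = b 1 ∧ c 2 = xor (b 2) (b 0 && b 1) := by
    constructor
    · rintro rfl
      simp
    · rintro ⟨h0, h1, h2⟩
      funext i
      fin_cases i
      · simp [h0]
      · simp [h1]
      · simp [h0, h1, h2]
  simp [toffoli, this]

section ElVec

variable {N : ℕ}

lemma notGate_mulVec (w : Fin 1 ↪ Fin N) (ψ : Basis N → ℂ) (y : Basis N) :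
    (applyOn notGate w).mulVec ψ y = ψ (flip (w 0) y) := by
  rw [applyOn_mulVec_perm notGate_apply]
  congr 1
  funext i
  by_cases hi : i = w 0
  · subst hi
    rw [w.injective.extend_apply]
    simp [flip]
  · rw [Function.extend_apply' _ _ _ (by
      rintro ⟨j, rfl⟩; exact hi (by rw [Subsingleton.elim j 0]))]
    simp [flip, Fin.val_inj, hi]

lemma toffoli_mulVec (w : Fin 3 ↪ Fin N) (ψ : Basis N → ℂ) (y : Basis N) :
    (applyOn toffoli w).mulVec ψ y =
      ψ (if bit y (w 0) && bit y (w 1) then flip (w 2) y else y) := by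
  rw [applyOn_mulVec_perm toffoli_apply]
  congr 1
  have hb : ∀ j, bit y (w j) = y (w j) := fun j => by simp [bit]
  rw [hb, hb]
  funext i
  by_cases hi : i ∈ Set.range w
  · obtain ⟨j, rfl⟩ := hi
    rw [w.injective.extend_apply]
    by_cases hj : j = 2
    · subst hj
      cases h : (y (w 0) && y (w 1)) <;> simp [h, flip]
    · have : ((w j : Fin N) : ℕ) ≠ w 2 := fun e => hj (w.injective (Fin.ext e))
      rw [Function.update_of_ne hj]
      split_ifs <;> simp [flip, this]
  · rw [Function.extend_apply' _ _ _ hi]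
    have : (i : ℕ) ≠ w 2 := fun e => hi ⟨2, Fin.ext e.symm⟩
    split_ifs <;> simp [flip, this]

lemma hadamard_mulVec (w : Fin 1 ↪ Fin N) (ψ : Basis N → ℂ) (y : Basis N) :
    (applyOn hadamard w).mulVec ψ y =
      ((if bit y (w 0) then -1 else 1) * ψ y + ψ (flip (w 0) y)) / (Real.sqrt 2 : ℂ) := by
  rw [applyOn_mulVec]
  have hb : bit y (w 0) = y (w 0) := by simp [bit]
  rw [hb]
  -- the two labels of one qubit
  rw [← (Equiv.funUnique (Fin 1) Bool).symm.sum_comp, Fintype.sum_bool]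
  have e : ∀ b : Bool, Function.extend w ((Equiv.funUnique (Fin 1) Bool).symm b) y =
      if b = y (w 0) then y else flip (w 0) y := by
    intro b
    funext i
    by_cases hi : i = w 0
    · subst hi
      rw [w.injective.extend_apply]
      cases b <;> cases h : y (w 0) <;> simp [flip, h]
    · rw [Function.extend_apply' _ _ _ (by
        rintro ⟨j, rfl⟩; exact hi (by rw [Subsingleton.elim j 0]))]
      split_ifs <;> simp [flip, Fin.val_inj, hi]
  rw [e, e]
  cases h : y (w 0) <;> simp [hadamard, h] <;> ring

/-- A vector is supported on the labels with bit `q` zero. -/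
def ZeroAt (q : ℕ) (ψ : Basis N → ℂ) : Prop := ∀ y, bit y q = true → ψ y = 0

variable {G : GateSet}

lemma applyOn_flip {r : ℕ} (U : Matrix (Basis r) (Basis r) ℂ) (w : Fin r ↪ Fin N) {q : ℕ}
    (hq : ∀ j, (w j : ℕ) ≠ q) (ψ : Basis N → ℂ) :
    (applyOn U w).mulVec (fun y => ψ (flip q y)) =
      fun y => (applyOn U w).mulVec ψ (flip q y) := by
  funext y
  rw [applyOn_mulVec, applyOn_mulVec]
  refine Finset.sum_congr rfl fun b _ => ?_
  congr 2
  · funext j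
    simp [flip, hq j]
  · funext i
    by_cases hi : i ∈ Set.range w
    · obtain ⟨j, rfl⟩ := hi
      simp [flip, hq j, w.injective.extend_apply]
    · simp only [flip]
      rw [Function.extend_apply' _ _ _ hi, Function.extend_apply' _ _ _ hi, flip]

lemma applyOn_zeroAt {r : ℕ} (U : Matrix (Basis r) (Basis r) ℂ) (w : Fin r ↪ Fin N) {q : ℕ}
    (hq : ∀ j, (w j : ℕ) ≠ q) {ψ : Basis N → ℂ} (hψ : ZeroAt q ψ) :
    ZeroAt q ((applyOn U w).mulVec ψ) := by
  intro y hy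
  rw [applyOn_mulVec]
  refine Finset.sum_eq_zero fun b _ => ?_
  rw [hψ, mul_zero]
  rw [← hy, bit, bit]
  split_ifs with h
  · rw [Function.extend_apply' _ _ _ (by
      rintro ⟨j, hj⟩
      exact hq j (congrArg Fin.val hj))]
  · rfl

lemma tokMat_flip {t : Tok G.Gate} {q : ℕ} (hq : q ∉ t.2) (ψ : Basis N → ℂ) :
    (tokMat G N t).mulVec (fun y => ψ (flip q y)) =
      fun y => (tokMat G N t).mulVec ψ (flip q y) := by
  rw [tokMat]
  split_ifs with h
  · refine applyOn_flip _ _ (fun j hj => hq ?_) ψ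
    rw [← hj]; exact List.getElem_mem _
  · simp

lemma tokMat_zeroAt {t : Tok G.Gate} {q : ℕ} (hq : q ∉ t.2) {ψ : Basis N → ℂ}
    (hψ : ZeroAt q ψ) : ZeroAt q ((tokMat G N t).mulVec ψ) := by
  rw [tokMat]
  split_ifs with h
  · refine applyOn_zeroAt _ _ (fun j hj => hq ?_) hψ
    rw [← hj]; exact List.getElem_mem _
  · simpa using hψ

/-- The action of a word on vectors. -/
noncomputable def act (G : GateSet) {N : ℕ} (w : List (Tok G.Gate)) (ψ : Basis N → ℂ) :
    Basis N → ℂ := (wordMat G N w).mulVec ψ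

@[simp] lemma act_nil (ψ : Basis N → ℂ) : act G [] ψ = ψ := by simp [act, wordMat]

lemma act_cons (t : Tok G.Gate) (w : List (Tok G.Gate)) (ψ : Basis N → ℂ) :
    act G (t :: w) ψ = act G w ((tokMat G N t).mulVec ψ) := by simp [act, wordMat]

lemma act_append (w w' : List (Tok G.Gate)) (ψ : Basis N → ℂ) :
    act G (w ++ w') ψ = act G w' (act G w ψ) := by simp [act, wordMat_append]

lemma act_flip {w : List (Tok G.Gate)} {q : ℕ} (hq : ∀ t ∈ w, q ∉ t.2) (ψ : Basis N → ℂ) :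
    act G w (fun y => ψ (flip q y)) = fun y => act G w ψ (flip q y) := by
  induction w generalizing ψ with
  | nil => simp
  | cons t w ih =>
    rw [act_cons, act_cons, tokMat_flip (hq t (by simp)), ih fun t ht => hq t (by simp [ht])]

lemma act_zeroAt {w : List (Tok G.Gate)} {q : ℕ} (hq : ∀ t ∈ w, q ∉ t.2) {ψ : Basis N → ℂ}
    (hψ : ZeroAt q ψ) : ZeroAt q (act G w ψ) := by
  induction w generalizing ψ with
  | nil => simpa using hψ
  | cons t w ih =>
    rw [act_cons]
    exact ih (fun t ht => hq t (by simp [ht])) (tokMat_zeroAt (hq t (by simp)) hψ)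

lemma act_add (w : List (Tok G.Gate)) (ψ φ : Basis N → ℂ) :
    act G w (ψ + φ) = act G w ψ + act G w φ := Matrix.mulVec_add _ _ _

lemma act_sub (w : List (Tok G.Gate)) (ψ φ : Basis N → ℂ) :
    act G w (ψ - φ) = act G w ψ - act G w φ := Matrix.mulVec_sub _ _ _

lemma act_smul (w : List (Tok G.Gate)) (c : ℂ) (ψ : Basis N → ℂ) :
    act G w (c • ψ) = c • act G w ψ := Matrix.mulVec_smul _ _ _

lemma act_norm (w : List (Tok G.Gate)) (ψ : Basis N → ℂ) :
    ∑ y, ‖act G w ψ y‖ ^ 2 = ∑ y, ‖ψ y‖ ^ 2 := by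
  have h := wordMat_mem_unitaryGroup (G := G) (N := N) w
  rw [Matrix.mem_unitaryGroup_iff', Matrix.star_eq_conjTranspose] at h
  have key : ∀ φ : Basis N → ℂ, ((∑ y, ‖φ y‖ ^ 2 : ℝ) : ℂ) = star φ ⬝ᵥ φ := by
    intro φ
    simp only [dotProduct, Pi.star_apply, RCLike.star_def, Complex.ofReal_sum]
    refine Finset.sum_congr rfl fun y _ => ?_
    rw [mul_comm, Complex.mul_conj, Complex.normSq_eq_norm_sq]
  have : star (act G w ψ) ⬝ᵥ act G w ψ = star ψ ⬝ᵥ ψ := by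
    rw [act, Matrix.star_mulVec, ← Matrix.dotProduct_mulVec, Matrix.mulVec_mulVec, h,
      Matrix.one_mulVec]
  exact_mod_cast (key _).trans (this.trans (key _).symm)

end ElVec

section ElTok

variable {G : GateSet} {hG : G.Admissible} {N : ℕ}

/-- The word for the inverse operator. -/
def invWord {Γ : Type} (w : List (Tok (El Γ))) : List (Tok (El Γ)) :=
  (w.map fun t => (t.1.inverse, t.2)).reverse

lemma tokMat_inverse (t : Tok (El G.Gate)) :
    tokMat (elGates G hG) N (t.1.inverse, t.2) = (tokMat (elGates G hG) N t).conjTranspose := by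
  obtain ⟨e, l⟩ := t
  have har : (elGates G hG).arity (El.inverse e) = (elGates G hG).arity e := by
    cases e <;> rfl
  by_cases h : TokValid (elGates G hG) N (e, l)
  · have h' : TokValid (elGates G hG) N (e.inverse, l) := ⟨h.1.trans har.symm, h.2⟩
    simp only [tokMat]
    rw [dif_pos h, dif_pos h', ← applyOn_conjTranspose]
    cases e with
    | had => exact congrArg (fun U => applyOn U _) hadamard_conjTranspose.symm
    | not => exact congrArg (fun U => applyOn U _) notGate_conjTranspose.symm
    | tof => exact congrArg (fun U => applyOn U _) toffoli_conjTranspose.symm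
    | gate g => rfl
    | inv g => exact congrArg (fun U => applyOn U _) (Matrix.conjTranspose_conjTranspose _).symm
  · have h' : ¬ TokValid (elGates G hG) N (e.inverse, l) :=
      fun h' => h ⟨h'.1.trans har, h'.2⟩
    simp only [tokMat]
    rw [dif_neg h, dif_neg h', Matrix.conjTranspose_one]

lemma wordMat_invWord (w : List (Tok (El G.Gate))) :
    wordMat (elGates G hG) N (invWord w) = (wordMat (elGates G hG) N w).conjTranspose := by
  induction w with
  | nil => simp [invWord, wordMat]
  | cons t w ih =>
    have : invWord (t :: w) = invWord w ++ [(t.1.inverse, t.2)] := by simp [invWord]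
    have h1 : wordMat (elGates G hG) N [(t.1.inverse, t.2)] =
        tokMat (elGates G hG) N (t.1.inverse, t.2) := Matrix.one_mul _
    have h2 : wordMat (elGates G hG) N (t :: w) =
        wordMat (elGates G hG) N w * tokMat (elGates G hG) N t := rfl
    rw [this, wordMat_append, ih, h1, h2, Matrix.conjTranspose_mul, tokMat_inverse]

lemma act_invWord (w : List (Tok (El G.Gate))) (ψ : Basis N → ℂ) :
    act (elGates G hG) (invWord w) (act (elGates G hG) w ψ) = ψ := by
  have h := wordMat_mem_unitaryGroup (G := elGates G hG) (N := N) w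
  rw [Matrix.mem_unitaryGroup_iff', Matrix.star_eq_conjTranspose] at h
  rw [act, act, Matrix.mulVec_mulVec, wordMat_invWord, h, Matrix.one_mulVec]

lemma act_invWord' (w : List (Tok (El G.Gate))) (ψ : Basis N → ℂ) :
    act (elGates G hG) w (act (elGates G hG) (invWord w) ψ) = ψ := by
  have h := wordMat_mem_unitaryGroup (G := elGates G hG) (N := N) w
  rw [Matrix.mem_unitaryGroup_iff, Matrix.star_eq_conjTranspose] at h
  rw [act, act, Matrix.mulVec_mulVec, wordMat_invWord, h, Matrix.one_mulVec]

lemma tokMat_not {q : ℕ} (hq : q < N) (ψ : Basis N → ℂ) :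
    (tokMat (elGates G hG) N (.not, [q])).mulVec ψ = fun y => ψ (flip q y) := by
  have h : TokValid (elGates G hG) N (.not, [q]) := ⟨rfl, by simp, by simpa using hq⟩
  funext y
  rw [tokMat, dif_pos h]
  exact notGate_mulVec (N := N) h.wires ψ y

lemma tokMat_had {q : ℕ} (hq : q < N) (ψ : Basis N → ℂ) :
    (tokMat (elGates G hG) N (.had, [q])).mulVec ψ = fun y =>
      ((if bit y q then -1 else 1) * ψ y + ψ (flip q y)) / (Real.sqrt 2 : ℂ) := by
  have h : TokValid (elGates G hG) N (.had, [q]) := ⟨rfl, by simp, by simpa using hq⟩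
  funext y
  rw [tokMat, dif_pos h]
  exact hadamard_mulVec (N := N) h.wires ψ y

lemma tokMat_tof {a b c : ℕ} (ha : a < N) (hb : b < N) (hc : c < N) (hab : a ≠ b) (hac : a ≠ c)
    (hbc : b ≠ c) (ψ : Basis N → ℂ) :
    (tokMat (elGates G hG) N (.tof, [a, b, c])).mulVec ψ = fun y =>
      ψ (if bit y a && bit y b then flip c y else y) := by
  have h : TokValid (elGates G hG) N (.tof, [a, b, c]) :=
    ⟨rfl, by simp [hab, hac, hbc], by simp [ha, hb, hc]⟩
  funext y
  rw [tokMat, dif_pos h]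
  exact toffoli_mulVec (N := N) h.wires ψ y

end ElTok

/-! ### Classical reversible words -/

section Classical

variable {Γ : Type} {N : ℕ}

/-- Flip bit `q` under the condition `S`. -/
def cflip (S : Bool) (q : ℕ) (y : Basis N) : Basis N := if S then flip q y else y

@[simp] lemma cflip_true (q : ℕ) (y : Basis N) : cflip true q y = flip q y := rfl
@[simp] lemma cflip_false (q : ℕ) (y : Basis N) : cflip false q y = y := rfl

/-- The permutation of the basis labels by which a NOT or Toffoli token pulls back vectors. -/
def cstep : Tok (El Γ) → Basis N → Basis N
  | (.not, [q]), y => flip q y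
  | (.tof, [a, b, c]), y => cflip (bit y a && bit y b) c y
  | _, y => y

/-- The token is a NOT or a Toffoli gate on distinct qubits among the first `N`. -/
def ClassicalTok (N : ℕ) : Tok (El Γ) → Prop
  | (.not, [q]) => q < N
  | (.tof, [a, b, c]) => a < N ∧ b < N ∧ c < N ∧ a ≠ b ∧ a ≠ c ∧ b ≠ c
  | _ => False

/-- The permutation of the basis labels by which a classical word pulls back vectors: the last
token is the first to be applied to a label. -/
def crun : List (Tok (El Γ)) → Basis N → Basis N
  | [], y => y
  | t :: w, y => cstep t (crun w y)

lemma crun_append (w w' : List (Tok (El Γ))) (y : Basis N) :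
    crun (w ++ w') y = crun w (crun w' y) := by
  induction w with
  | nil => rfl
  | cons t w ih => simp [crun, ih]

lemma tokMat_classical {G : GateSet} {hG : G.Admissible} {t : Tok (El G.Gate)}
    (ht : ClassicalTok N t) (ψ : Basis N → ℂ) :
    (tokMat (elGates G hG) N t).mulVec ψ = fun y => ψ (cstep t y) := by
  match t, ht with
  | (.not, [q]), h => exact tokMat_not h ψ
  | (.tof, [a, b, c]), ⟨ha, hb, hc, hab, hac, hbc⟩ => exact tokMat_tof ha hb hc hab hac hbc ψ

lemma act_classical {G : GateSet} {hG : G.Admissible} {w : List (Tok (El G.Gate))}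
    (hw : ∀ t ∈ w, ClassicalTok N t) (ψ : Basis N → ℂ) :
    act (elGates G hG) w ψ = fun y => ψ (crun w y) := by
  induction w generalizing ψ with
  | nil => exact act_nil ψ
  | cons t w ih =>
    rw [act_cons, tokMat_classical (hw t (by simp)), ih fun t ht => hw t (by simp [ht])]
    rfl

lemma bit_flip {q : ℕ} (hq : q < N) (y : Basis N) (r : ℕ) :
    bit (flip q y) r = (bit y r ^^ decide (r = q)) := by
  by_cases h : r = q
  · subst h; simp [bit_flip_self hq]
  · simp [bit_flip_ne h, h]

lemma bit_cflip {q : ℕ} (hq : q < N) (S : Bool) (y : Basis N) (r : ℕ) :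
    bit (cflip S q y) r = (bit y r ^^ (decide (r = q) && S)) := by
  cases S <;> simp [bit_flip hq]

lemma cstep_cstep {t : Tok (El Γ)} (ht : ClassicalTok N t) (y : Basis N) :
    cstep t (cstep t y) = y := by
  match t, ht with
  | (.not, [q]), h => exact flip_flip q y
  | (.tof, [a, b, c]), ⟨ha, hb, hc, hab, hac, hbc⟩ =>
    simp only [cstep]
    cases h : (bit y a && bit y b)
    · simp [h]
    · simp [bit_flip_ne hac, bit_flip_ne hbc, h]

lemma cstep_flip {t : Tok (El Γ)} (ht : ClassicalTok N t) {q : ℕ} (hq : q ∉ t.2) (y : Basis N) :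
    cstep t (flip q y) = flip q (cstep t y) := by
  match t, ht with
  | (.not, [r]), h => exact flip_comm _ _ y
  | (.tof, [a, b, c]), ⟨ha, hb, hc, hab, hac, hbc⟩ =>
    simp only [List.mem_cons, List.not_mem_nil, or_false, not_or] at hq
    simp only [cstep, bit_flip_ne (Ne.symm hq.1), bit_flip_ne (Ne.symm hq.2.1)]
    cases bit y a && bit y b
    · rfl
    · exact flip_comm _ _ _

lemma crun_flip {w : List (Tok (El Γ))} (hw : ∀ t ∈ w, ClassicalTok N t) {q : ℕ}
    (hq : ∀ t ∈ w, q ∉ t.2) (y : Basis N) : crun w (flip q y) = flip q (crun w y) := by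
  induction w with
  | nil => rfl
  | cons t w ih =>
    rw [crun, ih (fun t ht => hw t (by simp [ht])) fun t ht => hq t (by simp [ht]),
      cstep_flip (hw t (by simp)) (hq t (by simp)), crun]

lemma ClassicalTok.inverse_eq {t : Tok (El Γ)} (ht : ClassicalTok N t) :
    (t.1.inverse, t.2) = t := by
  match t, ht with
  | (.not, [q]), _ => rfl
  | (.tof, [a, b, c]), _ => rfl

lemma invWord_of_classical {w : List (Tok (El Γ))} (hw : ∀ t ∈ w, ClassicalTok N t) :
    invWord w = w.reverse := by
  rw [invWord]
  congr 1
  conv_rhs => rw [← List.map_id w]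
  exact List.map_congr_left fun t ht => (hw t ht).inverse_eq

lemma crun_reverse {w : List (Tok (El Γ))} (hw : ∀ t ∈ w, ClassicalTok N t) (y : Basis N) :
    crun w (crun w.reverse y) = y := by
  induction w generalizing y with
  | nil => rfl
  | cons t w ih =>
    rw [List.reverse_cons, crun_append, crun, ih fun t ht => hw t (by simp [ht])]
    exact cstep_cstep (hw t (by simp)) y

lemma invWord_append (w w' : List (Tok (El Γ))) :
    invWord (w ++ w') = invWord w' ++ invWord w := by simp [invWord]

lemma El.inverse_inverse (e : El Γ) : e.inverse.inverse = e := by cases e <;> rfl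

lemma invWord_invWord (w : List (Tok (El Γ))) : invWord (invWord w) = w := by
  have : (fun t : Tok (El Γ) => (t.1.inverse.inverse, t.2)) = id := by
    funext t; simp [El.inverse_inverse]
  simp [invWord, List.map_reverse, Function.comp_def, this]

end Classical

/-! ### The words of a level -/

section Words

variable {Γ : Type}

/-- Copy the acceptance qubit `8 * h + 3` to qubit `8 * h + 9`: a Toffoli gate, with the ladder qubit
`5` raised meanwhile. -/
def copyWord (Γ : Type) (h : ℕ) : List (Tok (El Γ)) :=
  [(.not, [5]), (.tof, [5, 8 * h + 3, 8 * h + 9]), (.not, [5])]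

/-- Extend the ladder over the four data qubits of the cell `i`, which are negated on the way.  The
ladder qubits `8 * i + 6`, `8 * i + 7`, `8 * i + 8`, `8 * i + 13` become the conjunctions of
`8 * i + 5` with the first data qubits. -/
def upWord (Γ : Type) (i : ℕ) : List (Tok (El Γ)) :=
  [(.not, [8 * i + 9]), (.tof, [8 * i + 9, 8 * i + 5, 8 * i + 6]),
    (.not, [8 * i + 10]), (.tof, [8 * i + 10, 8 * i + 6, 8 * i + 7]),
    (.not, [8 * i + 11]), (.tof, [8 * i + 11, 8 * i + 7, 8 * i + 8]),
    (.not, [8 * i + 12]), (.tof, [8 * i + 12, 8 * i + 8, 8 * i + 13])]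

/-- Compute the ladder over the first `h` cells: qubit `8 * h + 5` is raised if their data qubits are
all zero. -/
def ladderWord (Γ : Type) (h : ℕ) : List (Tok (El Γ)) :=
  (.not, [5]) :: (List.range h).flatMap (upWord Γ)

/-- Flip qubit `8 * h + 10` if the data qubits of the first `h` cells are all zero. -/
def testWord (Γ : Type) (h : ℕ) : List (Tok (El Γ)) :=
  ladderWord Γ h ++ (.tof, [5, 8 * h + 5, 8 * h + 10]) :: (ladderWord Γ h).reverse

/-- Compute the acceptance qubit of the next level, `8 * h + 11`.  Let `x`, `z`, `y` be the qubits
`8 * h + 9`, `8 * h + 10`, `8 * h + 3`: the outcome of the first run, whether the run backward led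
to zero, and the outcome of the second run.  The qubit is flipped if at least two of `x`, `x = z`,
`z = y` hold, that is, if `x` holds in case of `z`, and if `y` does not hold otherwise. -/
def sumWord (Γ : Type) (h : ℕ) : List (Tok (El Γ)) :=
  [(.not, [8 * h + 11]), (.not, [8 * h + 9]), (.tof, [8 * h + 9, 8 * h + 10, 8 * h + 11]),
    (.not, [8 * h + 9]), (.not, [8 * h + 10]), (.tof, [8 * h + 10, 8 * h + 3, 8 * h + 11]),
    (.not, [8 * h + 10])]

/-- Copy the acceptance qubit `8 * h + 3` to qubit `0`. -/
def finWord (Γ : Type) (h : ℕ) : List (Tok (El Γ)) :=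
  [(.not, [5]), (.tof, [5, 8 * h + 3, 0]), (.not, [5])]

/-- The qubits that are used as a ladder and are zero between the tests: `8 * i + 5`, …, `8 * i + 8`
for all `i`. -/
def IsLadder (q : ℕ) : Prop := 5 ≤ q ∧ (q + 3) % 8 < 4

instance : DecidablePred IsLadder := fun _ => inferInstanceAs (Decidable (_ ∧ _))

variable {N : ℕ}

/-- The ladder qubits are zero. -/
def Clean (ψ : Basis N → ℂ) : Prop := ∀ q, IsLadder q → ZeroAt q ψ

/-- The data qubits of the first `h` cells are all zero. -/
def zeroBelow (h : ℕ) (y : Basis N) : Bool :=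
  decide (∀ q < 8 * h + 5, 9 ≤ q → ¬ IsLadder q → bit y q = false)

lemma zeroBelow_zero (y : Basis N) : zeroBelow 0 y = true := by
  simp only [zeroBelow, decide_eq_true_eq]
  intro q h1 h2; omega

lemma zeroBelow_succ (h : ℕ) (y : Basis N) :
    zeroBelow (h + 1) y = (zeroBelow h y && !bit y (8 * h + 9) && !bit y (8 * h + 10) &&
      !bit y (8 * h + 11) && !bit y (8 * h + 12)) := by
  rw [Bool.eq_iff_iff]
  simp only [zeroBelow, Bool.and_eq_true, Bool.not_eq_true']
  rw [decide_eq_true_iff, decide_eq_true_iff]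
  simp only [IsLadder]
  constructor
  · intro H
    exact ⟨⟨⟨⟨fun q h1 h2 h3 => H q (by omega) h2 h3, H _ (by omega) (by omega) (by omega)⟩,
      H _ (by omega) (by omega) (by omega)⟩, H _ (by omega) (by omega) (by omega)⟩,
      H _ (by omega) (by omega) (by omega)⟩
  · rintro ⟨⟨⟨⟨H, h0⟩, h1⟩, h2⟩, h3⟩ q hq1 hq2 hq3
    by_cases hq : q < 8 * h + 5
    · exact H q hq hq2 hq3
    · have : q = 8 * h + 9 ∨ q = 8 * h + 10 ∨ q = 8 * h + 11 ∨ q = 8 * h + 12 := by omega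
      rcases this with rfl | rfl | rfl | rfl <;> assumption

lemma crun_copyWord {h : ℕ} (hN : 8 * h + 9 < N) (y : Basis N) :
    crun (copyWord Γ h) y = cflip (!bit y 5 && bit y (8 * h + 3)) (8 * h + 9) y := by
  have e1 : 8 * h + 3 ≠ 5 := by omega
  have e2 : ¬ (5 = 8 * h + 9) := by omega
  apply bit_ext
  intro q
  simp only [copyWord, crun, cstep]
  rw [bit_flip (by omega), bit_cflip hN, bit_flip (by omega), bit_cflip hN,
    bit_flip (by omega), bit_flip (by omega)]
  simp [e1]
  cases bit y q <;> cases bit y 5 <;> cases decide (q = 5) <;> simp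

lemma crun_finWord {h : ℕ} (hN : 8 * h + 9 < N) (y : Basis N) :
    crun (finWord Γ h) y = cflip (!bit y 5 && bit y (8 * h + 3)) 0 y := by
  have e1 : 8 * h + 3 ≠ 5 := by omega
  apply bit_ext
  intro q
  simp only [finWord, crun, cstep]
  rw [bit_flip (by omega), bit_cflip (by omega), bit_flip (by omega), bit_cflip (by omega),
    bit_flip (by omega), bit_flip (by omega)]
  simp [e1]
  cases bit y q <;> cases bit y 5 <;> cases decide (q = 5) <;> simp

lemma crun_sumWord {h : ℕ} (hN : 8 * h + 11 < N) (y : Basis N) :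
    crun (sumWord Γ h) y =
      cflip (!((!bit y (8 * h + 9) && bit y (8 * h + 10)) ^^
        (!bit y (8 * h + 10) && bit y (8 * h + 3)))) (8 * h + 11) y := by
  apply bit_ext
  intro q
  simp only [sumWord, crun, cstep]
  simp (discharger := omega) only [bit_flip, bit_cflip]
  simp
  generalize decide (q = 8 * h + 9) = a
  generalize decide (q = 8 * h + 10) = b
  generalize decide (q = 8 * h + 11) = c
  generalize bit y q = d
  generalize bit y (8 * h + 9) = e
  generalize bit y (8 * h + 10) = f
  generalize bit y (8 * h + 3) = g
  revert a b c d e f g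
  decide

lemma classical_ladderWord {h : ℕ} (hN : 8 * h + 5 < N) :
    ∀ t ∈ ladderWord Γ h, ClassicalTok N t ∧ ∀ q ∈ t.2, q < 8 * h + 6 := by
  intro t ht
  simp only [ladderWord, List.mem_cons, List.mem_flatMap, List.mem_range, upWord,
    List.not_mem_nil, or_false] at ht
  rcases ht with rfl | ⟨i, hi, rfl | rfl | rfl | rfl | rfl | rfl | rfl | rfl⟩ <;>
    refine ⟨by simp only [ClassicalTok]; omega, ?_⟩ <;>
    · simp only [List.mem_cons, List.not_mem_nil, or_false]
      omega

/-- The effect of the ladder on a basis label: qubit `8 * h + 5` tells whether the first `h` cells are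
zero, and the qubits beyond the ladder are unchanged.  The word is reversed since `crun` pulls
back. -/
lemma crun_ladderWord_reverse {h : ℕ} (hN : 8 * h + 5 < N) {y : Basis N}
    (hy : ∀ q, IsLadder q → bit y q = false) :
    bit (crun (ladderWord Γ h).reverse y) 5 = true ∧
    bit (crun (ladderWord Γ h).reverse y) (8 * h + 5) = zeroBelow h y ∧
    ∀ q, 8 * h + 6 ≤ q → bit (crun (ladderWord Γ h).reverse y) q = bit y q := by
  induction h with
  | zero =>
    simp only [ladderWord, List.range_zero, List.flatMap_nil, List.reverse_cons,
      List.reverse_nil, List.nil_append, crun, cstep]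
    rw [bit_flip (by omega), hy 5 (by decide), zeroBelow_zero]
    refine ⟨by simp, by simp, fun q hq => ?_⟩
    rw [bit_flip_ne (by omega)]
  | succ h ih =>
    obtain ⟨h1, h2, h3⟩ := ih (by omega)
    have e : (ladderWord Γ (h + 1)).reverse = (upWord Γ h).reverse ++ (ladderWord Γ h).reverse := by
      simp [ladderWord, List.range_succ]
    have l1 : bit y (8 * h + 6) = false := hy _ (by simp only [IsLadder]; omega)
    have l2 : bit y (8 * h + 7) = false := hy _ (by simp only [IsLadder]; omega)
    have l3 : bit y (8 * h + 8) = false := hy _ (by simp only [IsLadder]; omega)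
    have l4 : bit y (8 * h + 13) = false := hy _ (by simp only [IsLadder]; omega)
    rw [e, crun_append, zeroBelow_succ, ← h2, ← h3 (8 * h + 9) (by omega),
      ← h3 (8 * h + 10) (by omega), ← h3 (8 * h + 11) (by omega), ← h3 (8 * h + 12) (by omega)]
    rw [← h3 _ (by omega)] at l1 l2 l3 l4
    generalize crun (ladderWord Γ h).reverse y = z at *
    -- all bits after one more rung
    have key : ∀ q, bit (crun (upWord Γ h).reverse z) q = (bit z q ^^ decide (q = 8 * h + 9) ^^
        decide (q = 8 * h + 10) ^^ decide (q = 8 * h + 11) ^^ decide (q = 8 * h + 12) ^^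
        (decide (q = 8 * h + 6) && (!bit z (8 * h + 9) && bit z (8 * h + 5))) ^^
        (decide (q = 8 * h + 7) && (!bit z (8 * h + 10) && (!bit z (8 * h + 9) &&
          bit z (8 * h + 5)))) ^^
        (decide (q = 8 * h + 8) && (!bit z (8 * h + 11) && (!bit z (8 * h + 10) &&
          (!bit z (8 * h + 9) && bit z (8 * h + 5))))) ^^
        (decide (q = 8 * h + 13) && (!bit z (8 * h + 12) && (!bit z (8 * h + 11) &&
          (!bit z (8 * h + 10) && (!bit z (8 * h + 9) && bit z (8 * h + 5))))))) := by
      intro q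
      simp only [upWord, List.reverse_cons, List.reverse_nil, List.nil_append, List.cons_append,
        crun, cstep]
      simp (discharger := omega) only [bit_flip, bit_cflip]
      simp [l1, l2, l3]
      have : Std.Commutative (α := Bool) bne := ⟨by decide⟩
      ac_rfl
    refine ⟨?_, ?_, ?_⟩
    · rw [key, h1]
      have a1 : ∀ k, k ≠ 5 → 5 ≤ k → decide (5 = 8 * h + k) = false := by
        intro k hk hk'; simp; omega
      simp
    · rw [show 8 * (h + 1) + 5 = 8 * h + 13 by ring, key, l4]
      simp
      ac_rfl
    · intro q hq
      rw [key, ← h3 q (by omega)]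
      have a1 : ∀ k, k ≤ 13 → decide (q = 8 * h + k) = false := by
        intro k hk; simp; omega
      simp [a1]

variable {G : GateSet} {hG : G.Admissible}

lemma act_copyWord {h : ℕ} (hN : 8 * h + 9 < N) {ψ : Basis N → ℂ} (hψ : Clean ψ) :
    act (elGates G hG) (copyWord G.Gate h) ψ =
      fun y => ψ (cflip (bit y (8 * h + 3)) (8 * h + 9) y) := by
  rw [act_classical]
  · funext y
    rw [crun_copyWord hN]
    cases h5 : bit y 5
    · rfl
    · have h0 := hψ 5 (by decide)
      rw [h0 _ (by simpa using h5), h0]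
      cases bit y (8 * h + 3)
      · exact h5
      · rw [cflip_true, bit_flip_ne (by omega), h5]
  · intro t ht
    simp only [copyWord, List.mem_cons, List.not_mem_nil, or_false] at ht
    rcases ht with rfl | rfl | rfl <;> simp only [ClassicalTok] <;> omega

lemma act_finWord {h : ℕ} (hN : 8 * h + 9 < N) {ψ : Basis N → ℂ} (hψ : Clean ψ) :
    act (elGates G hG) (finWord G.Gate h) ψ =
      fun y => ψ (cflip (bit y (8 * h + 3)) 0 y) := by
  rw [act_classical]
  · funext y
    rw [crun_finWord hN]
    cases h5 : bit y 5
    · rfl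
    · have h0 := hψ 5 (by decide)
      rw [h0 _ (by simpa using h5), h0]
      cases bit y (8 * h + 3)
      · exact h5
      · rw [cflip_true, bit_flip_ne (by omega), h5]
  · intro t ht
    simp only [finWord, List.mem_cons, List.not_mem_nil, or_false] at ht
    rcases ht with rfl | rfl | rfl <;> simp only [ClassicalTok] <;> omega

lemma act_sumWord {h : ℕ} (hN : 8 * h + 11 < N) (ψ : Basis N → ℂ) :
    act (elGates G hG) (sumWord G.Gate h) ψ = fun y => ψ
      (cflip (!((!bit y (8 * h + 9) && bit y (8 * h + 10)) ^^
        (!bit y (8 * h + 10) && bit y (8 * h + 3)))) (8 * h + 11) y) := by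
  rw [act_classical]
  · funext y
    rw [crun_sumWord hN]
  · intro t ht
    simp only [sumWord, List.mem_cons, List.not_mem_nil, or_false] at ht
    rcases ht with rfl | rfl | rfl | rfl | rfl | rfl | rfl <;> simp only [ClassicalTok] <;> omega

/-- The ladder is computed, used once, and computed backward, so that only qubit `8 * h + 10` changes. -/
lemma act_testWord {h : ℕ} (hh : 0 < h) (hN : 8 * h + 10 < N) {ψ : Basis N → ℂ} (hψ : Clean ψ) :
    act (elGates G hG) (testWord G.Gate h) ψ =
      fun y => ψ (cflip (zeroBelow h y) (8 * h + 10) y) := by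
  have hL := classical_ladderWord (Γ := G.Gate) (N := N) (h := h) (by omega)
  rw [act_classical]
  · funext y
    rw [testWord, crun_append, crun]
    set u := crun (ladderWord G.Gate h).reverse y with hu
    have hback : crun (ladderWord G.Gate h) u = y := crun_reverse (fun t ht => (hL t ht).1) y
    have hflip : crun (ladderWord G.Gate h) (flip (8 * h + 10) u) = flip (8 * h + 10) y := by
      rw [crun_flip (fun t ht => (hL t ht).1), hback]
      intro t ht hq
      have := (hL t ht).2 _ hq
      omega
    by_cases hy : ∀ q, IsLadder q → bit y q = false
    · obtain ⟨h1, h2, -⟩ := crun_ladderWord_reverse (Γ := G.Gate) (h := h) (by omega) hy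
      simp only [cstep, ← hu] at h1 h2 ⊢
      rw [h1, h2]
      cases zeroBelow h y
      · simp [hback]
      · simp [hflip]
    · -- labels outside the support are permuted among themselves
      push Not at hy
      obtain ⟨q, hq, hq'⟩ := hy
      have hq' : bit y q = true := by simpa using hq'
      have hne : q ≠ 8 * h + 10 := by
        rintro rfl
        simp only [IsLadder] at hq
        omega
      have z1 : ψ y = 0 := hψ q hq _ hq'
      have z2 : ψ (flip (8 * h + 10) y) = 0 := hψ q hq _ (by rw [bit_flip_ne hne, hq'])
      simp only [cstep]
      cases bit u 5 && bit u (8 * h + 5) <;> cases zeroBelow h y <;> simp [hback, hflip, z1, z2]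
  · intro t ht
    simp only [testWord, List.mem_append, List.mem_cons, List.mem_reverse] at ht
    rcases ht with h | rfl | h
    · exact (hL t h).1
    · simp only [ClassicalTok]; omega
    · exact (hL t h).1

end Words

/-! ### One level of the amplification -/

section Level

variable {N : ℕ}

/-- The basis vector `|0…0⟩`. -/
def zeroVec (N : ℕ) : Basis N → ℂ := fun y => if y = (fun _ => false) then 1 else 0

/-- The restriction of a vector to the labels that satisfy `S`. -/
def restr (S : Basis N → Bool) (ψ : Basis N → ℂ) : Basis N → ℂ := fun y => if S y then ψ y else 0

/-- The NOT gate on qubit `q`, acting on vectors. -/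
def notVec (q : ℕ) (ψ : Basis N → ℂ) : Basis N → ℂ := fun y => ψ (flip q y)

/-- The probability of finding qubit `q` to be one. -/
noncomputable def prob (q : ℕ) (ψ : Basis N → ℂ) : ℝ := ∑ y, if bit y q then ‖ψ y‖ ^ 2 else 0

lemma zeroVec_zeroAt (q : ℕ) : ZeroAt q (zeroVec N) := by
  intro y hy
  refine if_neg ?_
  rintro rfl
  simp at hy

lemma zeroVec_clean : Clean (zeroVec N) := fun q _ => zeroVec_zeroAt q

lemma zeroVec_norm : ∑ y, ‖zeroVec N y‖ ^ 2 = 1 := by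
  rw [Finset.sum_eq_single (fun _ => false)]
  · simp [zeroVec]
  · intro y _ hy
    simp [zeroVec, hy]
  · simp

lemma mulVec_zeroVec (A : Matrix (Basis N) (Basis N) ℂ) (y : Basis N) :
    A.mulVec (zeroVec N) y = A y (fun _ => false) := by
  simp [Matrix.mulVec, dotProduct, zeroVec]

lemma ZeroAt.restr {q : ℕ} {ψ : Basis N → ℂ} (h : ZeroAt q ψ) (S : Basis N → Bool) :
    ZeroAt q (restr S ψ) := by
  intro y hy
  simp [UnitaryLogspace.restr, h y hy]

lemma ZeroAt.comp_cflip {q r : ℕ} {ψ : Basis N → ℂ} (h : ZeroAt q ψ) (hr : q ≠ r)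
    (S : Basis N → Bool) : ZeroAt q (fun y => ψ (cflip (S y) r y)) := by
  intro y hy
  refine h _ ?_
  cases S y
  · exact hy
  · rw [cflip_true, bit_flip_ne hr, hy]

lemma ZeroAt.notVec {q r : ℕ} {ψ : Basis N → ℂ} (h : ZeroAt q ψ) (hr : q ≠ r) :
    ZeroAt q (notVec r ψ) := by
  intro y hy
  exact h _ (by rw [bit_flip_ne hr, hy])

lemma ZeroAt.add {q : ℕ} {ψ φ : Basis N → ℂ} (h : ZeroAt q ψ) (h' : ZeroAt q φ) :
    ZeroAt q (ψ + φ) := by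
  intro y hy; simp [h y hy, h' y hy]

lemma ZeroAt.sub {q : ℕ} {ψ φ : Basis N → ℂ} (h : ZeroAt q ψ) (h' : ZeroAt q φ) :
    ZeroAt q (ψ - φ) := by
  intro y hy; simp [h y hy, h' y hy]

lemma ZeroAt.smul {q : ℕ} {ψ : Basis N → ℂ} (h : ZeroAt q ψ) (c : ℂ) : ZeroAt q (c • ψ) := by
  intro y hy; simp [h y hy]

/-- A controlled flip, as an operator. -/
lemma comp_cflip {q : ℕ} {S : Basis N → Bool} (hS : ∀ y, S (flip q y) = S y) (ψ : Basis N → ℂ) :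
    (fun y => ψ (cflip (S y) q y)) = ψ - restr S ψ + notVec q (restr S ψ) := by
  funext y
  cases h : S y <;> simp [restr, notVec, h, hS]

lemma sum_flip (q : ℕ) (g : Basis N → ℝ) : ∑ y, g (flip q y) = ∑ y, g y :=
  Equiv.sum_comp (flipEquiv N q) g

/-- A sum over all labels, the labels being paired by a flip. -/
lemma sum_pair {q : ℕ} (hq : q < N) (g : Basis N → ℝ) :
    ∑ y, g y = ∑ y, if bit y q then 0 else g y + g (flip q y) := by
  have h1 : ∑ y, g y = ∑ y, (if bit y q then 0 else g y) + ∑ y, (if bit y q then g y else 0) := by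
    rw [← Finset.sum_add_distrib]
    refine Finset.sum_congr rfl fun y _ => ?_
    split_ifs <;> simp
  rw [h1, ← sum_flip q fun y => if bit y q then g y else 0, ← Finset.sum_add_distrib]
  refine Finset.sum_congr rfl fun y _ => ?_
  rw [bit_flip_self hq]
  cases bit y q <;> simp

variable {G : GateSet} {hG : G.Admissible}

/-- A word that acts on the qubits of the first `h` cells, which are the cells `i < h` with data qubits
`8 * i + 9`, …, `8 * i + 12` and ladder qubits `8 * i + 5`, …, `8 * i + 8`, and that leaves the
ladder qubits zero, as does its inverse. -/
structure IsLevel (G : GateSet) (hG : G.Admissible) (N h : ℕ) (W : List (Tok (El G.Gate))) :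
    Prop where
  wires : ∀ t ∈ W, ∀ q ∈ t.2, 5 ≤ q ∧ q < 8 * h + 5
  clean : ∀ ψ : Basis N → ℂ, Clean ψ → Clean (act (elGates G hG) W ψ)
  clean_inv : ∀ ψ : Basis N → ℂ, Clean ψ → Clean (act (elGates G hG) (invWord W) ψ)

/-- The word of the next level: run, copy the outcome, run backwards, test for zero, run again,
combine the outcomes. -/
def levelWord {Γ : Type} (W : List (Tok (El Γ))) (h : ℕ) : List (Tok (El Γ)) :=
  W ++ copyWord Γ h ++ invWord W ++ testWord Γ h ++ W ++ sumWord Γ h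

lemma zeroBelow_flip {h q : ℕ} (hq : 8 * h + 5 ≤ q) (y : Basis N) :
    zeroBelow h (flip q y) = zeroBelow h y := by
  rw [Bool.eq_iff_iff, zeroBelow, zeroBelow, decide_eq_true_iff, decide_eq_true_iff]
  refine forall₂_congr fun r hr => ?_
  rw [bit_flip_ne (by omega)]

lemma mem_invWord {Γ : Type} {W : List (Tok (El Γ))} {t : Tok (El Γ)} (ht : t ∈ invWord W) :
    ∃ s ∈ W, s.2 = t.2 := by
  simp only [invWord, List.mem_reverse, List.mem_map] at ht
  obtain ⟨s, hs, rfl⟩ := ht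
  exact ⟨s, hs, rfl⟩

namespace IsLevel

variable {h : ℕ} {W : List (Tok (El G.Gate))}

lemma inv (hW : IsLevel G hG N h W) : IsLevel G hG N h (invWord W) where
  wires t ht q hq := by
    obtain ⟨s, hs, e⟩ := mem_invWord ht
    exact hW.wires s hs q (e ▸ hq)
  clean := hW.clean_inv
  clean_inv := by simpa only [invWord_invWord] using hW.clean

lemma act_notVec (hW : IsLevel G hG N h W) {q : ℕ} (hq : 8 * h + 5 ≤ q) (ψ : Basis N → ℂ) :
    act (elGates G hG) W (notVec q ψ) = notVec q (act (elGates G hG) W ψ) :=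
  act_flip (fun t ht hq' => by have := hW.wires t ht q hq'; omega) ψ

lemma act_zeroAt (hW : IsLevel G hG N h W) {q : ℕ} (hq : q < 5 ∨ 8 * h + 5 ≤ q) {ψ : Basis N → ℂ}
    (hψ : ZeroAt q ψ) : ZeroAt q (act (elGates G hG) W ψ) :=
  UnitaryLogspace.act_zeroAt (fun t ht hq' => by have := hW.wires t ht q hq'; omega) hψ

/-- The component of `W⁻¹ P W |0⟩` along `|0⟩` is the probability of acceptance, where `P` projects on
acceptance.  Since `W⁻¹ P W |0⟩` vanishes off the data qubits, testing these for zero projects on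
`|0⟩`. -/
lemma restr_zeroBelow (hW : IsLevel G hG N h W) (o : ℕ) :
    restr (zeroBelow h) (act (elGates G hG) (invWord W)
      (restr (fun y => bit y o) (act (elGates G hG) W (zeroVec N)))) =
      ((prob o (act (elGates G hG) W (zeroVec N)) : ℝ) : ℂ) • zeroVec N := by
  set ψ := act (elGates G hG) W (zeroVec N) with hψ
  set φ := act (elGates G hG) (invWord W) (restr (fun y => bit y o) ψ) with hφ
  have hφ0 : φ (fun _ => false) = ((prob o ψ : ℝ) : ℂ) := by
    rw [hφ, act, wordMat_invWord, Matrix.mulVec, dotProduct, prob, Complex.ofReal_sum]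
    refine Finset.sum_congr rfl fun y _ => ?_
    have e : wordMat (elGates G hG) N W y (fun _ => false) = ψ y := (mulVec_zeroVec _ y).symm
    rw [Matrix.conjTranspose_apply, e]
    simp only [restr]
    split_ifs
    · rw [Complex.star_def, mul_comm, Complex.mul_conj, Complex.normSq_eq_norm_sq]
    · simp
  have hcl : Clean φ := hW.clean_inv _ fun q hq => (hW.clean _ zeroVec_clean q hq).restr _
  have hz : ∀ q, q < 5 ∨ 8 * h + 5 ≤ q → ZeroAt q φ := fun q hq =>
    hW.inv.act_zeroAt hq ((hW.act_zeroAt hq (zeroVec_zeroAt q)).restr _)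
  funext y
  simp only [restr, Pi.smul_apply, smul_eq_mul]
  by_cases hy : y = fun _ => false
  · subst hy
    have : zeroBelow h (fun _ => false : Basis N) = true := by simp [zeroBelow]
    simp [this, hφ0, zeroVec]
  · rw [zeroVec, if_neg hy, mul_zero]
    split_ifs with hyz
    · have : ∃ q, bit y q = true := by
        by_contra! H
        exact hy (bit_ext fun q => by simpa using H q)
      obtain ⟨q, hq⟩ := this
      by_cases hl : IsLadder q
      · exact hcl q hl y hq
      · by_cases hq2 : q < 5 ∨ 8 * h + 5 ≤ q
        · exact hz q hq2 y hq
        · exfalso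
          rw [zeroBelow, decide_eq_true_iff] at hyz
          simp only [IsLadder] at hl hyz
          rw [hyz q (by omega) (by omega) hl] at hq
          simp at hq
    · rfl

end IsLevel

end Level

section LevelStep

variable {N : ℕ} {G : GateSet} {hG : G.Admissible}

lemma restr_add (S : Basis N → Bool) (ψ φ : Basis N → ℂ) :
    restr S (ψ + φ) = restr S ψ + restr S φ := by
  funext y; simp only [restr, Pi.add_apply]; split_ifs <;> simp

lemma restr_sub (S : Basis N → Bool) (ψ φ : Basis N → ℂ) :
    restr S (ψ - φ) = restr S ψ - restr S φ := by
  funext y; simp only [restr, Pi.sub_apply]; split_ifs <;> simp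

lemma restr_notVec {q : ℕ} {S : Basis N → Bool} (hS : ∀ y, S (flip q y) = S y) (ψ : Basis N → ℂ) :
    restr S (notVec q ψ) = notVec q (restr S ψ) := by
  funext y; simp [restr, notVec, hS]

/-- If a zero qubit is flipped under a condition, it is one with the probability of the condition. -/
lemma prob_comp_cflip {q : ℕ} (hq : q < N) {S : Basis N → Bool} (hS : ∀ y, S (flip q y) = S y)
    {ψ : Basis N → ℂ} (hψ : ZeroAt q ψ) :
    prob q (fun y => ψ (cflip (S y) q y)) = ∑ y, if S y then ‖ψ y‖ ^ 2 else 0 := by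
  rw [prob, ← sum_flip q]
  refine Finset.sum_congr rfl fun y _ => ?_
  rw [hS, bit_flip_self hq]
  cases h : bit y q
  · cases S y
    · simp [hψ (flip q y) (by rw [bit_flip_self hq, h]; rfl)]
    · simp
  · rw [hψ y h]
    simp

/-- The probability of acceptance at the end of a level.  Here `ψ` is the state `W |0⟩`, which accepts
with probability `a`; the qubits `y₁` and `y₂` hold the outcome of the first run and that of the
test for zero, and `χ` is the state before the outcomes are combined.  With `P` the projection on
acceptance, `χ` has the components `a ψ - P ψ` and `P ψ - a ψ` for `y₁ = 0, 1` and `y₂ = 0`, and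
`(1 - a) ψ` and `a ψ` for `y₁ = 0, 1` and `y₂ = 1`. -/
lemma sum_outcomes {o y₁ y₂ : ℕ} (h1 : y₁ < N) (h2 : y₂ < N) (h12 : y₁ ≠ y₂) (ho1 : o ≠ y₁)
    (ho2 : o ≠ y₂) {ψ : Basis N → ℂ} (hψ1 : ZeroAt y₁ ψ) (hψ2 : ZeroAt y₂ ψ)
    (hn : ∑ y, ‖ψ y‖ ^ 2 = 1) (a : ℝ) (ha : prob o ψ = a) {χ : Basis N → ℂ}
    (hχ : χ = ψ - restr (fun y => bit y o) ψ + notVec y₁ (restr (fun y => bit y o) ψ) -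
      (ψ - (a : ℂ) • ψ + notVec y₁ ((a : ℂ) • ψ)) +
      notVec y₂ (ψ - (a : ℂ) • ψ + notVec y₁ ((a : ℂ) • ψ))) :
    (∑ y, if !((!bit y y₁ && bit y y₂) ^^ (!bit y y₂ && bit y o)) then ‖χ y‖ ^ 2 else 0) =
      3 * a ^ 2 - 2 * a ^ 3 := by
  -- the components with `y₂ = 0` contribute on the labels with `o` zero, where `P ψ` vanishes
  have hsum : (∑ y, if !((!bit y y₁ && bit y y₂) ^^ (!bit y y₂ && bit y o)) then ‖χ y‖ ^ 2 else 0) =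
      ∑ y, (2 * a ^ 2 * (‖ψ y‖ ^ 2 - if bit y o then ‖ψ y‖ ^ 2 else 0) + a ^ 2 * ‖ψ y‖ ^ 2) := by
    rw [sum_pair h1, sum_pair h2]
    refine Finset.sum_congr rfl fun y _ => ?_
    rw [bit_flip_ne h12]
    cases e2 : bit y y₂
    · cases e1 : bit y y₁
      · have z1 : ψ (flip y₁ y) = 0 := hψ1 _ (by rw [bit_flip_self h1, e1]; rfl)
        have z2 : ψ (flip y₂ y) = 0 := hψ2 _ (by rw [bit_flip_self h2, e2]; rfl)
        have z3 : ψ (flip y₁ (flip y₂ y)) = 0 :=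
          hψ1 _ (by rw [bit_flip_self h1, bit_flip_ne h12, e1]; rfl)
        have z4 : ψ (flip y₂ (flip y₁ y)) = 0 := by rw [flip_comm, z3]
        have c0 : χ y = a * ψ y - (if bit y o then ψ y else 0) := by
          simp [hχ, restr, notVec, z1, z2, z3, bit_flip_ne ho1]
        have c1 : χ (flip y₁ y) = (if bit y o then ψ y else 0) - a * ψ y := by
          simp [hχ, restr, notVec, z1, z4, bit_flip_ne ho1]
          exact Or.inr (by rw [flip_comm, flip_flip, z2])
        have c3 : χ (flip y₁ (flip y₂ y)) = a * ψ y := by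
          simp [hχ, restr, notVec, z2, z3, bit_flip_ne ho1]
          rw [flip_comm, flip_flip, z1, flip_flip]; ring
        rw [c0, c1, c3]
        simp only [bit_flip_self h1, bit_flip_self h2, bit_flip_ne h12, bit_flip_ne h12.symm,
          bit_flip_ne ho1, bit_flip_ne ho2, e1, e2]
        cases bit y o
        · simp [mul_pow]; ring
        · simp [mul_pow]
      · rw [hψ1 y e1]
        simp
    · rw [hψ2 y e2]
      simp
  rw [hsum, Finset.sum_add_distrib, ← Finset.mul_sum, ← Finset.mul_sum, Finset.sum_sub_distrib, hn]
  change 2 * a ^ 2 * (1 - prob o ψ) + a ^ 2 * 1 = _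
  rw [ha]
  ring

namespace IsLevel

variable {h : ℕ} {W : List (Tok (El G.Gate))}

lemma norm (W : List (Tok (El G.Gate))) :
    ∑ y, ‖act (elGates G hG) W (zeroVec N) y‖ ^ 2 = 1 := by
  rw [act_norm, zeroVec_norm]

/-- The probability `a` of acceptance becomes `3 * a ^ 2 - 2 * a ^ 3`, the probability that at least two
of three independent events of probability `a` occur.  The three events are that the first run
accepts, that the test for zero agrees with the outcome of the first run, and that the second run
agrees with the outcome of the test: alternating measurements of `|0⟩` and of acceptance stay in the
plane spanned by `W |0⟩` and its projection, and consecutive outcomes agree with probability `a`. -/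
theorem prob_levelWord (hW : IsLevel G hG N h W) (hh : 0 < h) (hN : 8 * h + 11 < N) (a : ℝ)
    (ha : prob (8 * h + 3) (act (elGates G hG) W (zeroVec N)) = a) :
    prob (8 * (h + 1) + 3) (act (elGates G hG) (levelWord W h) (zeroVec N)) =
      3 * a ^ 2 - 2 * a ^ 3 := by
  have hP := hW.restr_zeroBelow (8 * h + 3)
  rw [ha] at hP
  rw [levelWord, act_append, act_append, act_append, act_append, act_append]
  set ψ := act (elGates G hG) W (zeroVec N) with hψ
  set P := restr (fun y => bit y (8 * h + 3)) ψ with hPdef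
  set φ := act (elGates G hG) (invWord W) P with hφ
  have hcl : Clean ψ := hW.clean _ zeroVec_clean
  have hclP : Clean P := fun q hq => (hcl q hq).restr _
  have hclφ : Clean φ := hW.clean_inv _ hclP
  have n1 : ∀ q, IsLadder q → q ≠ 8 * h + 9 := by
    rintro q hq rfl; simp only [IsLadder] at hq; omega
  have so : ∀ y : Basis N, bit (flip (8 * h + 9) y) (8 * h + 3) = bit y (8 * h + 3) :=
    fun y => bit_flip_ne (by omega) y
  -- the states after the first run has been copied, after the run backward, after the test for zero,
  -- and after the second run
  have b1 : act (elGates G hG) (copyWord G.Gate h) ψ = ψ - P + notVec (8 * h + 9) P := by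
    rw [act_copyWord (by omega) hcl, comp_cflip so]
  have b2 : act (elGates G hG) (invWord W) (ψ - P + notVec (8 * h + 9) P) =
      zeroVec N - φ + notVec (8 * h + 9) φ := by
    rw [act_add, act_sub, hW.inv.act_notVec (by omega), hψ, act_invWord]
  have hcl2 : Clean (zeroVec N - φ + notVec (8 * h + 9) φ) := fun q hq =>
    ((zeroVec_zeroAt q).sub (hclφ q hq)).add ((hclφ q hq).notVec (n1 q hq))
  have hr : restr (zeroBelow h) (zeroVec N - φ + notVec (8 * h + 9) φ) =
      zeroVec N - (a : ℂ) • zeroVec N + notVec (8 * h + 9) ((a : ℂ) • zeroVec N) := by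
    rw [restr_add, restr_sub, restr_notVec (fun y => zeroBelow_flip (by omega) y), hP]
    congr 2
    funext y
    simp only [restr]
    split_ifs with hz
    · rfl
    · rw [zeroVec, if_neg]
      rintro rfl
      exact hz (by simp [zeroBelow])
  have b3 : act (elGates G hG) (testWord G.Gate h) (zeroVec N - φ + notVec (8 * h + 9) φ) =
      zeroVec N - φ + notVec (8 * h + 9) φ -
        (zeroVec N - (a : ℂ) • zeroVec N + notVec (8 * h + 9) ((a : ℂ) • zeroVec N)) +
        notVec (8 * h + 10)
          (zeroVec N - (a : ℂ) • zeroVec N + notVec (8 * h + 9) ((a : ℂ) • zeroVec N)) := by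
    rw [act_testWord hh (by omega) hcl2, comp_cflip (fun y => zeroBelow_flip (by omega) y), hr]
  have b4 : act (elGates G hG) W (zeroVec N - φ + notVec (8 * h + 9) φ -
        (zeroVec N - (a : ℂ) • zeroVec N + notVec (8 * h + 9) ((a : ℂ) • zeroVec N)) +
        notVec (8 * h + 10)
          (zeroVec N - (a : ℂ) • zeroVec N + notVec (8 * h + 9) ((a : ℂ) • zeroVec N))) =
      ψ - P + notVec (8 * h + 9) P - (ψ - (a : ℂ) • ψ + notVec (8 * h + 9) ((a : ℂ) • ψ)) +
        notVec (8 * h + 10) (ψ - (a : ℂ) • ψ + notVec (8 * h + 9) ((a : ℂ) • ψ)) := by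
    have e : act (elGates G hG) W φ = P := act_invWord' _ _
    simp only [act_add, act_sub, act_smul, hW.act_notVec (show 8 * h + 5 ≤ 8 * h + 9 by omega),
      hW.act_notVec (show 8 * h + 5 ≤ 8 * h + 10 by omega), e, ← hψ]
  rw [b1, b2, b3, b4, act_sumWord hN]
  have z : ∀ q, 8 * h + 5 ≤ q → ZeroAt q ψ := fun q hq =>
    hW.act_zeroAt (Or.inr hq) (zeroVec_zeroAt q)
  rw [show 8 * (h + 1) + 3 = 8 * h + 11 by ring, prob_comp_cflip hN]
  · exact sum_outcomes (by omega) (by omega) (by omega) (by omega) (by omega)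
      (z _ (by omega)) (z _ (by omega)) (norm W) a ha rfl
  · intro y
    simp only [bit_flip_ne (show 8 * h + 9 ≠ 8 * h + 11 by omega),
      bit_flip_ne (show 8 * h + 10 ≠ 8 * h + 11 by omega),
      bit_flip_ne (show 8 * h + 3 ≠ 8 * h + 11 by omega)]
  · have z3 := z (8 * h + 11) (by omega)
    have zP : ZeroAt (8 * h + 11) P := z3.restr _
    have hx : ZeroAt (8 * h + 11) (ψ - (a : ℂ) • ψ + notVec (8 * h + 9) ((a : ℂ) • ψ)) :=
      (z3.sub (z3.smul _)).add ((z3.smul _).notVec (by omega))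
    exact (((z3.sub zP).add (zP.notVec (by omega))).sub hx).add (hx.notVec (by omega))

/-- A word whose tokens avoid the ladder qubits. -/
lemma clean_of_wires {W : List (Tok (El G.Gate))} (hW : ∀ t ∈ W, ∀ q ∈ t.2, ¬ IsLadder q)
    {ψ : Basis N → ℂ} (hψ : Clean ψ) : Clean (act (elGates G hG) W ψ) := fun q hq =>
  UnitaryLogspace.act_zeroAt (fun t ht hq' => hW t ht q hq' hq) (hψ q hq)

lemma of_wires {W : List (Tok (El G.Gate))}
    (hW : ∀ t ∈ W, ∀ q ∈ t.2, 5 ≤ q ∧ q < 8 * h + 5 ∧ ¬ IsLadder q) : IsLevel G hG N h W where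
  wires t ht q hq := ⟨(hW t ht q hq).1, (hW t ht q hq).2.1⟩
  clean _ hψ := clean_of_wires (fun t ht q hq => (hW t ht q hq).2.2) hψ
  clean_inv _ hψ := clean_of_wires (fun t ht q hq => by
    obtain ⟨s, hs, e⟩ := mem_invWord ht
    exact (hW s hs q (e ▸ hq)).2.2) hψ

lemma mono (hW : IsLevel G hG N h W) {h' : ℕ} (hh : h ≤ h') : IsLevel G hG N h' W where
  wires t ht q hq := by have := hW.wires t ht q hq; omega
  clean := hW.clean
  clean_inv := hW.clean_inv

lemma append {W' : List (Tok (El G.Gate))} (hW : IsLevel G hG N h W)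
    (hW' : IsLevel G hG N h W') : IsLevel G hG N h (W ++ W') where
  wires t ht := by
    rcases List.mem_append.1 ht with ht | ht
    · exact hW.wires t ht
    · exact hW'.wires t ht
  clean ψ hψ := by rw [act_append]; exact hW'.clean _ (hW.clean _ hψ)
  clean_inv ψ hψ := by
    rw [invWord_append, act_append]; exact hW.clean_inv _ (hW'.clean_inv _ hψ)

lemma copyWord (hh : 0 < h) (hN : 8 * h + 9 < N) : IsLevel G hG N (h + 1) (copyWord G.Gate h) where
  wires t ht q hq := by
    simp only [UnitaryLogspace.copyWord, List.mem_cons, List.not_mem_nil, or_false] at ht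
    rcases ht with rfl | rfl | rfl <;>
      simp only [List.mem_cons, List.not_mem_nil, or_false] at hq <;> omega
  clean ψ hψ := by
    rw [act_copyWord hN hψ]
    intro q hq
    refine (hψ q hq).comp_cflip ?_ _
    rintro rfl; simp only [IsLadder] at hq; omega
  clean_inv ψ hψ := by
    have e : invWord (UnitaryLogspace.copyWord G.Gate h) = UnitaryLogspace.copyWord G.Gate h := rfl
    rw [e, act_copyWord hN hψ]
    intro q hq
    refine (hψ q hq).comp_cflip ?_ _
    rintro rfl; simp only [IsLadder] at hq; omega

end IsLevel

lemma classical_testWord {Γ : Type} {h : ℕ} (hh : 0 < h) (hN : 8 * h + 10 < N) :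
    ∀ t ∈ testWord Γ h, ClassicalTok N t := by
  have hL := classical_ladderWord (Γ := Γ) (N := N) (h := h) (by omega)
  intro t ht
  simp only [testWord, List.mem_append, List.mem_cons, List.mem_reverse] at ht
  rcases ht with h | rfl | h
  · exact (hL t h).1
  · simp only [ClassicalTok]; omega
  · exact (hL t h).1

lemma invWord_testWord {Γ : Type} {h : ℕ} (hh : 0 < h) :
    invWord (testWord Γ h) = testWord Γ h := by
  rw [invWord_of_classical (classical_testWord hh (Nat.lt_succ_self (8 * h + 10)))]
  simp [testWord]

namespace IsLevel

variable {h : ℕ} {W : List (Tok (El G.Gate))}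

lemma testWord (hh : 0 < h) (hN : 8 * h + 10 < N) :
    IsLevel G hG N (h + 1) (testWord G.Gate h) where
  wires t ht q hq := by
    have hL : ∀ t ∈ ladderWord G.Gate h, ∀ q ∈ t.2, 5 ≤ q ∧ q < 8 * h + 6 := by
      intro t ht q hq
      refine ⟨?_, (classical_ladderWord (N := 8 * h + 6) (by omega) t ht).2 q hq⟩
      simp only [ladderWord, List.mem_cons, List.mem_flatMap, List.mem_range, upWord,
        List.not_mem_nil, or_false] at ht
      rcases ht with rfl | ⟨i, hi, rfl | rfl | rfl | rfl | rfl | rfl | rfl | rfl⟩ <;>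
        simp only [List.mem_cons, List.not_mem_nil, or_false] at hq <;> omega
    simp only [UnitaryLogspace.testWord, List.mem_append, List.mem_cons, List.mem_reverse] at ht
    rcases ht with ht | rfl | ht
    · have := hL t ht q hq; omega
    · simp only [List.mem_cons, List.not_mem_nil, or_false] at hq
      omega
    · have := hL t ht q hq; omega
  clean ψ hψ := by
    rw [act_testWord hh hN hψ]
    intro q hq
    refine (hψ q hq).comp_cflip ?_ _
    rintro rfl; simp only [IsLadder] at hq; omega
  clean_inv ψ hψ := by
    rw [invWord_testWord hh, act_testWord hh hN hψ]
    intro q hq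
    refine (hψ q hq).comp_cflip ?_ _
    rintro rfl; simp only [IsLadder] at hq; omega

lemma sumWord (hh : 0 < h) : IsLevel G hG N (h + 1) (sumWord G.Gate h) :=
  of_wires fun t ht q hq => by
    simp only [UnitaryLogspace.sumWord, List.mem_cons, List.not_mem_nil, or_false] at ht
    rcases ht with rfl | rfl | rfl | rfl | rfl | rfl | rfl <;>
      simp only [List.mem_cons, List.not_mem_nil, or_false] at hq <;>
      simp only [IsLadder] <;> omega

lemma levelWord (hW : IsLevel G hG N h W) (hh : 0 < h) (hN : 8 * h + 11 < N) :
    IsLevel G hG N (h + 1) (levelWord W h) := by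
  have w1 := hW.mono (Nat.le_succ h)
  exact ((((w1.append (copyWord hh (by omega))).append w1.inv).append
    (testWord hh (by omega))).append w1).append (sumWord hh)

end IsLevel

end LevelStep

/-! ### Expectations after words that toss fresh coins -/

section Expect

variable {Γ : Type} {N : ℕ}

/-- The expectation of a function of the measured label. -/
noncomputable def expect (ψ : Basis N → ℂ) (g : Basis N → ℝ) : ℝ := ∑ y, ‖ψ y‖ ^ 2 * g y

/-- A function of the label after an elementary gate, as a function of the label before it: a
Hadamard gate on a zero qubit tosses a coin. -/
noncomputable def pullTok : Tok (El Γ) → (Basis N → ℝ) → Basis N → ℝ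
  | (.had, [q]), g, y => (g y + g (flip q y)) / 2
  | t, g, y => g (cstep t y)

/-- A function of the label after a word, as a function of the label before it. -/
noncomputable def pull : List (Tok (El Γ)) → (Basis N → ℝ) → Basis N → ℝ
  | [], g => g
  | t :: w, g => pullTok t (pull w g)

/-- The word consists of NOT and Toffoli gates, and of Hadamard gates on qubits that satisfy `Z`
and have not been used before; such a word acts on expectations like a classical probabilistic
computation. -/
def Fresh (N : ℕ) : List (Tok (El Γ)) → (ℕ → Prop) → Prop
  | [], _ => True
  | t :: w, Z => ((∃ q, t = (.had, [q]) ∧ q < N ∧ Z q) ∨ ClassicalTok N t) ∧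
      Fresh N w fun q => Z q ∧ q ∉ t.2

lemma expect_flip (q : ℕ) (ψ : Basis N → ℂ) (g : Basis N → ℝ) :
    expect (fun y => ψ (flip q y)) g = expect ψ fun y => g (flip q y) := by
  simp only [expect]
  rw [← sum_flip q]
  simp

variable {G : GateSet} {hG : G.Admissible}

lemma expect_classical {t : Tok (El G.Gate)} (ht : ClassicalTok N t) (ψ : Basis N → ℂ)
    (g : Basis N → ℝ) :
    expect (fun y => ψ (cstep t y)) g = expect ψ fun y => g (cstep t y) := by
  simp only [expect]
  let e : Equiv.Perm (Basis N) := ⟨cstep t, cstep t, cstep_cstep ht, cstep_cstep ht⟩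
  rw [← Equiv.sum_comp e]
  refine Finset.sum_congr rfl fun y _ => ?_
  change ‖ψ (cstep t (cstep t y))‖ ^ 2 * g (cstep t y) = _
  rw [cstep_cstep ht]

/-- Since the qubit is zero, there is no interference. -/
lemma expect_had {q : ℕ} (hq : q < N) {ψ : Basis N → ℂ} (hψ : ZeroAt q ψ) (g : Basis N → ℝ) :
    expect ((tokMat (elGates G hG) N (.had, [q])).mulVec ψ) g =
      expect ψ fun y => (g y + g (flip q y)) / 2 := by
  have key : ∀ y, ‖(tokMat (elGates G hG) N (.had, [q])).mulVec ψ y‖ ^ 2 =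
      (‖ψ y‖ ^ 2 + ‖ψ (flip q y)‖ ^ 2) / 2 := by
    intro y
    rw [tokMat_had hq]
    dsimp only
    have h2 : ‖((Real.sqrt 2 : ℝ) : ℂ)‖ ^ 2 = 2 := by
      rw [Complex.norm_real, Real.norm_eq_abs, sq_abs, Real.sq_sqrt (by norm_num)]
    rw [norm_div, div_pow, h2]
    cases h : bit y q
    · rw [hψ (flip q y) (by rw [bit_flip_self hq, h]; rfl)]
      simp
    · rw [hψ y h]
      simp
  have e1 : expect ψ (fun y => g (flip q y)) = ∑ y, ‖ψ (flip q y)‖ ^ 2 * g y :=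
    (expect_flip q ψ g).symm
  have e2 : expect ψ (fun y => (g y + g (flip q y)) / 2) =
      (expect ψ g + expect ψ fun y => g (flip q y)) / 2 := by
    simp only [expect]
    rw [← Finset.sum_add_distrib, Finset.sum_div]
    exact Finset.sum_congr rfl fun y _ => by ring
  rw [e2, e1]
  simp only [expect, key]
  rw [← Finset.sum_add_distrib, Finset.sum_div]
  exact Finset.sum_congr rfl fun y _ => by ring

lemma pullTok_classical {t : Tok (El Γ)} (ht : ClassicalTok N t) (g : Basis N → ℝ) :
    pullTok t g = fun y => g (cstep t y) := by
  match t, ht with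
  | (.not, [q]), h => rfl
  | (.tof, [a, b, c]), h => rfl

lemma expect_act {w : List (Tok (El G.Gate))} {Z : ℕ → Prop} (hw : Fresh N w Z)
    {ψ : Basis N → ℂ} (hψ : ∀ q, Z q → ZeroAt q ψ) (g : Basis N → ℝ) :
    expect (act (elGates G hG) w ψ) g = expect ψ (pull w g) := by
  induction w generalizing Z ψ with
  | nil => rw [act_nil]; rfl
  | cons t w ih =>
    rw [act_cons, ih hw.2 fun q hq => tokMat_zeroAt hq.2 (hψ q hq.1), pull]
    rcases hw.1 with ⟨q, rfl, hq, hZ⟩ | ht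
    · exact expect_had hq (hψ q hZ) _
    · rw [tokMat_classical ht, expect_classical ht, pullTok_classical ht]

/-- The value of a bit. -/
def val (b : Bool) : ℝ := if b then 1 else 0

@[simp] lemma val_true : val true = 1 := rfl
@[simp] lemma val_false : val false = 0 := rfl

lemma prob_eq_expect (q : ℕ) (ψ : Basis N → ℂ) :
    prob q ψ = expect ψ fun y => val (bit y q) := by
  rw [prob, expect]
  refine Finset.sum_congr rfl fun y _ => ?_
  cases bit y q <;> simp

lemma expect_congr {ψ : Basis N → ℂ} {g g' : Basis N → ℝ} (h : ∀ y, ψ y ≠ 0 → g y = g' y) :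
    expect ψ g = expect ψ g' := by
  refine Finset.sum_congr rfl fun y _ => ?_
  by_cases hy : ψ y = 0
  · simp [hy]
  · rw [h y hy]

lemma expect_add (ψ : Basis N → ℂ) (g g' : Basis N → ℝ) :
    expect ψ (fun y => g y + g' y) = expect ψ g + expect ψ g' := by
  simp only [expect, mul_add, Finset.sum_add_distrib]

lemma expect_mul (ψ : Basis N → ℂ) (c : ℝ) (g : Basis N → ℝ) :
    expect ψ (fun y => c * g y) = c * expect ψ g := by
  simp only [expect, Finset.mul_sum]
  exact Finset.sum_congr rfl fun y _ => by ring

lemma expect_const {ψ : Basis N → ℂ} (hψ : ∑ y, ‖ψ y‖ ^ 2 = 1) (c : ℝ) :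
    expect ψ (fun _ => c) = c := by
  rw [expect, ← Finset.sum_mul, hψ, one_mul]

lemma ZeroAt.bit_eq {q : ℕ} {ψ : Basis N → ℂ} (h : ZeroAt q ψ) {y : Basis N} (hy : ψ y ≠ 0) :
    bit y q = false := by
  by_contra h'
  exact hy (h y (by simpa using h'))

end Expect

/-! ### The basic circuit -/

section Base

variable {Γ : Type}

/-- Prepare a zero qubit so that it is one with probability `(b + c) / 2`. -/
def prepWord (Γ : Type) (b c : Bool) (q : ℕ) : List (Tok (El Γ)) :=
  match b, c with
  | false, false => []
  | true, true => [(.not, [q])]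
  | _, _ => [(.had, [q])]

/-- A step of the preparation of a biased coin: the bit at `8 * i + 20` is, with equal
probabilities, the bit at `8 * i + 12` or a bit with expectation `(b + c) / 2`. -/
def chainStep (Γ : Type) (b c : Bool) (i : ℕ) : List (Tok (El Γ)) :=
  (.had, [8 * i + 10]) :: prepWord Γ b c (8 * i + 11) ++
    [(.tof, [8 * i + 10, 8 * i + 12, 8 * i + 20]), (.not, [8 * i + 10]),
      (.tof, [8 * i + 10, 8 * i + 11, 8 * i + 20])]

/-- The bit at `8 * K + 19` is with probability `1 / 2` the negation of the biased coin at `8 * K + 12`,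
with probability `1 / 4` the outcome of the given circuit at `9`, and otherwise zero. -/
def muxWord (Γ : Type) (K : ℕ) : List (Tok (El Γ)) :=
  [(.had, [8 * K + 10]), (.tof, [8 * K + 10, 9, 8 * K + 11]), (.had, [8 * K + 9]),
    (.not, [8 * K + 12]), (.tof, [8 * K + 9, 8 * K + 12, 8 * K + 19]), (.not, [8 * K + 9]),
    (.tof, [8 * K + 9, 8 * K + 11, 8 * K + 19])]

/-- The gates of a given circuit, its qubit `i` being placed at `8 * i + 9`. -/
def gateWord {G : GateSet} {l : ℕ} (V : Circuit G l) : List (Tok (El G.Gate)) :=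
  V.map fun a => (.gate a.1, List.ofFn fun j => 8 * (a.2 j : ℕ) + 9)

variable {G : GateSet} {hG : G.Admissible} {N l : ℕ}

lemma act_gateWord (V : Circuit G l) (w : Fin l ↪ Fin N) (hw : ∀ j, (w j : ℕ) = 8 * j + 9)
    (ψ : Basis N → ℂ) :
    act (elGates G hG) (gateWord V) ψ = (applyOn V.toMatrix w).mulVec ψ := by
  let C : Circuit (elGates G hG) l := V.map fun a => ⟨El.gate a.1, a.2⟩
  have hC : C.toMatrix = V.toMatrix := by
    change Circuit.toMatrix (V.map fun a => ⟨El.gate a.1, a.2⟩ : Circuit (elGates G hG) l) = _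
    induction V with
    | nil => rfl
    | cons a V ih => rw [List.map_cons, Circuit.toMatrix, ih, Circuit.toMatrix]; rfl
  have hargs : ∀ j : Fin l, (List.ofFn fun j : Fin l => 8 * (j : ℕ) + 9).getD j 0 = w j := by
    intro j
    rw [hw, List.getD_eq_getElem?_getD, List.getElem?_ofFn]
    simp
  have h := (wordMat_circuit C _ w hargs).2
  have e : (circuitExpand C).map (fun u => (u.1, u.2.map
      (Aff.val (List.ofFn fun j : Fin l => 8 * (j : ℕ) + 9)))) = gateWord V := by
    simp only [circuitExpand, C, gateWord, List.map_map]
    refine List.map_congr_left fun a _ => ?_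
    simp only [Function.comp_apply]
    congr 1
    rw [List.map_ofFn]
    congr 1
    funext j
    simp only [Function.comp_apply, Aff.val, one_mul, add_zero]
    rw [hargs, hw]
    rfl
  rw [act, ← e, h, hC]

lemma prob_gateWord (hl : 0 < l) (V : Circuit G l) (w : Fin l ↪ Fin N)
    (hw : ∀ j, (w j : ℕ) = 8 * j + 9) :
    prob 9 (act (elGates G hG) (gateWord V) (zeroVec N)) = V.acceptProb hl := by
  rw [act_gateWord V w hw, prob, Circuit.acceptProb, Finset.sum_filter]
  have key : ∀ y, (applyOn V.toMatrix w).mulVec (zeroVec N) y =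
      if ∀ i, i ∉ Set.range w → y i = false then V.toMatrix (y ∘ w) (fun _ => false) else 0 := by
    intro y
    rw [mulVec_zeroVec, applyOn]
    rfl
  have e9 : ∀ y : Basis N, bit y 9 = y (w ⟨0, hl⟩) := by
    intro y
    have h9 : ((w ⟨0, hl⟩ : Fin N) : ℕ) = 9 := by simp [hw]
    have hN : 9 < N := h9 ▸ (w ⟨0, hl⟩).2
    rw [bit, dif_pos hN]
    congr 1
    exact Fin.ext h9.symm
  simp only [key, e9]
  classical
  -- only the labels that vanish off the qubits of the circuit contribute
  rw [← Finset.sum_subset (Finset.filter_subset (fun y : Basis N =>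
    ∀ i, i ∉ Set.range w → y i = false) Finset.univ)]
  · refine Finset.sum_nbij' (fun y => y ∘ w)
      (fun b => Function.extend w b fun _ => false) ?_ ?_ ?_ ?_ ?_
    · simp
    · intro b _
      simp only [Finset.mem_filter, Finset.mem_univ, true_and]
      intro i hi
      rw [Function.extend_apply' _ _ _ hi]
    · intro y hy
      simp only [Finset.mem_filter, Finset.mem_univ, true_and] at hy
      funext i
      by_cases hi : i ∈ Set.range w
      · obtain ⟨j, rfl⟩ := hi
        rw [w.injective.extend_apply]; rfl
      · rw [Function.extend_apply' _ _ _ hi, hy i hi]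
    · intro b _
      exact extend_comp w b _
    · intro y hy
      simp only [Finset.mem_filter, Finset.mem_univ, true_and] at hy
      rw [if_pos hy]
      rfl
  · intro y _ hy
    simp only [Finset.mem_filter, Finset.mem_univ, true_and] at hy
    rw [if_neg hy]
    simp

lemma gateWord_wires (V : Circuit G l) {t : Tok (El G.Gate)} (ht : t ∈ gateWord V) {q : ℕ}
    (hq : q ∈ t.2) : ∃ j < l, q = 8 * j + 9 := by
  simp only [gateWord, List.mem_map] at ht
  obtain ⟨a, -, rfl⟩ := ht
  simp only [List.mem_ofFn] at hq
  obtain ⟨j, rfl⟩ := hq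
  exact ⟨_, (a.2 j).2, rfl⟩

lemma chainStep_wires {b c : Bool} {i : ℕ} {t : Tok (El Γ)} (ht : t ∈ chainStep Γ b c i) {q : ℕ}
    (hq : q ∈ t.2) : q = 8 * i + 10 ∨ q = 8 * i + 11 ∨ q = 8 * i + 12 ∨ q = 8 * i + 20 := by
  cases b <;> cases c <;>
    simp only [chainStep, prepWord, List.mem_cons, List.cons_append, List.nil_append,
      List.not_mem_nil, or_false] at ht <;>
    rcases ht with rfl | rfl | rfl | rfl | rfl <;>
    simp only [List.mem_cons, List.not_mem_nil, or_false] at hq <;> omega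

lemma muxWord_wires {K : ℕ} {t : Tok (El Γ)} (ht : t ∈ muxWord Γ K) {q : ℕ}
    (hq : q ∈ t.2) : q = 9 ∨ q = 8 * K + 9 ∨ q = 8 * K + 10 ∨ q = 8 * K + 11 ∨ q = 8 * K + 12 ∨
      q = 8 * K + 19 := by
  simp only [muxWord, List.mem_cons, List.not_mem_nil, or_false] at ht
  rcases ht with rfl | rfl | rfl | rfl | rfl | rfl | rfl <;>
    simp only [List.mem_cons, List.not_mem_nil, or_false] at hq <;> omega

end Base

section Chain

variable {Γ : Type} {G : GateSet} {hG : G.Admissible} {N l : ℕ}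

lemma fresh_chainStep (b c : Bool) {i : ℕ} (hN : 8 * i + 20 < N) {Z : ℕ → Prop}
    (h0 : Z (8 * i + 10)) (h1 : Z (8 * i + 11)) : Fresh N (chainStep Γ b c i) Z := by
  have e1 : (∃ q, ((El.had, [8 * i + 10]) : Tok (El Γ)) = (.had, [q]) ∧ q < N ∧ Z q) :=
    ⟨_, rfl, by omega, h0⟩
  cases b <;> cases c <;>
    simp only [chainStep, prepWord, List.cons_append, List.nil_append, Fresh, ClassicalTok]
  · exact ⟨.inl e1, .inr (by omega), .inr (by omega), .inr (by omega), trivial⟩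
  · exact ⟨.inl e1, .inl ⟨_, rfl, by omega, h1, by simp⟩, .inr (by omega), .inr (by omega),
      .inr (by omega), trivial⟩
  · exact ⟨.inl e1, .inl ⟨_, rfl, by omega, h1, by simp⟩, .inr (by omega), .inr (by omega),
      .inr (by omega), trivial⟩
  · exact ⟨.inl e1, .inr (by omega), .inr (by omega), .inr (by omega), .inr (by omega), trivial⟩

lemma pull_chainStep (b c : Bool) {i : ℕ} (hN : 8 * i + 20 < N) {y : Basis N}
    (h0 : bit y (8 * i + 10) = false) (h1 : bit y (8 * i + 11) = false)
    (h2 : bit y (8 * i + 20) = false) :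
    pull (chainStep Γ b c i) (fun y => val (bit y (8 * i + 20))) y =
      1 / 2 * val (bit y (8 * i + 12)) + (val b + val c) / 4 := by
  cases b <;> cases c <;>
    simp only [chainStep, prepWord, List.cons_append, List.nil_append, pull, pullTok, cstep] <;>
    simp (discharger := omega) only [bit_flip, bit_cflip] <;>
    simp [h0, h1, h2] <;> ring

lemma pull_chainStep_nine (b c : Bool) {i : ℕ} (hN : 8 * i + 20 < N) (y : Basis N) :
    pull (chainStep Γ b c i) (fun y => val (bit y 9)) y = val (bit y 9) := by
  have e : ∀ k, 10 ≤ k → decide (9 = 8 * i + k) = false := by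
    intro k hk; simp; omega
  cases b <;> cases c <;>
    simp only [chainStep, prepWord, List.cons_append, List.nil_append, pull, pullTok, cstep] <;>
    simp (discharger := omega) only [bit_flip, bit_cflip, e] <;> simp

lemma fresh_muxWord {K : ℕ} (hK : 0 < K) (hN : 8 * K + 19 < N) {Z : ℕ → Prop}
    (h0 : Z (8 * K + 10)) (h1 : Z (8 * K + 9)) : Fresh N (muxWord Γ K) Z := by
  simp only [muxWord, Fresh, ClassicalTok]
  refine ⟨.inl ⟨_, rfl, by omega, h0⟩, .inr (by omega), .inl ⟨_, rfl, by omega, ⟨h1, ?_⟩, ?_⟩,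
    .inr (by omega), .inr (by omega), .inr (by omega), .inr (by omega), trivial⟩
  · simp
  · simp; omega

lemma pull_muxWord {K : ℕ} (hK : 0 < K) (hN : 8 * K + 19 < N) {y : Basis N}
    (h0 : bit y (8 * K + 9) = false) (h1 : bit y (8 * K + 10) = false)
    (h2 : bit y (8 * K + 11) = false) (h3 : bit y (8 * K + 19) = false) :
    pull (muxWord Γ K) (fun y => val (bit y (8 * K + 19))) y =
      1 / 2 * (1 - val (bit y (8 * K + 12))) + 1 / 4 * val (bit y 9) := by
  have e : ∀ k, 9 ≤ k → decide (9 = 8 * K + k) = false := by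
    intro k hk; simp; omega
  simp only [muxWord, pull, pullTok, cstep]
  simp (discharger := omega) only [bit_flip, bit_cflip, e]
  simp [h0, h1, h2, h3]
  cases bit y (8 * K + 12) <;> cases bit y 9 <;> norm_num

/-- The preparation of the biased coin, with the first `n` bits of two numbers. -/
def coinWord (Γ : Type) (m m' : ℕ) (n : ℕ) : List (Tok (El Γ)) :=
  (List.range n).flatMap fun i => chainStep Γ (m.testBit i) (m'.testBit i) i

lemma coinWord_succ (m m' n : ℕ) : coinWord Γ m m' (n + 1) =
    coinWord Γ m m' n ++ chainStep Γ (m.testBit n) (m'.testBit n) n := by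
  simp [coinWord, List.range_succ]

/-- The bit at `8 * n + 12` is one with probability `(m + m') / 2 ^ (n + 1)`, up to the truncation of the
numbers to `n` bits.  The qubits still to be used are zero. -/
lemma coinWord_spec (m m' n : ℕ) (hN : 8 * n + 12 < N) {ψ : Basis N → ℂ}
    (hn : ∑ y, ‖ψ y‖ ^ 2 = 1) (hz : ∀ q, 10 ≤ q → q % 8 ≠ 1 → ZeroAt q ψ) :
    (∀ q, 8 * n + 13 ≤ q ∨ q = 8 * n + 10 ∨ q = 8 * n + 11 → q % 8 ≠ 1 →
      ZeroAt q (act (elGates G hG) (coinWord G.Gate m m' n) ψ)) ∧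
    prob 9 (act (elGates G hG) (coinWord G.Gate m m' n) ψ) = prob 9 ψ ∧
    prob (8 * n + 12) (act (elGates G hG) (coinWord G.Gate m m' n) ψ) =
      ((m % 2 ^ n : ℕ) + (m' % 2 ^ n : ℕ) : ℝ) / 2 ^ (n + 1) := by
  induction n with
  | zero =>
    have e : act (elGates G hG) (coinWord G.Gate m m' 0) ψ = ψ := act_nil ψ
    rw [e]
    refine ⟨fun q hq hq' => hz q (by omega) hq', rfl, ?_⟩
    have z := hz 12 (by norm_num) (by norm_num)
    rw [prob]
    simp only [Nat.pow_zero, Nat.mod_one, Nat.cast_zero, add_zero, zero_div]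
    refine Finset.sum_eq_zero fun y _ => ?_
    split_ifs with h
    · rw [z y h]; simp
    · rfl
  | succ n ih =>
    obtain ⟨h1, h2, h3⟩ := ih (by omega)
    rw [coinWord_succ, act_append]
    have hn' : ∑ y, ‖act (elGates G hG) (coinWord G.Gate m m' n) ψ y‖ ^ 2 = 1 := by
      rw [act_norm, hn]
    generalize act (elGates G hG) (coinWord G.Gate m m' n) ψ = φ at *
    have hf := fresh_chainStep (Γ := G.Gate) (N := N) (m.testBit n) (m'.testBit n) (i := n)
      (by omega) (Z := fun q => ZeroAt q φ) (h1 _ (by omega) (by omega))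
      (h1 _ (by omega) (by omega))
    refine ⟨fun q hq hq' => ?_, ?_, ?_⟩
    · refine act_zeroAt (fun t ht hqt => ?_) (h1 q (by omega) hq')
      have := chainStep_wires ht hqt
      omega
    · rw [prob_eq_expect, expect_act hf (fun q hq => hq), ← h2, prob_eq_expect]
      exact expect_congr fun y _ => pull_chainStep_nine _ _ (by omega) y
    · rw [show 8 * (n + 1) + 12 = 8 * n + 20 by ring, prob_eq_expect,
        expect_act hf (fun q hq => hq), expect_congr (fun y hy => pull_chainStep _ _ (by omega)
          ((h1 (8 * n + 10) (by omega) (by omega)).bit_eq hy)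
          ((h1 (8 * n + 11) (by omega) (by omega)).bit_eq hy)
          ((h1 (8 * n + 20) (by omega) (by omega)).bit_eq hy)),
        expect_add, expect_mul, expect_const hn', ← prob_eq_expect, h3,
        Nat.mod_pow_succ, Nat.mod_pow_succ, ← Nat.toNat_testBit,
        ← Nat.toNat_testBit]
      have hv : ∀ b : Bool, (b.toNat : ℝ) = val b := by intro b; cases b <;> simp
      push_cast
      rw [hv, hv, pow_succ, pow_succ]
      field_simp
      ring

/-- The basic circuit: the given circuit, a coin with bias `(m + m') / 2 ^ (K + 1)`, and their
combination. -/
def baseWord (V : Circuit G l) (m m' K : ℕ) : List (Tok (El G.Gate)) :=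
  gateWord V ++ coinWord G.Gate m m' K ++ muxWord G.Gate K

/-- The basic circuit compares the acceptance probability of the given circuit with the threshold
`(m + m') / 2 ^ K`, which is moved to `1 / 2`. -/
theorem prob_baseWord (hl : 0 < l) (V : Circuit G l) {m m' K : ℕ} (hK : l ≤ K) (hm : m < 2 ^ K)
    (hm' : m' < 2 ^ K) (hN : 8 * K + 19 < N) :
    prob (8 * (K + 2) + 3) (act (elGates G hG) (baseWord V m m' K) (zeroVec N)) =
      1 / 2 + (V.acceptProb hl - (m + m') / 2 ^ K) / 4 := by
  let w : Fin l ↪ Fin N := ⟨fun j => ⟨8 * j + 9, by omega⟩, fun i j h => by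
    simp only [Fin.mk.injEq] at h
    exact Fin.ext (by omega)⟩
  rw [baseWord, act_append, act_append, ← prob_gateWord (hG := hG) hl V w fun j => rfl]
  have hn : ∑ y, ‖act (elGates G hG) (gateWord V) (zeroVec N) y‖ ^ 2 = 1 := IsLevel.norm _
  have hz : ∀ q, q % 8 ≠ 1 ∨ 8 * l + 9 ≤ q →
      ZeroAt q (act (elGates G hG) (gateWord V) (zeroVec N)) := by
    intro q hq
    refine act_zeroAt (fun t ht hqt => ?_) (zeroVec_zeroAt q)
    obtain ⟨j, hj, rfl⟩ := gateWord_wires V ht hqt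
    omega
  generalize act (elGates G hG) (gateWord V) (zeroVec N) = φ at *
  obtain ⟨h1, h2, h3⟩ := coinWord_spec (hG := hG) m m' K (by omega) hn
    fun q _ hq => hz q (Or.inl hq)
  have h4 : ZeroAt (8 * K + 9) (act (elGates G hG) (coinWord G.Gate m m' K) φ) := by
    refine act_zeroAt (fun t ht hqt => ?_) (hz _ (Or.inr (by omega)))
    simp only [coinWord, List.mem_flatMap] at ht
    obtain ⟨i, -, ht⟩ := ht
    have := chainStep_wires ht hqt
    omega
  have hn' : ∑ y, ‖act (elGates G hG) (coinWord G.Gate m m' K) φ y‖ ^ 2 = 1 := by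
    rw [act_norm, hn]
  rw [← h2]
  generalize act (elGates G hG) (coinWord G.Gate m m' K) φ = χ at *
  have hf := fresh_muxWord (Γ := G.Gate) (N := N) (by omega : 0 < K) hN
    (Z := fun q => ZeroAt q χ) (h1 _ (by omega) (by omega)) h4
  rw [show 8 * (K + 2) + 3 = 8 * K + 19 by ring, prob_eq_expect, expect_act hf fun q hq => hq,
    expect_congr (fun y hy => pull_muxWord (by omega : 0 < K) hN (h4.bit_eq hy)
      ((h1 (8 * K + 10) (by omega) (by omega)).bit_eq hy)
      ((h1 (8 * K + 11) (by omega) (by omega)).bit_eq hy)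
      ((h1 (8 * K + 19) (by omega) (by omega)).bit_eq hy)), expect_add, expect_mul, expect_mul]
  have e : expect χ (fun y => 1 - val (bit y (8 * K + 12))) = 1 - prob (8 * K + 12) χ := by
    have := expect_add χ (fun y => 1 - val (bit y (8 * K + 12))) fun y => val (bit y (8 * K + 12))
    simp only [sub_add_cancel] at this
    rw [expect_const hn', ← prob_eq_expect] at this
    linarith
  rw [e, h3, ← prob_eq_expect, Nat.mod_eq_of_lt hm, Nat.mod_eq_of_lt hm', pow_succ]
  ring

theorem isLevel_baseWord (V : Circuit G l) {m m' K : ℕ} (hK : l ≤ K) :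
    IsLevel G hG N (K + 2) (baseWord V m m' K) := by
  refine IsLevel.of_wires fun t ht q hq => ?_
  simp only [baseWord, List.mem_append] at ht
  rcases ht with (ht | ht) | ht
  · obtain ⟨j, hj, rfl⟩ := gateWord_wires V ht hq
    simp only [IsLadder]; omega
  · simp only [coinWord, List.mem_flatMap, List.mem_range] at ht
    obtain ⟨i, hi, ht⟩ := ht
    have := chainStep_wires ht hq
    simp only [IsLadder]; omega
  · have := muxWord_wires ht hq
    simp only [IsLadder]; omega

end Chain

/-! ### The iterated amplification -/

section Iterate

variable {G : GateSet} {hG : G.Admissible} {N : ℕ}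

/-- The word obtained from `W`, which occupies the first `h` cells, by `j` levels. -/
def iterWord {Γ : Type} (W : List (Tok (El Γ))) (h : ℕ) : ℕ → List (Tok (El Γ))
  | 0 => W
  | j + 1 => levelWord (iterWord W h j) (h + j)

/-- The probability of acceptance after `j` levels. -/
noncomputable def iterProb (a : ℝ) : ℕ → ℝ
  | 0 => a
  | j + 1 => 3 * iterProb a j ^ 2 - 2 * iterProb a j ^ 3

lemma iterWord_spec {W : List (Tok (El G.Gate))} {h : ℕ} (hW : IsLevel G hG N h W) (hh : 0 < h)
    (j : ℕ) (hN : 8 * (h + j) + 3 < N) {a : ℝ}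
    (ha : prob (8 * h + 3) (act (elGates G hG) W (zeroVec N)) = a) :
    IsLevel G hG N (h + j) (iterWord W h j) ∧
    prob (8 * (h + j) + 3) (act (elGates G hG) (iterWord W h j) (zeroVec N)) = iterProb a j := by
  induction j with
  | zero => exact ⟨hW, ha⟩
  | succ j ih =>
    obtain ⟨h1, h2⟩ := ih (by omega)
    exact ⟨h1.levelWord (by omega) (by omega),
      h1.prob_levelWord (by omega) (by omega) _ h2⟩

/-- The outcome of the last level, copied to the first qubit. -/
theorem prob_finWord {W : List (Tok (El G.Gate))} {h : ℕ} (hW : IsLevel G hG N h W)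
    (hN : 8 * h + 9 < N) :
    prob 0 (act (elGates G hG) (W ++ finWord G.Gate h) (zeroVec N)) =
      prob (8 * h + 3) (act (elGates G hG) W (zeroVec N)) := by
  rw [act_append, act_finWord hN (hW.clean _ zeroVec_clean), prob_comp_cflip (by omega)]
  · rfl
  · intro y
    rw [bit_flip_ne (by omega)]
  · exact hW.act_zeroAt (Or.inl (by omega)) (zeroVec_zeroAt 0)

end Iterate

/-! ### The expansion of named blocks into elementary gates -/

section NameWord

variable {G : GateSet}

/-- The qubit at eight times the argument plus `b`. -/
def Aff.at (b : ℕ) : Aff := (0, 8, b)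

/-- The qubit at the fixed position `b`. -/
def Aff.fixed (b : ℕ) : Aff := (0, 0, b)

/-- The number of arguments of a block. -/
def Name.arity (G : GateSet) : Name G.Gate → ℕ
  | .gate g _ => G.arity g
  | .leaf _ => 0
  | .rung => 0
  | _ => 1

/-- Whether a block is to be inverted; the blocks without a Boolean argument are their own inverses. -/
def Name.orient {Γ : Type} : Name Γ → Bool
  | .gate _ o => o
  | .chain _ _ o => o
  | .mux o => o
  | .up o => o
  | .sum o => o
  | _ => false

/-- The name of the inverse block. -/
def Name.flip {Γ : Type} : Name Γ → Name Γ
  | .gate g o => .gate g !o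
  | .chain b c o => .chain b c !o
  | .mux o => .mux !o
  | .leaf o => .leaf !o
  | .copy => .copy
  | .rung => .rung
  | .up o => .up !o
  | .record => .record
  | .sum o => .sum !o
  | .fin => .fin

/-- The expansion of a block that is not to be inverted; the leaves have none, since the word of the
basic circuit is substituted for them. -/
def Name.forward (G : GateSet) : Name G.Gate → List (El G.Gate × List Aff)
  | .gate g _ => [(.gate g, List.ofFn fun j : Fin (G.arity g) => ((j : ℕ), 8, 9))]
  | .chain b c _ => (.had, [.at 10]) ::
      (match b, c with
        | false, false => []
        | true, true => [(.not, [.at 11])]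
        | _, _ => [(.had, [.at 11])]) ++
      [(.tof, [.at 10, .at 12, .at 20]), (.not, [.at 10]), (.tof, [.at 10, .at 11, .at 20])]
  | .mux _ => [(.had, [.at 10]), (.tof, [.at 10, .fixed 9, .at 11]), (.had, [.at 9]),
      (.not, [.at 12]), (.tof, [.at 9, .at 12, .at 19]), (.not, [.at 9]),
      (.tof, [.at 9, .at 11, .at 19])]
  | .leaf _ => []
  | .copy => [(.not, [.fixed 5]), (.tof, [.fixed 5, .at 3, .at 9]), (.not, [.fixed 5])]
  | .rung => [(.not, [.fixed 5])]
  | .up _ => [(.not, [.at 9]), (.tof, [.at 9, .at 5, .at 6]),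
      (.not, [.at 10]), (.tof, [.at 10, .at 6, .at 7]),
      (.not, [.at 11]), (.tof, [.at 11, .at 7, .at 8]),
      (.not, [.at 12]), (.tof, [.at 12, .at 8, .at 13])]
  | .record => [(.tof, [.fixed 5, .at 5, .at 10])]
  | .sum _ => [(.not, [.at 11]), (.not, [.at 9]), (.tof, [.at 9, .at 10, .at 11]),
      (.not, [.at 9]), (.not, [.at 10]), (.tof, [.at 10, .at 3, .at 11]), (.not, [.at 10])]
  | .fin => [(.not, [.fixed 5]), (.tof, [.fixed 5, .at 3, .fixed 0]), (.not, [.fixed 5])]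

/-- The expansion of a block. -/
def Name.expand (G : GateSet) (a : Name G.Gate) : List (El G.Gate × List Aff) :=
  if a.orient then ((a.forward G).map fun u => (u.1.inverse, u.2)).reverse else a.forward G

lemma Name.expand_flip (a : Name G.Gate) :
    a.flip.expand G = ((a.expand G).map fun u => (u.1.inverse, u.2)).reverse := by
  have inv : ∀ l : List (El G.Gate × List Aff),
      ((l.map fun u => (u.1.inverse, u.2)).reverse.map fun u => (u.1.inverse, u.2)).reverse = l := by
    intro l
    have : (fun t : El G.Gate × List Aff => (t.1.inverse.inverse, t.2)) = id := by
      funext t; simp [El.inverse_inverse]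
    simp [List.map_reverse, Function.comp_def, this]
  cases a with
  | gate g o => cases o <;> simp [Name.expand, Name.flip, Name.orient, Name.forward, El.inverse]
  | chain b c o =>
    cases o
    · rfl
    · exact (inv _).symm
  | mux o =>
    cases o
    · rfl
    · exact (inv _).symm
  | up o =>
    cases o
    · rfl
    · exact (inv _).symm
  | sum o =>
    cases o
    · rfl
    · exact (inv _).symm
  | leaf o => rfl
  | copy => rfl
  | rung => rfl
  | record => rfl
  | fin => rfl

/-- The expansion of a word of blocks. -/
def nameWord (G : GateSet) (w : List (Tok (Name G.Gate))) : List (Tok (El G.Gate)) :=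
  w.flatMap (expandTok (Name.expand G))

/-- The word of the inverse blocks. -/
def flipWord {Γ : Type} (w : List (Tok (Name Γ))) : List (Tok (Name Γ)) :=
  (w.map fun t => (t.1.flip, t.2)).reverse

lemma nameWord_append (w w' : List (Tok (Name G.Gate))) :
    nameWord G (w ++ w') = nameWord G w ++ nameWord G w' := by simp [nameWord]

lemma nameWord_flipWord (w : List (Tok (Name G.Gate))) :
    nameWord G (flipWord w) = invWord (nameWord G w) := by
  induction w with
  | nil => rfl
  | cons t w ih =>
    have e1 : flipWord (t :: w) = flipWord w ++ [(t.1.flip, t.2)] := by simp [flipWord]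
    have e2 : nameWord G (t :: w) = expandTok (Name.expand G) t ++ nameWord G w := rfl
    rw [e1, nameWord_append, ih, e2, invWord_append]
    congr 1
    simp only [nameWord, List.flatMap_cons, List.flatMap_nil, List.append_nil, expandTok,
      Name.expand_flip, invWord, List.map_reverse, List.map_map]
    rfl

/-- The substitution of a word and its inverse for the leaves. -/
def leafSub {Γ : Type} (B : List (Tok (Name Γ))) (t : Tok (Name Γ)) : List (Tok (Name Γ)) :=
  match t.1 with
  | .leaf false => B
  | .leaf true => flipWord B
  | _ => [t]

lemma nameWord_zeroTest (B : List (Tok (Name G.Gate))) (h : ℕ) :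
    nameWord G ((zeroTest G.Gate h).flatMap (leafSub B)) = testWord G.Gate h := by
  have e1 : ∀ l : List ℕ, nameWord G ((l.map fun i => ((.up false : Name G.Gate), [i])).flatMap
      (leafSub B)) = l.flatMap (upWord G.Gate) := by
    intro l
    induction l with
    | nil => rfl
    | cons i l ih =>
      rw [List.map_cons, List.flatMap_cons, nameWord_append, ih]
      rfl
  have e2 : ∀ l : List ℕ, nameWord G ((l.reverse.map fun i => ((.up true : Name G.Gate), [i])).flatMap
      (leafSub B)) = (l.flatMap (upWord G.Gate)).reverse := by
    intro l
    induction l with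
    | nil => rfl
    | cons i l ih =>
      rw [List.reverse_cons, List.map_append, List.flatMap_append, nameWord_append, ih,
        List.flatMap_cons, List.reverse_append]
      rfl
  have e3 : zeroTest G.Gate h = [(.rung, [])] ++ (List.range h).map (fun i => (.up false, [i])) ++
      [(.record, [h])] ++ (List.range h).reverse.map (fun i => (.up true, [i])) ++
      [(.rung, [])] := by simp [zeroTest]
  rw [e3, List.flatMap_append, List.flatMap_append, List.flatMap_append, List.flatMap_append,
    nameWord_append, nameWord_append, nameWord_append, nameWord_append, e1, e2, testWord,
    ladderWord, List.reverse_cons]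
  have f1 : nameWord G (List.flatMap (leafSub B) [(.rung, [])]) = [(.not, [5])] := rfl
  have f2 : nameWord G (List.flatMap (leafSub B) [(.record, [h])]) =
      [(.tof, [5, 8 * h + 5, 8 * h + 10])] := by
    simp [nameWord, leafSub, expandTok, Name.expand, Name.orient, Name.forward, Aff.val, Aff.fixed,
      Aff.at]
  rw [f1, f2]
  simp

lemma nameWord_copy (B : List (Tok (Name G.Gate))) (h : ℕ) :
    nameWord G (List.flatMap (leafSub B) [(.copy, [h])]) = copyWord G.Gate h := by
  simp [nameWord, leafSub, expandTok, Name.expand, Name.orient, Name.forward, Aff.val, Aff.fixed,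
    Aff.at, copyWord]

lemma nameWord_fin (B : List (Tok (Name G.Gate))) (h : ℕ) :
    nameWord G (List.flatMap (leafSub B) [(.fin, [h])]) = finWord G.Gate h := by
  simp [nameWord, leafSub, expandTok, Name.expand, Name.orient, Name.forward, Aff.val, Aff.fixed,
    Aff.at, finWord]

lemma nameWord_sum (B : List (Tok (Name G.Gate))) (h : ℕ) :
    nameWord G (List.flatMap (leafSub B) [(.sum false, [h])]) = sumWord G.Gate h := rfl

lemma nameWord_sum_true (B : List (Tok (Name G.Gate))) (h : ℕ) :
    nameWord G (List.flatMap (leafSub B) [(.sum true, [h])]) = invWord (sumWord G.Gate h) := rfl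

/-- The recursive word of blocks expands into the word of the iterated amplification. -/
lemma nameWord_treeWord (B : List (Tok (Name G.Gate))) {h : ℕ} (hh : 0 < h) (j : ℕ) :
    nameWord G ((treeWord G.Gate h false j).flatMap (leafSub B)) = iterWord (nameWord G B) h j ∧
    nameWord G ((treeWord G.Gate h true j).flatMap (leafSub B)) =
      invWord (iterWord (nameWord G B) h j) := by
  induction j with
  | zero =>
    constructor
    · simp [treeWord, leafSub, iterWord]
    · simp [treeWord, leafSub, iterWord, nameWord_flipWord]
  | succ j ih =>
    have e0 : ∀ (a : Tok (Name G.Gate)) l, a :: l = [a] ++ l := fun _ _ => rfl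
    have c : invWord (copyWord G.Gate (h + j)) = copyWord G.Gate (h + j) := rfl
    constructor
    · rw [treeWord, e0 (.copy, _)]
      simp only [List.flatMap_append, nameWord_append, ih.1, ih.2, nameWord_copy, nameWord_sum,
        nameWord_zeroTest, iterWord, levelWord, List.append_assoc]
    · rw [treeWord, e0 (.copy, _), e0 (.sum true, _)]
      simp only [List.flatMap_append, nameWord_append, ih.1, ih.2, nameWord_copy,
        nameWord_sum_true, nameWord_zeroTest, iterWord, levelWord, List.append_assoc,
        invWord_append, invWord_invWord, c, invWord_testWord (show 0 < h + j by omega)]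

/-- The word of blocks for the basic circuit. -/
def baseNames {l : ℕ} (V : Circuit G l) (m m' K : ℕ) : List (Tok (Name G.Gate)) :=
  (V.toks.map fun t => (.gate t.1 false, t.2)) ++ chainWord G.Gate K m.bits m'.bits ++
    [(.mux false, [K])]

lemma nameWord_baseNames {l : ℕ} (V : Circuit G l) (m m' K : ℕ) :
    nameWord G (baseNames V m m' K) = baseWord V m m' K := by
  rw [baseNames, nameWord_append, nameWord_append, baseWord]
  have hb : ∀ (m i : ℕ), m.bits.getD i false = m.testBit i := by
    intro m i
    rw [Nat.testBit_eq_inth, List.getI_eq_getElem?_getD, List.getD_eq_getElem?_getD]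
    rfl
  congr 1
  congr 1
  · induction V with
    | nil => rfl
    | cons a V ih =>
      have e1 : Circuit.toks (a :: V) = (a.1, List.ofFn fun j => (a.2 j : ℕ)) :: Circuit.toks V := rfl
      have e2 : gateWord (a :: V) =
          (.gate a.1, List.ofFn fun j => 8 * (a.2 j : ℕ) + 9) :: gateWord V := rfl
      rw [e1, e2, List.map_cons, ← ih]
      simp only [nameWord, List.flatMap_cons, expandTok, Name.expand, Name.orient, Name.forward]
      simp only [Bool.false_eq_true, if_false, List.map_cons, List.map_nil, List.cons_append,
        List.nil_append, List.map_ofFn]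
      congr 2
      congr 1
      funext j
      simp [Aff.val, List.getD_eq_getElem?_getD]
  · rw [chainWord, coinWord, nameWord, List.flatMap_map]
    refine List.flatMap_congr fun i _ => ?_
    simp only [hb]
    cases m.testBit i <;> cases m'.testBit i <;>
      simp [expandTok, Name.expand, Name.orient, Name.forward, Aff.val, Aff.at, chainStep, prepWord]
  · simp [nameWord, expandTok, Name.expand, Name.orient, Name.forward, Aff.val, Aff.fixed,
      Aff.at, muxWord]

end NameWord

/-! ### The amplified circuit -/

section Valid

variable {G : GateSet} {hG : G.Admissible} {N : ℕ}

lemma ClassicalTok.valid {t : Tok (El G.Gate)} (ht : ClassicalTok N t) :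
    TokValid (elGates G hG) N t := by
  match t, ht with
  | (.not, [q]), h => exact ⟨rfl, by simp, by simpa using (show q < N from h)⟩
  | (.tof, [a, b, c]), ⟨ha, hb, hc, hab, hac, hbc⟩ =>
    exact ⟨rfl, by simp [hab, hac, hbc], by simp [ha, hb, hc]⟩

lemma valid_had {q : ℕ} (hq : q < N) : TokValid (elGates G hG) N (.had, [q]) :=
  ⟨rfl, by simp, by simpa using hq⟩

lemma Fresh.valid {w : List (Tok (El G.Gate))} {Z : ℕ → Prop} (hw : Fresh N w Z) :
    ∀ t ∈ w, TokValid (elGates G hG) N t := by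
  induction w generalizing Z with
  | nil => simp
  | cons t w ih =>
    intro t' ht'
    rcases List.mem_cons.1 ht' with rfl | ht'
    · rcases hw.1 with ⟨q, rfl, hq, -⟩ | h
      · exact valid_had hq
      · exact h.valid
    · exact ih hw.2 t' ht'

lemma valid_invWord {w : List (Tok (El G.Gate))} (hw : ∀ t ∈ w, TokValid (elGates G hG) N t) :
    ∀ t ∈ invWord w, TokValid (elGates G hG) N t := by
  intro t ht
  simp only [invWord, List.mem_reverse, List.mem_map] at ht
  obtain ⟨s, hs, rfl⟩ := ht
  have h := hw s hs
  refine ⟨?_, h.2⟩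
  have har : (elGates G hG).arity (El.inverse s.1) = (elGates G hG).arity s.1 := by
    cases s.1 <;> rfl
  exact h.1.trans har.symm

lemma valid_iterWord {W : List (Tok (El G.Gate))} (hW : ∀ t ∈ W, TokValid (elGates G hG) N t)
    {h : ℕ} (hh : 0 < h) (j : ℕ) (hN : 8 * (h + j) + 3 < N) :
    ∀ t ∈ iterWord W h j, TokValid (elGates G hG) N t := by
  induction j with
  | zero => exact hW
  | succ j ih =>
    have ih := ih (by omega)
    intro t ht
    simp only [iterWord, levelWord, List.mem_append] at ht
    rcases ht with ((((ht | ht) | ht) | ht) | ht) | ht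
    · exact ih t ht
    · simp only [copyWord, List.mem_cons, List.not_mem_nil, or_false] at ht
      refine ClassicalTok.valid ?_
      rcases ht with rfl | rfl | rfl <;> simp only [ClassicalTok] <;> omega
    · exact valid_invWord ih t ht
    · exact (classical_testWord (by omega) (by omega) t ht).valid
    · exact ih t ht
    · simp only [sumWord, List.mem_cons, List.not_mem_nil, or_false] at ht
      refine ClassicalTok.valid ?_
      rcases ht with rfl | rfl | rfl | rfl | rfl | rfl | rfl <;> simp only [ClassicalTok] <;> omega

lemma valid_finWord {h : ℕ} (hN : 8 * h + 9 < N) :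
    ∀ t ∈ finWord G.Gate h, TokValid (elGates G hG) N t := by
  intro t ht
  simp only [finWord, List.mem_cons, List.not_mem_nil, or_false] at ht
  refine ClassicalTok.valid ?_
  rcases ht with rfl | rfl | rfl <;> simp only [ClassicalTok] <;> omega

lemma valid_baseWord {l : ℕ} (V : Circuit G l) {m m' K : ℕ} (hK : l ≤ K) (hK0 : 0 < K)
    (hN : 8 * K + 19 < N) : ∀ t ∈ baseWord V m m' K, TokValid (elGates G hG) N t := by
  intro t ht
  simp only [baseWord, List.mem_append] at ht
  rcases ht with (ht | ht) | ht
  · simp only [gateWord, List.mem_map] at ht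
    obtain ⟨a, -, rfl⟩ := ht
    refine ⟨by simp; rfl, ?_, ?_⟩
    · rw [List.nodup_ofFn]
      intro i j hij
      exact a.2.injective (Fin.ext (by simpa using hij))
    · intro i hi
      rw [List.mem_ofFn] at hi
      obtain ⟨j, rfl⟩ := hi
      have := (a.2 j).2
      omega
  · simp only [coinWord, List.mem_flatMap, List.mem_range] at ht
    obtain ⟨i, hi, ht⟩ := ht
    exact (fresh_chainStep _ _ (by omega) (Z := fun _ => True) trivial trivial).valid t ht
  · exact (fresh_muxWord hK0 hN (Z := fun _ => True) trivial trivial).valid t ht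

/-- The expansion of an elementary gate into gates of the gate set. -/
noncomputable def El.expand (hG : G.Admissible) (e : El G.Gate) : List (G.Gate × List Aff) :=
  circuitExpand (El.exists_circuit hG e).choose

/-- The expansion of a word of elementary gates. -/
noncomputable def compile (hG : G.Admissible) (w : List (Tok (El G.Gate))) : List (Tok G.Gate) :=
  w.flatMap (expandTok (El.expand hG))

lemma compile_spec {w : List (Tok (El G.Gate))} (hw : ∀ t ∈ w, TokValid (elGates G hG) N t) :
    (∀ t ∈ compile hG w, TokValid G N t) ∧
      wordMat G N (compile hG w) = wordMat (elGates G hG) N w := by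
  induction w with
  | nil => exact ⟨by simp [compile], rfl⟩
  | cons t w ih =>
    have ih := ih fun t ht => hw t (by simp [ht])
    have h := hw t (by simp)
    have key := wordMat_circuit (N := N) (El.exists_circuit hG t.1).choose t.2 h.wires fun j => by
      have hj : (j : ℕ) < t.2.length := by rw [h.1]; exact j.2
      rw [List.getD_eq_getElem?_getD, List.getElem?_eq_getElem hj]
      rfl
    rw [(El.exists_circuit hG t.1).choose_spec] at key
    have e : compile hG (t :: w) = expandTok (El.expand hG) t ++ compile hG w := rfl
    rw [e]
    constructor
    · intro t' ht'
      rcases List.mem_append.1 ht' with ht' | ht'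
      · exact key.1 t' ht'
      · exact ih.1 t' ht'
    · rw [wordMat_append, ih.2, wordMat, tokMat, dif_pos h]
      congr 1
      exact key.2

/-- The word of blocks for the amplified circuit.  The basic circuit, with coins of `L + 2` bits,
occupies `L + 4` cells, and each of the `L` levels occupies one more. -/
def fullNames {l : ℕ} (V : Circuit G l) (m m' L : ℕ) : List (Tok (Name G.Gate)) :=
  (treeWord G.Gate (L + 4) false L ++ [((.fin : Name G.Gate), [L + 4 + L])]).flatMap
    (leafSub (baseNames V m m' (L + 2)))

lemma nameWord_fullNames {l : ℕ} (V : Circuit G l) (m m' L : ℕ) :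
    nameWord G (fullNames V m m' L) =
      iterWord (baseWord V m m' (L + 2)) (L + 4) L ++ finWord G.Gate (L + 4 + L) := by
  rw [fullNames, List.flatMap_append, nameWord_append, (nameWord_treeWord _ (by omega) L).1,
    nameWord_fin, nameWord_baseNames]

lemma valid_fullNames {l : ℕ} (V : Circuit G l) {m m' L : ℕ} (hL : l ≤ L) :
    ∀ t ∈ nameWord G (fullNames V m m' L), TokValid (elGates G hG) (16 * L + 42) t := by
  intro t ht
  rw [nameWord_fullNames, List.mem_append] at ht
  rcases ht with ht | ht
  · exact valid_iterWord (valid_baseWord V (by omega) (by omega) (by omega)) (by omega) L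
      (by omega) t ht
  · exact valid_finWord (by omega) t ht

/-- The word for the amplified circuit is the description of a circuit, and this has the acceptance
probability of the iterated amplification. -/
theorem exists_amplified {l : ℕ} (hl : 0 < l) (V : Circuit G l) {m m' L : ℕ} (hL : l ≤ L)
    (hm : m < 2 ^ (L + 2)) (hm' : m' < 2 ^ (L + 2)) :
    ∃ C : Circuit G (16 * L + 42),
      C.encode = encToks (compile hG (nameWord G (fullNames V m m' L))) ∧
      C.acceptProb (by omega) =
        iterProb (1 / 2 + (V.acceptProb hl - (m + m') / 2 ^ (L + 2)) / 4) L := by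
  obtain ⟨h1, h2⟩ := compile_spec (hG := hG) (valid_fullNames V (m := m) (m' := m') hL)
  obtain ⟨C, hC, hC'⟩ := exists_circuit _ h1
  refine ⟨C, hC, ?_⟩
  have hb := iterWord_spec (hG := hG) (N := 16 * L + 42)
    (isLevel_baseWord V (m := m) (m' := m') (K := L + 2) (by omega)) (by omega) L (by omega)
    (prob_baseWord hl V (by omega) hm hm' (by omega))
  have hf := prob_finWord hb.1 (by omega)
  rw [← hb.2, ← hf, ← nameWord_fullNames, prob, act, Circuit.acceptProb, Finset.sum_filter, hC',
    h2]
  refine Finset.sum_congr rfl fun y _ => ?_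
  have e : bit y 0 = y ⟨0, by omega⟩ := dif_pos _
  rw [mulVec_zeroVec, e]

end Valid

/-! ### The amplified circuit is written in logarithmic space -/

section Space

variable {G : GateSet}

lemma zeroTest_args {h : ℕ} {t : Tok (Name G.Gate)} (ht : t ∈ zeroTest G.Gate h) :
    t.2.length = t.1.arity G ∧ ∀ i ∈ t.2, i ≤ h := by
  simp only [zeroTest, List.mem_append, List.mem_cons, List.mem_map, List.mem_range,
    List.mem_reverse, List.not_mem_nil, or_false] at ht
  rcases ht with ((rfl | ⟨i, hi, rfl⟩) | (rfl | ⟨i, hi, rfl⟩)) | rfl <;>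
    simp [Name.arity] <;> omega

lemma treeWord_args {h : ℕ} {o : Bool} {j : ℕ} {t : Tok (Name G.Gate)}
    (ht : t ∈ treeWord G.Gate h o j) : t.2.length = t.1.arity G ∧ ∀ i ∈ t.2, i ≤ h + j := by
  induction j generalizing o with
  | zero =>
    cases o <;> simp only [treeWord, List.mem_cons, List.not_mem_nil, or_false] at ht <;>
      subst ht <;> simp [Name.arity]
  | succ j ih =>
    have ih' : ∀ o, t ∈ treeWord G.Gate h o j →
        t.2.length = t.1.arity G ∧ ∀ i ∈ t.2, i ≤ h + (j + 1) := fun o ho =>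
      ⟨(ih ho).1, fun i hi => by have := (ih ho).2 i hi; omega⟩
    have hz : t ∈ zeroTest G.Gate (h + j) →
        t.2.length = t.1.arity G ∧ ∀ i ∈ t.2, i ≤ h + (j + 1) := fun ho =>
      ⟨(zeroTest_args ho).1, fun i hi => by have := (zeroTest_args ho).2 i hi; omega⟩
    cases o <;> simp only [treeWord, List.mem_append, List.mem_cons, List.not_mem_nil,
      or_false] at ht
    · rcases ht with (((ht | rfl | ht) | ht) | ht) | rfl
      · exact ih' _ ht
      · simp [Name.arity]
      · exact ih' _ ht
      · exact hz ht
      · exact ih' _ ht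
      · simp [Name.arity]
    · rcases ht with (((rfl | ht) | ht) | ht) | rfl | ht
      · simp [Name.arity]
      · exact ih' _ ht
      · exact hz ht
      · exact ih' _ ht
      · simp [Name.arity]
      · exact ih' _ ht

lemma baseNames_args {l : ℕ} (V : Circuit G l) {m m' K : ℕ} (hK : l ≤ K) {t : Tok (Name G.Gate)}
    (ht : t ∈ baseNames V m m' K) : t.2.length = t.1.arity G ∧ ∀ i ∈ t.2, i ≤ K := by
  simp only [baseNames, List.mem_append, List.mem_map, List.mem_cons, List.not_mem_nil,
    or_false, chainWord, List.mem_range] at ht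
  rcases ht with (⟨s, hs, rfl⟩ | ⟨i, hi, rfl⟩) | rfl
  · simp only [Circuit.toks, List.mem_map] at hs
    obtain ⟨a, -, rfl⟩ := hs
    refine ⟨by simp [Name.arity], fun i hi => ?_⟩
    simp only [List.mem_ofFn] at hi
    obtain ⟨j, rfl⟩ := hi
    have := (a.2 j).2
    omega
  · simp [Name.arity]; omega
  · simp [Name.arity]

lemma Name.arity_flip (a : Name G.Gate) : a.flip.arity G = a.arity G := by cases a <;> rfl

lemma fullNames_args {l : ℕ} (V : Circuit G l) {m m' L : ℕ} (hL : l ≤ L) {t : Tok (Name G.Gate)}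
    (ht : t ∈ fullNames V m m' L) : t.2.length = t.1.arity G ∧ ∀ i ∈ t.2, i ≤ L + 4 + L := by
  simp only [fullNames, List.mem_flatMap, List.mem_append, List.mem_cons, List.not_mem_nil,
    or_false] at ht
  obtain ⟨s, hs, ht⟩ := ht
  have hs' : s.2.length = s.1.arity G ∧ ∀ i ∈ s.2, i ≤ L + 4 + L := by
    rcases hs with hs | rfl
    · exact treeWord_args hs
    · simp [Name.arity]
  have hb : t ∈ baseNames V m m' (L + 2) → t.2.length = t.1.arity G ∧ ∀ i ∈ t.2, i ≤ L + 4 + L := by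
    intro h
    have := baseNames_args V (by omega) h
    exact ⟨this.1, fun i hi => by have := this.2 i hi; omega⟩
  have hf : t ∈ flipWord (baseNames V m m' (L + 2)) →
      t.2.length = t.1.arity G ∧ ∀ i ∈ t.2, i ≤ L + 4 + L := by
    intro h
    simp only [flipWord, List.mem_reverse, List.mem_map] at h
    obtain ⟨r, hr, rfl⟩ := h
    have := baseNames_args V (by omega) hr
    exact ⟨this.1.trans (Name.arity_flip _).symm, fun i hi => by have := this.2 i hi; omega⟩
  obtain ⟨a, args⟩ := s
  cases a with
  | leaf o =>
    cases o
    · exact hb ht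
    · exact hf ht
  | _ => rw [List.mem_singleton.1 ht]; exact hs'

/-- The substitution for the leaves, letter by letter. -/
def leafLetter {Γ : Type} (B : List (Tok (Name Γ))) : Name Γ ⊕ Bool → List (Name Γ ⊕ Bool)
  | .inl (.leaf false) => encToks B
  | .inl (.leaf true) => encToks (flipWord B)
  | a => [a]

lemma flatMap_leafLetter (B w : List (Tok (Name G.Gate)))
    (hw : ∀ t ∈ w, t.2.length = t.1.arity G) :
    (encToks w).flatMap (leafLetter B) = encToks (w.flatMap (leafSub B)) := by
  induction w with
  | nil => rfl
  | cons t w ih =>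
    rw [encToks_cons, List.flatMap_append, ih fun t ht => hw t (by simp [ht]), List.flatMap_cons,
      encToks_append]
    congr 1
    have h := hw t (by simp)
    obtain ⟨a, args⟩ := t
    have hnum : ∀ l : List ℕ, (l.flatMap encNat).flatMap (leafLetter B) = l.flatMap encNat := by
      intro l
      have : ∀ s : List (Name G.Gate ⊕ Bool), (∀ a ∈ s, ∃ b, a = .inr b) →
          s.flatMap (leafLetter B) = s := by
        intro s hs
        induction s with
        | nil => rfl
        | cons a s ih =>
          obtain ⟨b, rfl⟩ := hs a (by simp)
          rw [List.flatMap_cons, ih fun a ha => hs a (by simp [ha])]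
          rfl
      exact this _ fun a ha => isInr_of_mem_flatMap_encNat ha
    rw [encTok, List.flatMap_cons, hnum]
    cases a with
    | leaf o =>
      have : args = [] := List.length_eq_zero_iff.1 h
      subst this
      cases o <;> simp [leafLetter, leafSub]
    | _ => simp [leafLetter, leafSub, encTok, encToks]

variable {hG : G.Admissible}

lemma LS.baseNames {l : List Bool → ℕ} {V : (x : List Bool) → Circuit G (l x)}
    (hV : LS fun x => (V x).encode) {m m' K : List Bool → ℕ} (hm : LS fun x => (m x).bits)
    (hm' : LS fun x => (m' x).bits) (hK : LS fun x => List.replicate (K x) true) (C : ℕ)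
    (hC : ∀ x, K x ≤ C * (Nat.log 2 x.length + 1)) :
    LS fun x => encToks (baseNames (V x) (m x) (m' x) (K x)) := by
  have := G.finiteGate
  have h1 : LS fun x => encToks ((V x).toks.map fun t => ((.gate t.1 false : Name G.Gate), t.2)) := by
    have h := hV.flatMap (O := Name G.Gate ⊕ Bool) fun a =>
      [a.map (fun g => .gate g false) id]
    convert h using 2 with x
    rw [Circuit.encode_eq]
    generalize (V x).toks = w
    rw [← List.map_eq_flatMap]
    induction w with
    | nil => rfl
    | cons t w ih =>
      rw [List.map_cons, encToks_cons, encToks_cons, List.map_append, ih]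
      congr 1
      simp only [encTok, List.map_cons, List.map_flatMap, encNat, List.map_append,
        List.map_replicate, List.map_nil, Sum.map_inl, Sum.map_inr, id]
      rfl
  have h2 := LS.chainWord (Γ := G.Gate) hK hm hm' C hC
  have h3 : LS fun x => encToks [((.mux false : Name G.Gate), [K x])] := by
    have h := (LS.const (O := Name G.Gate ⊕ Bool) [.inl (.mux false)]).append
      ((hK.flatMap (O := Name G.Gate ⊕ Bool) fun b => [.inr b]).append (LS.const [.inr false]))
    convert h using 2 with x
    rw [← List.map_eq_flatMap, List.map_replicate]
    simp [encToks, encTok, encNat]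
  simpa only [UnitaryLogspace.baseNames, encToks_append] using (h1.append h2).append h3

/-- The description of the amplified circuit is computable in logarithmic space.  Its length is polynomial
and its tree has logarithmic depth, so it is not stored but obtained by closure properties: the
words for the levels, substitution of the basic circuit and of its inverse, and two expansions. -/
theorem LS.fullNames {l : List Bool → ℕ} {V : (x : List Bool) → Circuit G (l x)}
    (hV : LS fun x => (V x).encode) {m m' L : List Bool → ℕ} (hm : LS fun x => (m x).bits)
    (hm' : LS fun x => (m' x).bits) (hL : LS fun x => List.replicate (L x) true)
    (hlL : ∀ x, l x ≤ L x) (C : ℕ) (hC : ∀ x, L x ≤ C * (Nat.log 2 x.length + 1)) :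
    LS fun x => encToks (compile hG (nameWord G (fullNames (V x) (m x) (m' x) (L x)))) := by
  have := G.finiteGate
  have hlog : ∀ x : List Bool, 1 ≤ Nat.log 2 x.length + 1 := fun x => by omega
  have hL2 : LS fun x => List.replicate (L x + 2) true := by
    convert hL.append (LS.const [true, true]) using 2 with x
    rw [List.replicate_add]; rfl
  have hB := LS.baseNames hV hm hm' hL2 (C + 2) fun x => by nlinarith [hC x, hlog x]
  have hB' := hB.blockReverse Name.flip
  have hT : LS fun x => List.replicate (L x + 4) false ++ List.replicate (L x) true := by
    refine LS.append ?_ hL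
    convert (hL.flatMap (fun _ => [false])).append (LS.const [false, false, false, false]) using 2
      with x
    rw [List.replicate_add]
    rw [← List.map_eq_flatMap, List.map_replicate]
    rfl
  have hT := LS.treeWord (Γ := G.Gate) hT (2 * C + 4) fun x => by nlinarith [hC x, hlog x]
  have h1 : LS fun x => encToks (UnitaryLogspace.fullNames (V x) (m x) (m' x) (L x)) := by
    have h := hT.subst (g := fun a x => leafLetter (UnitaryLogspace.baseNames (V x) (m x) (m' x)
      (L x + 2)) a) fun a => by
        rcases a with a | b
        · cases a with
          | leaf o =>
            cases o
            · exact hB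
            · exact hB'
          | _ => exact LS.const _
        · exact LS.const _
    convert h using 2 with x
    rw [flatMap_leafLetter]
    · rfl
    · intro t ht
      rcases List.mem_append.1 ht with ht | ht
      · exact (treeWord_args ht).1
      · rw [List.mem_singleton.1 ht]; rfl
  have h2 := h1.expand (Name.expand G) (Name.arity G) (2 * C + 4) fun x t ht =>
    ⟨(fullNames_args (V x) (hlL x) ht).1, fun i hi => by
      have := (fullNames_args (V x) (hlL x) ht).2 i hi
      nlinarith [hC x, hlog x]⟩
  exact h2.expand (El.expand hG) (El.arity G) (16 * C + 42) fun x t ht => by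
    have hv := valid_fullNames (hG := hG) (V x) (hlL x) t ht
    exact ⟨hv.1, fun i hi => by
      have := hv.2.2 i hi
      nlinarith [hC x, hlog x]⟩

end Space

/-! ### The iteration of the majority map -/

section Numerics

lemma iterProb_one_sub (a : ℝ) (j : ℕ) : iterProb (1 - a) j = 1 - iterProb a j := by
  induction j with
  | zero => rfl
  | succ j ih => rw [iterProb, iterProb, ih]; ring

lemma iterProb_mem {a : ℝ} (h0 : 0 ≤ a) (h1 : a ≤ 1) (j : ℕ) :
    0 ≤ iterProb a j ∧ iterProb a j ≤ 1 := by
  induction j with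
  | zero => exact ⟨h0, h1⟩
  | succ j ih =>
    obtain ⟨i0, i1⟩ := ih
    rw [iterProb]
    constructor
    · nlinarith [mul_nonneg (mul_nonneg i0 i0) (sub_nonneg.2 i1)]
    · nlinarith [mul_nonneg (sq_nonneg (1 - iterProb a j)) (by linarith : 0 ≤ 1 + 2 * iterProb a j)]

lemma iterProb_add (a : ℝ) (i j : ℕ) : iterProb a (i + j) = iterProb (iterProb a i) j := by
  induction j with
  | zero => rfl
  | succ j ih => rw [← add_assoc, iterProb, iterProb, ih]

/-- The bias grows by a factor of `11 / 8` until it reaches `1 / 4`: for `0 ≤ t ≤ 1 / 4` the majority map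
takes `1 / 2 + t` to `1 / 2 + t * (3 / 2 - 2 * t ^ 2)`. -/
lemma iterProb_bias {a d : ℝ} (hd : 0 ≤ d) (ha : 1 / 2 + d ≤ a) (h1 : a ≤ 1) (j : ℕ) :
    1 / 2 + min (1 / 4) ((11 / 8) ^ j * d) ≤ iterProb a j := by
  induction j with
  | zero =>
    simp only [pow_zero, one_mul, iterProb]
    linarith [min_le_right (1 / 4) d]
  | succ j ih =>
    have hp : 0 ≤ (11 / 8 : ℝ) ^ j * d := by positivity
    have h01 := iterProb_mem (by linarith) h1 j
    set b := iterProb a j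
    rw [iterProb]
    change _ ≤ 3 * b ^ 2 - 2 * b ^ 3
    have hm : 0 ≤ min (1 / 4) ((11 / 8 : ℝ) ^ j * d) := le_min (by norm_num) hp
    by_cases hb : b ≤ 3 / 4
    · have hx : min (1 / 4) ((11 / 8 : ℝ) ^ (j + 1) * d) ≤
          11 / 8 * min (1 / 4) ((11 / 8 : ℝ) ^ j * d) := by
        rw [mul_min_of_nonneg _ _ (by norm_num)]
        refine min_le_min (by norm_num) ?_
        rw [pow_succ]; linarith
      have : 1 / 2 + 11 / 8 * (b - 1 / 2) ≤ 3 * b ^ 2 - 2 * b ^ 3 := by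
        have hb0 : 0 ≤ b - 1 / 2 := by linarith
        nlinarith [mul_nonneg hb0 (mul_nonneg (by linarith : 0 ≤ 3 / 4 - b)
          (by linarith : 0 ≤ b - 1 / 4))]
      linarith
    · have h2 : 3 / 4 ≤ 3 * b ^ 2 - 2 * b ^ 3 := by
        nlinarith [mul_nonneg (sub_nonneg.2 h01.2) (by linarith : 0 ≤ b - 3 / 4),
          mul_nonneg (mul_nonneg (sub_nonneg.2 h01.2) (by linarith : 0 ≤ b - 3 / 4)) h01.1]
      linarith [min_le_left (1 / 4) ((11 / 8 : ℝ) ^ (j + 1) * d)]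

/-- The majority map takes the error `e` to `3 * e ^ 2 - 2 * e ^ 3`, so three times the error is at most
squared; it is at most `3 / 4` at the start. -/
lemma iterProb_error {a : ℝ} (ha : 3 / 4 ≤ a) (h1 : a ≤ 1) (j : ℕ) :
    3 * (1 - iterProb a j) ≤ (3 / 4) ^ 2 ^ j := by
  induction j with
  | zero =>
    simp only [iterProb, pow_zero, pow_one]
    linarith
  | succ j ih =>
    have h01 := iterProb_mem (by linarith) h1 j
    set b := iterProb a j
    have e : iterProb a (j + 1) = 3 * b ^ 2 - 2 * b ^ 3 := rfl
    rw [e, pow_succ 2 j, pow_mul]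
    have h3 : (3 * (1 - b)) ^ 2 ≤ ((3 / 4 : ℝ) ^ 2 ^ j) ^ 2 :=
      pow_le_pow_left₀ (by linarith) ih 2
    have h4 : 0 ≤ (1 - b) ^ 3 := pow_nonneg (by linarith) 3
    nlinarith

/-- From a bias of `1 / (16 * q)` to an error of `2 ^ (- p)`: within `3 * s` steps the bias reaches
`1 / 4`, since `2 ≤ (11 / 8) ^ 3`, and within `s` more steps the error is small enough, since
`(3 / 4) ^ 3 ≤ 1 / 2`. -/
lemma iterProb_amplify {a : ℝ} {p q s : ℕ} (hq0 : 0 < q) (hq : 4 * q ≤ 2 ^ s) (hp : 3 * p ≤ 2 ^ s)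
    (ha : 1 / 2 + 1 / (16 * q) ≤ a) (h1 : a ≤ 1) :
    1 - ((2 : ℝ) ^ p)⁻¹ ≤ iterProb a (4 * s) := by
  have hq0' : (0 : ℝ) < q := by exact_mod_cast hq0
  have hd : (0 : ℝ) ≤ 1 / (16 * q) := by positivity
  rw [show 4 * s = 3 * s + s by ring, iterProb_add]
  have e1 := iterProb_bias hd ha h1 (3 * s)
  have e2 : (1 / 4 : ℝ) ≤ (11 / 8) ^ (3 * s) * (1 / (16 * q)) := by
    have hq' : (4 * q : ℝ) ≤ 2 ^ s := by exact_mod_cast hq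
    have : (2 : ℝ) ^ s ≤ (11 / 8) ^ (3 * s) := by
      rw [pow_mul]
      exact pow_le_pow_left₀ (by norm_num) (by norm_num) s
    rw [mul_one_div, le_div_iff₀ (by positivity)]
    linarith
  rw [min_eq_left e2] at e1
  have h01 := iterProb_mem (by linarith) h1 (3 * s)
  have e3 := iterProb_error (by linarith : 3 / 4 ≤ iterProb a (3 * s)) h01.2 s
  have e4 : (3 / 4 : ℝ) ^ 2 ^ s ≤ (2 ^ p)⁻¹ := by
    calc (3 / 4 : ℝ) ^ 2 ^ s ≤ (3 / 4) ^ (3 * p) :=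
          pow_le_pow_of_le_one (by norm_num) (by norm_num) hp
      _ = ((3 / 4) ^ 3) ^ p := by rw [pow_mul]
      _ ≤ (2⁻¹) ^ p := pow_le_pow_left₀ (by norm_num) (by norm_num) p
      _ = (2 ^ p)⁻¹ := by rw [inv_pow]
  have : (0 : ℝ) ≤ (2 ^ p)⁻¹ := by positivity
  linarith

/-- The mean `(m + m') / 2 ^ (k + 1)` of approximations of `c` and `s` lies between `s` and `c`, at
a distance of a quarter of the gap from both. -/
lemma threshold {c s : ℝ} {m m' k q : ℕ} (hq0 : 0 < q) (hq : 4 * q ≤ 2 ^ k)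
    (hgap : 1 / (q : ℝ) ≤ c - s) (hm : |c - m / 2 ^ k| ≤ ((2 : ℝ) ^ k)⁻¹)
    (hm' : |s - m' / 2 ^ k| ≤ ((2 : ℝ) ^ k)⁻¹) :
    s + 1 / (4 * q) ≤ ((m : ℝ) + m') / 2 ^ (k + 1) ∧
      ((m : ℝ) + m') / 2 ^ (k + 1) ≤ c - 1 / (4 * q) := by
  have hq0' : (0 : ℝ) < q := by exact_mod_cast hq0
  have hq' : (4 * q : ℝ) ≤ 2 ^ k := by exact_mod_cast hq
  have e : ((2 : ℝ) ^ k)⁻¹ ≤ 1 / (4 * q) := by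
    rw [one_div]
    exact inv_anti₀ (by positivity) hq'
  have e2 : ((m : ℝ) + m') / 2 ^ (k + 1) = (m / 2 ^ k + m' / 2 ^ k) / 2 := by
    rw [pow_succ]; field_simp
  have e3 : 1 / (q : ℝ) = 4 * (1 / (4 * q)) := by field_simp
  rw [abs_le] at hm hm'
  rw [e2]
  constructor <;> linarith [hm.1, hm.2, hm'.1, hm'.2]

lemma lt_two_pow_of_abs_le {c : ℝ} {m k : ℕ} (hk : 0 < k) (hc : c ≤ 1)
    (hm : |c - m / 2 ^ k| ≤ ((2 : ℝ) ^ k)⁻¹) : m < 2 ^ (k + 1) := by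
  have h2 : (0 : ℝ) < 2 ^ k := by positivity
  rw [abs_le] at hm
  have h : (m : ℝ) / 2 ^ k ≤ 1 + (2 ^ k)⁻¹ := by linarith [hm.1]
  rw [div_le_iff₀ h2, add_mul, inv_mul_cancel₀ h2.ne', one_mul] at h
  have h' : m ≤ 2 ^ k + 1 := by exact_mod_cast h
  have : 2 ≤ 2 ^ k := by
    calc 2 = 2 ^ 1 := rfl
      _ ≤ 2 ^ k := Nat.pow_le_pow_right (by norm_num) hk
  rw [pow_succ]
  omega

end Numerics

/-! ### Growth of functions of the input length -/

section Growth

/-- A polynomial bound, for all arguments and in terms of the length of the binary expansion. -/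
lemma PolynomiallyBounded.exists_le {f : ℕ → ℕ} (hf : PolynomiallyBounded f) :
    ∃ D, ∀ n, f n ≤ 2 ^ (D * (n.size + 1)) := by
  obtain ⟨d, hd⟩ := hf
  obtain ⟨C, hC⟩ := hd.bound
  obtain ⟨n₀, hn₀⟩ := eventually_atTop.1 hC
  obtain ⟨B, hB⟩ := exists_nat_ge (max C 0)
  refine ⟨B + d + ∑ i ∈ Finset.range n₀, f i, fun n => ?_⟩
  set S := ∑ i ∈ Finset.range n₀, f i
  have h2 : ∀ k : ℕ, k ≤ 2 ^ k := fun k => Nat.lt_two_pow_self.le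
  by_cases hn : n < n₀
  · calc f n ≤ S := Finset.single_le_sum (f := f) (fun _ _ => Nat.zero_le _) (Finset.mem_range.2 hn)
      _ ≤ 2 ^ S := h2 _
      _ ≤ _ := Nat.pow_le_pow_right (by norm_num) (by nlinarith [Nat.zero_le (B + d)])
  · have h := hn₀ n (not_lt.1 hn)
    rw [Real.norm_of_nonneg (by positivity), Real.norm_of_nonneg (by positivity)] at h
    have h' : (f n : ℝ) ≤ (B * n ^ d : ℕ) := by
      push_cast
      exact h.trans (mul_le_mul_of_nonneg_right ((le_max_left _ _).trans hB) (by positivity))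
    have h'' : f n ≤ B * n ^ d := by exact_mod_cast h'
    calc f n ≤ B * n ^ d := h''
      _ ≤ 2 ^ B * (2 ^ n.size) ^ d :=
        Nat.mul_le_mul (h2 B) (Nat.pow_le_pow_left (Nat.lt_size_self n).le d)
      _ = 2 ^ (B + n.size * d) := by rw [← pow_mul, ← pow_add]
      _ ≤ _ := Nat.pow_le_pow_right (by norm_num) (by nlinarith [Nat.zero_le S, Nat.zero_le d])

/-- A logarithmic bound, for all arguments and in terms of the length of the binary expansion. -/
lemma exists_le_size {l : ℕ → ℕ} (hl : (fun n => (l n : ℝ)) =O[atTop] fun n => Real.log (n : ℝ)) :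
    ∃ D, ∀ n, l n ≤ D * (n.size + 1) := by
  obtain ⟨C, hC⟩ := hl.bound
  obtain ⟨n₀, hn₀⟩ := eventually_atTop.1 hC
  obtain ⟨B, hB⟩ := exists_nat_ge (max C 0)
  refine ⟨B + ∑ i ∈ Finset.range (n₀ + 1), l i, fun n => ?_⟩
  set S := ∑ i ∈ Finset.range (n₀ + 1), l i
  by_cases hn : n < n₀ + 1
  · calc l n ≤ S := Finset.single_le_sum (f := l) (fun _ _ => Nat.zero_le _) (Finset.mem_range.2 hn)
      _ ≤ _ := by nlinarith [Nat.zero_le B, Nat.zero_le n.size]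
  · have hn1 : 1 ≤ n := by omega
    have hn1' : (1 : ℝ) ≤ n := by exact_mod_cast hn1
    have h := hn₀ n (by omega)
    have hlog : Real.log n ≤ n.size := by
      have h1 : (n : ℝ) ≤ 2 ^ n.size := by exact_mod_cast (Nat.lt_size_self n).le
      calc Real.log n ≤ Real.log (2 ^ n.size) := Real.log_le_log (by linarith) h1
        _ = n.size * Real.log 2 := Real.log_pow _ _
        _ ≤ n.size * 1 := by
          refine mul_le_mul_of_nonneg_left ?_ (by positivity)
          linarith [Real.log_two_lt_d9]
        _ = n.size := mul_one _
    rw [Real.norm_of_nonneg (by positivity), Real.norm_of_nonneg (Real.log_nonneg hn1')] at h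
    have h' : (l n : ℝ) ≤ (B * n.size : ℕ) := by
      push_cast
      calc (l n : ℝ) ≤ C * Real.log n := h
        _ ≤ B * Real.log n := mul_le_mul_of_nonneg_right ((le_max_left _ _).trans hB)
          (Real.log_nonneg hn1')
        _ ≤ B * n.size := mul_le_mul_of_nonneg_left hlog (by positivity)
    have h'' : l n ≤ B * n.size := by exact_mod_cast h'
    nlinarith [Nat.zero_le S, Nat.zero_le B, Nat.zero_le n.size]

lemma size_le_log (n : ℕ) : n.size ≤ Nat.log 2 n + 1 :=
  Nat.size_le.2 (Nat.lt_pow_succ_log_self (by norm_num) n)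

lemma size_isBigO (A B : ℕ) :
    (fun n : ℕ => ((A * n.size + B : ℕ) : ℝ)) =O[atTop] fun n => Real.log (n : ℝ) := by
  refine IsBigO.of_bound ((4 * A + 2 * B : ℕ) : ℝ) ?_
  filter_upwards [eventually_ge_atTop 2] with n hn
  have hn' : (2 : ℝ) ≤ n := by exact_mod_cast hn
  have h2 : Real.log 2 ≤ Real.log n := Real.log_le_log (by norm_num) hn'
  have h3 : (1 / 2 : ℝ) ≤ Real.log 2 := by linarith [Real.log_two_gt_d9]
  have hs : (Nat.log 2 n : ℝ) * Real.log 2 ≤ Real.log n := by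
    rw [← Real.log_pow]
    refine Real.log_le_log (by positivity) ?_
    exact_mod_cast Nat.pow_log_le_self 2 (by omega)
  have hs' : (n.size : ℝ) ≤ Nat.log 2 n + 1 := by exact_mod_cast size_le_log n
  have hl0 : (0 : ℝ) ≤ Nat.log 2 n := by positivity
  have hs3 : (n.size : ℝ) ≤ 4 * Real.log n := by nlinarith
  rw [Real.norm_of_nonneg (by positivity), Real.norm_of_nonneg (by linarith)]
  push_cast
  have hA : (A : ℝ) * n.size ≤ A * (4 * Real.log n) := mul_le_mul_of_nonneg_left hs3 (by positivity)
  have hB : (B : ℝ) * 1 ≤ B * (2 * Real.log n) :=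
    mul_le_mul_of_nonneg_left (by linarith) (by positivity)
  linarith

end Growth

lemma Circuit.acceptProb_nonneg {G : GateSet} {l : ℕ} (hl : 0 < l) (C : Circuit G l) :
    0 ≤ C.acceptProb hl := Finset.sum_nonneg fun _ _ => by positivity

lemma Circuit.acceptProb_le_one {G : GateSet} {l : ℕ} (hl : 0 < l) (C : Circuit G l) :
    C.acceptProb hl ≤ 1 := by
  have h := C.toMatrix_mem_unitaryGroup
  rw [Matrix.mem_unitaryGroup_iff', Matrix.star_eq_conjTranspose] at h
  have h0 := congrFun (congrFun h fun _ => false) fun _ => false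
  rw [Matrix.mul_apply, Matrix.one_apply_eq] at h0
  have h1 : ((∑ y, ‖C.toMatrix y fun _ => false‖ ^ 2 : ℝ) : ℂ) = 1 := by
    rw [← h0, Complex.ofReal_sum]
    refine Finset.sum_congr rfl fun y _ => ?_
    rw [Matrix.conjTranspose_apply, Complex.star_def, mul_comm, Complex.mul_conj,
      Complex.normSq_eq_norm_sq]
  have h2 : ∑ y, ‖C.toMatrix y fun _ => false‖ ^ 2 = 1 := by exact_mod_cast h1
  rw [← h2]
  exact Finset.sum_le_sum_of_subset_of_nonneg (Finset.filter_subset _ _) fun _ _ _ => by positivity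

/-- A function whose values can be written in unary, given the input, can be computed in binary. -/
lemma LS.logspaceComputableNat {f : ℕ → ℕ}
    (h : LS fun x : List Bool => List.replicate (f x.length) true) : LogspaceComputableNat f := by
  obtain ⟨M, K, hM⟩ := h.length_bits.logspaceComputable
  refine ⟨M, K, fun n => ?_⟩
  have := hM (unary n)
  simpa [unary] using this

lemma LS.replicate_size (A B : ℕ) :
    LS fun x : List Bool => List.replicate (A * x.length.size + B) true := by
  have hid : LS fun x : List Bool => x := by simpa using LS.flatMap_const fun b => [b]
  have h := (hid.length_bits.flatMap fun _ => List.replicate A true).append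
    (LS.const (List.replicate B true))
  convert h using 2 with x
  rw [List.replicate_add, ← Nat.size_eq_bits_len]
  congr 1
  induction x.length.bits with
  | nil => simp
  | cons b s ih =>
    rw [List.flatMap_cons, ← ih, List.length_cons, Nat.mul_succ, add_comm, List.replicate_add]

lemma LogspaceComputable.ls_bits {m : ℕ × ℕ → ℕ}
    (hm : LogspaceComputable (fun a : ℕ × ℕ => unary a.1 ++ false :: unary a.2)
      fun a => (m a).bits) {k : ℕ → ℕ}
    (hk : LS fun x : List Bool => List.replicate (k x.length) true) :
    LS fun x => (m (x.length, k x.length)).bits := by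
  refine LS.comp_logspaceComputable hm (a := fun x => (x.length, k x.length)) ?_
  have h := (LS.flatMap_const fun _ => [true]).append ((LS.const [false]).append hk)
  convert h using 2 with x
  rw [← List.map_eq_flatMap, List.map_const']
  rfl

/-! ### Amplification of the gap -/

/-- The threshold of the basic circuit is the mean of approximations of `c` and `s`, and the number of
levels is a multiple of the length of the binary expansion of the input length, which is
computable in logarithmic space and exceeds the logarithms of the polynomial bounds. -/
theorem QUL_subset_of_gap {G : GateSet} (hG : G.Admissible) {p q : ℕ → ℕ}
    (hp_poly : PolynomiallyBounded p) {c s : ℕ → ℝ} (hc : ∀ n, c n ≤ 1) (hs : ∀ n, s n ≤ 1)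
    (hc_log : LogspaceComputableReal c) (hs_log : LogspaceComputableReal s)
    (hq0 : ∀ n, 0 < q n) (hq_poly : PolynomiallyBounded q)
    (hgap : ∀ n, 1 / (q n : ℝ) ≤ c n - s n) :
    QUL G c s ⊆ QUL G (fun n => 1 - ((2 : ℝ) ^ p n)⁻¹) (fun n => ((2 : ℝ) ^ p n)⁻¹) := by
  rintro A ⟨l, hl, V, ⟨-, hl_log⟩, hV, hyes, hno⟩
  obtain ⟨mc, hmc, hmc_log⟩ := hc_log
  obtain ⟨ms, hms, hms_log⟩ := hs_log
  obtain ⟨Dl, hDl⟩ := exists_le_size hl_log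
  obtain ⟨Dp, hDp⟩ := hp_poly.exists_le
  obtain ⟨Dq, hDq⟩ := hq_poly.exists_le
  -- with `s = D * (n.size + 1)`, both `4 * q n` and `3 * p n` are at most `2 ^ s`, and `4 * s` levels
  -- are iterated; the coins have `L n + 2` bits
  obtain ⟨D, hD⟩ : ∃ D, D = Dl + Dp + Dq + 2 := ⟨_, rfl⟩
  obtain ⟨L, hL⟩ : ∃ L : ℕ → ℕ, ∀ n, L n = 4 * (D * (n.size + 1)) := ⟨_, fun _ => rfl⟩
  have hpow : ∀ n D' : ℕ, D' ≤ Dp + Dq → 4 * 2 ^ (D' * (n.size + 1)) ≤ 2 ^ (D * (n.size + 1)) := by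
    intro n D' hD'
    calc 4 * 2 ^ (D' * (n.size + 1)) = 2 ^ (2 + D' * (n.size + 1)) := by rw [pow_add]; norm_num
      _ ≤ _ := Nat.pow_le_pow_right (by norm_num) (by nlinarith [Nat.zero_le n.size])
  have hq4 : ∀ n, 4 * q n ≤ 2 ^ (D * (n.size + 1)) := fun n =>
    (Nat.mul_le_mul_left 4 (hDq n)).trans (hpow n Dq (by omega))
  have hp3 : ∀ n, 3 * p n ≤ 2 ^ (D * (n.size + 1)) := fun n => by
    have := (Nat.mul_le_mul_left 4 (hDp n)).trans (hpow n Dp (by omega))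
    omega
  have hq4' : ∀ n, 4 * q n ≤ 2 ^ (L n + 1) := fun n =>
    (hq4 n).trans (Nat.pow_le_pow_right (by norm_num) (by rw [hL]; omega))
  have hlL : ∀ n, l n ≤ L n := fun n => (hDl n).trans (by
    rw [hL]; nlinarith [Nat.zero_le n.size])
  have hLS : ∀ B, LS fun x : List Bool => List.replicate (L x.length + B) true := fun B => by
    have h := LS.replicate_size (4 * D) (4 * D + B)
    convert h using 3 with x
    rw [hL]; ring
  have hm1 : ∀ n, mc (n, L n + 1) < 2 ^ (L n + 2) := fun n =>
    lt_two_pow_of_abs_le (by omega) (hc n) (hmc n _)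
  have hm2 : ∀ n, ms (n, L n + 1) < 2 ^ (L n + 2) := fun n =>
    lt_two_pow_of_abs_le (by omega) (hs n) (hms n _)
  have hamp := fun x : List Bool => exists_amplified (hG := hG) (hl x.length) (V x)
    (hlL x.length) (hm1 x.length) (hm2 x.length)
  choose V' hV' hacc using hamp
  have hthr := fun n => threshold (hq0 n) (hq4' n) (hgap n) (hmc n (L n + 1)) (hms n (L n + 1))
  have hqpos : ∀ n, (0 : ℝ) < q n := fun n => by exact_mod_cast hq0 n
  have e16 : ∀ n, 1 / (16 * q n : ℝ) = 1 / (4 * q n) / 4 := fun n => by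
    have := hqpos n
    field_simp; norm_num
  refine ⟨fun n => 16 * L n + 42, fun n => Nat.succ_pos _, V', ⟨?_, ?_⟩, ?_, fun x hx => ?_,
    fun x hx => ?_⟩
  -- the number of qubits is logarithmically bounded
  · refine LS.logspaceComputableNat ?_
    have h := LS.replicate_size (64 * D) (64 * D + 42)
    convert h using 3 with x
    rw [hL]; ring
  · refine (size_isBigO (64 * D) (64 * D + 42)).congr_left fun n => ?_
    congr 1
    change _ = 16 * L n + 42
    rw [hL]; ring
  -- the description of the circuits is computable
  · suffices key : LogspaceComputable (fun x : List Bool => x) fun x => encToks (compile hG (nameWord G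
        (fullNames (V x) (mc (x.length, L x.length + 1)) (ms (x.length, L x.length + 1))
          (L x.length)))) by
      simpa only [hV'] using key
    have hm := hmc_log.ls_bits (k := fun n => L n + 1) (hLS 1)
    have hm' := hms_log.ls_bits (k := fun n => L n + 1) (hLS 1)
    have hL0 : LS fun x : List Bool => List.replicate (L x.length) true := hLS 0
    have hK : ∀ x : List Bool, L x.length ≤ 8 * D * (Nat.log 2 x.length + 1) := fun x => by
      have := size_le_log x.length
      rw [hL]
      nlinarith [Nat.zero_le D]
    exact (LS.fullNames (hG := hG) (l := fun x => l x.length) (V := V)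
      (m := fun x => mc (x.length, L x.length + 1)) (m' := fun x => ms (x.length, L x.length + 1))
      (L := fun x => L x.length) hV.ls hm hm' hL0 (fun x => hlL x.length) (8 * D)
      hK).logspaceComputable
  · rw [hacc]
    have h1 := hyes x hx
    have h2 := hthr x.length
    have h3 := (V x).acceptProb_le_one (hl x.length)
    set t := ((mc (x.length, L x.length + 1) : ℝ) + ms (x.length, L x.length + 1)) /
      2 ^ (L x.length + 2)
    have ht : 0 ≤ t := by positivity
    have := iterProb_amplify (a := 1 / 2 + ((V x).acceptProb (hl x.length) - t) / 4)
      (hq0 _) (hq4 x.length) (hp3 x.length) (by rw [e16]; linarith [h2.2]) (by linarith)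
    rwa [← hL] at this
  · rw [hacc]
    have h1 := hno x hx
    have h2 := hthr x.length
    have h3 := (V x).acceptProb_nonneg (hl x.length)
    have h4 : (0 : ℝ) < 1 / (4 * q x.length) := by have := hqpos x.length; positivity
    set a := 1 / 2 + ((V x).acceptProb (hl x.length) - ((mc (x.length, L x.length + 1) : ℝ) +
      ms (x.length, L x.length + 1)) / 2 ^ (L x.length + 2)) / 4 with ha
    -- the majority map commutes with negation
    have := iterProb_amplify (a := 1 - a) (hq0 _) (hq4 x.length) (hp3 x.length) (by
      rw [e16, ha]; linarith [h2.1]) (by linarith [h2.2, hc x.length])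
    rw [iterProb_one_sub, ← hL] at this
    linarith

end UnitaryLogspace

theorem mainTheorem2
    (G : UnitaryLogspace.GateSet) (hG : G.Admissible)
    (p : ℕ → ℕ) (hp_pos : ∀ n, 0 < p n)
    (hp_poly : UnitaryLogspace.PolynomiallyBounded p)
    (hp_log : UnitaryLogspace.LogspaceComputableNat p)
    (c s : ℕ → ℝ)
    (hc : ∀ n, c n ∈ Set.Icc (0 : ℝ) 1) (hs : ∀ n, s n ∈ Set.Icc (0 : ℝ) 1)
    (hc_log : UnitaryLogspace.LogspaceComputableReal c)
    (hs_log : UnitaryLogspace.LogspaceComputableReal s)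
    (hgap : ∃ q : ℕ → ℕ, (∀ n, 0 < q n) ∧ UnitaryLogspace.PolynomiallyBounded q ∧
      ∀ n, 1 / (q n : ℝ) ≤ c n - s n) :
    UnitaryLogspace.QUL G c s ⊆
      UnitaryLogspace.QUL G (fun n => 1 - ((2 : ℝ) ^ p n)⁻¹) (fun n => ((2 : ℝ) ^ p n)⁻¹) := by
  obtain ⟨q, hq0, hq_poly, hgap⟩ := hgap
  exact UnitaryLogspace.QUL_subset_of_gap hG hp_poly (fun n => (hc n).2) (fun n => (hs n).2)
    hc_log hs_log hq0 hq_poly hgap
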